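/- Let $K\in\mathbb N$. For each $n$ let $p=p(n)$, let $A_n^{(1)},\dots,A_n^{(K)}$ be (possibly random) $p\times p$ and $B_n^{(1)},\dots,B_n^{(K)}$ (possibly random) $n\times n$ complex matrices, and let $Z_n^{(1)},\dots,Z_n^{(K)}$ be random $p\times n$ complex matrices such that, for each $n$, $(Z_n^{(r)})_r$ is independent of $(A_n^{(r)},B_n^{(r)})_r$. Assume: * **T1** $p/n\to c\in(0,\infty)$. * **T2** For each $n$ the entries of $Z_n^{(1)},\dots,Z_n^{(K)}$ are independent, with $\mathbb E z=0$ and $\mathbb E|z|^2=1$, and for some $\eta_0>0$ the moments $\mathbb E|z|^{4+\eta_0}$ are bounded uniformly over all entries and all $n$. * **T3** Almost surely all $A_n^{(r)},B_n^{(r)}$ are positive semidefinite, and the joint empirical spectral distributions of $(A_n^{(1)},\dots,A_n^{(K)})$ and of $(B_n^{(1)},\dots,B_n^{(K)})$ converge weakly to non-random probability distributions $H$ and $G$ on $\mathbb R_+^K$, respectively. Neither $H$ nor $G$ is $\delta_{\mathbf 0}$ or is supported on a coordinate hyperplane $\{\lambda_r=0\}$, $1\le r\le K$. * **T4** There is a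 constant $C_0$ such that almost surely $\limsup_n\max_r\max\{\frac1p\operatorname{tr}A_n^{(r)},\frac1n\operatorname{tr}B_n^{(r)}\}<C_0$. * **T5** Almost surely, for each $n$, the $A_n^{(r)}$ commute with each other and the $B_n^{(r)}$ commute with each other. (The joint empirical spectral distribution of commuting Hermitian $d\times d$ matrices puts mass $1/d$ at each joint eigenvalue in $\mathbb R^K$, counted with multiplicity.) Let $$S_n=\frac1nX_nX_n^*,\qquad X_n=\sum_{r=1}^K (A_n^{(r)})^{1/2}Z_n^{(r)}(B_n^{(r)})^{1/2},$$ and for $z\in\mathbb C_+=\{z:\Im z>0\}$, $\mathbf q\in\mathbb C^K$ and a measure $\mu$ on $\mathbb R_+^K$ put $\mathbf O(z,\mathbf q,\mu)=\int\frac{\boldsymbol\lambda\,\mu(d\boldsymbol\lambda)}{-z(1+\boldsymbol\lambda^T\mathbf q)}\in\mathbb C^K$ whenever this integral exists. Then there are a probability measure $F$ on $\mathbb R$ and functions $\mathbf h,\mathbf g:\mathbb C_+\to\mathbb C_+^K$ with the following properties. 1. Almost surely the empirical spectral distribution of $S_n$ converges weakly to $F$. 2. The coordinates of $\mathbf h$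 and $\mathbf g$ are Stieltjes transforms of finite measures on $\mathbb R_+$, and for all $z\in\mathbb C_+$ $$\mathbf h(z)=\int\frac{\boldsymbol\lambda\,dH(\boldsymbol\lambda)}{-z(1+\boldsymbol\lambda^T\mathbf O(z,c\,\mathbf h(z),G))},\qquad \mathbf g(z)=\int\frac{\boldsymbol\theta\,dG(\boldsymbol\theta)}{-z(1+c\,\boldsymbol\theta^T\mathbf O(z,\mathbf g(z),H))}.$$ Each of $\mathbf h$, $\mathbf g$ is the only solution of its equation among the functions $\mathbb C_+\to\mathbb C_+^K$ whose coordinates are Stieltjes transforms of finite measures on $\mathbb R$. 3. For all $z\in\mathbb C_+$ the Stieltjes transform $s_F(z)=\int\frac{dF(x)}{x-z}$ satisfies $$s_F(z)=\frac1c\int\frac{dG(\boldsymbol\theta)}{-z(1+c\,\boldsymbol\theta^T\mathbf O(z,\mathbf g(z),H))}+\Big(\frac1c-1\Big)\frac1z .$$ 4. For all $z\in\mathbb C_+$, $\mathbf g(z)=\mathbf O(z,c\,\mathbf h(z),G)$ and $\mathbf h(z)=\mathbf O(z,\mathbf g(z),H)$. 5. For all $z\in\mathbb C_+$, $$s_F(z)=\frac1z\Big(\frac1c-1\Big)-\frac1{cz}\int\frac{dG(\boldsymbol\theta)}{1+c\,\boldsymbol\theta^T\mathbf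 h(z)}=-\frac1z-\mathbf h(z)^T\mathbf g(z).$$ -/

import Mathlib

open MeasureTheory ProbabilityTheory Filter Topology
open scoped ComplexOrder

namespace SumSepCov

noncomputable section

/-- Weak convergence `μs n → μ` of measures: convergence of the integrals of all bounded continuous
real functions. -/
def WeakConv {E : Type*} [TopologicalSpace E] [MeasurableSpace E]
    (μs : ℕ → Measure E) (μ : Measure E) : Prop :=
  ∀ f : BoundedContinuousFunction E ℝ,
    Tendsto (fun n => ∫ x, f x ∂(μs n)) atTop (𝓝 (∫ x, f x ∂μ))

/-- The array of the entries of a family of matrices. -/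
def entries {K p n : ℕ} (M : Fin K → Matrix (Fin p) (Fin n) ℂ) : Fin K → Fin p → Fin n → ℂ :=
  fun r i j => M r i j

/-- The empirical spectral distribution of a Hermitian `d × d` matrix: mass `1 / d` at each
eigenvalue, counted with multiplicity. -/
def esd {d : ℕ} {M : Matrix (Fin d) (Fin d) ℂ} (hM : M.IsHermitian) : Measure ℝ :=
  (d : ENNReal)⁻¹ • ∑ j, Measure.dirac (hM.eigenvalues j)

/-- The joint empirical spectral distribution of a commuting family `A 0, …, A (K-1)` of Hermitian
`d × d` matrices: the point `x ∈ ℝ^K` carries the mass `m(x) / d`, where `m(x)` is the dimension of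
the joint eigenspace `{v | A r v = x r v for all r}`. -/
def jesd {K d : ℕ} (A : Fin K → Matrix (Fin d) (Fin d) ℂ) : Measure (Fin K → ℝ) :=
  (d : ENNReal)⁻¹ • Measure.sum fun x : Fin K → ℝ =>
    (Module.finrank ℂ
      (⨅ r, Module.End.eigenspace (Matrix.toLin' (A r)) (x r : ℂ) : Submodule ℂ (Fin d → ℂ)) :
        ENNReal) • Measure.dirac x

open scoped MatrixOrder in
/-- The data matrix `X = ∑ r, A_r^{1/2} Z_r B_r^{1/2}`, with positive semidefinite square roots. -/
def dataMatrix {K p n : ℕ} (A : Fin K → Matrix (Fin p) (Fin p) ℂ)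
    (B : Fin K → Matrix (Fin n) (Fin n) ℂ) (Z : Fin K → Matrix (Fin p) (Fin n) ℂ) :
    Matrix (Fin p) (Fin n) ℂ :=
  ∑ r, CFC.sqrt (A r) * Z r * CFC.sqrt (B r)

/-- The sample covariance matrix `S = n⁻¹ X X^*` of a `p × n` matrix `X`. -/
def sampleCov {p n : ℕ} (X : Matrix (Fin p) (Fin n) ℂ) : Matrix (Fin p) (Fin p) ℂ :=
  (n : ℝ)⁻¹ • (X * X.conjTranspose)

theorem sampleCov_isHermitian {p n : ℕ} (X : Matrix (Fin p) (Fin n) ℂ) :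
    (sampleCov X).IsHermitian := by
  unfold sampleCov
  rw [Matrix.IsHermitian, Matrix.conjTranspose_smul, Matrix.conjTranspose_mul,
    Matrix.conjTranspose_conjTranspose, star_trivial]

/-- The Stieltjes transform `∫ (x - z)⁻¹ μ(dx)` of a measure on `ℝ`. -/
def stieltjes (μ : Measure ℝ) (z : ℂ) : ℂ := ∫ x, ((x : ℂ) - z)⁻¹ ∂μ

/-- On the upper half plane, `f` is the Stieltjes transform of a finite measure that is carried
by `S`. -/
def IsStieltjes (S : Set ℝ) (f : ℂ → ℂ) : Prop :=
  ∃ μ : Measure ℝ, IsFiniteMeasure μ ∧ μ Sᶜ = 0 ∧ ∀ z : ℂ, 0 < z.im → f z = stieltjes μ z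

/-- `xᵀ q = ∑ s, x s * q s` for real `x` and complex `q`. -/
def pair {K : ℕ} (x : Fin K → ℝ) (q : Fin K → ℂ) : ℂ := ∑ s, (x s : ℂ) * q s

/-- The operator `O(z, q, μ) = ∫ x μ(dx) / (-z (1 + xᵀ q))`, with values in `ℂ^K`. -/
def opO {K : ℕ} (z : ℂ) (q : Fin K → ℂ) (μ : Measure (Fin K → ℝ)) : Fin K → ℂ :=
  fun r => ∫ x, (x r : ℂ) / (-z * (1 + pair x q)) ∂μ

/-- `h` is a `ℂ₊^K`-valued solution on `ℂ₊` of
`h(z) = ∫ x H(dx) / (-z (1 + xᵀ O(z, c h(z), G)))` whose coordinates are Stieltjes transforms of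
finite measures carried by `S`. -/
def IsSolutionH {K : ℕ} (S : Set ℝ) (c : ℝ) (H G : Measure (Fin K → ℝ))
    (h : ℂ → Fin K → ℂ) : Prop :=
  (∀ r, IsStieltjes S fun z => h z r) ∧
  ∀ z : ℂ, 0 < z.im → ∀ r, 0 < (h z r).im ∧
    h z r = ∫ x, (x r : ℂ) / (-z * (1 + pair x (opO z ((c : ℂ) • h z) G))) ∂H

/-- `g` is a `ℂ₊^K`-valued solution on `ℂ₊` of
`g(z) = ∫ y G(dy) / (-z (1 + c yᵀ O(z, g(z), H)))` whose coordinates are Stieltjes transforms of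
finite measures carried by `S`. -/
def IsSolutionG {K : ℕ} (S : Set ℝ) (c : ℝ) (H G : Measure (Fin K → ℝ))
    (g : ℂ → Fin K → ℂ) : Prop :=
  (∀ r, IsStieltjes S fun z => g z r) ∧
  ∀ z : ℂ, 0 < z.im → ∀ r, 0 < (g z r).im ∧
    g z r = ∫ y, (y r : ℂ) / (-z * (1 + (c : ℂ) * pair y (opO z (g z) H))) ∂G

/-- `μ` is a probability distribution on `ℝ₊^K`, different from the unit mass at `0` and not
supported on a coordinate hyperplane `{x | x r = 0}`. -/
structure IsLimitSpectrum {K : ℕ} (μ : Measure (Fin K → ℝ)) : Prop where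
  prob : IsProbabilityMeasure μ
  nonneg : ∀ᵐ x ∂μ, ∀ r, 0 ≤ x r
  ne_dirac : μ ≠ Measure.dirac 0
  nondegenerate : ∀ r, ¬ ∀ᵐ x ∂μ, x r = 0

end

end SumSepCov

open MeasureTheory ProbabilityTheory Filter Topology
open scoped ComplexOrder

namespace SumSepCov

noncomputable section

/-! ### Stieltjes transforms: elementary bounds and inversion -/

section StieltjesTransform

/-! Write Y = n^{-1/2} X_n, Q = (YYᴴ − z)⁻¹, Q' = (YᴴY − z)⁻¹. The theorem is a closed system of
equations for the traces h_r = p⁻¹ tr(A_r Q) and g_r = n⁻¹ tr(B_r Q'). Integration by parts in the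
entries of Z gives, for every deterministic matrix T, the loop equation E[tr T + z tr(TQ) + z ∑_r
(n⁻¹ tr B_r Q') tr(T A_r Q)] ≈ 0, and a dual one with the roles of the two sides exchanged
(`IsInnovation.norm_integral_loop_le`, `IsInnovation.norm_integral_dual_loop_le`). For this the
resolvent is linearized: `herm` has off-diagonal blocks Y and Yᴴ and depends real-linearly on the
entries, a single entry perturbs it with rank at most two, and its resolvent at w with w² = z
contains w Q and w Q' as diagonal blocks. Expanding to second order in one entry, independence and
E|ζ|² = 1 produce the loop equation; E ζ² need not vanish, but its contribution is of lower order by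
Cauchy-Schwarz (`sum_norm_trace_unitBlock_le`), and the remainder is paid for by third moments.

Replacing one column of all the Z_r perturbs Y with rank at most K, hence moves a trace against the
resolvent by a bounded amount. The method of bounded differences then gives fourth moments of order
n² for centred traces (`integral_norm_pow_four_le_of_columns`). So the factors n⁻¹ tr B_r Q' may be
replaced by their means. In the joint eigenbasis the test matrix T = A_s (z(1 + ∑ g_r A_r))⁻¹ turns
the loop equation into h ≈ O(z, g, H_n), its dual gives g ≈ O(z, (p/n) h, G_n), and T = 1 gives 1 +
z(s_n + hᵀg) ≈ 0 for the mean Stieltjes transform s_n. The norms of A_r and B_r are kept small by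
truncating the eigenvalues at `cutoff n` = n^{1/16}; as normalized traces are bounded, truncation
changes Y by a matrix of rank o(n) and is invisible in s_n.

The means of h and g stay bounded. Their limits along ultrafilters solve the exact equations and lie
in the open half planes Im h, Im g, Im zh, Im zg > 0; this uses that H and G charge every coordinate
(`isFixedPair_of_tendsto`). There the solution is unique (`opO_comp_unique`): in the metric |a − a'|
/ √(Im a · Im a') a weighted Cauchy-Schwarz inequality makes the composed map strictly decrease
distances, the gain coming from Im z > 0. Hence the means converge (`IsModel.exists_isFixedPair`).
The limits are Stieltjes transforms, being limits of such with bounded mass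
(`isStieltjes_of_tendsto`), and −1/z − hᵀg is the transform of a measure of mass one, because hᵀg =
O(v⁻²) at z = iv.

Random A and B are frozen: the deterministic theory applies for almost every realization, with the
same limit by uniqueness, while the deviation of the spectral statistic from its mean over Z alone
has fourth moments summable in n, uniformly in A and B (`ae_tendsto_covStat_sub_integral`). The
remaining formulas for s_F follow from −1/z − hᵀg by integrating a partial fraction
(`IsFixedPair.mul_sum_eq`). -/

theorem ofReal_sub_ne_zero {z : ℂ} (hz : 0 < z.im) (x : ℝ) : (x : ℂ) - z ≠ 0 := by
  intro h
  have := congrArg Complex.im h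
  simp at this
  linarith

theorem im_le_norm_ofReal_sub (z : ℂ) (x : ℝ) : |z.im| ≤ ‖(x : ℂ) - z‖ := by
  have := Complex.abs_im_le_norm ((x : ℂ) - z)
  simpa using this

theorem norm_inv_ofReal_sub_le {z : ℂ} (hz : 0 < z.im) (x : ℝ) :
    ‖((x : ℂ) - z)⁻¹‖ ≤ z.im⁻¹ := by
  rw [norm_inv]
  refine inv_anti₀ hz ?_
  have := im_le_norm_ofReal_sub z x
  rwa [abs_of_pos hz] at this

theorem continuous_inv_ofReal_sub {z : ℂ} (hz : 0 < z.im) :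
    Continuous fun x : ℝ => ((x : ℂ) - z)⁻¹ :=
  (Complex.continuous_ofReal.sub continuous_const).inv₀ (ofReal_sub_ne_zero hz)

theorem integrable_inv_ofReal_sub (μ : Measure ℝ) [IsFiniteMeasure μ] {z : ℂ} (hz : 0 < z.im) :
    Integrable (fun x : ℝ => ((x : ℂ) - z)⁻¹) μ :=
  Integrable.of_bound (continuous_inv_ofReal_sub hz).aestronglyMeasurable z.im⁻¹
    (ae_of_all _ (norm_inv_ofReal_sub_le hz))

theorem norm_stieltjes_le (μ : Measure ℝ) [IsFiniteMeasure μ] {z : ℂ} (hz : 0 < z.im) :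
    ‖stieltjes μ z‖ ≤ μ.real Set.univ / z.im := by
  have := norm_integral_le_of_norm_le_const (μ := μ) (ae_of_all _ (norm_inv_ofReal_sub_le hz))
  rw [stieltjes, div_eq_inv_mul]
  exact this

/-- The Stieltjes transform is locally Lipschitz, with a constant that depends only on the mass. -/
theorem norm_stieltjes_sub_le (μ : Measure ℝ) [IsFiniteMeasure μ] {z z' : ℂ} (hz : 0 < z.im)
    (hz' : 0 < z'.im) :
    ‖stieltjes μ z - stieltjes μ z'‖ ≤ μ.real Set.univ * (‖z - z'‖ / (z.im * z'.im)) := by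
  rw [stieltjes, stieltjes, ← integral_sub (integrable_inv_ofReal_sub μ hz)
    (integrable_inv_ofReal_sub μ hz'), mul_comm]
  refine norm_integral_le_of_norm_le_const (ae_of_all _ fun x => ?_)
  rw [inv_sub_inv (ofReal_sub_ne_zero hz x) (ofReal_sub_ne_zero hz' x), norm_div, norm_mul]
  have e : ‖(x : ℂ) - z' - (x - z)‖ = ‖z - z'‖ := by congr 1; ring
  rw [e]
  have h1 := im_le_norm_ofReal_sub z x
  have h2 := im_le_norm_ofReal_sub z' x
  rw [abs_of_pos hz] at h1
  rw [abs_of_pos hz'] at h2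
  gcongr

theorem im_inv_ofReal_sub (z : ℂ) (x : ℝ) :
    (((x : ℂ) - z)⁻¹).im = z.im / ((x - z.re) ^ 2 + z.im ^ 2) := by
  rw [Complex.inv_im, Complex.normSq_apply]
  simp
  ring

theorem stieltjes_im (μ : Measure ℝ) [IsFiniteMeasure μ] {z : ℂ} (hz : 0 < z.im) :
    (stieltjes μ z).im = ∫ x, z.im / ((x - z.re) ^ 2 + z.im ^ 2) ∂μ := by
  have := integral_im (𝕜 := ℂ) (integrable_inv_ofReal_sub μ hz)
  simp only [RCLike.im_to_complex] at this
  rw [stieltjes, ← this]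
  simp only [im_inv_ofReal_sub]

theorem stieltjes_im_nonneg (μ : Measure ℝ) [IsFiniteMeasure μ] {z : ℂ} (hz : 0 < z.im) :
    0 ≤ (stieltjes μ z).im := by
  rw [stieltjes_im μ hz]
  exact integral_nonneg fun x => by positivity

/-- Since z/(x − z) = x/(x − z) − 1, the imaginary part of the integrand is x times a positive
number. The support condition is used exactly here. -/
theorem mul_stieltjes_im_nonneg (μ : Measure ℝ) [IsFiniteMeasure μ] (hμ : μ (Set.Ici 0)ᶜ = 0)
    {z : ℂ} (hz : 0 < z.im) : 0 ≤ (z * stieltjes μ z).im := by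
  have hi : Integrable (fun x : ℝ => z * ((x : ℂ) - z)⁻¹) μ :=
    (integrable_inv_ofReal_sub μ hz).const_mul z
  have := integral_im (𝕜 := ℂ) hi
  simp only [RCLike.im_to_complex] at this
  rw [stieltjes, ← integral_const_mul, ← this]
  have hae : ∀ᵐ x ∂μ, x ∈ Set.Ici (0 : ℝ) := hμ
  refine integral_nonneg_of_ae ?_
  filter_upwards [hae] with x hx
  have hx : (0 : ℝ) ≤ x := hx
  have h2 : z * ((x : ℂ) - z)⁻¹ = x * ((x : ℂ) - z)⁻¹ - 1 := by
    field_simp [ofReal_sub_ne_zero hz x]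
    ring
  rw [h2, Complex.sub_im, Complex.im_ofReal_mul, im_inv_ofReal_sub]
  simp only [Complex.one_im, sub_zero, Pi.zero_apply]
  positivity

/-- The Poisson integral of a compactly supported function against a finite measure, in terms of
the Stieltjes transform. -/
theorem integral_poisson_eq (μ : Measure ℝ) [IsFiniteMeasure μ] {f : ℝ → ℝ} (hf : Continuous f)
    (hfs : HasCompactSupport f) {c : ℝ} (hc : 0 < c) :
    ∫ x, (∫ t, (c ^ 1 * (Real.pi⁻¹ * (1 + (c • (x - t)) ^ 2)⁻¹)) • f t) ∂μ =
      ∫ t, f t * (Real.pi⁻¹ * (stieltjes μ (t + (c⁻¹ : ℝ) * Complex.I)).im) := by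
  have hfi : Integrable f := hf.integrable_of_hasCompactSupport hfs
  rw [integral_integral_swap]
  · refine integral_congr_ae (ae_of_all _ fun t => ?_)
    have him : (t + (c⁻¹ : ℝ) * Complex.I : ℂ).im = c⁻¹ := by simp
    have hre : (t + (c⁻¹ : ℝ) * Complex.I : ℂ).re = t := by simp
    have hpos : 0 < (t + (c⁻¹ : ℝ) * Complex.I : ℂ).im := by rw [him]; positivity
    dsimp only
    rw [stieltjes_im μ hpos, ← integral_const_mul, ← integral_const_mul, him, hre]
    refine integral_congr_ae (ae_of_all _ fun x => ?_)
    have h1 : 1 + (c * (x - t)) ^ 2 ≠ 0 := by positivity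
    have h2 : (x - t) ^ 2 + c⁻¹ ^ 2 ≠ 0 := by positivity
    simp only [smul_eq_mul]
    field_simp
    ring
  · have h1 : Integrable (fun q : ℝ × ℝ => (1 : ℝ) * f q.2) (μ.prod volume) :=
      (integrable_const (1 : ℝ)).mul_prod hfi
    simp only [one_mul] at h1
    refine Integrable.bdd_mul (c := c * Real.pi⁻¹) h1 ?_ (ae_of_all _ fun q => ?_)
    · refine Continuous.aestronglyMeasurable ?_
      refine continuous_const.mul (continuous_const.mul (Continuous.inv₀ ?_ ?_))
      · fun_prop
      · intro q; positivity
    · rw [Real.norm_of_nonneg (by positivity), pow_one]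
      refine mul_le_mul_of_nonneg_left ?_ hc.le
      refine mul_le_of_le_one_right (by positivity) ?_
      refine inv_le_one_of_one_le₀ ?_
      nlinarith [sq_nonneg (c • (q.1 - q.2))]

theorem integral_inv_pi_mul_inv_one_add_sq : ∫ x : ℝ, Real.pi⁻¹ * (1 + x ^ 2)⁻¹ = 1 := by
  rw [integral_const_mul, integral_univ_inv_one_add_sq]
  exact inv_mul_cancel₀ Real.pi_ne_zero

/-- The kernel has mass one and concentrates as c → ∞, so the inner integral tends to f(x); a bound
of |f| also bounds the inner integrals, and dominated convergence finishes. The factor `c ^ 1` is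
the general form c^dim of an approximate identity. -/
theorem tendsto_integral_poisson (μ : Measure ℝ) [IsFiniteMeasure μ] {f : ℝ → ℝ}
    (hf : Continuous f) (hfs : HasCompactSupport f) :
    Tendsto (fun c : ℝ =>
      ∫ x, (∫ t, (c ^ 1 * (Real.pi⁻¹ * (1 + (c • (x - t)) ^ 2)⁻¹)) • f t) ∂μ) atTop
      (𝓝 (∫ x, f x ∂μ)) := by
  have hfi : Integrable f := hf.integrable_of_hasCompactSupport hfs
  obtain ⟨C, hC⟩ := hf.bounded_above_of_compact_support hfs
  have hker : Integrable (fun x : ℝ => Real.pi⁻¹ * (1 + x ^ 2)⁻¹) :=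
    integrable_of_integral_eq_one integral_inv_pi_mul_inv_one_add_sq
  refine tendsto_integral_filter_of_dominated_convergence (fun _ => C) ?_ ?_
    (integrable_const C) ?_
  · filter_upwards [eventually_gt_atTop 0] with c hc
    refine StronglyMeasurable.aestronglyMeasurable ?_
    refine StronglyMeasurable.integral_prod_right' (f := fun q : ℝ × ℝ =>
      (c ^ 1 * (Real.pi⁻¹ * (1 + (c • (q.1 - q.2)) ^ 2)⁻¹)) • f q.2) ?_
    refine Continuous.stronglyMeasurable ?_
    have hk : Continuous fun q : ℝ × ℝ => (1 + (c • (q.1 - q.2)) ^ 2)⁻¹ :=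
      Continuous.inv₀ (by fun_prop) fun q => by positivity
    fun_prop
  · filter_upwards [eventually_gt_atTop 0] with c hc
    refine ae_of_all _ fun x => ?_
    have hcomp : ∫ t, (c ^ 1 * (Real.pi⁻¹ * (1 + (c • (x - t)) ^ 2)⁻¹)) * C = C := by
      rw [integral_mul_const, integral_const_mul,
        integral_sub_left_eq_self (fun y => Real.pi⁻¹ * (1 + (c • y) ^ 2)⁻¹) volume x,
        Measure.integral_comp_smul volume (fun y : ℝ => Real.pi⁻¹ * (1 + y ^ 2)⁻¹) c,
        integral_inv_pi_mul_inv_one_add_sq]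
      simp [abs_of_pos (inv_pos.2 hc), hc.ne']
    calc ‖∫ t, (c ^ 1 * (Real.pi⁻¹ * (1 + (c • (x - t)) ^ 2)⁻¹)) • f t‖
        ≤ ∫ t, (c ^ 1 * (Real.pi⁻¹ * (1 + (c • (x - t)) ^ 2)⁻¹)) * C := by
          refine norm_integral_le_of_norm_le ?_ (ae_of_all _ fun t => ?_)
          · refine Integrable.mul_const (Integrable.const_mul ?_ _) _
            have h3 := (hker.comp_smul hc.ne').comp_sub_left x
            exact h3
          · rw [norm_smul, Real.norm_of_nonneg (by positivity)]
            exact mul_le_mul_of_nonneg_left (hC t) (by positivity)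
      _ = C := hcomp
  · refine ae_of_all _ fun x => ?_
    have := tendsto_integral_comp_smul_smul_of_integrable' (μ := (volume : Measure ℝ))
      (φ := fun y : ℝ => Real.pi⁻¹ * (1 + y ^ 2)⁻¹) (fun y => by positivity)
      integral_inv_pi_mul_inv_one_add_sq ?_ hfi (hf.continuousAt (x := x))
    · simpa only [Module.finrank_self] using this
    · simp only [Module.finrank_self, pow_one]
      have h1 : Tendsto (fun x : ℝ => Real.pi⁻¹ * ‖x‖⁻¹) (Bornology.cobounded ℝ) (𝓝 0) := by
        have := (tendsto_inv_atTop_zero.comp (tendsto_norm_cobounded_atTop (E := ℝ))).const_mul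
          Real.pi⁻¹
        simpa using this
      refine squeeze_zero (fun x => by positivity) (fun x => ?_) h1
      rcases eq_or_ne x 0 with rfl | hx
      · simp
      have hx' : 0 < ‖x‖ := norm_pos_iff.2 hx
      rw [mul_left_comm]
      refine mul_le_mul_of_nonneg_left ?_ (by positivity)
      rw [← div_eq_mul_inv, div_le_iff₀ (by positivity), ← sq_abs x,
        ← Real.norm_eq_abs]
      rw [inv_mul_eq_div, le_div_iff₀ hx']
      nlinarith

/-- A finite measure is determined by its Stieltjes transform. -/
theorem eq_of_stieltjes_eq (μ ν : Measure ℝ) [IsFiniteMeasure μ] [IsFiniteMeasure ν]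
    (h : ∀ z : ℂ, 0 < z.im → stieltjes μ z = stieltjes ν z) : μ = ν := by
  refine Measure.ext_of_integral_eq_on_compactlySupported fun f => ?_
  -- Stieltjes inversion: the Poisson integral at height c⁻¹ depends on the transform only, and it
  -- recovers the integral of f as c → ∞.
  have h1 := tendsto_integral_poisson μ f.continuous f.hasCompactSupport
  have h2 := tendsto_integral_poisson ν f.continuous f.hasCompactSupport
  refine tendsto_nhds_unique h1 (h2.congr' ?_)
  filter_upwards [eventually_gt_atTop 0] with c hc
  rw [integral_poisson_eq μ f.continuous f.hasCompactSupport hc,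
    integral_poisson_eq ν f.continuous f.hasCompactSupport hc]
  refine integral_congr_ae (ae_of_all _ fun t => ?_)
  dsimp only
  rw [h]
  simpa using hc

end StieltjesTransform

/-! ### Limits of Stieltjes transforms and weak convergence -/

section StieltjesConvergence

/-- Convergence of the integrals of real bounded continuous functions extends to complex ones. -/
theorem tendsto_integral_complex {ι E : Type*} [TopologicalSpace E] [MeasurableSpace E]
    [OpensMeasurableSpace E] {l : Filter ι} {μ : ι → Measure E} {μ₀ : Measure E}
    (hμ : ∀ᶠ i in l, IsFiniteMeasure (μ i)) [IsFiniteMeasure μ₀]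
    (h : ∀ f : BoundedContinuousFunction E ℝ,
      Tendsto (fun i => ∫ x, f x ∂(μ i)) l (𝓝 (∫ x, f x ∂μ₀)))
    {k : E → ℂ} (hk : Continuous k) {C : ℝ} (hC : ∀ x, ‖k x‖ ≤ C) :
    Tendsto (fun i => ∫ x, k x ∂(μ i)) l (𝓝 (∫ x, k x ∂μ₀)) := by
  have key : ∀ m : Measure E, IsFiniteMeasure m → ((∫ x, (k x).re ∂m : ℝ) : ℂ) +
      ((∫ x, (k x).im ∂m : ℝ) : ℂ) * Complex.I = ∫ x, k x ∂m := fun m _ =>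
    integral_re_add_im (𝕜 := ℂ)
      (Integrable.of_bound hk.aestronglyMeasurable C (ae_of_all _ hC))
  have h1 := h (BoundedContinuousFunction.ofNormedAddCommGroup (fun x => (k x).re)
    (Complex.continuous_re.comp hk) C fun x => (Complex.abs_re_le_norm _).trans (hC x))
  have h2 := h (BoundedContinuousFunction.ofNormedAddCommGroup (fun x => (k x).im)
    (Complex.continuous_im.comp hk) C fun x => (Complex.abs_im_le_norm _).trans (hC x))
  simp only [BoundedContinuousFunction.coe_ofNormedAddCommGroup] at h1 h2
  rw [← key μ₀ inferInstance]
  refine (((Complex.continuous_ofReal.tendsto _).comp h1).add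
    (((Complex.continuous_ofReal.tendsto _).comp h2).mul_const _)).congr' ?_
  filter_upwards [hμ] with i hi using key (μ i) hi

theorem tendsto_integral_bounded_continuous {ι : Type*} {l : Filter ι} {ν : ι → FiniteMeasure ℝ}
    {ν₀ : FiniteMeasure ℝ} (h : Tendsto ν l (𝓝 ν₀)) {k : ℝ → ℂ} (hk : Continuous k) {C : ℝ}
    (hC : ∀ x, ‖k x‖ ≤ C) :
    Tendsto (fun i => ∫ x, k x ∂(ν i : Measure ℝ)) l (𝓝 (∫ x, k x ∂(ν₀ : Measure ℝ))) :=
  tendsto_integral_complex (Eventually.of_forall fun _ => inferInstance)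
    (FiniteMeasure.tendsto_iff_forall_integral_tendsto.1 h) hk hC

/-- In the coordinate y = (1 + x)⁻¹ the kernel (x − z)⁻¹ becomes y / (1 − (1 + z) y). The half line
[0, ∞) becomes (0, 1], and the kernel extends continuously to y = 0, the image of infinity, where it
vanishes. -/
theorem one_sub_mul_ofReal_ne_zero {z : ℂ} (hz : 0 < z.im) (y : ℝ) :
    1 - (1 + z) * (y : ℂ) ≠ 0 := by
  intro h
  have h1 := congrArg Complex.im h
  have h2 := congrArg Complex.re h
  simp at h1 h2
  rcases h1 with h1 | h1
  · linarith
  · subst h1; simp at h2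

theorem norm_div_one_sub_mul_ofReal_le {z : ℂ} (hz : 0 < z.im) (y : ℝ) :
    ‖(y : ℂ) / (1 - (1 + z) * (y : ℂ))‖ ≤ z.im⁻¹ := by
  rw [norm_div, div_le_iff₀ (norm_pos_iff.2 (one_sub_mul_ofReal_ne_zero hz y))]
  have := Complex.abs_im_le_norm (1 - (1 + z) * (y : ℂ))
  simp only [Complex.sub_im, Complex.one_im, Complex.mul_im, Complex.add_re, Complex.one_re,
    Complex.ofReal_im, mul_zero, Complex.add_im, zero_add, Complex.ofReal_re, zero_sub,
    abs_neg, abs_mul, abs_of_pos hz] at this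
  rw [Complex.norm_real, Real.norm_eq_abs, inv_mul_eq_div, le_div_iff₀ hz]
  linarith

/-- A pointwise limit of Stieltjes transforms of measures on `[0, ∞)` of bounded mass is the
Stieltjes transform of a finite measure on `[0, ∞)`. -/
theorem isStieltjes_of_tendsto {ι : Type*} {l : Filter ι} [l.NeBot] (μ : ι → Measure ℝ)
    [∀ i, IsFiniteMeasure (μ i)] (hμ : ∀ i, μ i (Set.Ici 0)ᶜ = 0) {C : NNReal}
    (hC : ∀ᶠ i in l, μ i Set.univ ≤ C) {f : ℂ → ℂ}
    (h : ∀ z : ℂ, 0 < z.im → Tendsto (fun i => stieltjes (μ i) z) l (𝓝 (f z))) :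
    IsStieltjes (Set.Ici 0) f := by
  -- The absolute value only makes the change of coordinate y = (1 + x)⁻¹ continuous on the whole
  -- line; the measures live on x ≥ 0.
  have hy : Continuous fun x : ℝ => (1 + |x|)⁻¹ :=
    (continuous_const.add continuous_abs).inv₀ fun x => (by linarith [abs_nonneg x] : (0 : ℝ) < 1 + |x|).ne'
  let ν : ι → FiniteMeasure ℝ := fun i => ⟨(μ i).map fun x => (1 + |x|)⁻¹, inferInstance⟩
  -- On [0, 1] measures of bounded mass form a compact set, so no tightness is needed.
  have hcomp := isCompact_setOfPred_finiteMeasure_le_of_isCompact C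
    (isCompact_Icc (a := (0 : ℝ)) (b := 1))
  have hmem : ∀ᶠ i in l, ν i ∈ {m : FiniteMeasure ℝ | m.mass ≤ C ∧ m (Set.Icc 0 1)ᶜ = 0} := by
    filter_upwards [hC] with i hi
    constructor
    · rw [← ENNReal.coe_le_coe, FiniteMeasure.ennreal_mass]
      change (μ i).map _ Set.univ ≤ C
      rw [Measure.map_apply hy.measurable MeasurableSet.univ]
      simpa using hi
    · rw [← ENNReal.coe_eq_zero, FiniteMeasure.ennreal_coeFn_eq_coeFn_toMeasure]
      change (μ i).map _ (Set.Icc 0 1)ᶜ = 0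
      rw [Measure.map_apply hy.measurable measurableSet_Icc.compl]
      convert measure_empty (μ := μ i)
      ext x
      simp only [Set.preimage_compl, Set.mem_compl_iff, Set.mem_preimage, Set.mem_Icc,
        Set.mem_empty_iff_false, iff_false, not_not]
      refine ⟨by positivity, inv_le_one_of_one_le₀ (by linarith [abs_nonneg x])⟩
  obtain ⟨ν₀, ⟨-, hν₀⟩, hcl⟩ := hcomp.exists_mapClusterPt (f := l) (u := ν)
    (by rw [le_principal_iff]; exact hmem)
  obtain ⟨U, hU, hlim⟩ := mapClusterPt_iff_ultrafilter.1 hcl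
  have hν₀' : (ν₀ : Measure ℝ) (Set.Icc 0 1)ᶜ = 0 := by
    rw [← FiniteMeasure.ennreal_coeFn_eq_coeFn_toMeasure, hν₀]; rfl
  have hm : Measurable fun y : ℝ => y⁻¹ - 1 := by fun_prop
  -- Mass that escaped to infinity sits at y = 0. It is discarded, which does not change the
  -- transform because the kernel is zero there.
  refine ⟨((ν₀ : Measure ℝ).restrict (Set.Ioc 0 1)).map fun y => y⁻¹ - 1, inferInstance, ?_, ?_⟩
  · rw [Measure.map_apply hm measurableSet_Ici.compl,
      Measure.restrict_apply (hm measurableSet_Ici.compl)]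
    convert measure_empty (μ := (ν₀ : Measure ℝ))
    ext y
    simp only [Set.preimage_compl, Set.mem_inter_iff, Set.mem_compl_iff, Set.mem_preimage,
      Set.mem_Ici, Set.mem_Ioc, Set.mem_empty_iff_false, iff_false, not_and]
    intro h1 h2 h3
    have := (one_le_inv₀ h2).2 h3
    exact h1 (by linarith)
  · intro z hz
    have hk : Continuous fun y : ℝ => (y : ℂ) / (1 - (1 + z) * (y : ℂ)) :=
      Continuous.div (by fun_prop) (by fun_prop) (one_sub_mul_ofReal_ne_zero hz)
    have h1 := tendsto_integral_bounded_continuous hlim hk (norm_div_one_sub_mul_ofReal_le hz)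
    have h2 : ∀ i, ∫ y, (y : ℂ) / (1 - (1 + z) * (y : ℂ)) ∂(ν i : Measure ℝ) =
        stieltjes (μ i) z := by
      intro i
      change ∫ y : ℝ, (y : ℂ) / (1 - (1 + z) * (y : ℂ)) ∂((μ i).map fun x : ℝ => (1 + |x|)⁻¹) = _
      rw [integral_map hy.measurable.aemeasurable hk.aestronglyMeasurable, stieltjes]
      have hae : ∀ᵐ x ∂(μ i), x ∈ Set.Ici (0 : ℝ) := hμ i
      refine integral_congr_ae ?_
      filter_upwards [hae] with x hx
      have hx : (0 : ℝ) ≤ x := hx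
      rw [abs_of_nonneg hx]
      have hx1 : (1 + x : ℂ) ≠ 0 := by
        have : (1 + x : ℝ) ≠ 0 := by positivity
        exact_mod_cast this
      have h3 := ofReal_sub_ne_zero hz x
      have h4 := one_sub_mul_ofReal_ne_zero hz (1 + x)⁻¹
      push_cast at h4 ⊢
      rw [div_eq_iff h4, eq_comm, inv_mul_eq_iff_eq_mul₀ h3]
      field_simp
      ring
    simp only [h2] at h1
    have h5 := tendsto_nhds_unique h1 ((h z hz).mono_left hU)
    rw [← h5, stieltjes, integral_map hm.aemeasurable
      (continuous_inv_ofReal_sub hz).aestronglyMeasurable,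
      ← integral_indicator measurableSet_Ioc]
    have hae : ∀ᵐ y ∂(ν₀ : Measure ℝ), y ∈ Set.Icc (0 : ℝ) 1 := hν₀'
    refine integral_congr_ae ?_
    filter_upwards [hae] with y hy'
    rcases hy'.1.eq_or_lt with h0 | h0
    · simp [← h0]
    · rw [Set.indicator_of_mem (show y ∈ Set.Ioc (0 : ℝ) 1 from ⟨h0, hy'.2⟩)]
      have h3 := ofReal_sub_ne_zero hz (y⁻¹ - 1)
      have h4 := one_sub_mul_ofReal_ne_zero hz y
      have h6 : (y : ℂ) ≠ 0 := by exact_mod_cast h0.ne'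
      push_cast at h3 ⊢
      rw [div_eq_iff h4, eq_comm, inv_mul_eq_iff_eq_mul₀ h3]
      field_simp
      ring

/-- The quantity equals ∫ v² / (x² + v²) dμ. It serves to read off the total mass of a measure from
its transform. -/
theorem tendsto_mul_im_stieltjes (μ : Measure ℝ) [IsFiniteMeasure μ] :
    Tendsto (fun v : ℝ => v * (stieltjes μ (v * Complex.I)).im) atTop (𝓝 (μ.real Set.univ)) := by
  have h1 : ∀ᶠ v : ℝ in atTop, ∫ x, v ^ 2 / (x ^ 2 + v ^ 2) ∂μ =
      v * (stieltjes μ (v * Complex.I)).im := by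
    filter_upwards [eventually_gt_atTop 0] with v hv
    rw [stieltjes_im μ (by simpa using hv), ← integral_const_mul]
    refine integral_congr_ae (ae_of_all _ fun x => ?_)
    simp
    ring
  refine Tendsto.congr' h1 ?_
  have h2 : μ.real Set.univ = ∫ _, (1 : ℝ) ∂μ := by simp
  rw [h2]
  refine tendsto_integral_filter_of_dominated_convergence (fun _ => 1) ?_ ?_
    (integrable_const _) ?_
  · exact Eventually.of_forall fun v => (by fun_prop : Measurable fun x : ℝ =>
      v ^ 2 / (x ^ 2 + v ^ 2)).aestronglyMeasurable
  · refine Eventually.of_forall fun v => ae_of_all _ fun x => ?_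
    rw [Real.norm_of_nonneg (by positivity)]
    exact div_le_one_of_le₀ (by nlinarith [sq_nonneg x]) (by positivity)
  · refine ae_of_all _ fun x => ?_
    have h3 : Tendsto (fun v : ℝ => 1 - x ^ 2 / (x ^ 2 + v ^ 2)) atTop (𝓝 (1 - 0)) := by
      refine tendsto_const_nhds.sub (Tendsto.div_atTop tendsto_const_nhds ?_)
      exact tendsto_atTop_add_const_left _ _ (tendsto_pow_atTop two_ne_zero)
    rw [sub_zero] at h3
    refine h3.congr' ?_
    filter_upwards [eventually_gt_atTop 0] with v hv
    have : x ^ 2 + v ^ 2 ≠ 0 := by positivity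
    field_simp
    ring

/-- The right side is 2 ∫ x² / (x² + v²) dμ, and the integrand x² / (x² + v²) exceeds 1/2 where |x|
> v. Thus pointwise convergence of transforms controls tails and gives tightness. -/
theorem measureReal_abs_gt_le (μ : Measure ℝ) [IsProbabilityMeasure μ] {v : ℝ} (hv : 0 < v) :
    μ.real {x | v < ‖x‖} ≤ 2 * (1 - v * (stieltjes μ (v * Complex.I)).im) := by
  have hm : MeasurableSet {x : ℝ | v < ‖x‖} := measurableSet_lt measurable_const measurable_norm
  have hi : Integrable (fun x : ℝ => x ^ 2 / (x ^ 2 + v ^ 2)) μ := by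
    refine Integrable.of_bound (by fun_prop : Measurable fun x : ℝ =>
      x ^ 2 / (x ^ 2 + v ^ 2)).aestronglyMeasurable 1 (ae_of_all _ fun x => ?_)
    rw [Real.norm_of_nonneg (by positivity)]
    exact div_le_one_of_le₀ (by nlinarith [sq_nonneg v]) (by positivity)
  have h1 : 1 - v * (stieltjes μ (v * Complex.I)).im = ∫ x, x ^ 2 / (x ^ 2 + v ^ 2) ∂μ := by
    have hx : ∀ x : ℝ, v * (v / (x ^ 2 + v ^ 2)) = 1 - x ^ 2 / (x ^ 2 + v ^ 2) := by
      intro x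
      have : x ^ 2 + v ^ 2 ≠ 0 := by positivity
      field_simp
      ring
    rw [stieltjes_im μ (by simpa using hv), ← integral_const_mul]
    simp only [Complex.re_ofReal_mul, Complex.I_re, mul_zero, sub_zero, Complex.im_ofReal_mul,
      Complex.I_im, mul_one, hx]
    rw [integral_sub (integrable_const _) hi]
    simp
  rw [h1, ← integral_const_mul]
  have h2 : μ.real {x | v < ‖x‖} = ∫ x, {x : ℝ | v < ‖x‖}.indicator (fun _ => (1 : ℝ)) x ∂μ := by
    rw [integral_indicator hm]
    simp
  rw [h2]
  refine integral_mono ((integrable_const _).indicator hm) (hi.const_mul 2) fun x => ?_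
  by_cases hx : v < ‖x‖
  · rw [Set.indicator_of_mem (show x ∈ {x : ℝ | v < ‖x‖} from hx)]
    have : v ^ 2 < x ^ 2 := by
      rw [← sq_abs x, ← Real.norm_eq_abs]
      gcongr
    rw [← mul_div_assoc, le_div_iff₀ (by positivity)]
    linarith
  · rw [Set.indicator_of_notMem (show x ∉ {x : ℝ | v < ‖x‖} from hx)]
    positivity

/-- Convergence of the Stieltjes transforms of probability measures to that of a probability
measure implies weak convergence. -/
theorem weakConv_of_tendsto_stieltjes {μ : ℕ → Measure ℝ} {F : Measure ℝ} [IsProbabilityMeasure F]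
    (hμ : ∀ᶠ n in atTop, IsProbabilityMeasure (μ n))
    (h : ∀ z : ℂ, 0 < z.im → Tendsto (fun n => stieltjes (μ n) z) atTop (𝓝 (stieltjes F z))) :
    WeakConv μ F := by
  obtain ⟨N, hN⟩ := eventually_atTop.1 hμ
  -- The shift skips the initial indices at which the measures may fail to be probabilities, such as
  -- empirical distributions of empty matrices.
  let ν : ℕ → ProbabilityMeasure ℝ := fun n => ⟨μ (n + N), hN _ (Nat.le_add_left _ _)⟩
  have hν : ∀ z : ℂ, 0 < z.im → Tendsto (fun n => stieltjes (ν n : Measure ℝ) z) atTop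
      (𝓝 (stieltjes F z)) := fun z hz => (tendsto_add_atTop_iff_nat N).2 (h z hz)
  have htight : IsTightMeasureSet (Set.range fun n => (ν n : Measure ℝ)) := by
    refine isTightMeasureSet_range_of_tendsto_limsup_measure_norm_gt ?_
    have hlim : Tendsto (fun v : ℝ => ENNReal.ofReal
        (2 * (1 - v * (stieltjes F (v * Complex.I)).im))) atTop (𝓝 0) := by
      have h1 := (((tendsto_mul_im_stieltjes F).const_sub 1).const_mul 2)
      simp only [probReal_univ, sub_self, mul_zero] at h1
      simpa using ENNReal.tendsto_ofReal h1
    refine tendsto_of_tendsto_of_tendsto_of_le_of_le' tendsto_const_nhds hlim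
      (Eventually.of_forall fun _ => zero_le) ?_
    filter_upwards [eventually_gt_atTop 0] with v hv
    have h2 : Tendsto (fun n => ENNReal.ofReal
        (2 * (1 - v * (stieltjes (ν n : Measure ℝ) (v * Complex.I)).im))) atTop
        (𝓝 (ENNReal.ofReal (2 * (1 - v * (stieltjes F (v * Complex.I)).im)))) := by
      refine ENNReal.tendsto_ofReal (Tendsto.const_mul _ (Tendsto.const_sub _
        (Tendsto.const_mul _ ?_)))
      exact (Complex.continuous_im.tendsto _).comp (hν _ (by simpa using hv))
    rw [← h2.limsup_eq]
    refine limsup_le_limsup (Eventually.of_forall fun n => ?_)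
    dsimp only
    rw [← ofReal_measureReal (measure_ne_top _ _)]
    exact ENNReal.ofReal_le_ofReal (measureReal_abs_gt_le _ hv)
  have hcomp : IsCompact (closure (Set.range ν)) := by
    refine isCompact_closure_of_isTightMeasureSet ?_
    convert htight using 1
    ext m
    simp
  let F' : ProbabilityMeasure ℝ := ⟨F, inferInstance⟩
  have htend : Tendsto ν atTop (𝓝 F') := by
    -- Tightness gives compactness, and every cluster point has the transform of F, hence equals F.
    refine hcomp.tendsto_nhds_of_unique_mapClusterPt
      (Eventually.of_forall fun n => subset_closure ⟨n, rfl⟩) fun ρ _ hρ => ?_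
    obtain ⟨U, hU, hlim⟩ := mapClusterPt_iff_ultrafilter.1 hρ
    have h1 : Tendsto (fun n => (ν n).toFiniteMeasure) U (𝓝 ρ.toFiniteMeasure) :=
      (ProbabilityMeasure.toFiniteMeasure_continuous.tendsto _).comp hlim
    have h2 : (ρ : Measure ℝ) = F := by
      refine eq_of_stieltjes_eq _ _ fun z hz => ?_
      have h3 := tendsto_integral_bounded_continuous h1 (continuous_inv_ofReal_sub hz)
        (norm_inv_ofReal_sub_le hz)
      exact tendsto_nhds_unique h3 ((hν z hz).mono_left hU)
    exact Subtype.ext h2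
  intro f
  rw [ProbabilityMeasure.tendsto_iff_forall_integral_tendsto] at htend
  exact (tendsto_add_atTop_iff_nat N).1 (htend f)

/-- For functions with a common local Lipschitz bound on the upper half plane, convergence to zero
on a dense set implies convergence to zero everywhere. -/
theorem tendsto_zero_of_dense {u : ℕ → ℂ → ℂ} {C : ℝ} {D : Set ℂ} (hD : Dense D)
    (hu : ∀ᶠ n in atTop, ∀ z z' : ℂ, 0 < z.im → 0 < z'.im →
      ‖u n z - u n z'‖ ≤ C * (‖z - z'‖ / (z.im * z'.im)))
    (h : ∀ z ∈ D, 0 < z.im → Tendsto (fun n => u n z) atTop (𝓝 0)) {z : ℂ} (hz : 0 < z.im) :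
    Tendsto (fun n => u n z) atTop (𝓝 0) := by
  rw [Metric.tendsto_nhds]
  intro ε hε
  have hcont : Tendsto (fun z' : ℂ => C * (‖z - z'‖ / (z.im * z'.im))) (𝓝 z) (𝓝 0) := by
    have h1 : ContinuousAt (fun z' : ℂ => C * (‖z - z'‖ / (z.im * z'.im))) z := by
      have : z.im * z.im ≠ 0 := by positivity
      refine ContinuousAt.mul continuousAt_const (ContinuousAt.div ?_ ?_ this)
      · fun_prop
      · exact continuousAt_const.mul Complex.continuous_im.continuousAt
    simpa [ContinuousAt] using h1
  have h2 : ∀ᶠ z' in 𝓝 z, C * (‖z - z'‖ / (z.im * z'.im)) < ε / 2 :=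
    hcont.eventually_lt_const (by positivity)
  have h3 : ∀ᶠ z' in 𝓝 z, 0 < z'.im :=
    (Complex.continuous_im.tendsto z).eventually_const_lt hz
  obtain ⟨z', hzD, hz1, hz2⟩ := hD.inter_nhds_nonempty (h2.and h3)
  filter_upwards [hu, (Metric.tendsto_nhds.1 (h z' hzD hz2)) (ε / 2) (by positivity)] with n h4 h5
  rw [dist_zero_right] at h5 ⊢
  calc ‖u n z‖ = ‖(u n z - u n z') + u n z'‖ := by congr 1; ring
    _ ≤ ‖u n z - u n z'‖ + ‖u n z'‖ := norm_add_le _ _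
    _ < ε / 2 + ε / 2 := add_lt_add ((h4 z z' hz hz2).trans_lt hz1) h5
    _ = ε := by ring

end StieltjesConvergence

/-! ### The operator O and uniqueness for the fixed-point equations -/

section FixedPoint

variable {K : ℕ}

theorem pair_sub (x : Fin K → ℝ) (q q' : Fin K → ℂ) :
    pair x q - pair x q' = ∑ s, (x s : ℂ) * (q s - q' s) := by
  simp [pair, ← Finset.sum_sub_distrib, mul_sub]

theorem pair_smul (x : Fin K → ℝ) (a : ℂ) (q : Fin K → ℂ) : pair x (a • q) = a * pair x q := by
  simp only [pair, Finset.mul_sum, Pi.smul_apply, smul_eq_mul]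
  exact Finset.sum_congr rfl fun s _ => by ring

theorem im_mul_one_add_pair (ξ : ℂ) (x : Fin K → ℝ) (q : Fin K → ℂ) :
    (ξ * (1 + pair x q)).im = ξ.im + ∑ s, x s * (ξ * q s).im := by
  have : ξ * (1 + pair x q) = ξ + ∑ s, (x s : ℂ) * (ξ * q s) := by
    rw [pair, mul_add, Finset.mul_sum, mul_one]
    congr 1
    exact Finset.sum_congr rfl fun s _ => by ring
  rw [this, Complex.add_im, Complex.im_sum]
  simp only [Complex.im_ofReal_mul]

theorem continuous_pair (q : Fin K → ℂ) : Continuous fun x : Fin K → ℝ => pair x q := by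
  unfold pair
  fun_prop

/-- A direction `ξ` in the upper half plane with `ξ q` in the upper half plane bounds `1 + xᵀ q`
away from zero, with linear growth in `x`. -/
theorem mul_one_add_sum_le_norm_one_add_pair {ξ : ℂ} {δ : ℝ} (hδ : δ ≤ ξ.im)
    {q : Fin K → ℂ} (hq : ∀ s, δ ≤ (ξ * q s).im) {x : Fin K → ℝ} (hx : ∀ s, 0 ≤ x s) :
    δ * (1 + ∑ s, x s) ≤ ‖ξ‖ * ‖1 + pair x q‖ := by
  rw [← norm_mul]
  refine le_trans ?_ ((le_abs_self _).trans (Complex.abs_im_le_norm _))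
  rw [im_mul_one_add_pair, mul_add, mul_one, Finset.mul_sum]
  refine add_le_add hδ (Finset.sum_le_sum fun s _ => ?_)
  rw [mul_comm]
  exact mul_le_mul_of_nonneg_left (hq s) (hx s)

/-- The vectors `q` for which `1 + xᵀ q` is bounded away from zero on the orthant. -/
def Admissible (q : Fin K → ℂ) : Prop :=
  ∃ κ > (0 : ℝ), ∀ x : Fin K → ℝ, (∀ s, 0 ≤ x s) → κ * (1 + ∑ s, x s) ≤ ‖1 + pair x q‖

theorem admissible_of_im_mul_pos {ξ : ℂ} (hξ : 0 < ξ.im) {q : Fin K → ℂ}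
    (hq : ∀ s, 0 < (ξ * q s).im) : Admissible q := by
  have hne : 0 < ‖ξ‖ := norm_pos_iff.2 fun h => by simp [h] at hξ
  obtain ⟨δ, hδ, h1, h2⟩ : ∃ δ > (0 : ℝ), δ ≤ ξ.im ∧ ∀ s, δ ≤ (ξ * q s).im := by
    rcases isEmpty_or_nonempty (Fin K) with h | h
    · exact ⟨ξ.im, hξ, le_rfl, fun s => h.elim s⟩
    · obtain ⟨s₀, hs₀⟩ := Finite.exists_min fun s => (ξ * q s).im
      exact ⟨min ξ.im (ξ * q s₀).im, lt_min hξ (hq s₀), min_le_left _ _,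
        fun s => (min_le_right _ _).trans (hs₀ s)⟩
  refine ⟨δ / ‖ξ‖, by positivity, fun x hx => ?_⟩
  rw [div_mul_eq_mul_div, div_le_iff₀ hne, mul_comm ‖1 + pair x q‖]
  exact mul_one_add_sum_le_norm_one_add_pair h1 h2 hx

/-- The direction ξ = 1 is real and gives no lower bound at x = 0. The tilted direction 1 + iε
works: ε is small enough to keep the finitely many ξ q_s in the upper half plane. -/
theorem admissible_of_im_pos {q : Fin K → ℂ} (hq : ∀ s, 0 < (q s).im) : Admissible q := by
  obtain ⟨ε, hε, h⟩ : ∃ ε > (0 : ℝ), ∀ s, 0 < (q s).im + ε * (q s).re := by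
    have : ∀ᶠ ε : ℝ in 𝓝[>] 0, ∀ s, 0 < (q s).im + ε * (q s).re := by
      rw [eventually_all]
      intro s
      have hc : Tendsto (fun ε : ℝ => (q s).im + ε * (q s).re) (𝓝[>] 0) (𝓝 (q s).im) := by
        have : Tendsto (fun ε : ℝ => (q s).im + ε * (q s).re) (𝓝 0)
            (𝓝 ((q s).im + 0 * (q s).re)) :=
          Continuous.tendsto (by fun_prop) 0
        simpa using this.mono_left nhdsWithin_le_nhds
      exact hc.eventually_const_lt (hq s)
    obtain ⟨ε, h1, h2⟩ := (this.and self_mem_nhdsWithin).exists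
    exact ⟨ε, h2, h1⟩
  refine admissible_of_im_mul_pos (ξ := 1 + ε * Complex.I) (by simpa using hε) fun s => ?_
  have : ((1 + ε * Complex.I) * q s).im = (q s).im + ε * (q s).re := by
    simp [Complex.add_im, Complex.mul_im]
  rw [this]
  exact h s

theorem Admissible.one_add_pair_ne_zero {q : Fin K → ℂ} (hq : Admissible q) {x : Fin K → ℝ}
    (hx : ∀ s, 0 ≤ x s) : 1 + pair x q ≠ 0 := by
  obtain ⟨κ, hκ, h⟩ := hq
  intro h0
  have := h x hx
  rw [h0, norm_zero] at this
  have h2 : 0 ≤ ∑ s, x s := Finset.sum_nonneg fun s _ => hx s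
  nlinarith

theorem measurable_opO_integrand (z : ℂ) (q : Fin K → ℂ) (r : Fin K) :
    Measurable fun x : Fin K → ℝ => (x r : ℂ) / (-z * (1 + pair x q)) := by
  have := (continuous_pair q).measurable
  fun_prop

/-- These bounds make every integrand below bounded on the orthant, so the limit laws H and G need
no moments. -/
theorem Admissible.div_norm_le {q : Fin K → ℂ} (hq : Admissible q) :
    ∃ C : ℝ, 0 ≤ C ∧ ∀ x : Fin K → ℝ, (∀ s, 0 ≤ x s) →
      ‖1 + pair x q‖⁻¹ ≤ C ∧ ∀ s, x s / ‖1 + pair x q‖ ≤ C := by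
  obtain ⟨κ, hκ, h⟩ := id hq
  refine ⟨κ⁻¹, by positivity, fun x hx => ?_⟩
  have hpos : 0 < ‖1 + pair x q‖ := norm_pos_iff.2 (hq.one_add_pair_ne_zero hx)
  have h2 := h x hx
  have h3 : 0 ≤ ∑ s, x s := Finset.sum_nonneg fun s _ => hx s
  constructor
  · refine inv_anti₀ hκ ?_
    nlinarith
  · intro s
    have h4 : x s ≤ ∑ s, x s := Finset.single_le_sum (fun s _ => hx s) (Finset.mem_univ s)
    rw [div_le_iff₀ hpos, inv_mul_eq_div, le_div_iff₀ hκ]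
    nlinarith

theorem Admissible.integrable_opO {q : Fin K → ℂ} (hq : Admissible q) (z : ℂ)
    {μ : Measure (Fin K → ℝ)} [IsFiniteMeasure μ] (hμ : ∀ᵐ x ∂μ, ∀ r, 0 ≤ x r) (r : Fin K) :
    Integrable (fun x : Fin K → ℝ => (x r : ℂ) / (-z * (1 + pair x q))) μ := by
  obtain ⟨C, hC, h⟩ := hq.div_norm_le
  refine Integrable.of_bound (measurable_opO_integrand z q r).aestronglyMeasurable (‖z‖⁻¹ * C) ?_
  filter_upwards [hμ] with x hx
  rw [norm_div, norm_mul, norm_neg, Complex.norm_real, Real.norm_of_nonneg (hx r), mul_comm ‖z‖,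
    ← div_div, div_eq_inv_mul]
  exact mul_le_mul_of_nonneg_left ((h x hx).2 r) (by positivity)

theorem Admissible.integrable_div_sq {q : Fin K → ℂ} (hq : Admissible q)
    {μ : Measure (Fin K → ℝ)} [IsFiniteMeasure μ] (hμ : ∀ᵐ x ∂μ, ∀ r, 0 ≤ x r) (r : Fin K)
    (u₀ : ℝ) (u : Fin K → ℝ) :
    Integrable (fun x : Fin K → ℝ => x r * (u₀ + ∑ s, x s * u s) / ‖1 + pair x q‖ ^ 2) μ := by
  obtain ⟨C, hC, h⟩ := hq.div_norm_le
  have hm := (continuous_pair q).measurable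
  refine Integrable.of_bound (by fun_prop : Measurable _).aestronglyMeasurable
    (C * (C * |u₀| + ∑ s, C * |u s|)) ?_
  filter_upwards [hμ] with x hx
  have hpos : 0 < ‖1 + pair x q‖ := norm_pos_iff.2 (hq.one_add_pair_ne_zero hx)
  have e : x r * (u₀ + ∑ s, x s * u s) / ‖1 + pair x q‖ ^ 2 =
      x r / ‖1 + pair x q‖ * (‖1 + pair x q‖⁻¹ * u₀ + ∑ s, x s / ‖1 + pair x q‖ * u s) := by
    have : ∑ s, x s / ‖1 + pair x q‖ * u s = ‖1 + pair x q‖⁻¹ * ∑ s, x s * u s := by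
      rw [Finset.mul_sum]
      exact Finset.sum_congr rfl fun s _ => by ring
    rw [this]
    field_simp
  have h0 : ∀ s, 0 ≤ x s / ‖1 + pair x q‖ := fun s => div_nonneg (hx s) (norm_nonneg _)
  rw [e, Real.norm_eq_abs, abs_mul, abs_of_nonneg (h0 r)]
  refine mul_le_mul ((h x hx).2 r) ?_ (abs_nonneg _) hC
  refine (abs_add_le _ _).trans (add_le_add ?_ ((Finset.abs_sum_le_sum_abs _ _).trans
    (Finset.sum_le_sum fun s _ => ?_)))
  · rw [abs_mul, abs_of_nonneg (by positivity)]
    exact mul_le_mul_of_nonneg_right (h x hx).1 (abs_nonneg _)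
  · rw [abs_mul, abs_of_nonneg (h0 s)]
    exact mul_le_mul_of_nonneg_right ((h x hx).2 s) (abs_nonneg _)

/-- The integrand is −x_r / (z (1 + xᵀq)). Multiplied by z, its imaginary part is governed by Im q;
without the factor z it is governed by Im(zq), with an additional term Im z > 0. Composing two
operators O passes from Im a to Im(zb) and back, and the additional term is the gain that forces
uniqueness. -/
theorem im_mul_opO_integrand {z : ℂ} (hz : z ≠ 0) (q : Fin K → ℂ) (x : Fin K → ℝ) (r : Fin K) :
    (z * ((x r : ℂ) / (-z * (1 + pair x q)))).im =
      x r * (0 + ∑ s, x s * (q s).im) / ‖1 + pair x q‖ ^ 2 := by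
  have h1 : z * ((x r : ℂ) / (-z * (1 + pair x q))) = ((-x r : ℝ) : ℂ) * (1 + pair x q)⁻¹ := by
    rcases eq_or_ne (1 + pair x q) 0 with h | h
    · simp [h]
    · push_cast
      field_simp
  have h2 := im_mul_one_add_pair 1 x q
  simp only [one_mul, Complex.one_im] at h2
  rw [h1, Complex.im_ofReal_mul, Complex.inv_im, h2, Complex.normSq_eq_norm_sq]
  ring

theorem im_opO_integrand (z : ℂ) (q : Fin K → ℂ) (x : Fin K → ℝ) (r : Fin K) :
    ((x r : ℂ) / (-z * (1 + pair x q))).im =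
      (‖z‖ ^ 2)⁻¹ * (x r * (z.im + ∑ s, x s * (z * q s).im) / ‖1 + pair x q‖ ^ 2) := by
  have h1 : (x r : ℂ) / (-z * (1 + pair x q)) = ((-x r : ℝ) : ℂ) * (z * (1 + pair x q))⁻¹ := by
    rw [div_eq_mul_inv, neg_mul, inv_neg]
    push_cast
    ring
  have h2 := im_mul_one_add_pair z x q
  rw [h1, Complex.im_ofReal_mul, Complex.inv_im, h2, Complex.normSq_eq_norm_sq, norm_mul]
  ring

theorem im_integral {α : Type*} [MeasurableSpace α] {μ : Measure α} {f : α → ℂ}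
    (hf : Integrable f μ) : (∫ x, f x ∂μ).im = ∫ x, (f x).im ∂μ := by
  have := integral_im (𝕜 := ℂ) hf
  simpa only [RCLike.im_to_complex] using this.symm

theorem im_mul_opO {z : ℂ} (hz : z ≠ 0) {q : Fin K → ℂ} {μ : Measure (Fin K → ℝ)} {r : Fin K}
    (hi : Integrable (fun x : Fin K → ℝ => (x r : ℂ) / (-z * (1 + pair x q))) μ) :
    (z * opO z q μ r).im = ∫ x, x r * (0 + ∑ s, x s * (q s).im) / ‖1 + pair x q‖ ^ 2 ∂μ := by
  rw [opO, ← integral_const_mul, im_integral (hi.const_mul z)]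
  simp only [im_mul_opO_integrand hz]

theorem im_opO {z : ℂ} {q : Fin K → ℂ} {μ : Measure (Fin K → ℝ)} {r : Fin K}
    (hi : Integrable (fun x : Fin K → ℝ => (x r : ℂ) / (-z * (1 + pair x q))) μ) :
    (opO z q μ r).im = (‖z‖ ^ 2)⁻¹ *
      ∫ x, x r * (z.im + ∑ s, x s * (z * q s).im) / ‖1 + pair x q‖ ^ 2 ∂μ := by
  rw [opO, im_integral hi, ← integral_const_mul]
  simp only [im_opO_integrand]

/-- The positive quantities `∫ x_r (u₀ + xᵀ u) / |1 + xᵀ q|² dμ`. -/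
theorem Admissible.integral_div_sq_pos {q : Fin K → ℂ} (hq : Admissible q)
    {μ : Measure (Fin K → ℝ)} [IsFiniteMeasure μ] (hμ : ∀ᵐ x ∂μ, ∀ r, 0 ≤ x r) {r : Fin K}
    (hr : ¬ ∀ᵐ x ∂μ, x r = 0) {u₀ : ℝ} (hu₀ : 0 ≤ u₀) {u : Fin K → ℝ} (hu : ∀ s, 0 < u s) :
    0 < ∫ x, x r * (u₀ + ∑ s, x s * u s) / ‖1 + pair x q‖ ^ 2 ∂μ := by
  have h0 : 0 ≤ᵐ[μ] fun x => x r * (u₀ + ∑ s, x s * u s) / ‖1 + pair x q‖ ^ 2 := by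
    filter_upwards [hμ] with x hx
    have : 0 ≤ ∑ s, x s * u s := Finset.sum_nonneg fun s _ => mul_nonneg (hx s) (hu s).le
    have := hx r
    simp only [Pi.zero_apply]
    positivity
  refine lt_of_le_of_ne (integral_nonneg_of_ae h0) fun h => hr ?_
  have h1 := (integral_eq_zero_iff_of_nonneg_ae h0 (hq.integrable_div_sq hμ r u₀ u)).1 h.symm
  filter_upwards [h1, hμ] with x hx hx0
  have hpos : 0 < ‖1 + pair x q‖ := norm_pos_iff.2 (hq.one_add_pair_ne_zero hx0)
  simp only [Pi.zero_apply, div_eq_zero_iff, mul_eq_zero, pow_eq_zero_iff, ne_eq,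
    OfNat.ofNat_ne_zero, not_false_eq_true, hpos.ne', or_false] at hx
  rcases hx with hx | hx
  · exact hx
  · have h2 : x r * u r ≤ ∑ s, x s * u s :=
      Finset.single_le_sum (f := fun s => x s * u s)
        (fun s _ => mul_nonneg (hx0 s) (hu s).le) (Finset.mem_univ r)
    have h3 : x r * u r ≤ 0 := by linarith
    have h4 := hx0 r
    have h5 := hu r
    by_contra hne
    have : 0 < x r := lt_of_le_of_ne h4 (Ne.symm hne)
    nlinarith [mul_pos this h5]

theorem norm_opO_integrand_sub_le {z : ℂ} {q₁ q₂ : Fin K → ℂ} {x : Fin K → ℝ}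
    (hx : ∀ s, 0 ≤ x s) (h₁ : 1 + pair x q₁ ≠ 0) (h₂ : 1 + pair x q₂ ≠ 0) (r : Fin K) :
    ‖(x r : ℂ) / (-z * (1 + pair x q₁)) - (x r : ℂ) / (-z * (1 + pair x q₂))‖ ≤
      ‖z‖⁻¹ * (x r * (∑ s, x s * ‖q₁ s - q₂ s‖) / (‖1 + pair x q₁‖ * ‖1 + pair x q₂‖)) := by
  rcases eq_or_ne z 0 with rfl | hz
  · simp
  have e : (x r : ℂ) / (-z * (1 + pair x q₁)) - (x r : ℂ) / (-z * (1 + pair x q₂)) =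
      z⁻¹ * ((x r : ℂ) * (pair x q₁ - pair x q₂) / ((1 + pair x q₁) * (1 + pair x q₂))) := by
    field_simp
    ring
  rw [e, norm_mul, norm_inv, norm_div, norm_mul, norm_mul, Complex.norm_real,
    Real.norm_of_nonneg (hx r), pair_sub]
  have h3 := hx r
  gcongr
  refine (norm_sum_le _ _).trans (Finset.sum_le_sum fun s _ => ?_)
  rw [norm_mul, Complex.norm_real, Real.norm_of_nonneg (hx s)]

/-- The contraction estimate behind uniqueness: a weighted form of the Cauchy-Schwarz
inequality. -/
theorem norm_opO_sub_le {z : ℂ} {μ : Measure (Fin K → ℝ)} [IsFiniteMeasure μ]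
    (hμ : ∀ᵐ x ∂μ, ∀ r, 0 ≤ x r) {q₁ q₂ : Fin K → ℂ} (h₁ : Admissible q₁) (h₂ : Admissible q₂)
    {u₁ u₂ : Fin K → ℝ} (hu₁ : ∀ s, 0 < u₁ s) (hu₂ : ∀ s, 0 < u₂ s) {t : ℝ} (ht : 0 ≤ t)
    (hq : ∀ s, ‖q₁ s - q₂ s‖ ≤ t * √(u₁ s * u₂ s)) {r : Fin K} {V₁ V₂ : ℝ}
    (hV₁ : V₁ = ∫ x, x r * (0 + ∑ s, x s * u₁ s) / ‖1 + pair x q₁‖ ^ 2 ∂μ)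
    (hV₂ : V₂ = ∫ x, x r * (0 + ∑ s, x s * u₂ s) / ‖1 + pair x q₂‖ ^ 2 ∂μ)
    (hp₁ : 0 < V₁) (hp₂ : 0 < V₂) :
    ‖opO z q₁ μ r - opO z q₂ μ r‖ ≤ ‖z‖⁻¹ * (t * √(V₁ * V₂)) := by
  have i₁ := h₁.integrable_div_sq hμ r 0 u₁
  have i₂ := h₂.integrable_div_sq hμ r 0 u₂
  -- The weight that balances the arithmetic-geometric mean inequality: with it the average of lam
  -- V₁ and lam⁻¹ V₂ is exactly √(V₁ V₂).
  set lam : ℝ := √(V₂ / V₁) with hlam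
  have hlpos : 0 < lam := Real.sqrt_pos.2 (div_pos hp₂ hp₁)
  have hval : lam * V₁ / 2 + lam⁻¹ * V₂ / 2 = √(V₁ * V₂) := by
    have e1 : lam * V₁ = √(V₁ * V₂) := by
      rw [hlam, ← Real.sqrt_mul_self hp₁.le, ← Real.sqrt_mul (by positivity),
        Real.sqrt_mul_self hp₁.le]
      congr 1
      field_simp
    have e2 : lam⁻¹ * V₂ = √(V₁ * V₂) := by
      rw [hlam, ← Real.sqrt_inv, inv_div]
      nth_rewrite 2 [← Real.sqrt_mul_self hp₂.le]
      rw [← Real.sqrt_mul (by positivity)]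
      congr 1
      field_simp
    rw [e1, e2]
    ring
  rw [opO, opO, ← integral_sub (h₁.integrable_opO z hμ r) (h₂.integrable_opO z hμ r), ← hval]
  have hintg : Integrable (fun x : Fin K → ℝ => ‖z‖⁻¹ * (t *
      (lam / 2 * (x r * (0 + ∑ s, x s * u₁ s) / ‖1 + pair x q₁‖ ^ 2) +
        lam⁻¹ / 2 * (x r * (0 + ∑ s, x s * u₂ s) / ‖1 + pair x q₂‖ ^ 2)))) μ :=
    (((i₁.const_mul _).add (i₂.const_mul _)).const_mul _).const_mul _
  refine (norm_integral_le_of_norm_le hintg ?_).trans (le_of_eq ?_)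
  · filter_upwards [hμ] with x hx
    have n₁ := h₁.one_add_pair_ne_zero hx
    have n₂ := h₂.one_add_pair_ne_zero hx
    refine (norm_opO_integrand_sub_le hx n₁ n₂ r).trans ?_
    refine mul_le_mul_of_nonneg_left ?_ (by positivity)
    have p₁ : 0 < ‖1 + pair x q₁‖ := norm_pos_iff.2 n₁
    have p₂ : 0 < ‖1 + pair x q₂‖ := norm_pos_iff.2 n₂
    set d₁ := ‖1 + pair x q₁‖
    set d₂ := ‖1 + pair x q₂‖
    have amgm : ∀ s, √(u₁ s * u₂ s) / (d₁ * d₂) ≤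
        lam / 2 * (u₁ s / d₁ ^ 2) + lam⁻¹ / 2 * (u₂ s / d₂ ^ 2) := by
      intro s
      have a1 := sq_nonneg (√lam * (√(u₁ s) / d₁) - √lam⁻¹ * (√(u₂ s) / d₂))
      have a2 : √lam * √lam⁻¹ = 1 := by
        rw [← Real.sqrt_mul hlpos.le, mul_inv_cancel₀ hlpos.ne', Real.sqrt_one]
      have a3 : (√lam * (√(u₁ s) / d₁) - √lam⁻¹ * (√(u₂ s) / d₂)) ^ 2 =
          (√lam) ^ 2 * ((√(u₁ s)) ^ 2 / d₁ ^ 2) + (√lam⁻¹) ^ 2 * ((√(u₂ s)) ^ 2 / d₂ ^ 2)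
            - 2 * (√lam * √lam⁻¹) * ((√(u₁ s) * √(u₂ s)) / (d₁ * d₂)) := by
        field_simp
        ring
      rw [a3, a2, Real.sq_sqrt hlpos.le, Real.sq_sqrt (inv_pos.2 hlpos).le,
        Real.sq_sqrt (hu₁ s).le, Real.sq_sqrt (hu₂ s).le, ← Real.sqrt_mul (hu₁ s).le] at a1
      linarith
    calc x r * (∑ s, x s * ‖q₁ s - q₂ s‖) / (d₁ * d₂)
        ≤ x r * (∑ s, x s * (t * √(u₁ s * u₂ s))) / (d₁ * d₂) := by
          have := hx r
          gcongr with s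
          · exact hx s
          · exact hq s
      _ = t * (x r * ∑ s, x s * (√(u₁ s * u₂ s) / (d₁ * d₂))) := by
          simp only [Finset.mul_sum, Finset.sum_div]
          exact Finset.sum_congr rfl fun s _ => by ring
      _ ≤ t * (x r * ∑ s, x s * (lam / 2 * (u₁ s / d₁ ^ 2) + lam⁻¹ / 2 * (u₂ s / d₂ ^ 2))) := by
          have := hx r
          gcongr with s
          · exact hx s
          · exact amgm s
      _ = _ := by
          congr 1
          simp only [zero_add, Finset.mul_sum, Finset.sum_div]
          rw [← Finset.sum_add_distrib]
          exact Finset.sum_congr rfl fun s _ => by ring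
  · rw [integral_const_mul, integral_const_mul,
      integral_add (i₁.const_mul _) (i₂.const_mul _), integral_const_mul, integral_const_mul,
      ← hV₁, ← hV₂]
    ring

/-- Pointwise uniqueness for the composed fixed-point equation. -/
theorem opO_comp_unique {z : ℂ} (hz : 0 < z.im) {μ ν : Measure (Fin K → ℝ)} [IsFiniteMeasure μ]
    [IsFiniteMeasure ν] (hμ : ∀ᵐ x ∂μ, ∀ r, 0 ≤ x r) (hν : ∀ᵐ x ∂ν, ∀ r, 0 ≤ x r)
    (hμ0 : ∀ r, ¬ ∀ᵐ x ∂μ, x r = 0) (hν0 : ∀ r, ¬ ∀ᵐ x ∂ν, x r = 0) {a₁ a₂ : Fin K → ℂ}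
    (h₁ : ∀ r, 0 < (a₁ r).im) (h₂ : ∀ r, 0 < (a₂ r).im)
    (e₁ : ∀ r, a₁ r = opO z (opO z a₁ ν) μ r) (e₂ : ∀ r, a₂ r = opO z (opO z a₂ ν) μ r) :
    a₁ = a₂ := by
  have hz0 : z ≠ 0 := fun h => by simp [h] at hz
  have hzn : 0 < ‖z‖ := norm_pos_iff.2 hz0
  -- For a solution a, put b = O(z, a, ν). Then Im(zb) is an exact integral against Im a, while Im a
  -- strictly exceeds |z|⁻² times the corresponding integral against Im(zb).
  have step : ∀ {a : Fin K → ℂ}, (∀ r, 0 < (a r).im) → (∀ r, a r = opO z (opO z a ν) μ r) →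
      Admissible a ∧ (∀ r, 0 < (z * opO z a ν r).im) ∧ Admissible (opO z a ν) ∧
      (∀ r, (z * opO z a ν r).im =
        ∫ x, x r * (0 + ∑ s, x s * (a s).im) / ‖1 + pair x a‖ ^ 2 ∂ν) ∧
      ∀ r, 0 < ∫ x, x r * (0 + ∑ s, x s * (z * opO z a ν s).im) /
          ‖1 + pair x (opO z a ν)‖ ^ 2 ∂μ ∧
        (‖z‖ ^ 2)⁻¹ * ∫ x, x r * (0 + ∑ s, x s * (z * opO z a ν s).im) /
          ‖1 + pair x (opO z a ν)‖ ^ 2 ∂μ < (a r).im := by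
    intro a ha hea
    have had := admissible_of_im_pos ha
    have hv : ∀ r, (z * opO z a ν r).im =
        ∫ x, x r * (0 + ∑ s, x s * (a s).im) / ‖1 + pair x a‖ ^ 2 ∂ν := fun r =>
      im_mul_opO hz0 (had.integrable_opO z hν r)
    have hvpos : ∀ r, 0 < (z * opO z a ν r).im := fun r => by
      rw [hv r]
      exact had.integral_div_sq_pos hν (hν0 r) le_rfl ha
    have hbd := admissible_of_im_mul_pos hz hvpos
    refine ⟨had, hvpos, hbd, hv, fun r => ⟨hbd.integral_div_sq_pos hμ (hμ0 r) le_rfl hvpos, ?_⟩⟩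
    have h3 : (a r).im = _ := (congrArg Complex.im (hea r)).trans
      (im_opO (hbd.integrable_opO z hμ r))
    rw [h3]
    refine mul_lt_mul_of_pos_left ?_ (by positivity)
    have i1 := hbd.integrable_div_sq hμ r 0 fun s => (z * opO z a ν s).im
    -- Taking u = 0 isolates the forcing term Im z ∫ x_r / |1 + xᵀb|² dμ. It is positive because x_r
    -- does not vanish almost everywhere, and so the inequality is strict.
    have i2 := hbd.integrable_div_sq hμ r z.im 0
    have h4 : ∫ x, x r * (z.im + ∑ s, x s * (z * opO z a ν s).im) /
          ‖1 + pair x (opO z a ν)‖ ^ 2 ∂μ =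
        ∫ x, x r * (0 + ∑ s, x s * (z * opO z a ν s).im) / ‖1 + pair x (opO z a ν)‖ ^ 2 ∂μ +
        ∫ x, x r * (z.im + ∑ s, x s * (0 : Fin K → ℝ) s) / ‖1 + pair x (opO z a ν)‖ ^ 2 ∂μ := by
      rw [← integral_add i1 i2]
      refine integral_congr_ae (ae_of_all _ fun x => ?_)
      simp
      ring
    rw [h4]
    refine lt_add_of_pos_right _ ?_
    have h0 : 0 ≤ᵐ[μ] fun x => x r * (z.im + ∑ s, x s * (0 : Fin K → ℝ) s) /
        ‖1 + pair x (opO z a ν)‖ ^ 2 := by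
      filter_upwards [hμ] with x hx
      have := hx r
      simp only [Pi.zero_apply, mul_zero, Finset.sum_const_zero, add_zero]
      positivity
    refine lt_of_le_of_ne (integral_nonneg_of_ae h0) fun h => hμ0 r ?_
    have h1 := (integral_eq_zero_iff_of_nonneg_ae h0 i2).1 h.symm
    filter_upwards [h1, hμ] with x hx hx0
    have hpos : 0 < ‖1 + pair x (opO z a ν)‖ := norm_pos_iff.2 (hbd.one_add_pair_ne_zero hx0)
    simpa [hz.ne', hpos.ne'] using hx
  obtain ⟨A₁, v₁, B₁, ev₁, w₁⟩ := step h₁ e₁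
  obtain ⟨A₂, v₂, B₂, ev₂, w₂⟩ := step h₂ e₂
  by_contra hne
  obtain ⟨r₁, hr₁⟩ := Function.ne_iff.1 hne
  have : Nonempty (Fin K) := ⟨r₁⟩
  have hs : ∀ r, 0 < √((a₁ r).im * (a₂ r).im) := fun r => Real.sqrt_pos.2 (mul_pos (h₁ r) (h₂ r))
  -- t is the distance of the two solutions in the weighted sup metric. The inner operator carries
  -- it to |z|⁻¹ t relative to Im(zb), and the outer one back to a distance strictly below t at the
  -- maximizing coordinate, a contradiction.
  obtain ⟨r₀, hr₀⟩ := Finite.exists_max fun r => ‖a₁ r - a₂ r‖ / √((a₁ r).im * (a₂ r).im)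
  set t := ‖a₁ r₀ - a₂ r₀‖ / √((a₁ r₀).im * (a₂ r₀).im) with ht
  have htpos : 0 < t :=
    lt_of_lt_of_le (div_pos (norm_pos_iff.2 (sub_ne_zero.2 hr₁)) (hs r₁)) (hr₀ r₁)
  have hb : ∀ r, ‖opO z a₁ ν r - opO z a₂ ν r‖ ≤
      (‖z‖⁻¹ * t) * √((z * opO z a₁ ν r).im * (z * opO z a₂ ν r).im) := by
    intro r
    rw [mul_assoc]
    refine norm_opO_sub_le hν A₁ A₂ h₁ h₂ htpos.le (fun s => ?_) (ev₁ r) (ev₂ r) (v₁ r) (v₂ r)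
    have := hr₀ s
    rwa [div_le_iff₀ (hs s)] at this
  have ha := norm_opO_sub_le (z := z) hμ B₁ B₂ v₁ v₂ (by positivity) hb rfl rfl (w₁ r₀).1
    (w₂ r₀).1
  rw [← e₁ r₀, ← e₂ r₀] at ha
  set W₁ := ∫ x, x r₀ * (0 + ∑ s, x s * (z * opO z a₁ ν s).im) /
          ‖1 + pair x (opO z a₁ ν)‖ ^ 2 ∂μ
  set W₂ := ∫ x, x r₀ * (0 + ∑ s, x s * (z * opO z a₂ ν s).im) /
          ‖1 + pair x (opO z a₂ ν)‖ ^ 2 ∂μ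
  have hlt : √(((‖z‖ ^ 2)⁻¹ * W₁) * ((‖z‖ ^ 2)⁻¹ * W₂)) < √((a₁ r₀).im * (a₂ r₀).im) := by
    refine Real.sqrt_lt_sqrt ?_ ?_
    · have := (w₁ r₀).1
      have := (w₂ r₀).1
      positivity
    · have p1 := (w₁ r₀).1
      exact mul_lt_mul'' (w₁ r₀).2 (w₂ r₀).2 (by positivity)
        (by have := (w₂ r₀).1; positivity)
  have heq : √(((‖z‖ ^ 2)⁻¹ * W₁) * ((‖z‖ ^ 2)⁻¹ * W₂)) = ‖z‖⁻¹ * ‖z‖⁻¹ * √(W₁ * W₂) := by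
    rw [show ((‖z‖ ^ 2)⁻¹ * W₁) * ((‖z‖ ^ 2)⁻¹ * W₂) =
      (‖z‖⁻¹ * ‖z‖⁻¹) ^ 2 * (W₁ * W₂) by field_simp,
      Real.sqrt_mul (by positivity), Real.sqrt_sq (by positivity)]
  have hfin : ‖a₁ r₀ - a₂ r₀‖ < t * √((a₁ r₀).im * (a₂ r₀).im) := by
    refine lt_of_le_of_lt ha ?_
    rw [← mul_assoc, ← mul_assoc, mul_comm (‖z‖⁻¹ * ‖z‖⁻¹) t, mul_assoc t, ← heq]
    exact mul_lt_mul_of_pos_left hlt htpos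
  rw [ht, div_mul_cancel₀ _ (hs r₀).ne'] at hfin
  exact lt_irrefl _ hfin

end FixedPoint

/-! ### Passage to the limit in approximate fixed-point equations -/

section Stability

variable {K : ℕ}

/-- Probability measures on the orthant with finite first moments. -/
structure IsOrthantLaw (μ : Measure (Fin K → ℝ)) : Prop where
  prob : IsProbabilityMeasure μ
  nonneg : ∀ᵐ x ∂μ, ∀ r, 0 ≤ x r
  integrable : ∀ r, Integrable (fun x : Fin K → ℝ => x r) μ

theorem norm_one_add_pair_le {M : ℝ} {q : Fin K → ℂ} (hq : ∀ s, ‖q s‖ ≤ M)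
    {x : Fin K → ℝ} (hx : ∀ s, 0 ≤ x s) : ‖1 + pair x q‖ ≤ 1 + M * ∑ s, x s := by
  refine (norm_add_le _ _).trans (add_le_add (by simp) ?_)
  rw [pair, Finset.mul_sum]
  refine (norm_sum_le _ _).trans (Finset.sum_le_sum fun s _ => ?_)
  rw [norm_mul, Complex.norm_real, Real.norm_of_nonneg (hx s), mul_comm]
  exact mul_le_mul_of_nonneg_right (hq s) (hx s)

theorem im_le_norm_mul_one_add_pair {z : ℂ} {q : Fin K → ℂ}
    (hq : ∀ s, 0 ≤ (z * q s).im) {x : Fin K → ℝ} (hx : ∀ s, 0 ≤ x s) :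
    z.im ≤ ‖z * (1 + pair x q)‖ := by
  refine le_trans ?_ ((le_abs_self _).trans (Complex.abs_im_le_norm _))
  rw [im_mul_one_add_pair]
  exact le_add_of_nonneg_right (Finset.sum_nonneg fun s _ => mul_nonneg (hx s) (hq s))

/-- Before the limit only the weak inequality Im(zq) ≥ 0 is at hand. Then |z(1 + xᵀq)| ≥ Im z
without growth in x, and integrability rests on first moments, which empirical measures have. -/
theorem norm_opO_integrand_le {z : ℂ} (hz : 0 < z.im) {q : Fin K → ℂ}
    (hq : ∀ s, 0 ≤ (z * q s).im) {x : Fin K → ℝ} (hx : ∀ s, 0 ≤ x s) (r : Fin K) :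
    ‖(x r : ℂ) / (-z * (1 + pair x q))‖ ≤ z.im⁻¹ * x r := by
  have h := im_le_norm_mul_one_add_pair hq hx
  rw [neg_mul, div_neg, norm_neg, norm_div, Complex.norm_real, Real.norm_of_nonneg (hx r),
    div_eq_inv_mul]
  exact mul_le_mul_of_nonneg_right (inv_anti₀ hz h) (hx r)

theorem IsOrthantLaw.integrable_opO {μ : Measure (Fin K → ℝ)} (hμ : IsOrthantLaw μ) {z : ℂ}
    (hz : 0 < z.im) {q : Fin K → ℂ} (hq : ∀ s, 0 ≤ (z * q s).im) (r : Fin K) :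
    Integrable (fun x : Fin K → ℝ => (x r : ℂ) / (-z * (1 + pair x q))) μ := by
  refine Integrable.mono' ((hμ.integrable r).const_mul z.im⁻¹)
    (measurable_opO_integrand z q r).aestronglyMeasurable ?_
  filter_upwards [hμ.nonneg] with x hx using norm_opO_integrand_le hz hq hx r

/-- A bounded continuous function on `ℝ^K` that equals `x_r^k / (1 + M ∑ x)²` on the orthant. -/
def orthantTest (M : ℝ) (r : Fin K) (k : ℕ) (x : Fin K → ℝ) : ℝ :=
  max (x r) 0 ^ k / (1 + M * ∑ s, max (x s) 0) ^ 2

theorem orthantTest_eq {M : ℝ} {r : Fin K} {k : ℕ} {x : Fin K → ℝ} (hx : ∀ s, 0 ≤ x s) :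
    orthantTest M r k x = x r ^ k / (1 + M * ∑ s, x s) ^ 2 := by
  simp [orthantTest, max_eq_left (hx _)]

theorem continuous_orthantTest {M : ℝ} (hM : 1 ≤ M) (r : Fin K) (k : ℕ) :
    Continuous (orthantTest M r k) := by
  unfold orthantTest
  refine Continuous.div (by fun_prop) (by fun_prop) fun x => ?_
  have : 0 ≤ ∑ s, max (x s) 0 := Finset.sum_nonneg fun s _ => le_max_right _ _
  positivity

theorem norm_orthantTest_le {M : ℝ} (hM : 1 ≤ M) (r : Fin K) {k : ℕ} (hk : k ≤ 2)
    (x : Fin K → ℝ) : ‖orthantTest M r k x‖ ≤ 1 := by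
  have h0 : 0 ≤ ∑ s, max (x s) 0 := Finset.sum_nonneg fun s _ => le_max_right _ _
  have h1 : max (x r) 0 ≤ ∑ s, max (x s) 0 :=
    Finset.single_le_sum (f := fun s => max (x s) 0) (fun s _ => le_max_right _ _)
      (Finset.mem_univ r)
  have h2 : (0 : ℝ) ≤ max (x r) 0 := le_max_right _ _
  have h3 : max (x r) 0 ≤ 1 + M * ∑ s, max (x s) 0 := by nlinarith
  have h4 : 1 ≤ 1 + M * ∑ s, max (x s) 0 := by nlinarith
  rw [orthantTest, Real.norm_of_nonneg (by positivity)]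
  refine div_le_one_of_le₀ ?_ (by positivity)
  exact (pow_le_pow_left₀ h2 h3 k).trans (pow_le_pow_right₀ h4 hk)

/-- The place where nondegeneracy of each coordinate enters the stability argument: a nonnegative
function with vanishing integral would force x_r = 0 almost everywhere. -/
theorem integral_orthantTest_pos {M : ℝ} (hM : 1 ≤ M) {H : Measure (Fin K → ℝ)}
    (hH : IsLimitSpectrum H) (r : Fin K) {k : ℕ} (hk : k ≤ 2) (hk0 : k ≠ 0) :
    0 < ∫ x, orthantTest M r k x ∂H := by
  have := hH.prob
  have h0 : ∀ x : Fin K → ℝ, 0 ≤ orthantTest M r k x := fun x => by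
    have : (0 : ℝ) ≤ max (x r) 0 := le_max_right _ _
    unfold orthantTest
    positivity
  have hi : Integrable (orthantTest M r k) H :=
    Integrable.of_bound (continuous_orthantTest hM r k).aestronglyMeasurable 1
      (ae_of_all _ (norm_orthantTest_le hM r hk))
  refine lt_of_le_of_ne (integral_nonneg h0) fun h => hH.nondegenerate r ?_
  have h1 := (integral_eq_zero_iff_of_nonneg h0 hi).1 h.symm
  filter_upwards [h1, hH.nonneg] with x hx hx0
  have h2 : 0 ≤ ∑ s, x s := Finset.sum_nonneg fun s _ => hx0 s
  have h3 : 1 + M * ∑ s, x s ≠ 0 := by positivity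
  rw [orthantTest_eq hx0] at hx
  simpa [hk0, h3] using hx

theorem IsLimitSpectrum.tendsto_orthantTest {ι : Type*} {l : Filter ι}
    {μ : ι → Measure (Fin K → ℝ)} {H : Measure (Fin K → ℝ)}
    (hw : ∀ f : BoundedContinuousFunction (Fin K → ℝ) ℝ,
      Tendsto (fun i => ∫ x, f x ∂(μ i)) l (𝓝 (∫ x, f x ∂H)))
    {M : ℝ} (hM : 1 ≤ M) (r : Fin K) {k : ℕ} (hk : k ≤ 2) :
    Tendsto (fun i => ∫ x, orthantTest M r k x ∂(μ i)) l (𝓝 (∫ x, orthantTest M r k x ∂H)) :=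
  hw (BoundedContinuousFunction.ofNormedAddCommGroup _ (continuous_orthantTest hM r k) 1
    (norm_orthantTest_le hM r hk))

variable {ι : Type*} {l : Filter ι} {μ : ι → Measure (Fin K → ℝ)}
  {H : Measure (Fin K → ℝ)} {q : ι → Fin K → ℂ} {z : ℂ}

/-- A limit of numbers with nonnegative imaginary part could be real. It is not, because Im O(z, q,
μ)_r dominates |z|⁻² Im z ∫ x_r / (1 + M ∑ x)² dμ, whose integrand is a bounded continuous test
function on the orthant with positive integral under the limit law. -/
theorem im_pos_of_tendsto_opO [l.NeBot] (hz : 0 < z.im) (hμ : ∀ᶠ i in l, IsOrthantLaw (μ i))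
    (hH : IsLimitSpectrum H)
    (hw : ∀ f : BoundedContinuousFunction (Fin K → ℝ) ℝ,
      Tendsto (fun i => ∫ x, f x ∂(μ i)) l (𝓝 (∫ x, f x ∂H)))
    {M : ℝ} (hM : ∀ᶠ i in l, ∀ s, ‖q i s‖ ≤ M) (hq : ∀ᶠ i in l, ∀ s, 0 ≤ (z * q i s).im)
    {r : Fin K} {p : ℂ} (hp : Tendsto (fun i => opO z (q i) (μ i) r) l (𝓝 p)) : 0 < p.im := by
  have hz0 : z ≠ 0 := fun h => by simp [h] at hz
  have hzn : 0 < ‖z‖ := norm_pos_iff.2 hz0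
  have hM1 : 1 ≤ max M 1 := le_max_right _ _
  have hpos := integral_orthantTest_pos hM1 hH r (k := 1) (by norm_num) one_ne_zero
  have ht := (IsLimitSpectrum.tendsto_orthantTest hw hM1 r (k := 1) (by norm_num)).const_mul
    ((‖z‖ ^ 2)⁻¹ * z.im)
  have hc : 0 < (‖z‖ ^ 2)⁻¹ * z.im := by positivity
  refine lt_of_lt_of_le (mul_pos hc hpos)
    (le_of_tendsto_of_tendsto ht ((Complex.continuous_im.tendsto _).comp hp) ?_)
  filter_upwards [hμ, hM, hq] with i h1 h2 h3
  have := h1.prob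
  have hi := h1.integrable_opO hz h3 r
  rw [Function.comp_apply, opO, im_integral hi, ← integral_const_mul]
  refine integral_mono_ae ?_ hi.im ?_
  · exact (Integrable.of_bound (continuous_orthantTest hM1 r 1).aestronglyMeasurable 1
      (ae_of_all _ (norm_orthantTest_le hM1 r (by norm_num)))).const_mul _
  · filter_upwards [h1.nonneg] with x hx
    have hx0 : 0 ≤ ∑ s, x s := Finset.sum_nonneg fun s _ => hx s
    have h4 := norm_one_add_pair_le (fun s => (h2 s).trans (le_max_left M 1)) hx
    have h5 := im_le_norm_mul_one_add_pair h3 hx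
    have h6 : 0 < ‖1 + pair x (q i)‖ := by
      rw [norm_mul] at h5
      exact pos_of_mul_pos_right (lt_of_lt_of_le hz h5) hzn.le
    have h7 : 0 ≤ ∑ s, x s * (z * q i s).im :=
      Finset.sum_nonneg fun s _ => mul_nonneg (hx s) (h3 s)
    have h8 := hx r
    rw [orthantTest_eq hx, im_opO_integrand, pow_one, mul_assoc]
    refine mul_le_mul_of_nonneg_left ?_ (by positivity)
    rw [← mul_div_assoc]
    gcongr ?_ / ?_ ^ 2
    nlinarith

/-- Here the numerator is x_r ∑_s x_s Im q_s, of which only the term s = r is kept. This explains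
the square of x_r in the test function and the need for a limit of q_r already known to lie in the
open half plane. -/
theorem im_mul_pos_of_tendsto_opO [l.NeBot] (hz : 0 < z.im) (hμ : ∀ᶠ i in l, IsOrthantLaw (μ i))
    (hH : IsLimitSpectrum H)
    (hw : ∀ f : BoundedContinuousFunction (Fin K → ℝ) ℝ,
      Tendsto (fun i => ∫ x, f x ∂(μ i)) l (𝓝 (∫ x, f x ∂H)))
    {M : ℝ} (hM : ∀ᶠ i in l, ∀ s, ‖q i s‖ ≤ M) (hq : ∀ᶠ i in l, ∀ s, 0 ≤ (z * q i s).im)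
    (hq' : ∀ᶠ i in l, ∀ s, 0 ≤ (q i s).im) {r : Fin K} {q₀ : ℂ} (hq₀ : 0 < q₀.im)
    (hqt : Tendsto (fun i => q i r) l (𝓝 q₀))
    {p : ℂ} (hp : Tendsto (fun i => opO z (q i) (μ i) r) l (𝓝 p)) : 0 < (z * p).im := by
  have hz0 : z ≠ 0 := fun h => by simp [h] at hz
  have hzn : 0 < ‖z‖ := norm_pos_iff.2 hz0
  have hM1 : 1 ≤ max M 1 := le_max_right _ _
  have hpos := integral_orthantTest_pos hM1 hH r (k := 2) le_rfl two_ne_zero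
  have ht := ((Complex.continuous_im.tendsto _).comp hqt).mul
    (IsLimitSpectrum.tendsto_orthantTest hw hM1 r (k := 2) le_rfl)
  refine lt_of_lt_of_le (mul_pos hq₀ hpos)
    (le_of_tendsto_of_tendsto ht ((Complex.continuous_im.tendsto _).comp (hp.const_mul z)) ?_)
  filter_upwards [hμ, hM, hq, hq'] with i h1 h2 h3 h3'
  have := h1.prob
  have hi := (h1.integrable_opO hz h3 r).const_mul z
  simp only [Function.comp_apply]
  rw [opO, ← integral_const_mul z, im_integral hi, ← integral_const_mul]
  refine integral_mono_ae ?_ hi.im ?_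
  · exact (Integrable.of_bound (continuous_orthantTest hM1 r 2).aestronglyMeasurable 1
      (ae_of_all _ (norm_orthantTest_le hM1 r le_rfl))).const_mul _
  · filter_upwards [h1.nonneg] with x hx
    have hx0 : 0 ≤ ∑ s, x s := Finset.sum_nonneg fun s _ => hx s
    have h4 := norm_one_add_pair_le (fun s => (h2 s).trans (le_max_left M 1)) hx
    have h5 := im_le_norm_mul_one_add_pair h3 hx
    have h6 : 0 < ‖1 + pair x (q i)‖ := by
      rw [norm_mul] at h5
      exact pos_of_mul_pos_right (lt_of_lt_of_le hz h5) hzn.le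
    have h7 : x r * (q i r).im ≤ ∑ s, x s * (q i s).im :=
      Finset.single_le_sum (f := fun s => x s * (q i s).im)
        (fun s _ => mul_nonneg (hx s) (h3' s)) (Finset.mem_univ r)
    have h8 := hx r
    have h9 := mul_nonneg h8 (h3' r)
    have h10 : 0 ≤ ∑ s, x s * (q i s).im := h9.trans h7
    rw [orthantTest_eq hx, im_mul_opO_integrand hz0, ← mul_div_assoc]
    gcongr ?_ / ?_ ^ 2
    nlinarith

/-- Replacing q by its limit costs O(|q − q₀|) uniformly in the measure, since q₀ lies in the open
half plane; for a fixed parameter the integrand is bounded and weak convergence applies. -/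
theorem tendsto_opO (hz : 0 < z.im) (hμ : ∀ᶠ i in l, IsOrthantLaw (μ i))
    (hH : IsLimitSpectrum H)
    (hw : ∀ f : BoundedContinuousFunction (Fin K → ℝ) ℝ,
      Tendsto (fun i => ∫ x, f x ∂(μ i)) l (𝓝 (∫ x, f x ∂H)))
    {q₀ : Fin K → ℂ} (hq₀ : ∀ s, 0 < (z * q₀ s).im) (hqt : Tendsto q l (𝓝 q₀)) (r : Fin K) :
    Tendsto (fun i => opO z (q i) (μ i) r) l (𝓝 (opO z q₀ H r)) := by
  have hz0 : z ≠ 0 := fun h => by simp [h] at hz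
  have hzn : 0 < ‖z‖ := norm_pos_iff.2 hz0
  have := hH.prob
  obtain ⟨δ, hδ, hδz, hδq⟩ : ∃ δ > (0 : ℝ), δ ≤ z.im ∧ ∀ s, 2 * δ ≤ (z * q₀ s).im := by
    have : Nonempty (Fin K) := ⟨r⟩
    obtain ⟨s₀, hs₀⟩ := Finite.exists_min fun s => (z * q₀ s).im
    have h1 : 0 < min z.im (z * q₀ s₀).im := lt_min hz (hq₀ s₀)
    refine ⟨min z.im (z * q₀ s₀).im / 2, by positivity, ?_, fun s => ?_⟩
    · have := min_le_left z.im (z * q₀ s₀).im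
      linarith
    · have := min_le_right z.im (z * q₀ s₀).im
      have := hs₀ s
      linarith
  have hqe : ∀ᶠ i in l, ∀ s, δ ≤ (z * q i s).im := by
    rw [eventually_all]
    intro s
    have h1 : Tendsto (fun i => (z * q i s).im) l (𝓝 (z * q₀ s).im) :=
      (Complex.continuous_im.tendsto _).comp ((tendsto_pi_nhds.1 hqt s).const_mul z)
    filter_upwards [h1.eventually_const_lt (show δ < (z * q₀ s).im by linarith [hδq s])] with i hi
      using hi.le
  have hqδ : ∀ s, δ ≤ (z * q₀ s).im := fun s => by linarith [hδq s]
  -- the parameter that is kept fixed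
  have hfix : Tendsto (fun i => opO z q₀ (μ i) r) l (𝓝 (opO z q₀ H r)) := by
    -- Positive parts of the coordinates extend the integrand from the orthant to a bounded
    -- continuous function on the whole space.
    let k : (Fin K → ℝ) → ℂ := fun x =>
      ((max (x r) 0 : ℝ) : ℂ) / (-z * (1 + pair (fun s => max (x s) 0) q₀))
    have hx : ∀ x : Fin K → ℝ, ∀ s, 0 ≤ (fun s => max (x s) 0) s := fun x s => le_max_right _ _
    have hne : ∀ x : Fin K → ℝ, 1 + pair (fun s => max (x s) 0) q₀ ≠ 0 := fun x =>
      (admissible_of_im_mul_pos hz hq₀).one_add_pair_ne_zero (hx x)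
    have hk : Continuous k := by
      refine Continuous.div (by fun_prop) ?_ fun x => mul_ne_zero (neg_ne_zero.2 hz0) (hne x)
      exact continuous_const.mul (continuous_const.add
        ((continuous_pair q₀).comp (by fun_prop)))
    have hkb : ∀ x, ‖k x‖ ≤ δ⁻¹ := fun x => by
      have h2 := mul_one_add_sum_le_norm_one_add_pair hδz hqδ (hx x)
      have h3 : max (x r) 0 ≤ ∑ s, max (x s) 0 :=
        Finset.single_le_sum (f := fun s => max (x s) 0) (fun s _ => le_max_right _ _)
          (Finset.mem_univ r)
      have h4 : (0 : ℝ) ≤ max (x r) 0 := le_max_right _ _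
      have h5 : 0 < ‖z‖ * ‖1 + pair (fun s => max (x s) 0) q₀‖ :=
        mul_pos hzn (norm_pos_iff.2 (hne x))
      rw [norm_div, norm_mul, norm_neg, Complex.norm_real, Real.norm_of_nonneg h4,
        div_le_iff₀ h5, inv_mul_eq_div, le_div_iff₀ hδ]
      nlinarith
    have hae : ∀ m : Measure (Fin K → ℝ), (∀ᵐ x ∂m, ∀ s, 0 ≤ x s) →
        ∫ x, k x ∂m = opO z q₀ m r := fun m hm => by
      refine integral_congr_ae ?_
      filter_upwards [hm] with x hx'
      have e : (fun s => max (x s) 0) = x := funext fun s => max_eq_left (hx' s)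
      simp only [k, e, max_eq_left (hx' r)]
    rw [← hae H hH.nonneg]
    refine (tendsto_integral_complex (hμ.mono fun i hi => ?_) hw hk hkb).congr' ?_
    · have := hi.prob
      infer_instance
    · filter_upwards [hμ] with i hi using hae _ hi.nonneg
  have hsub : Tendsto (fun i => opO z (q i) (μ i) r - opO z q₀ (μ i) r) l (𝓝 0) := by
    have hb : Tendsto (fun i => ‖z‖ * (δ⁻¹ * δ⁻¹) * ∑ s, ‖q i s - q₀ s‖) l (𝓝 0) := by
      have : Tendsto (fun i => ∑ s, ‖q i s - q₀ s‖) l (𝓝 (∑ _s : Fin K, (0 : ℝ))) := by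
        refine tendsto_finsetSum _ fun s _ => ?_
        have h1 := ((tendsto_pi_nhds.1 hqt s).sub_const (q₀ s)).norm
        simpa using h1
      simpa using this.const_mul (‖z‖ * (δ⁻¹ * δ⁻¹))
    refine squeeze_zero_norm' ?_ hb
    filter_upwards [hμ, hqe] with i h1 h2
    have := h1.prob
    have hq0' : ∀ s, 0 ≤ (z * q i s).im := fun s => hδ.le.trans (h2 s)
    rw [opO, opO, ← integral_sub (h1.integrable_opO hz hq0' r)
      (h1.integrable_opO hz (fun s => (hq₀ s).le) r)]
    have hfin := norm_integral_le_of_norm_le_const (μ := μ i)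
      (f := fun x => (x r : ℂ) / (-z * (1 + pair x (q i))) - (x r : ℂ) / (-z * (1 + pair x q₀)))
      (C := ‖z‖ * (δ⁻¹ * δ⁻¹) * ∑ s, ‖q i s - q₀ s‖) ?_
    · simpa using hfin
    filter_upwards [h1.nonneg] with x hx
    have b1 := mul_one_add_sum_le_norm_one_add_pair hδz h2 hx
    have b2 := mul_one_add_sum_le_norm_one_add_pair hδz hqδ hx
    have hx0 : 0 ≤ ∑ s, x s := Finset.sum_nonneg fun s _ => hx s
    have b0 : 0 < δ * (1 + ∑ s, x s) := by positivity
    have p1 : 0 < ‖1 + pair x (q i)‖ := pos_of_mul_pos_right (b0.trans_le b1) hzn.le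
    have p2 : 0 < ‖1 + pair x q₀‖ := pos_of_mul_pos_right (b0.trans_le b2) hzn.le
    refine (norm_opO_integrand_sub_le hx (norm_pos_iff.1 p1) (norm_pos_iff.1 p2) r).trans ?_
    have hsx : ∀ s, x s ≤ ∑ s, x s := fun s =>
      Finset.single_le_sum (fun s _ => hx s) (Finset.mem_univ s)
    have c1 : x r / ‖1 + pair x (q i)‖ ≤ ‖z‖ * δ⁻¹ := by
      rw [div_le_iff₀ p1, mul_right_comm, ← div_eq_mul_inv, le_div_iff₀ hδ]
      nlinarith [hsx r]
    have c2 : ∀ s, x s / ‖1 + pair x q₀‖ ≤ ‖z‖ * δ⁻¹ := fun s => by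
      rw [div_le_iff₀ p2, mul_right_comm, ← div_eq_mul_inv, le_div_iff₀ hδ]
      nlinarith [hsx s]
    calc ‖z‖⁻¹ * (x r * (∑ s, x s * ‖q i s - q₀ s‖) /
          (‖1 + pair x (q i)‖ * ‖1 + pair x q₀‖))
        = ‖z‖⁻¹ * (x r / ‖1 + pair x (q i)‖ *
            ∑ s, x s / ‖1 + pair x q₀‖ * ‖q i s - q₀ s‖) := by
          have : ∑ s, x s / ‖1 + pair x q₀‖ * ‖q i s - q₀ s‖ =
              ‖1 + pair x q₀‖⁻¹ * ∑ s, x s * ‖q i s - q₀ s‖ := by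
            rw [Finset.mul_sum]
            exact Finset.sum_congr rfl fun s _ => by ring
          rw [this]
          field_simp
      _ ≤ ‖z‖⁻¹ * ((‖z‖ * δ⁻¹) * ∑ s, (‖z‖ * δ⁻¹) * ‖q i s - q₀ s‖) := by
          have h0 : 0 ≤ ∑ s, x s / ‖1 + pair x q₀‖ * ‖q i s - q₀ s‖ :=
            Finset.sum_nonneg fun s _ => mul_nonneg (div_nonneg (hx s) p2.le) (norm_nonneg _)
          gcongr with s
          exact c2 s
      _ = _ := by
          rw [← Finset.mul_sum]
          field_simp
  simpa using hsub.add hfix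

/-- The pair `(h, g)` solves the coupled equations at the point `z`, in the half planes where the
solution is unique. -/
structure IsFixedPair (z : ℂ) (c : ℝ) (H G : Measure (Fin K → ℝ)) (h g : Fin K → ℂ) : Prop where
  h_im : ∀ r, 0 < (h r).im
  g_im : ∀ r, 0 < (g r).im
  zh_im : ∀ r, 0 < (z * h r).im
  zg_im : ∀ r, 0 < (z * g r).im
  h_eq : h = opO z g H
  g_eq : g = opO z ((c : ℂ) • h) G

/-- Absorbing c into the measure makes both coupled equations instances of `opO_comp_unique` with
the finite measure cH: for h one takes a = c h with cH as the outer measure, for g one takes a = g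
with cH as the inner one. -/
theorem opO_smul_measure {c : ℝ} (hc : 0 < c) (z : ℂ) (q : Fin K → ℂ)
    (m : Measure (Fin K → ℝ)) : opO z q (c.toNNReal • m) = (c : ℂ) • opO z q m := by
  funext r
  simp only [opO, Pi.smul_apply, smul_eq_mul]
  rw [integral_smul_nnreal_measure, NNReal.smul_def, Real.coe_toNNReal c hc.le]
  simp

theorem eq_of_solutionH {c : ℝ} (hc : 0 < c) (hz : 0 < z.im) {G : Measure (Fin K → ℝ)}
    (hH : IsLimitSpectrum H) (hG : IsLimitSpectrum G) {h₁ h₂ : Fin K → ℂ}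
    (i₁ : ∀ r, 0 < (h₁ r).im) (i₂ : ∀ r, 0 < (h₂ r).im)
    (e₁ : ∀ r, h₁ r = opO z (opO z ((c : ℂ) • h₁) G) H r)
    (e₂ : ∀ r, h₂ r = opO z (opO z ((c : ℂ) • h₂) G) H r) : h₁ = h₂ := by
  have := hH.prob
  have := hG.prob
  have hc' : c.toNNReal ≠ 0 := by simpa using hc
  have hac : c.toNNReal • H ≪ H := Measure.smul_absolutelyContinuous
  have key := opO_comp_unique hz (μ := c.toNNReal • H) (ν := G)
    (a₁ := (c : ℂ) • h₁) (a₂ := (c : ℂ) • h₂) (hac hH.nonneg) hG.nonneg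
    (fun r h => hH.nondegenerate r ?_) hG.nondegenerate (fun r => ?_) (fun r => ?_)
    (fun r => ?_) (fun r => ?_)
  · funext r
    have h3 := congrFun key r
    simpa [hc.ne'] using h3
  · have h4 : H ≪ c.toNNReal • H := by
      refine Measure.AbsolutelyContinuous.mk fun s _ hs => ?_
      rw [Measure.smul_apply] at hs
      simpa [hc'] using hs
    exact h4 h
  · simpa [Complex.im_ofReal_mul] using mul_pos hc (i₁ r)
  · simpa [Complex.im_ofReal_mul] using mul_pos hc (i₂ r)
  · rw [opO_smul_measure hc, Pi.smul_apply, Pi.smul_apply, ← e₁ r]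
  · rw [opO_smul_measure hc, Pi.smul_apply, Pi.smul_apply, ← e₂ r]

theorem eq_of_solutionG {c : ℝ} (hc : 0 < c) (hz : 0 < z.im) {G : Measure (Fin K → ℝ)}
    (hH : IsLimitSpectrum H) (hG : IsLimitSpectrum G) {g₁ g₂ : Fin K → ℂ}
    (i₁ : ∀ r, 0 < (g₁ r).im) (i₂ : ∀ r, 0 < (g₂ r).im)
    (e₁ : ∀ r, g₁ r = opO z ((c : ℂ) • opO z g₁ H) G r)
    (e₂ : ∀ r, g₂ r = opO z ((c : ℂ) • opO z g₂ H) G r) : g₁ = g₂ := by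
  have := hH.prob
  have := hG.prob
  have hc' : c.toNNReal ≠ 0 := by simpa using hc
  have hac : c.toNNReal • H ≪ H := Measure.smul_absolutelyContinuous
  refine opO_comp_unique hz (μ := G) (ν := c.toNNReal • H) hG.nonneg (hac hH.nonneg)
    hG.nondegenerate (fun r h => hH.nondegenerate r ?_) i₁ i₂ (fun r => ?_) (fun r => ?_)
  · have h4 : H ≪ c.toNNReal • H := by
      refine Measure.AbsolutelyContinuous.mk fun s _ hs => ?_
      rw [Measure.smul_apply] at hs
      simpa [hc'] using hs
    exact h4 h
  · rw [opO_smul_measure hc, ← e₁ r]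
  · rw [opO_smul_measure hc, ← e₂ r]

theorem IsFixedPair.unique {c : ℝ} (hc : 0 < c) (hz : 0 < z.im) {G : Measure (Fin K → ℝ)}
    (hH : IsLimitSpectrum H) (hG : IsLimitSpectrum G) {h₁ h₂ g₁ g₂ : Fin K → ℂ}
    (i₁ : IsFixedPair z c H G h₁ g₁) (i₂ : IsFixedPair z c H G h₂ g₂) : h₁ = h₂ ∧ g₁ = g₂ := by
  have h : h₁ = h₂ := eq_of_solutionH hc hz hH hG i₁.h_im i₂.h_im
    (fun r => by rw [← i₁.g_eq]; exact congrFun i₁.h_eq r)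
    (fun r => by rw [← i₂.g_eq]; exact congrFun i₂.h_eq r)
  exact ⟨h, by rw [i₁.g_eq, i₂.g_eq, h]⟩

/-- The order matters: the weak inequalities give Im h₀, Im g₀ > 0 in the limit, these give Im zh₀,
Im zg₀ > 0, and only then is O continuous at the limit parameters, so that the equations themselves
pass to the limit. -/
theorem isFixedPair_of_tendsto [l.NeBot] {c : ℝ} (hc : 0 < c) (hz : 0 < z.im) {G : Measure (Fin K → ℝ)}
    (hH : IsLimitSpectrum H) (hG : IsLimitSpectrum G) {ν : ι → Measure (Fin K → ℝ)}
    (hμ : ∀ᶠ i in l, IsOrthantLaw (μ i)) (hν : ∀ᶠ i in l, IsOrthantLaw (ν i))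
    (hwH : ∀ f : BoundedContinuousFunction (Fin K → ℝ) ℝ,
      Tendsto (fun i => ∫ x, f x ∂(μ i)) l (𝓝 (∫ x, f x ∂H)))
    (hwG : ∀ f : BoundedContinuousFunction (Fin K → ℝ) ℝ,
      Tendsto (fun i => ∫ x, f x ∂(ν i)) l (𝓝 (∫ x, f x ∂G)))
    {cs : ι → ℝ} (hcs : Tendsto cs l (𝓝 c)) {h g : ι → Fin K → ℂ} {h₀ g₀ : Fin K → ℂ}
    (hh : Tendsto h l (𝓝 h₀)) (hg : Tendsto g l (𝓝 g₀))
    (hh_im : ∀ᶠ i in l, ∀ r, 0 ≤ (h i r).im) (hg_im : ∀ᶠ i in l, ∀ r, 0 ≤ (g i r).im)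
    (hzh_im : ∀ᶠ i in l, ∀ r, 0 ≤ (z * h i r).im) (hzg_im : ∀ᶠ i in l, ∀ r, 0 ≤ (z * g i r).im)
    (eh : ∀ r, Tendsto (fun i => h i r - opO z (g i) (μ i) r) l (𝓝 0))
    (eg : ∀ r, Tendsto (fun i => g i r - opO z ((cs i : ℂ) • h i) (ν i) r) l (𝓝 0)) :
    IsFixedPair z c H G h₀ g₀ := by
  have bdd : ∀ {q : ι → Fin K → ℂ} {q₀ : Fin K → ℂ}, Tendsto q l (𝓝 q₀) →
      ∀ᶠ i in l, ∀ s, ‖q i s‖ ≤ ‖q₀‖ + 1 := by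
    intro q q₀ hq
    filter_upwards [hq.norm.eventually_lt_const (lt_add_one ‖q₀‖)] with i hi s
    exact (norm_le_pi_norm (q i) s).trans hi.le
  have hch : Tendsto (fun i => (cs i : ℂ) • h i) l (𝓝 ((c : ℂ) • h₀)) :=
    ((Complex.continuous_ofReal.tendsto _).comp hcs).smul hh
  have hcpos : ∀ᶠ i in l, 0 ≤ cs i := (hcs.eventually_const_lt hc).mono fun i hi => hi.le
  have hch_im : ∀ᶠ i in l, ∀ r, 0 ≤ (((cs i : ℂ) • h i) r).im := by
    filter_upwards [hcpos, hh_im] with i h1 h2 r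
    rw [Pi.smul_apply, smul_eq_mul, Complex.im_ofReal_mul]
    exact mul_nonneg h1 (h2 r)
  have hzch_im : ∀ᶠ i in l, ∀ r, 0 ≤ (z * ((cs i : ℂ) • h i) r).im := by
    filter_upwards [hcpos, hzh_im] with i h1 h2 r
    rw [Pi.smul_apply, smul_eq_mul, mul_left_comm, Complex.im_ofReal_mul]
    exact mul_nonneg h1 (h2 r)
  have th : ∀ r, Tendsto (fun i => opO z (g i) (μ i) r) l (𝓝 (h₀ r)) := fun r => by
    simpa using (tendsto_pi_nhds.1 hh r).sub (eh r)
  have tg : ∀ r, Tendsto (fun i => opO z ((cs i : ℂ) • h i) (ν i) r) l (𝓝 (g₀ r)) := fun r => by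
    simpa using (tendsto_pi_nhds.1 hg r).sub (eg r)
  have p1 : ∀ r, 0 < (h₀ r).im := fun r =>
    im_pos_of_tendsto_opO hz hμ hH hwH (bdd hg) hzg_im (th r)
  have p2 : ∀ r, 0 < (g₀ r).im := fun r =>
    im_pos_of_tendsto_opO hz hν hG hwG (bdd hch) hzch_im (tg r)
  have p1' : ∀ r, 0 < (((c : ℂ) • h₀) r).im := fun r => by
    rw [Pi.smul_apply, smul_eq_mul, Complex.im_ofReal_mul]
    exact mul_pos hc (p1 r)
  have p3 : ∀ r, 0 < (z * h₀ r).im := fun r =>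
    im_mul_pos_of_tendsto_opO hz hμ hH hwH (bdd hg) hzg_im hg_im (p2 r)
      (tendsto_pi_nhds.1 hg r) (th r)
  have p4 : ∀ r, 0 < (z * g₀ r).im := fun r =>
    im_mul_pos_of_tendsto_opO hz hν hG hwG (bdd hch) hzch_im hch_im (p1' r)
      (tendsto_pi_nhds.1 hch r) (tg r)
  have p3' : ∀ r, 0 < (z * ((c : ℂ) • h₀) r).im := fun r => by
    rw [Pi.smul_apply, smul_eq_mul, mul_left_comm, Complex.im_ofReal_mul]
    exact mul_pos hc (p3 r)
  exact ⟨p1, p2, p3, p4,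
    funext fun r => tendsto_nhds_unique (th r) (tendsto_opO hz hμ hH hwH p4 hg r),
    funext fun r => tendsto_nhds_unique (tg r) (tendsto_opO hz hν hG hwG p3' hch r)⟩

end Stability

/-! ### Concentration by bounded differences -/

section BoundedDifferences

/-- The exponential moment bound of the bounded differences method. -/
theorem integral_exp_le_of_bounded_differences {E : Type*} [MeasurableSpace E] {d : ℝ}
    (hd : 0 ≤ d) (t : ℝ) :
    ∀ {n : ℕ} (ρ : Fin n → Measure E) [∀ j, IsProbabilityMeasure (ρ j)] {f : (Fin n → E) → ℝ},
      Measurable f → ∀ {B : ℝ}, (∀ x, |f x| ≤ B) →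
      (∀ x j y, |f (Function.update x j y) - f x| ≤ d) →
      ∫ x, Real.exp (t * (f x - ∫ y, f y ∂Measure.pi ρ)) ∂Measure.pi ρ ≤
        Real.exp (n * (d ^ 2 * t ^ 2 / 2)) := by
  intro n
  induction n with
  | zero =>
    intro ρ _ f hf B hB hfd
    have hc : ∀ x : Fin 0 → E, f x = f finZeroElim := fun x => congrArg f (Subsingleton.elim _ _)
    simp [hc]
  | succ n ih =>
    intro ρ _ f hf B hB hfd
    set e := MeasurableEquiv.piFinSuccAbove (fun _ : Fin (n + 1) => E) 0 with he
    have hmp := measurePreserving_piFinSuccAbove ρ 0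
    set ρ' : Fin n → Measure E := fun j => ρ ((0 : Fin (n + 1)).succAbove j) with hρ'
    have hesymm : ∀ a b, e.symm (a, b) = Fin.cons a b := fun a b => by
      rw [he, MeasurableEquiv.piFinSuccAbove_symm_apply]
      simp [Fin.insertNthEquiv]
    let F : E → (Fin n → E) → ℝ := fun a b => f (Fin.cons a b)
    have hFm : Measurable (fun q : E × (Fin n → E) => F q.1 q.2) := by
      have : (fun q : E × (Fin n → E) => F q.1 q.2) = f ∘ e.symm := by
        funext q
        simp only [Function.comp_apply, F, ← hesymm]
      rw [this]
      exact hf.comp e.symm.measurable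
    have hFa : ∀ b, Measurable fun a => F a b := fun b => hFm.comp (measurable_id.prodMk
      measurable_const)
    have hFB : ∀ a b, |F a b| ≤ B := fun a b => hB _
    have hF1 : ∀ a a' b, |F a b - F a' b| ≤ d := fun a a' b => by
      have := hfd (Fin.cons a' b) 0 a
      rwa [Fin.update_cons_zero] at this
    have hF2 : ∀ a b j y, |F a (Function.update b j y) - F a b| ≤ d := fun a b j y => by
      have := hfd (Fin.cons a b) j.succ y
      rwa [← Fin.cons_update] at this
    -- g averages out the first coordinate. It inherits the bounded differences in the others, and F
    -- − g is centred in the first coordinate and bounded by d, so Hoeffding's lemma contributes the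
    -- factor exp(d² t² / 2).
    let g : (Fin n → E) → ℝ := fun b => ∫ a, F a b ∂ρ 0
    have hFi : ∀ b, Integrable (fun a => F a b) (ρ 0) := fun b =>
      Integrable.of_bound (hFa b).aestronglyMeasurable B (ae_of_all _ fun a => hFB a b)
    have hg : Measurable g :=
      (StronglyMeasurable.integral_prod_left' (f := fun q : E × (Fin n → E) => F q.1 q.2)
        hFm.stronglyMeasurable).measurable
    have hgB : ∀ b, |g b| ≤ B := fun b => by
      have := norm_integral_le_of_norm_le_const (μ := ρ 0) (f := fun a => F a b) (C := B)
        (ae_of_all _ fun a => hFB a b)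
      simpa using this
    have hgd : ∀ b j y, |g (Function.update b j y) - g b| ≤ d := fun b j y => by
      have h1 : g (Function.update b j y) - g b =
          ∫ a, (F a (Function.update b j y) - F a b) ∂ρ 0 := (integral_sub (hFi _) (hFi _)).symm
      have := norm_integral_le_of_norm_le_const (μ := ρ 0)
        (f := fun a => F a (Function.update b j y) - F a b) (C := d)
        (ae_of_all _ fun a => hF2 a b j y)
      rw [h1]
      simpa using this
    have hFg : ∀ a b, |F a b - g b| ≤ d := fun a b => by
      have h1 : F a b - g b = ∫ a', (F a b - F a' b) ∂ρ 0 := by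
        rw [integral_sub (integrable_const _) (hFi b)]
        simp [g]
      have := norm_integral_le_of_norm_le_const (μ := ρ 0)
        (f := fun a' => F a b - F a' b) (C := d) (ae_of_all _ fun a' => hF1 a a' b)
      rw [h1]
      simpa using this
    have htrans : ∀ φ : ℝ → ℝ, ∫ x, φ (f x) ∂Measure.pi ρ =
        ∫ q, φ (F q.1 q.2) ∂((ρ 0).prod (Measure.pi ρ')) := fun φ => by
      rw [← hmp.symm.integral_comp' (g := fun x => φ (f x))]
      refine integral_congr_ae (ae_of_all _ fun q => ?_)
      change φ (f (e.symm (q.1, q.2))) = _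
      rw [hesymm]
    have hbdd_int : ∀ {φ : ℝ → ℝ}, Continuous φ →
        Integrable (fun q : E × (Fin n → E) => φ (F q.1 q.2))
          ((ρ 0).prod (Measure.pi ρ')) := fun {φ} hφ => by
      obtain ⟨C, hC⟩ := (isCompact_Icc (a := -B) (b := B)).exists_bound_of_continuousOn
        hφ.continuousOn
      exact Integrable.of_bound (hφ.measurable.comp hFm).aestronglyMeasurable C
        (ae_of_all _ fun q => hC _ (abs_le.1 (hFB q.1 q.2)))
    have hmean : ∫ x, f x ∂Measure.pi ρ = ∫ b, g b ∂Measure.pi ρ' := by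
      have := htrans id
      simp only [id] at this
      rw [this]
      exact integral_prod_symm _ (hbdd_int continuous_id)
    set m := ∫ x, f x ∂Measure.pi ρ with hm
    rw [htrans fun u => Real.exp (t * (u - m)),
      integral_prod_symm _ (hbdd_int (φ := fun u => Real.exp (t * (u - m))) (by fun_prop))]
    have hin : ∀ b, ∫ a, Real.exp (t * (F a b - m)) ∂ρ 0 ≤
        Real.exp (d ^ 2 * t ^ 2 / 2) * Real.exp (t * (g b - m)) := fun b => by
      have h1 : ∀ a, Real.exp (t * (F a b - m)) =
          Real.exp (t * (F a b - g b)) * Real.exp (t * (g b - m)) := fun a => by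
        rw [← Real.exp_add]
        ring_nf
      simp only [h1]
      rw [integral_mul_const]
      refine mul_le_mul_of_nonneg_right ?_ (Real.exp_nonneg _)
      have h2 := (hasSubgaussianMGF_of_mem_Icc_of_integral_eq_zero (μ := ρ 0)
        (X := fun a => F a b - g b) (a := -d) (b := d)
        ((hFa b).sub_const _).aemeasurable (ae_of_all _ fun a => abs_le.1 (hFg a b)) (by
          rw [integral_sub (hFi b) (integrable_const _)]
          simp [g])).mgf_le t
      refine h2.trans (le_of_eq ?_)
      congr 1
      simp only [NNReal.coe_pow, NNReal.coe_div, coe_nnnorm, sub_neg_eq_add, NNReal.coe_ofNat]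
      rw [Real.norm_of_nonneg (by linarith)]
      ring
    have hgi : Integrable (fun b => Real.exp (t * (g b - m))) (Measure.pi ρ') := by
      have hφ : Continuous fun u : ℝ => Real.exp (t * (u - m)) := by fun_prop
      obtain ⟨C, hC⟩ := (isCompact_Icc (a := -B) (b := B)).exists_bound_of_continuousOn
        hφ.continuousOn
      exact Integrable.of_bound (hφ.measurable.comp hg).aestronglyMeasurable C
        (ae_of_all _ fun b => hC _ (abs_le.1 (hgB b)))
    calc ∫ b, ∫ a, Real.exp (t * (F a b - m)) ∂ρ 0 ∂Measure.pi ρ'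
        ≤ ∫ b, Real.exp (d ^ 2 * t ^ 2 / 2) * Real.exp (t * (g b - m)) ∂Measure.pi ρ' :=
          integral_mono_of_nonneg (ae_of_all _ fun b => integral_nonneg fun a => Real.exp_nonneg _)
            (hgi.const_mul _) (ae_of_all _ hin)
      _ = Real.exp (d ^ 2 * t ^ 2 / 2) *
            ∫ b, Real.exp (t * (g b - ∫ b', g b' ∂Measure.pi ρ')) ∂Measure.pi ρ' := by
          rw [integral_const_mul, hmean]
      _ ≤ Real.exp (d ^ 2 * t ^ 2 / 2) * Real.exp (n * (d ^ 2 * t ^ 2 / 2)) :=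
          mul_le_mul_of_nonneg_left (ih ρ' hg hgB hgd) (Real.exp_nonneg _)
      _ = Real.exp ((n + 1 : ℕ) * (d ^ 2 * t ^ 2 / 2)) := by
          rw [← Real.exp_add]
          push_cast
          ring_nf

theorem pow_four_le_exp_add_exp (x : ℝ) : x ^ 4 ≤ 24 * (Real.exp x + Real.exp (-x)) := by
  have h1 := Real.pow_div_factorial_le_exp |x| (abs_nonneg x) 4
  have h2 : |x| ^ 4 = x ^ 4 := by rw [← abs_pow]; exact abs_of_nonneg (by positivity)
  rw [h2] at h1
  have h3 : Real.exp |x| ≤ Real.exp x + Real.exp (-x) := by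
    rcases abs_cases x with ⟨h, -⟩ | ⟨h, -⟩ <;> rw [h] <;>
      linarith [Real.exp_pos x, Real.exp_pos (-x)]
  have h4 : ((4).factorial : ℝ) = 24 := by norm_num [Nat.factorial]
  rw [h4, div_le_iff₀ (by norm_num)] at h1
  linarith

/-- With t = (d √n)⁻¹ the exponent n d² t² / 2 is 1/2, so both exponential moments are at most 2,
and u⁴ ≤ 24 (eᵘ + e⁻ᵘ) gives 24 · 4 = 96. Fourth moments are used because for normalized traces they
are summable in n; variances of order 1/n would not be. -/
theorem integral_pow_four_le_of_bounded_differences {E : Type*} [MeasurableSpace E] {d : ℝ}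
    (hd : 0 < d) {n : ℕ} (hn : 0 < n) (ρ : Fin n → Measure E) [∀ j, IsProbabilityMeasure (ρ j)]
    {f : (Fin n → E) → ℝ} (hf : Measurable f) {B : ℝ} (hB : ∀ x, |f x| ≤ B)
    (hfd : ∀ x j y, |f (Function.update x j y) - f x| ≤ d) :
    ∫ x, (f x - ∫ y, f y ∂Measure.pi ρ) ^ 4 ∂Measure.pi ρ ≤ 96 * (n ^ 2 * d ^ 4) := by
  set m := ∫ y, f y ∂Measure.pi ρ with hm
  have hn' : (0 : ℝ) < n := by exact_mod_cast hn
  set t : ℝ := (d * √n)⁻¹ with ht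
  have hst : 0 < d * √n := by positivity
  have ht0 : 0 < t := inv_pos.2 hst
  have hsq : √(n : ℝ) ^ 2 = n := Real.sq_sqrt hn'.le
  have ht2 : n * (d ^ 2 * t ^ 2 / 2) = 1 / 2 := by
    rw [ht, inv_pow, mul_pow, hsq]
    field_simp
  have ht4 : t ^ 4 = (n ^ 2 * d ^ 4)⁻¹ := by
    rw [ht, inv_pow, mul_pow, show √(n : ℝ) ^ 4 = (√(n : ℝ) ^ 2) ^ 2 by ring, hsq, mul_comm]
  have hb : ∀ {φ : ℝ → ℝ}, Continuous φ → Integrable (fun x => φ (f x)) (Measure.pi ρ) :=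
    fun {φ} hφ => by
      obtain ⟨C, hC⟩ := (isCompact_Icc (a := -B) (b := B)).exists_bound_of_continuousOn
        hφ.continuousOn
      exact Integrable.of_bound (hφ.measurable.comp hf).aestronglyMeasurable C
        (ae_of_all _ fun q => hC _ (abs_le.1 (hB q)))
  have i1 := hb (φ := fun u => Real.exp (t * (u - m))) (by fun_prop)
  have i2 := hb (φ := fun u => Real.exp (-t * (u - m))) (by fun_prop)
  have h1 := integral_exp_le_of_bounded_differences hd.le t ρ hf hB hfd
  have h2 := integral_exp_le_of_bounded_differences hd.le (-t) ρ hf hB hfd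
  rw [neg_sq, ht2] at h2
  rw [ht2] at h1
  have he : Real.exp (1 / 2) ≤ 2 := by
    have := Real.exp_one_lt_d9
    have h3 : Real.exp (1 / 2) ^ 2 = Real.exp 1 := by
      rw [← Real.exp_nat_mul]
      norm_num
    nlinarith [Real.exp_pos (1 / 2)]
  have h3 : ∫ x, (t * (f x - m)) ^ 4 ∂Measure.pi ρ ≤ 96 := by
    calc ∫ x, (t * (f x - m)) ^ 4 ∂Measure.pi ρ
        ≤ ∫ x, 24 * (Real.exp (t * (f x - m)) + Real.exp (-t * (f x - m))) ∂Measure.pi ρ := by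
          refine integral_mono (hb (φ := fun u => (t * (u - m)) ^ 4) (by fun_prop))
            ((i1.add i2).const_mul _) fun x => ?_
          have := pow_four_le_exp_add_exp (t * (f x - m))
          rwa [← neg_mul] at this
      _ = 24 * (∫ x, Real.exp (t * (f x - m)) ∂Measure.pi ρ +
            ∫ x, Real.exp (-t * (f x - m)) ∂Measure.pi ρ) := by
          rw [integral_const_mul, integral_add i1 i2]
      _ ≤ 96 := by linarith
  simp only [mul_pow] at h3
  rw [integral_const_mul, ht4, inv_mul_le_iff₀ (by positivity)] at h3
  linarith

/-- Real and imaginary parts are treated separately; |u|⁴ ≤ 2 ((Re u)⁴ + (Im u)⁴) accounts for 384 =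
2 · (96 + 96). -/
theorem integral_norm_pow_four_le_of_bounded_differences {E : Type*} [MeasurableSpace E] {d : ℝ}
    (hd : 0 < d) {n : ℕ} (hn : 0 < n) (ρ : Fin n → Measure E) [∀ j, IsProbabilityMeasure (ρ j)]
    {f : (Fin n → E) → ℂ} (hf : Measurable f) {B : ℝ} (hB : ∀ x, ‖f x‖ ≤ B)
    (hfd : ∀ x j y, ‖f (Function.update x j y) - f x‖ ≤ d) :
    ∫ x, ‖f x - ∫ y, f y ∂Measure.pi ρ‖ ^ 4 ∂Measure.pi ρ ≤ 384 * (n ^ 2 * d ^ 4) := by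
  have hfi : Integrable f (Measure.pi ρ) :=
    Integrable.of_bound hf.aestronglyMeasurable B (ae_of_all _ hB)
  have hmB : ‖∫ y, f y ∂Measure.pi ρ‖ ≤ B := by
    simpa using norm_integral_le_of_norm_le_const (μ := Measure.pi ρ) (ae_of_all _ hB)
  have hre : (∫ y, f y ∂Measure.pi ρ).re = ∫ y, (f y).re ∂Measure.pi ρ := by
    simpa only [RCLike.re_to_complex] using (integral_re (𝕜 := ℂ) hfi).symm
  have him : (∫ y, f y ∂Measure.pi ρ).im = ∫ y, (f y).im ∂Measure.pi ρ := im_integral hfi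
  have h1 := integral_pow_four_le_of_bounded_differences hd hn ρ (f := fun x => (f x).re)
    (Complex.measurable_re.comp hf) (fun x => (Complex.abs_re_le_norm _).trans (hB x))
    fun x j y => (Complex.abs_re_le_norm _).trans (hfd x j y)
  have h2 := integral_pow_four_le_of_bounded_differences hd hn ρ (f := fun x => (f x).im)
    (Complex.measurable_im.comp hf) (fun x => (Complex.abs_im_le_norm _).trans (hB x))
    fun x j y => (Complex.abs_im_le_norm _).trans (hfd x j y)
  rw [← hre] at h1
  rw [← him] at h2
  set m := ∫ y, f y ∂Measure.pi ρ
  have hb : ∀ {φ : ℂ → ℝ}, Continuous φ → Integrable (fun x => φ (f x)) (Measure.pi ρ) :=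
    fun {φ} hφ => by
      obtain ⟨C, hC⟩ := (isCompact_closedBall (0 : ℂ) B).exists_bound_of_continuousOn
        hφ.continuousOn
      exact Integrable.of_bound (hφ.measurable.comp hf).aestronglyMeasurable C
        (ae_of_all _ fun q => hC _ (by simpa using hB q))
  have i1 := hb (φ := fun u => (u.re - m.re) ^ 4) (by fun_prop)
  have i2 := hb (φ := fun u => (u.im - m.im) ^ 4) (by fun_prop)
  calc ∫ x, ‖f x - m‖ ^ 4 ∂Measure.pi ρ
      ≤ ∫ x, 2 * (((f x).re - m.re) ^ 4 + ((f x).im - m.im) ^ 4) ∂Measure.pi ρ := by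
        refine integral_mono (hb (φ := fun u => ‖u - m‖ ^ 4) (by fun_prop))
          ((i1.add i2).const_mul _) fun x => ?_
        have e : ‖f x - m‖ ^ 4 = (((f x).re - m.re) ^ 2 + ((f x).im - m.im) ^ 2) ^ 2 := by
          rw [show ‖f x - m‖ ^ 4 = (‖f x - m‖ ^ 2) ^ 2 by ring, ← Complex.normSq_eq_norm_sq,
            Complex.normSq_apply, Complex.sub_re, Complex.sub_im]
          ring
        simp only [e]
        nlinarith [sq_nonneg (((f x).re - m.re) ^ 2 - ((f x).im - m.im) ^ 2)]
    _ = 2 * (∫ x, ((f x).re - m.re) ^ 4 ∂Measure.pi ρ +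
          ∫ x, ((f x).im - m.im) ^ 4 ∂Measure.pi ρ) := by
        rw [integral_const_mul, integral_add i1 i2]
    _ ≤ _ := by linarith

/-- Fourth-moment concentration of a function of a random array with independent entries, in terms
of its oscillation over single columns. -/
theorem integral_norm_pow_four_le_of_columns {Ω : Type*} [MeasurableSpace Ω] {P : Measure Ω}
    [IsProbabilityMeasure P] {K p n : ℕ} {Z : Ω → Fin K → Fin p → Fin n → ℂ}
    (hZ : Measurable Z)
    (hind : iIndepFun (fun (e : Fin K × Fin p × Fin n) ω => Z ω e.1 e.2.1 e.2.2) P)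
    {f : (Fin K → Fin p → Fin n → ℂ) → ℂ} (hf : Measurable f) {B : ℝ} (hB : ∀ ζ, ‖f ζ‖ ≤ B)
    {d : ℝ} (hd : 0 < d) (hn : 0 < n)
    (hfd : ∀ ζ ζ' j, (∀ r i j', j' ≠ j → ζ r i j' = ζ' r i j') → ‖f ζ - f ζ'‖ ≤ d) :
    ∫ ω, ‖f (Z ω) - ∫ ω', f (Z ω') ∂P‖ ^ 4 ∂P ≤ 384 * (n ^ 2 * d ^ 4) := by
  have hZe : ∀ r i j, Measurable fun ω => Z ω r i j := fun r i j => by fun_prop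
  -- The column index is put first, so that currying the joint law of the entries exhibits it as a
  -- product over columns.
  let ent : Fin n × (Fin K × Fin p) → Ω → ℂ := fun e ω => Z ω e.2.1 e.2.2 e.1
  have hent : iIndepFun ent P :=
    hind.precomp (g := fun e : Fin n × (Fin K × Fin p) => (e.2.1, e.2.2, e.1)) fun a b h => by
      rcases a with ⟨a1, a2, a3⟩
      rcases b with ⟨b1, b2, b3⟩
      simp only [Prod.mk.injEq] at h ⊢
      tauto
  have hpr : ∀ e, IsProbabilityMeasure (P.map (ent e)) := fun e =>
    Measure.isProbabilityMeasure_map (hZe _ _ _).aemeasurable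
  let ρ : Fin n → Measure (Fin K × Fin p → ℂ) := fun j => Measure.pi fun ri => P.map (ent (j, ri))
  let Y : Ω → Fin n → (Fin K × Fin p → ℂ) := fun ω j ri => Z ω ri.1 ri.2 j
  have hY : Measurable Y := by fun_prop
  have hlaw : P.map Y = Measure.pi ρ := by
    have h1 := (iIndepFun_iff_map_fun_eq_infinitePi_map (X := ent) (P := P)
      fun e => hZe _ _ _).1 hent
    have h2 := Measure.infinitePi_map_curry (fun (j : Fin n) (ri : Fin K × Fin p) =>
      P.map (ent (j, ri)))
    have h3 : Y = (MeasurableEquiv.curry (Fin n) (Fin K × Fin p) ℂ) ∘ fun ω e => ent e ω := by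
      funext ω j ri
      simp [Y, ent]
    rw [h3, ← Measure.map_map (MeasurableEquiv.measurable _) (by fun_prop), h1, h2,
      Measure.infinitePi_eq_pi]
    simp only [Measure.infinitePi_eq_pi, ρ]
  let asm : (Fin n → (Fin K × Fin p → ℂ)) → Fin K → Fin p → Fin n → ℂ :=
    fun x r i j => x j (r, i)
  have hasm : Measurable asm := by fun_prop
  have hYZ : ∀ ω, asm (Y ω) = Z ω := fun ω => rfl
  have key := integral_norm_pow_four_le_of_bounded_differences hd hn ρ (f := f ∘ asm)
    (hf.comp hasm) (fun x => hB _) fun x j y => hfd _ _ j fun r i j' hj' => by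
      simp [asm, Function.update_of_ne hj']
  rw [← hlaw, integral_map hY.aemeasurable, integral_map hY.aemeasurable] at key
  · simpa only [Function.comp_apply, hYZ] using key
  · exact (hf.comp hasm).aestronglyMeasurable
  · exact (((hf.comp hasm).sub_const _).norm.pow_const 4).aestronglyMeasurable

end BoundedDifferences

/-! ### Resolvents, traces and the Hermitian linearization -/

section Resolvent

open scoped Matrix.Norms.L2Operator Matrix

variable {m n : Type*} [Fintype m] [Fintype n] [DecidableEq m] [DecidableEq n]

theorem rank_add_le {m n : Type*} [Fintype n] (M N : Matrix m n ℂ) : (M + N).rank ≤ M.rank + N.rank := by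
  unfold Matrix.rank
  rw [Matrix.mulVecLin_add]
  refine le_trans (Submodule.finrank_mono ?_) (Submodule.finrank_add_le_finrank_add_finrank _ _)
  rintro _ ⟨x, rfl⟩
  exact Submodule.add_mem_sup ⟨x, rfl⟩ ⟨x, rfl⟩

/-- `|tr M| ≤ rank M * ‖M‖` in the operator norm. -/
theorem norm_trace_le_rank_mul (M : Matrix m m ℂ) : ‖M.trace‖ ≤ M.rank * ‖M‖ := by
  set T := Matrix.toEuclideanLin M with hT
  have htr : LinearMap.trace ℂ _ T = M.trace := by
    rw [hT, Matrix.toEuclideanLin_eq_toLin_orthonormal, LinearMap.trace_eq_matrix_trace ℂ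
      (EuclideanSpace.basisFun m ℂ).toBasis, LinearMap.toMatrix_toLin]
  set V := LinearMap.range T with hV
  have hmem : ∀ x, T x ∈ V := fun x => ⟨x, rfl⟩
  -- An operator has the same trace as its restriction to its own range, a space of dimension rank
  -- M, where each diagonal coefficient is at most ‖M‖.
  have hres := LinearMap.trace_restrict_eq_of_forall_mem V T hmem
  have hrank : Module.finrank ℂ V = M.rank := by
    rw [Matrix.rank_eq_finrank_range_toLin M (EuclideanSpace.basisFun m ℂ).toBasis
      (EuclideanSpace.basisFun m ℂ).toBasis, hV, hT, Matrix.toEuclideanLin_eq_toLin_orthonormal]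
  rw [← htr, ← hres, LinearMap.trace_eq_sum_inner _ (stdOrthonormalBasis ℂ V)]
  refine (norm_sum_le _ _).trans ?_
  have hb : ∀ i ∈ Finset.univ, ‖inner ℂ ((stdOrthonormalBasis ℂ V) i)
      ((T.restrict fun x _ => hmem x) ((stdOrthonormalBasis ℂ V) i))‖ ≤ ‖M‖ := by
    intro i _
    have h1 : ‖(stdOrthonormalBasis ℂ V) i‖ = 1 := (stdOrthonormalBasis ℂ V).orthonormal.1 i
    refine (norm_inner_le_norm (𝕜 := ℂ) (E := V) _ _).trans ?_
    rw [h1, one_mul]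
    have h2 := (LinearMap.toContinuousLinearMap T).le_opNorm ((stdOrthonormalBasis ℂ V) i : V)
    have h3 : ‖(((stdOrthonormalBasis ℂ V) i : V) : EuclideanSpace ℂ m)‖ = 1 := h1
    rw [h3, mul_one] at h2
    exact h2
  refine (Finset.sum_le_card_nsmul _ _ _ hb).trans ?_
  rw [Finset.card_univ, Fintype.card_fin, hrank, nsmul_eq_mul]

theorem norm_trace_le_card_mul (M : Matrix m m ℂ) : ‖M.trace‖ ≤ Fintype.card m * ‖M‖ := by
  refine (norm_trace_le_rank_mul M).trans ?_
  have := M.rank_le_card_width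
  gcongr

theorem norm_matrix_one_le : ‖(1 : Matrix m m ℂ)‖ ≤ 1 := by
  rw [← Matrix.diagonal_one, Matrix.l2_opNorm_diagonal]
  exact (pi_norm_le_iff_of_nonneg zero_le_one).2 fun i => by simp

theorem norm_le_one_of_isometry {m n : Type*} [Fintype m] [Fintype n] [DecidableEq n]
    {J : Matrix m n ℂ} (h : Jᴴ * J = 1) : ‖J‖ ≤ 1 := by
  have h1 := Matrix.l2_opNorm_conjTranspose_mul_self J
  rw [h] at h1
  have h2 := norm_matrix_one_le (m := n)
  nlinarith [norm_nonneg J]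

/-- The resolvent `(L - w)⁻¹`. -/
def resolv (L : Matrix m m ℂ) (w : ℂ) : Matrix m m ℂ := (L - w • 1)⁻¹

theorem resolv_eq_unitary_conj {L : Matrix m m ℂ} (hL : L.IsHermitian) {w : ℂ} (hw : 0 < w.im) :
    (L - w • 1) * ((hL.eigenvectorUnitary : Matrix m m ℂ) *
      Matrix.diagonal (fun i => ((hL.eigenvalues i : ℂ) - w)⁻¹) *
      star (hL.eigenvectorUnitary : Matrix m m ℂ)) = 1 := by
  set U := (hL.eigenvectorUnitary : Matrix m m ℂ) with hU
  have hUU : U * star U = 1 := Unitary.mul_star_self_of_mem hL.eigenvectorUnitary.2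
  have hUU' : star U * U = 1 := Unitary.star_mul_self_of_mem hL.eigenvectorUnitary.2
  have hsp : L = U * Matrix.diagonal (fun i => (hL.eigenvalues i : ℂ)) * star U := by
    have := hL.spectral_theorem
    rw [Unitary.conjStarAlgAut_apply] at this
    exact this
  have h1 : L - w • 1 = U * Matrix.diagonal (fun i => (hL.eigenvalues i : ℂ) - w) * star U := by
    have h2 : w • (1 : Matrix m m ℂ) = U * (w • 1) * star U := by
      rw [Matrix.mul_smul, Matrix.smul_mul, Matrix.mul_one, hUU]
    have h3 : Matrix.diagonal (fun i => (hL.eigenvalues i : ℂ) - w) =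
        Matrix.diagonal (fun i => (hL.eigenvalues i : ℂ)) - w • (1 : Matrix m m ℂ) := by
      rw [← Matrix.diagonal_one, ← Matrix.diagonal_smul, Matrix.diagonal_sub]
      congr 1
      ext i
      simp
    rw [h3, Matrix.mul_sub, Matrix.sub_mul, ← hsp, ← h2]
  rw [h1]
  calc U * Matrix.diagonal (fun i => (hL.eigenvalues i : ℂ) - w) * star U *
        (U * Matrix.diagonal (fun i => ((hL.eigenvalues i : ℂ) - w)⁻¹) * star U)
      = U * (Matrix.diagonal (fun i => (hL.eigenvalues i : ℂ) - w) * (star U * U) *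
          Matrix.diagonal (fun i => ((hL.eigenvalues i : ℂ) - w)⁻¹)) * star U := by
        simp only [Matrix.mul_assoc]
    _ = 1 := by
        rw [hUU', Matrix.mul_one, Matrix.diagonal_mul_diagonal]
        have : (fun i => ((hL.eigenvalues i : ℂ) - w) * ((hL.eigenvalues i : ℂ) - w)⁻¹) =
            fun _ => 1 := funext fun i => mul_inv_cancel₀ (ofReal_sub_ne_zero hw _)
        rw [this, Matrix.diagonal_one, Matrix.mul_one, hUU]

theorem resolv_eq {L : Matrix m m ℂ} (hL : L.IsHermitian) {w : ℂ} (hw : 0 < w.im) :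
    resolv L w = (hL.eigenvectorUnitary : Matrix m m ℂ) *
      Matrix.diagonal (fun i => ((hL.eigenvalues i : ℂ) - w)⁻¹) *
      star (hL.eigenvectorUnitary : Matrix m m ℂ) :=
  Matrix.inv_eq_right_inv (resolv_eq_unitary_conj hL hw)

theorem mul_resolv {L : Matrix m m ℂ} (hL : L.IsHermitian) {w : ℂ} (hw : 0 < w.im) :
    (L - w • 1) * resolv L w = 1 := by
  rw [resolv_eq hL hw]
  exact resolv_eq_unitary_conj hL hw

theorem resolv_mul {L : Matrix m m ℂ} (hL : L.IsHermitian) {w : ℂ} (hw : 0 < w.im) :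
    resolv L w * (L - w • 1) = 1 :=
  mul_eq_one_comm.1 (mul_resolv hL hw)

theorem norm_resolv_le {L : Matrix m m ℂ} (hL : L.IsHermitian) {w : ℂ} (hw : 0 < w.im) :
    ‖resolv L w‖ ≤ w.im⁻¹ := by
  rw [resolv_eq hL hw, mul_assoc, CStarRing.norm_coe_unitary_mul, ← Unitary.coe_star,
    CStarRing.norm_mul_coe_unitary, Matrix.l2_opNorm_diagonal]
  exact (pi_norm_le_iff_of_nonneg (by positivity)).2 fun i => norm_inv_ofReal_sub_le hw _

theorem resolv_sub_resolv {L₀ L : Matrix m m ℂ} (hL₀ : L₀.IsHermitian) (hL : L.IsHermitian)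
    {w : ℂ} (hw : 0 < w.im) :
    resolv L₀ w - resolv L w = resolv L₀ w * (L - L₀) * resolv L w := by
  have h1 : L - L₀ = (L - w • 1) - (L₀ - w • 1) := by abel
  rw [h1, mul_sub, sub_mul, mul_assoc, mul_resolv hL hw, resolv_mul hL₀ hw, mul_one, one_mul]

/-- The isometric embedding of the first summand. -/
def inlMat (m n : Type*) [DecidableEq m] : Matrix (m ⊕ n) m ℂ := Matrix.fromRows 1 0

/-- The isometric embedding of the second summand. -/
def inrMat (m n : Type*) [DecidableEq n] : Matrix (m ⊕ n) n ℂ := Matrix.fromRows 0 1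

theorem inlMat_conjTranspose_mul_self : (inlMat m n)ᴴ * inlMat m n = 1 := by
  simp [inlMat, Matrix.conjTranspose_fromRows_eq_fromCols_conjTranspose,
    Matrix.fromCols_mul_fromRows]

theorem inrMat_conjTranspose_mul_self : (inrMat m n)ᴴ * inrMat m n = 1 := by
  simp [inrMat, Matrix.conjTranspose_fromRows_eq_fromCols_conjTranspose,
    Matrix.fromCols_mul_fromRows]

theorem inlMat_conjTranspose_mul_inrMat : (inlMat m n)ᴴ * inrMat m n = 0 := by
  simp [inlMat, inrMat, Matrix.conjTranspose_fromRows_eq_fromCols_conjTranspose,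
    Matrix.fromCols_mul_fromRows]

theorem inrMat_conjTranspose_mul_inlMat : (inrMat m n)ᴴ * inlMat m n = 0 := by
  simp [inlMat, inrMat, Matrix.conjTranspose_fromRows_eq_fromCols_conjTranspose,
    Matrix.fromCols_mul_fromRows]

theorem norm_inlMat_le : ‖inlMat m n‖ ≤ 1 := norm_le_one_of_isometry inlMat_conjTranspose_mul_self

theorem norm_inrMat_le : ‖inrMat m n‖ ≤ 1 := norm_le_one_of_isometry inrMat_conjTranspose_mul_self

theorem norm_mul_mul_conjTranspose_le {k l : Type*} [Fintype k] [DecidableEq k] [Fintype l]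
    [DecidableEq l] {J : Matrix m k ℂ} {J' : Matrix m l ℂ}
    (hJ : ‖J‖ ≤ 1) (hJ' : ‖J'‖ ≤ 1) (M : Matrix k l ℂ) : ‖J * M * J'ᴴ‖ ≤ ‖M‖ := by
  refine (Matrix.l2_opNorm_mul _ _).trans ?_
  have h1 := Matrix.l2_opNorm_mul J M
  rw [Matrix.l2_opNorm_conjTranspose]
  have h2 : ‖J‖ * ‖M‖ ≤ ‖M‖ := mul_le_of_le_one_left (norm_nonneg _) hJ
  exact (mul_le_of_le_one_right (norm_nonneg _) hJ').trans (h1.trans h2)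

/-- The Hermitian matrix with off-diagonal blocks `Y` and `Yᴴ`. -/
def herm (Y : Matrix m n ℂ) : Matrix (m ⊕ n) (m ⊕ n) ℂ :=
  inlMat m n * Y * (inrMat m n)ᴴ + (inlMat m n * Y * (inrMat m n)ᴴ)ᴴ

theorem herm_isHermitian (Y : Matrix m n ℂ) : (herm Y).IsHermitian := by
  rw [herm, Matrix.IsHermitian, Matrix.conjTranspose_add, Matrix.conjTranspose_conjTranspose,
    add_comm]

theorem inlMat_conjTranspose_mul_herm (Y : Matrix m n ℂ) :
    (inlMat m n)ᴴ * herm Y = Y * (inrMat m n)ᴴ := by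
  rw [herm, Matrix.mul_add, Matrix.conjTranspose_mul, Matrix.conjTranspose_conjTranspose,
    ← Matrix.mul_assoc, ← Matrix.mul_assoc, inlMat_conjTranspose_mul_self, Matrix.one_mul,
    ← Matrix.mul_assoc, inlMat_conjTranspose_mul_inrMat, Matrix.zero_mul, add_zero]

theorem inrMat_conjTranspose_mul_herm (Y : Matrix m n ℂ) :
    (inrMat m n)ᴴ * herm Y = Yᴴ * (inlMat m n)ᴴ := by
  rw [herm, Matrix.mul_add, Matrix.conjTranspose_mul, Matrix.conjTranspose_conjTranspose,
    Matrix.conjTranspose_mul, ← Matrix.mul_assoc, ← Matrix.mul_assoc,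
    inrMat_conjTranspose_mul_inlMat, Matrix.zero_mul, Matrix.zero_mul, zero_add,
    ← Matrix.mul_assoc, inrMat_conjTranspose_mul_self, Matrix.one_mul]

/-- The diagonal blocks of the resolvent of `herm Y`. -/
theorem inlMat_resolv_herm {Y : Matrix m n ℂ} {w : ℂ} (hw : 0 < w.im) (hw2 : 0 < (w ^ 2).im) :
    (inlMat m n)ᴴ * resolv (herm Y) w * inlMat m n = w • resolv (Y * Yᴴ) (w ^ 2) := by
  have hR := mul_resolv (herm_isHermitian Y) hw
  set R := resolv (herm Y) w
  have e1 : Y * ((inrMat m n)ᴴ * R * inlMat m n) - w • ((inlMat m n)ᴴ * R * inlMat m n) = 1 := by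
    have := congrArg (fun M => (inlMat m n)ᴴ * M * inlMat m n) hR
    simp only [Matrix.sub_mul, Matrix.mul_sub, Matrix.mul_one, inlMat_conjTranspose_mul_self,
      Matrix.smul_mul, Matrix.mul_smul, Matrix.one_mul] at this
    rw [← Matrix.mul_assoc, inlMat_conjTranspose_mul_herm] at this
    simpa only [Matrix.mul_assoc] using this
  have e2 : Yᴴ * ((inlMat m n)ᴴ * R * inlMat m n) - w • ((inrMat m n)ᴴ * R * inlMat m n) = 0 := by
    have := congrArg (fun M => (inrMat m n)ᴴ * M * inlMat m n) hR
    simp only [Matrix.sub_mul, Matrix.mul_sub, Matrix.mul_one, inrMat_conjTranspose_mul_inlMat,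
      Matrix.smul_mul, Matrix.mul_smul, Matrix.one_mul] at this
    rw [← Matrix.mul_assoc, inrMat_conjTranspose_mul_herm] at this
    simpa only [Matrix.mul_assoc] using this
  set R₁ := (inlMat m n)ᴴ * R * inlMat m n
  set R₂ := (inrMat m n)ᴴ * R * inlMat m n
  -- Schur complement: the off-diagonal block is eliminated between e1 and e2.
  have e3 : (Y * Yᴴ - w ^ 2 • 1) * R₁ = w • 1 := by
    rw [sub_eq_zero] at e2
    have e1' : w • (1 : Matrix _ _ ℂ) = w • (Y * R₂ - w • R₁) := by rw [e1]
    rw [Matrix.sub_mul, Matrix.mul_assoc, e2, e1', smul_sub, Matrix.mul_smul, smul_smul,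
      Matrix.smul_mul, Matrix.one_mul, sq]
  have hS : (Y * Yᴴ).IsHermitian := Matrix.isHermitian_mul_conjTranspose_self Y
  have e4 := congrArg (fun M => resolv (Y * Yᴴ) (w ^ 2) * M) e3
  rw [← Matrix.mul_assoc, resolv_mul hS hw2, Matrix.one_mul, Matrix.mul_smul, Matrix.mul_one] at e4
  exact e4

theorem inrMat_resolv_herm {Y : Matrix m n ℂ} {w : ℂ} (hw : 0 < w.im) (hw2 : 0 < (w ^ 2).im) :
    (inrMat m n)ᴴ * resolv (herm Y) w * inrMat m n = w • resolv (Yᴴ * Y) (w ^ 2) := by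
  have hR := mul_resolv (herm_isHermitian Y) hw
  set R := resolv (herm Y) w
  have e1 : Yᴴ * ((inlMat m n)ᴴ * R * inrMat m n) - w • ((inrMat m n)ᴴ * R * inrMat m n) = 1 := by
    have := congrArg (fun M => (inrMat m n)ᴴ * M * inrMat m n) hR
    simp only [Matrix.sub_mul, Matrix.mul_sub, Matrix.mul_one, inrMat_conjTranspose_mul_self,
      Matrix.smul_mul, Matrix.mul_smul, Matrix.one_mul] at this
    rw [← Matrix.mul_assoc, inrMat_conjTranspose_mul_herm] at this
    simpa only [Matrix.mul_assoc] using this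
  have e2 : Y * ((inrMat m n)ᴴ * R * inrMat m n) - w • ((inlMat m n)ᴴ * R * inrMat m n) = 0 := by
    have := congrArg (fun M => (inlMat m n)ᴴ * M * inrMat m n) hR
    simp only [Matrix.sub_mul, Matrix.mul_sub, Matrix.mul_one, inlMat_conjTranspose_mul_inrMat,
      Matrix.smul_mul, Matrix.mul_smul, Matrix.one_mul] at this
    rw [← Matrix.mul_assoc, inlMat_conjTranspose_mul_herm] at this
    simpa only [Matrix.mul_assoc] using this
  set R₁ := (inrMat m n)ᴴ * R * inrMat m n
  set R₂ := (inlMat m n)ᴴ * R * inrMat m n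
  have e3 : (Yᴴ * Y - w ^ 2 • 1) * R₁ = w • 1 := by
    rw [sub_eq_zero] at e2
    have e1' : w • (1 : Matrix _ _ ℂ) = w • (Yᴴ * R₂ - w • R₁) := by rw [e1]
    rw [Matrix.sub_mul, Matrix.mul_assoc, e2, e1', smul_sub, Matrix.mul_smul, smul_smul,
      Matrix.smul_mul, Matrix.one_mul, sq]
  have hS : (Yᴴ * Y).IsHermitian := Matrix.isHermitian_conjTranspose_mul_self Y
  have e4 := congrArg (fun M => resolv (Yᴴ * Y) (w ^ 2) * M) e3
  rw [← Matrix.mul_assoc, resolv_mul hS hw2, Matrix.one_mul, Matrix.mul_smul, Matrix.mul_one] at e4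
  exact e4

theorem rank_herm_sub_le (Y Y' : Matrix m n ℂ) :
    (herm Y - herm Y').rank ≤ 2 * (Y - Y').rank := by
  have h1 : herm Y - herm Y' = inlMat m n * (Y - Y') * (inrMat m n)ᴴ +
      (inlMat m n * (Y - Y') * (inrMat m n)ᴴ)ᴴ := by
    simp only [herm, Matrix.mul_sub, Matrix.sub_mul, Matrix.conjTranspose_sub]
    abel
  have h2 : (inlMat m n * (Y - Y') * (inrMat m n)ᴴ).rank ≤ (Y - Y').rank :=
    (Matrix.rank_mul_le_left _ _).trans (Matrix.rank_mul_le_right _ _)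
  rw [h1]
  refine (rank_add_le _ _).trans ?_
  rw [Matrix.rank_conjTranspose]
  omega

/-- Stability of linear statistics of the resolvent under perturbations of low rank. -/
theorem norm_trace_mul_resolv_sub_le (T : Matrix (m ⊕ n) (m ⊕ n) ℂ) (Y Y' : Matrix m n ℂ) {w : ℂ}
    (hw : 0 < w.im) :
    ‖(T * resolv (herm Y) w).trace - (T * resolv (herm Y') w).trace‖ ≤
      4 * (Y - Y').rank * ‖T‖ / w.im := by
  rw [← Matrix.trace_sub, ← Matrix.mul_sub]
  refine (norm_trace_le_rank_mul _).trans ?_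
  -- The factor 4 of the statement is 2 for the rank of the linearization times 2 for the two
  -- resolvent norms.
  have h1 : (T * (resolv (herm Y) w - resolv (herm Y') w)).rank ≤ 2 * (Y - Y').rank := by
    refine (Matrix.rank_mul_le_right _ _).trans ?_
    rw [resolv_sub_resolv (herm_isHermitian Y) (herm_isHermitian Y') hw]
    refine (Matrix.rank_mul_le_left _ _).trans ((Matrix.rank_mul_le_right _ _).trans ?_)
    rw [← neg_sub, ← neg_one_smul ℂ, Matrix.rank_smul_of_mem_nonZeroDivisors]
    · exact rank_herm_sub_le Y Y'
    · simp
  have h2 : ‖T * (resolv (herm Y) w - resolv (herm Y') w)‖ ≤ ‖T‖ * (2 * w.im⁻¹) := by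
    refine (norm_mul_le _ _).trans (mul_le_mul_of_nonneg_left ?_ (norm_nonneg _))
    refine (norm_sub_le _ _).trans ?_
    linarith [norm_resolv_le (herm_isHermitian Y) hw, norm_resolv_le (herm_isHermitian Y') hw]
  calc ((T * (resolv (herm Y) w - resolv (herm Y') w)).rank : ℝ) *
        ‖T * (resolv (herm Y) w - resolv (herm Y') w)‖
      ≤ (2 * (Y - Y').rank : ℕ) * (‖T‖ * (2 * w.im⁻¹)) := by
        gcongr
    _ = _ := by
        push_cast
        ring

end Resolvent

/-! ### Calculus of unitarily diagonalized matrices -/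

section ConjDiagonal

open scoped Matrix.Norms.L2Operator Matrix MatrixOrder

variable {m : Type*} [Fintype m] [DecidableEq m] {U : Matrix m m ℂ}

/-- The matrix with eigenvalues `v` in the basis given by the columns of `U`. -/
def cdiag (U : Matrix m m ℂ) (v : m → ℂ) : Matrix m m ℂ := U * Matrix.diagonal v * Uᴴ

theorem conjTranspose_mul_of_mem_unitary (hU : U ∈ unitary (Matrix m m ℂ)) : Uᴴ * U = 1 :=
  Unitary.star_mul_self_of_mem hU

theorem mul_conjTranspose_of_mem_unitary (hU : U ∈ unitary (Matrix m m ℂ)) : U * Uᴴ = 1 :=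
  Unitary.mul_star_self_of_mem hU

theorem cdiag_mul (hU : U ∈ unitary (Matrix m m ℂ)) (v v' : m → ℂ) :
    cdiag U v * cdiag U v' = cdiag U (fun i => v i * v' i) := by
  calc U * Matrix.diagonal v * Uᴴ * (U * Matrix.diagonal v' * Uᴴ)
      = U * (Matrix.diagonal v * (Uᴴ * U) * Matrix.diagonal v') * Uᴴ := by
        simp only [Matrix.mul_assoc]
    _ = _ := by
        rw [conjTranspose_mul_of_mem_unitary hU, Matrix.mul_one, Matrix.diagonal_mul_diagonal]
        rfl

theorem cdiag_one (hU : U ∈ unitary (Matrix m m ℂ)) : cdiag U (fun _ => 1) = 1 := by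
  rw [cdiag, Matrix.diagonal_one, Matrix.mul_one, mul_conjTranspose_of_mem_unitary hU]

theorem cdiag_add (U : Matrix m m ℂ) (v v' : m → ℂ) :
    cdiag U v + cdiag U v' = cdiag U (fun i => v i + v' i) := by
  rw [cdiag, cdiag, cdiag, ← Matrix.add_mul, ← Matrix.mul_add, Matrix.diagonal_add]

theorem cdiag_sub (U : Matrix m m ℂ) (v v' : m → ℂ) :
    cdiag U v - cdiag U v' = cdiag U (fun i => v i - v' i) := by
  rw [cdiag, cdiag, cdiag, ← Matrix.sub_mul, ← Matrix.mul_sub, Matrix.diagonal_sub]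

theorem smul_cdiag (U : Matrix m m ℂ) (a : ℂ) (v : m → ℂ) :
    a • cdiag U v = cdiag U (fun i => a * v i) := by
  have : Matrix.diagonal (fun i => a * v i) = a • Matrix.diagonal v := by
    rw [← Matrix.diagonal_smul]
    rfl
  rw [cdiag, cdiag, this, Matrix.mul_smul, Matrix.smul_mul]

theorem sum_cdiag {ι : Type*} (s : Finset ι) (U : Matrix m m ℂ) (v : ι → m → ℂ) :
    ∑ r ∈ s, cdiag U (v r) = cdiag U (fun i => ∑ r ∈ s, v r i) := by
  classical
  induction s using Finset.induction_on with
  | empty =>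
    have : Matrix.diagonal (fun _ : m => (0 : ℂ)) = 0 := Matrix.diagonal_zero
    simp [cdiag, this]
  | insert a s ha ih =>
    rw [Finset.sum_insert ha, ih, cdiag_add]
    simp only [Finset.sum_insert ha]

theorem cdiag_conjTranspose (U : Matrix m m ℂ) (v : m → ℂ) :
    (cdiag U v)ᴴ = cdiag U (fun i => star (v i)) := by
  rw [cdiag, cdiag, Matrix.conjTranspose_mul, Matrix.conjTranspose_mul,
    Matrix.conjTranspose_conjTranspose, Matrix.diagonal_conjTranspose, Matrix.mul_assoc]
  rfl

theorem trace_cdiag (hU : U ∈ unitary (Matrix m m ℂ)) (v : m → ℂ) :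
    (cdiag U v).trace = ∑ i, v i := by
  rw [cdiag, Matrix.trace_mul_comm, ← Matrix.mul_assoc, conjTranspose_mul_of_mem_unitary hU,
    Matrix.one_mul, Matrix.trace_diagonal]

theorem norm_cdiag_le (hU : U ∈ unitary (Matrix m m ℂ)) {v : m → ℂ} {t : ℝ} (ht : 0 ≤ t)
    (hv : ∀ i, ‖v i‖ ≤ t) : ‖cdiag U v‖ ≤ t := by
  have hU' : Uᴴ ∈ unitary (Matrix m m ℂ) := Unitary.star_mem hU
  rw [cdiag, CStarRing.norm_mul_mem_unitary _ hU', CStarRing.norm_mem_unitary_mul _ hU,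
    Matrix.l2_opNorm_diagonal]
  exact (pi_norm_le_iff_of_nonneg ht).2 hv

theorem rank_cdiag (hU : U ∈ unitary (Matrix m m ℂ)) (v : m → ℂ) :
    (cdiag U v).rank = Fintype.card {i // v i ≠ 0} := by
  have h1 : IsUnit U.det := (Matrix.isUnit_iff_isUnit_det U).1
    (IsUnit.of_mul_eq_one _ (mul_conjTranspose_of_mem_unitary hU))
  have h2 : IsUnit Uᴴ.det := (Matrix.isUnit_iff_isUnit_det _).1
    (IsUnit.of_mul_eq_one _ (conjTranspose_mul_of_mem_unitary hU))
  rw [cdiag, Matrix.rank_mul_eq_left_of_isUnit_det _ _ h2,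
    Matrix.rank_mul_eq_right_of_isUnit_det _ _ h1, Matrix.rank_diagonal]

theorem posSemidef_cdiag (U : Matrix m m ℂ) {v : m → ℝ} (hv : ∀ i, 0 ≤ v i) :
    (cdiag U (fun i => (v i : ℂ))).PosSemidef := by
  refine Matrix.PosSemidef.mul_mul_conjTranspose_same ?_ U
  exact Matrix.PosSemidef.diagonal fun i => by simpa using hv i

theorem sqrt_cdiag (hU : U ∈ unitary (Matrix m m ℂ)) {v : m → ℝ} (hv : ∀ i, 0 ≤ v i) :
    CFC.sqrt (cdiag U (fun i => (v i : ℂ))) = cdiag U (fun i => (√(v i) : ℂ)) := by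
  refine CFC.sqrt_unique ?_ (Matrix.nonneg_iff_posSemidef.2 (posSemidef_cdiag U fun i => Real.sqrt_nonneg _))
  rw [cdiag_mul hU]
  congr 1
  ext i
  rw [← Complex.ofReal_mul, Real.mul_self_sqrt (hv i)]

end ConjDiagonal

/-! ### Joint spectra of commuting matrices as empirical measures -/

section JointSpectrum

open scoped Matrix

variable {K d : ℕ}

/-- The empirical measure of a finite family of points. -/
def emp {E : Type*} [MeasurableSpace E] (x : Fin d → E) : Measure E :=
  (d : ENNReal)⁻¹ • ∑ j, Measure.dirac (x j)

/-- Commuting self-adjoint operators decompose the space orthogonally into joint eigenspaces; an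
orthonormal basis adapted to the decomposition supplies the columns of U. Semidefiniteness makes the
joint eigenvalues real and nonnegative. -/
theorem exists_eq_cdiag {A : Fin K → Matrix (Fin d) (Fin d) ℂ} (hA : ∀ r, (A r).PosSemidef)
    (hc : ∀ r s, Commute (A r) (A s)) :
    ∃ U ∈ unitary (Matrix (Fin d) (Fin d) ℂ), ∃ x : Fin d → Fin K → ℝ, (∀ j r, 0 ≤ x j r) ∧
      ∀ r, A r = cdiag U fun j => (x j r : ℂ) := by
  classical
  let T : Fin K → Module.End ℂ (EuclideanSpace ℂ (Fin d)) := fun r => Matrix.toEuclideanLin (A r)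
  have hT : ∀ r, (T r).IsSymmetric := fun r => Matrix.isSymmetric_toEuclideanLin_iff.2 (hA r).1
  have hC : Pairwise (Function.onFun Commute T) := by
    intro r s _
    have h1 := (hc r s).eq
    change T r * T s = T s * T r
    ext x : 1
    have : ∀ M N : Matrix (Fin d) (Fin d) ℂ, Matrix.toEuclideanLin M (Matrix.toEuclideanLin N x) =
        Matrix.toEuclideanLin (M * N) x := by
      intro M N
      simp [Matrix.toLpLin_apply, Matrix.mulVec_mulVec]
    change Matrix.toEuclideanLin (A r) (Matrix.toEuclideanLin (A s) x) =
      Matrix.toEuclideanLin (A s) (Matrix.toEuclideanLin (A r) x)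
    rw [this, this, h1]
  have hintg := LinearMap.IsSymmetric.directSum_isInternal_of_pairwise_commute hT hC
  -- The decomposition is indexed by all of ℂ^K; discarding the zero summands leaves the finite
  -- index set that an adapted basis requires.
  have hintg' := DirectSum.isInternal_ne_bot_iff.2 hintg
  have horth := LinearMap.IsSymmetric.orthogonalFamily_iInf_eigenspaces hT
  have : Fintype {α : Fin K → ℂ // (⨅ j, (T j).eigenspace (α j)) ≠ ⊥} :=
    hintg.submodule_iSupIndep.fintypeNeBotOfFiniteDimensional
  have horth' := horth.comp (Subtype.val_injective (p := fun α : Fin K → ℂ => (⨅ j, (T j).eigenspace (α j)) ≠ ⊥))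
  have hn : Module.finrank ℂ (EuclideanSpace ℂ (Fin d)) = d := finrank_euclideanSpace_fin
  let b := hintg'.subordinateOrthonormalBasis hn horth'
  let α : Fin d → Fin K → ℂ := fun j => (hintg'.subordinateOrthonormalBasisIndex hn j horth').1
  have hb : ∀ j r, T r (b j) = α j r • b j := by
    intro j r
    have := hintg'.subordinateOrthonormalBasis_subordinate hn j horth'
    exact Module.End.mem_eigenspace_iff.1 ((Submodule.mem_iInf _).1 this r)
  let U : Matrix (Fin d) (Fin d) ℂ :=
    (EuclideanSpace.basisFun (Fin d) ℂ).toBasis.toMatrix b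
  have hU : U ∈ unitary (Matrix (Fin d) (Fin d) ℂ) :=
    OrthonormalBasis.toMatrix_orthonormalBasis_mem_unitary _ _
  have hUij : ∀ i j, U i j = b j i := fun i j => by simp [U, Module.Basis.toMatrix_apply]
  have hAU : ∀ r, A r * U = U * Matrix.diagonal (fun j => α j r) := by
    intro r
    ext i j
    have h1 := congrArg (fun v : EuclideanSpace ℂ (Fin d) => v i) (hb j r)
    simp only [T, Matrix.toLpLin_apply, PiLp.smul_apply, smul_eq_mul] at h1
    rw [Matrix.mul_diagonal, hUij, mul_comm, ← h1, Matrix.mul_apply]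
    simp only [hUij, Matrix.mulVec, dotProduct]
  have hAr : ∀ r, A r = cdiag U fun j => α j r := by
    intro r
    rw [cdiag, ← hAU, Matrix.mul_assoc, mul_conjTranspose_of_mem_unitary hU, Matrix.mul_one]
  have hα : ∀ j r, 0 ≤ α j r := by
    intro j r
    have h1 : Uᴴ * A r * U = Matrix.diagonal (fun j => α j r) := by
      rw [Matrix.mul_assoc, hAU, ← Matrix.mul_assoc, conjTranspose_mul_of_mem_unitary hU,
        Matrix.one_mul]
    have h2 := (hA r).conjTranspose_mul_mul_same U
    rw [h1] at h2
    exact Matrix.posSemidef_diagonal_iff.1 h2 j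
  refine ⟨U, hU, fun j r => (α j r).re, fun j r => (Complex.nonneg_iff.1 (hα j r)).1, fun r => ?_⟩
  rw [hAr r]
  congr 1
  ext j
  exact Complex.ext (by simp) (by simpa using (Complex.nonneg_iff.1 (hα j r)).2.symm)

/-- The joint eigenspace is the kernel of the single matrix with eigenvalue 0 at the indices where x
j = y and 1 elsewhere, so its dimension follows from rank and nullity. -/
theorem finrank_iInf_eigenspace_cdiag {U : Matrix (Fin d) (Fin d) ℂ}
    (hU : U ∈ unitary (Matrix (Fin d) (Fin d) ℂ)) (x : Fin d → Fin K → ℝ) (y : Fin K → ℝ) :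
    Module.finrank ℂ (⨅ r, Module.End.eigenspace (Matrix.toLin' (cdiag U fun j => (x j r : ℂ)))
      (y r : ℂ) : Submodule ℂ (Fin d → ℂ)) = Fintype.card {j // x j = y} := by
  classical
  let χ : Fin d → ℂ := fun j => if x j = y then 0 else 1
  have key : ∀ (v : Fin d → ℂ) (w : Fin d → ℂ) (a : ℂ),
      (cdiag U w).mulVec v = a • v ↔ ∀ j, w j * (Uᴴ.mulVec v) j = a * (Uᴴ.mulVec v) j := by
    intro v w a
    have h1 : (cdiag U w).mulVec v = U.mulVec (fun j => w j * (Uᴴ.mulVec v) j) := by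
      rw [cdiag, ← Matrix.mulVec_mulVec, ← Matrix.mulVec_mulVec]
      congr 1
      ext j
      rw [Matrix.mulVec_diagonal]
    constructor
    · intro h j
      have h2 := congrArg (fun u => Uᴴ.mulVec u j) (h1 ▸ h)
      simp only [Matrix.mulVec_mulVec, conjTranspose_mul_of_mem_unitary hU, Matrix.one_mulVec,
        Matrix.mulVec_smul, Pi.smul_apply, smul_eq_mul] at h2
      exact h2
    · intro h
      rw [h1, funext h]
      change U.mulVec (a • Uᴴ.mulVec v) = _
      rw [Matrix.mulVec_smul, Matrix.mulVec_mulVec, mul_conjTranspose_of_mem_unitary hU,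
        Matrix.one_mulVec]
  have hker : (⨅ r, Module.End.eigenspace (Matrix.toLin' (cdiag U fun j => (x j r : ℂ)))
      (y r : ℂ) : Submodule ℂ (Fin d → ℂ)) = LinearMap.ker (cdiag U χ).mulVecLin := by
    ext v
    rw [Submodule.mem_iInf, LinearMap.mem_ker, Matrix.mulVecLin_apply, ← zero_smul ℂ v, key]
    simp only [Module.End.mem_eigenspace_iff, Matrix.toLin'_apply, key]
    rw [forall_comm]
    refine forall_congr' fun j => ?_
    by_cases hj : x j = y
    · simp [χ, hj]
    · obtain ⟨r, hr⟩ := Function.ne_iff.1 hj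
      simp only [χ, hj, if_false, one_mul, zero_mul]
      constructor
      · intro h
        have h3 : ((x j r : ℂ) - y r) * (Uᴴ.mulVec v) j = 0 := by rw [sub_mul, h r, sub_self]
        refine (mul_eq_zero.1 h3).resolve_left ?_
        exact sub_ne_zero.2 (by exact_mod_cast hr)
      · intro h r
        rw [h, mul_zero, mul_zero]
  have h1 := LinearMap.finrank_range_add_finrank_ker (cdiag U χ).mulVecLin
  have h2 : Module.finrank ℂ (LinearMap.range (cdiag U χ).mulVecLin) =
      Fintype.card {j // χ j ≠ 0} := rank_cdiag hU χ
  have h3 : Fintype.card {j // χ j ≠ 0} = Fintype.card {j // ¬ x j = y} :=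
    Fintype.card_congr (Equiv.subtypeEquivRight fun j => by by_cases hj : x j = y <;> simp [χ, hj])
  have h4 := Fintype.card_subtype_compl (fun j : Fin d => x j = y)
  have h5 := Fintype.card_subtype_le (fun j : Fin d => x j = y)
  rw [hker]
  rw [h2, h3, h4, Module.finrank_fin_fun, Fintype.card_fin] at h1
  rw [Fintype.card_fin] at h5
  omega

/-- The multiplicity at a point counts the indices j that sit there; exchanging the sum over all
points of ℝ^K with the finite sum over j leaves one term for each j. -/
theorem jesd_cdiag {U : Matrix (Fin d) (Fin d) ℂ}
    (hU : U ∈ unitary (Matrix (Fin d) (Fin d) ℂ)) (x : Fin d → Fin K → ℝ) :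
    jesd (fun r => cdiag U fun j => (x j r : ℂ)) = emp x := by
  classical
  unfold jesd emp
  congr 1
  ext s hs
  rw [Measure.sum_apply _ hs, Measure.finsetSum_apply]
  have h1 : ∀ y : Fin K → ℝ, ((Fintype.card {j // x j = y} : ENNReal) • Measure.dirac y) s =
      ∑ j, if x j = y then Measure.dirac (x j) s else 0 := by
    intro y
    rw [Measure.smul_apply, smul_eq_mul, Fintype.card_subtype, Finset.card_filter, Nat.cast_sum,
      Finset.sum_mul]
    refine Finset.sum_congr rfl fun j _ => ?_
    by_cases hj : x j = y <;> simp [hj]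
  simp only [finrank_iInf_eigenspace_cdiag hU, h1]
  rw [Summable.tsum_finsetSum fun j _ => ENNReal.summable]
  refine Finset.sum_congr rfl fun j _ => ?_
  rw [tsum_eq_single (x j) fun y hy => if_neg hy.symm, if_pos rfl]

theorem isProbabilityMeasure_emp {E : Type*} [MeasurableSpace E] (hd : d ≠ 0) (x : Fin d → E) :
    IsProbabilityMeasure (emp x) := by
  constructor
  rw [emp, Measure.smul_apply, Measure.finsetSum_apply]
  simp only [measure_univ, Finset.sum_const, Finset.card_univ, Fintype.card_fin, nsmul_eq_mul,
    mul_one, smul_eq_mul]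
  exact ENNReal.inv_mul_cancel (by exact_mod_cast hd) (ENNReal.natCast_ne_top d)

theorem integral_emp {E F : Type*} [MeasurableSpace E] [MeasurableSingletonClass E]
    [NormedAddCommGroup F] [NormedSpace ℝ F] [CompleteSpace F] (x : Fin d → E) (f : E → F) :
    ∫ y, f y ∂(emp x) = (d : ℝ)⁻¹ • ∑ j, f (x j) := by
  have hf : ∀ j, Integrable f (Measure.dirac (x j)) := fun j =>
    integrable_dirac (by finiteness)
  rw [emp, integral_smul_measure, integral_finsetSum_measure fun j _ => hf j]
  simp [integral_dirac]

theorem ae_emp {E : Type*} [MeasurableSpace E] [MeasurableSingletonClass E] {x : Fin d → E}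
    {q : E → Prop} (h : ∀ j, q (x j)) : ∀ᵐ y ∂(emp x), q y := by
  rw [ae_iff, emp, Measure.smul_apply, Measure.finsetSum_apply]
  simp [Measure.dirac_apply, h]

theorem isOrthantLaw_emp (hd : d ≠ 0) {x : Fin d → Fin K → ℝ} (hx : ∀ j r, 0 ≤ x j r) :
    IsOrthantLaw (emp x) where
  prob := isProbabilityMeasure_emp hd x
  nonneg := ae_emp hx
  integrable r := by
    refine Integrable.smul_measure ?_ (ENNReal.inv_ne_top.2 (by exact_mod_cast hd))
    exact integrable_finsetSum_measure.2 fun j _ => integrable_dirac (by finiteness)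

end JointSpectrum

/-! ### Traces against the resolvent as Stieltjes transforms -/

section TraceStieltjes

open scoped Matrix

variable {m : Type*} [Fintype m] [DecidableEq m]

/-- The weighted spectral measure with Stieltjes transform `tr (A (S - z)⁻¹)`. -/
theorem exists_stieltjes_eq_trace {A S : Matrix m m ℂ} (hA : A.PosSemidef) (hS : S.PosSemidef) :
    ∃ μ : Measure ℝ, IsFiniteMeasure μ ∧ μ (Set.Ici 0)ᶜ = 0 ∧ μ.real Set.univ = A.trace.re ∧
      ∀ z : ℂ, 0 < z.im → (A * resolv S z).trace = stieltjes μ z := by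
  set U := (hS.1.eigenvectorUnitary : Matrix m m ℂ) with hU
  have hUU : U * Uᴴ = 1 := Unitary.mul_star_self_of_mem hS.1.eigenvectorUnitary.2
  -- In the eigenbasis of S, the diagonal of W consists of nonnegative numbers with sum tr A; these
  -- are the weights placed at the eigenvalues of S.
  set W := Uᴴ * A * U with hW
  have hWp : W.PosSemidef := hA.conjTranspose_mul_mul_same U
  have hWd : ∀ i, 0 ≤ (W i i).re ∧ 0 = (W i i).im := fun i =>
    Complex.nonneg_iff.1 hWp.diag_nonneg
  have hWr : ∀ i, ((W i i).re : ℂ) = W i i := fun i => Complex.ext rfl (hWd i).2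
  let ν : m → Measure ℝ := fun i =>
    ENNReal.ofReal (W i i).re • Measure.dirac (hS.1.eigenvalues i)
  have hν : ∀ i, IsFiniteMeasure (ν i) := fun i => Measure.smul_finite _ ENNReal.ofReal_ne_top
  refine ⟨∑ i, ν i, inferInstance, ?_, ?_, ?_⟩
  · rw [Measure.finsetSum_apply]
    refine Finset.sum_eq_zero fun i _ => ?_
    have := hS.eigenvalues_nonneg i
    simp [ν, this]
  · rw [measureReal_def, Measure.finsetSum_apply, ENNReal.toReal_sum fun i _ => measure_ne_top _ _]
    have h1 : A.trace = W.trace := by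
      rw [hW, Matrix.mul_assoc, Matrix.trace_mul_comm, Matrix.mul_assoc, hUU, Matrix.mul_one]
    rw [h1, Matrix.trace, Complex.re_sum]
    refine Finset.sum_congr rfl fun i _ => ?_
    simp [ν, (hWd i).1]
  · intro z hz
    have hintg : ∀ i ∈ Finset.univ, Integrable (fun x : ℝ => ((x : ℂ) - z)⁻¹) (ν i) := fun i _ =>
      integrable_inv_ofReal_sub _ hz
    rw [stieltjes, integral_finsetSum_measure hintg]
    have h1 : (A * resolv S z).trace =
        (W * Matrix.diagonal fun i => ((hS.1.eigenvalues i : ℂ) - z)⁻¹).trace := by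
      rw [resolv_eq hS.1 hz, ← Matrix.mul_assoc, Matrix.trace_mul_comm, hW]
      simp only [Matrix.mul_assoc]
      rfl
    rw [h1, Matrix.trace]
    refine Finset.sum_congr rfl fun i _ => ?_
    rw [Matrix.diag_apply, Matrix.mul_diagonal, integral_smul_measure, integral_dirac,
      ENNReal.toReal_ofReal (hWd i).1, Complex.real_smul, hWr]

theorem stieltjes_esd {d : ℕ} {S : Matrix (Fin d) (Fin d) ℂ} (hS : S.IsHermitian) {z : ℂ}
    (hz : 0 < z.im) : stieltjes (esd hS) z = (d : ℂ)⁻¹ * (resolv S z).trace := by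
  have h1 : (resolv S z).trace = ∑ i, ((hS.eigenvalues i : ℂ) - z)⁻¹ := by
    rw [resolv_eq hS hz, Matrix.trace_mul_comm, ← Matrix.mul_assoc,
      Unitary.star_mul_self_of_mem hS.eigenvectorUnitary.2, Matrix.one_mul, Matrix.trace_diagonal]
  rw [h1, stieltjes]
  have := integral_emp hS.eigenvalues (fun x : ℝ => ((x : ℂ) - z)⁻¹)
  rw [emp] at this
  rw [esd, this, Complex.real_smul, Complex.ofReal_inv, Complex.ofReal_natCast]

end TraceStieltjes

/-! ### Measurability of matrix operations -/

section MatrixMeasurability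

open scoped Matrix

instance matrixMeasurableSpace {m n : Type*} : MeasurableSpace (Matrix m n ℂ) :=
  inferInstanceAs (MeasurableSpace (m → n → ℂ))

instance matrixBorelSpace {m n : Type*} [Fintype m] [Fintype n] : BorelSpace (Matrix m n ℂ) :=
  inferInstanceAs (BorelSpace (m → n → ℂ))

instance matrixSecondCountable {m n : Type*} [Fintype m] [Fintype n] :
    SecondCountableTopology (Matrix m n ℂ) :=
  inferInstanceAs (SecondCountableTopology (m → n → ℂ))

variable {Ω : Type*} [MeasurableSpace Ω] {m n k : Type*} [Fintype m] [Fintype n] [Fintype k]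

theorem measurable_matrix_mul {f : Ω → Matrix m n ℂ} {g : Ω → Matrix n k ℂ} (hf : Measurable f)
    (hg : Measurable g) : Measurable fun ω => f ω * g ω :=
  (continuous_fst.matrix_mul continuous_snd).measurable.comp (hf.prodMk hg)

theorem measurable_conjTranspose {f : Ω → Matrix m n ℂ} (hf : Measurable f) :
    Measurable fun ω => (f ω)ᴴ :=
  (continuous_id.matrix_conjTranspose).measurable.comp hf

theorem measurable_trace {f : Ω → Matrix m m ℂ} (hf : Measurable f) :
    Measurable fun ω => (f ω).trace :=
  (continuous_id.matrix_trace).measurable.comp hf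

theorem measurable_matrix_add {f g : Ω → Matrix m n ℂ} (hf : Measurable f)
    (hg : Measurable g) : Measurable fun ω => f ω + g ω :=
  (continuous_fst.add continuous_snd).measurable.comp (hf.prodMk hg)

theorem measurable_matrix_sum {ι : Type*} (s : Finset ι) {f : ι → Ω → Matrix m n ℂ}
    (hf : ∀ r, Measurable (f r)) : Measurable fun ω => ∑ r ∈ s, f r ω := by
  classical
  induction s using Finset.induction_on with
  | empty => simp
  | insert a s ha ih =>
    simp only [Finset.sum_insert ha]
    exact measurable_matrix_add (hf a) ih

variable [DecidableEq m] [DecidableEq n]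

theorem measurable_matrix_inv {f : Ω → Matrix m m ℂ} (hf : Measurable f) :
    Measurable fun ω => (f ω)⁻¹ := by
  have h1 : Measurable fun ω => (f ω).det := (continuous_id.matrix_det).measurable.comp hf
  have h2 : Measurable fun ω => (f ω).adjugate := (continuous_id.matrix_adjugate).measurable.comp hf
  have h3 : Measurable fun q : ℂ × Matrix m m ℂ => q.1 • q.2 :=
    (continuous_fst.smul continuous_snd).measurable
  simp only [Matrix.inv_def, Ring.inverse_eq_inv']
  exact h3.comp (h1.inv.prodMk h2)

theorem measurable_herm {f : Ω → Matrix m n ℂ} (hf : Measurable f) :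
    Measurable fun ω => herm (f ω) := by
  have h : Measurable fun ω => inlMat m n * f ω * (inrMat m n)ᴴ :=
    measurable_matrix_mul (measurable_matrix_mul measurable_const hf) measurable_const
  exact measurable_matrix_add h (measurable_conjTranspose h)

theorem measurable_resolv {f : Ω → Matrix m m ℂ} (hf : Measurable f) (w : ℂ) :
    Measurable fun ω => resolv (f ω) w := by
  have h : Measurable fun ω => f ω - w • (1 : Matrix m m ℂ) := by
    simp only [sub_eq_add_neg]
    exact measurable_matrix_add hf measurable_const
  exact measurable_matrix_inv h

-- The square root is continuous on the closed cone of positive semidefinite matrices and has the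
-- default value 0 off it, so it is measurable on all matrices.
open scoped Matrix.Norms.L2Operator MatrixOrder in
theorem measurable_sqrt : Measurable (CFC.sqrt : Matrix m m ℂ → Matrix m m ℂ) := by
  classical
  have hcl : IsClosed {M : Matrix m m ℂ | 0 ≤ M} := isClosed_Ici
  have hc : ContinuousOn (CFC.sqrt : Matrix m m ℂ → Matrix m m ℂ) {M | 0 ≤ M} :=
    CFC.continuousOn_sqrt
  have h0 : (CFC.sqrt : Matrix m m ℂ → Matrix m m ℂ) =
      Set.piecewise {M | 0 ≤ M} CFC.sqrt fun _ => 0 := by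
    ext M : 1
    by_cases hM : 0 ≤ M
    · simp [Set.piecewise, hM]
    · have : CFC.sqrt M = 0 := cfcₙ_apply_of_not_predicate M hM
      simp [Set.piecewise, hM, this]
  rw [h0]
  exact hc.measurable_piecewise continuousOn_const hcl.measurableSet

end MatrixMeasurability

/-! ### Expansion of the resolvent in a single entry -/

section EntryExpansion

open scoped Matrix.Norms.L2Operator Matrix

variable {k : Type*} [Fintype k] [DecidableEq k] {T N N' R₀ R : Matrix k k ℂ} {η t a : ℝ}

/-- Rank one removes the dimension from the trace bound. This keeps the error of one entry so small
that the sum over all p n entries is still negligible. -/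
theorem norm_trace_mul_mul_le (hN : N.rank ≤ 1) (hNa : ‖N‖ ≤ a) (hT : ‖T‖ ≤ t)
    (W : Matrix k k ℂ) : ‖(T * N * W).trace‖ ≤ t * a * ‖W‖ := by
  have ha : 0 ≤ a := (norm_nonneg _).trans hNa
  have ht : 0 ≤ t := (norm_nonneg _).trans hT
  refine (norm_trace_le_rank_mul _).trans ?_
  have h1 : (T * N * W).rank ≤ 1 :=
    (Matrix.rank_mul_le_left _ _).trans ((Matrix.rank_mul_le_right _ _).trans hN)
  have h2 : ‖T * N * W‖ ≤ t * a * ‖W‖ := by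
    refine (norm_mul_le _ _).trans ?_
    refine mul_le_mul_of_nonneg_right ?_ (norm_nonneg _)
    exact (norm_mul_le _ _).trans (mul_le_mul hT hNa (norm_nonneg _) ht)
  have h3 : ((T * N * W).rank : ℝ) ≤ 1 := by exact_mod_cast h1
  exact (mul_le_of_le_one_left (norm_nonneg _) h3).trans h2

theorem norm_mul_mul_le (hη : 0 < η) (hNa : ‖N‖ ≤ a) {R R' : Matrix k k ℂ} (hR : ‖R‖ ≤ η⁻¹)
    (hR' : ‖R'‖ ≤ η⁻¹) : ‖R * N * R'‖ ≤ a / η ^ 2 := by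
  have ha : 0 ≤ a := (norm_nonneg _).trans hNa
  calc ‖R * N * R'‖ ≤ ‖R‖ * ‖N‖ * ‖R'‖ :=
        (norm_mul_le _ _).trans (mul_le_mul_of_nonneg_right (norm_mul_le _ _) (norm_nonneg _))
    _ ≤ η⁻¹ * a * η⁻¹ := by gcongr
    _ = a / η ^ 2 := by field_simp

theorem norm_smul_add_star_smul_le (hNa : ‖N‖ ≤ a) (ζ : ℂ) :
    ‖ζ • N + star ζ • Nᴴ‖ ≤ 2 * ‖ζ‖ * a := by
  refine (norm_add_le _ _).trans ?_
  rw [norm_smul, norm_smul, norm_star, Matrix.l2_opNorm_conjTranspose]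
  nlinarith [norm_nonneg ζ]

theorem norm_resolvent_increment_le (hη : 0 < η) (hNa : ‖N‖ ≤ a) (hR₀ : ‖R₀‖ ≤ η⁻¹)
    (hR : ‖R‖ ≤ η⁻¹) {ζ : ℂ} (h : R₀ - R = R₀ * (ζ • N + star ζ • Nᴴ) * R) :
    ‖R₀ - R‖ ≤ 2 * ‖ζ‖ * a / η ^ 2 := by
  rw [h]
  exact norm_mul_mul_le hη (norm_smul_add_star_smul_le hNa ζ) hR₀ hR

theorem norm_sandwich_sub_le (hη : 0 < η) (hNa : ‖N‖ ≤ a) (hN' : ‖N'‖ ≤ a) (hR₀ : ‖R₀‖ ≤ η⁻¹)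
    (hR : ‖R‖ ≤ η⁻¹) {ζ : ℂ} (h : R₀ - R = R₀ * (ζ • N + star ζ • Nᴴ) * R) :
    ‖R₀ * N' * R₀ - R * N' * R‖ ≤ 4 * ‖ζ‖ * a ^ 2 / η ^ 3 := by
  have ha : 0 ≤ a := (norm_nonneg _).trans hNa
  have hd := norm_resolvent_increment_le hη hNa hR₀ hR h
  have e : R₀ * N' * R₀ - R * N' * R = (R₀ - R) * N' * R₀ + R * N' * (R₀ - R) := by noncomm_ring
  have hd0 := norm_nonneg (R₀ - R)
  rw [e]
  refine (norm_add_le _ _).trans ?_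
  have h1 : ‖(R₀ - R) * N' * R₀‖ ≤ (2 * ‖ζ‖ * a / η ^ 2) * a * η⁻¹ :=
    (norm_mul_le _ _).trans (mul_le_mul ((norm_mul_le _ _).trans
      (mul_le_mul hd hN' (norm_nonneg _) (by positivity))) hR₀ (norm_nonneg _) (by positivity))
  have h2 : ‖R * N' * (R₀ - R)‖ ≤ η⁻¹ * a * (2 * ‖ζ‖ * a / η ^ 2) :=
    (norm_mul_le _ _).trans (mul_le_mul ((norm_mul_le _ _).trans
      (mul_le_mul hR hN' (norm_nonneg _) (by positivity))) hd (norm_nonneg _) (by positivity))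
  calc _ ≤ (2 * ‖ζ‖ * a / η ^ 2) * a * η⁻¹ + η⁻¹ * a * (2 * ‖ζ‖ * a / η ^ 2) := add_le_add h1 h2
    _ = _ := by
      field_simp
      ring

/-- With Δ = ζN + ζ̄Nᴴ, the resolvent identity used twice gives R = R₀ − R₀ΔR₀ + R₀ΔR₀ΔR. Here R₀
does not involve the entry ζ, so the first three terms factorize under expectation. -/
theorem trace_expansion {ζ : ℂ} (h : R₀ - R = R₀ * (ζ • N + star ζ • Nᴴ) * R) :
    ζ * (T * N * R).trace = ζ * (T * N * R₀).trace - ζ ^ 2 * (T * N * (R₀ * N * R₀)).trace -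
      (‖ζ‖ ^ 2 : ℝ) * (T * N * (R₀ * Nᴴ * R₀)).trace +
      ζ * (T * N * (R₀ * (ζ • N + star ζ • Nᴴ) * (R₀ * (ζ • N + star ζ • Nᴴ) * R))).trace := by
  have h1 : R = R₀ - R₀ * (ζ • N + star ζ • Nᴴ) * R₀ +
      R₀ * (ζ • N + star ζ • Nᴴ) * (R₀ * (ζ • N + star ζ • Nᴴ) * R) := by
    rw [← h, Matrix.mul_sub, ← h]
    abel
  have h2 : R₀ * (ζ • N + star ζ • Nᴴ) * R₀ = ζ • (R₀ * N * R₀) + star ζ • (R₀ * Nᴴ * R₀) := by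
    simp only [Matrix.mul_add, Matrix.add_mul, Matrix.mul_smul, Matrix.smul_mul]
  have h3 : ((‖ζ‖ ^ 2 : ℝ) : ℂ) = ζ * star ζ := by
    rw [Complex.star_def, Complex.mul_conj, Complex.normSq_eq_norm_sq]
  have h4 := congrArg (fun W => (T * N * W).trace) h1
  rw [h2] at h4
  simp only [Matrix.mul_add, Matrix.mul_sub, Matrix.mul_smul, Matrix.trace_add, Matrix.trace_sub,
    Matrix.trace_smul, smul_eq_mul] at h4
  rw [h3]
  simp only [Matrix.mul_add] at h4 ⊢
  rw [h4]
  simp only [Matrix.mul_smul]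
  ring

theorem norm_trace_expansion_remainder_le (hη : 0 < η) (hN : N.rank ≤ 1) (hNa : ‖N‖ ≤ a)
    (hT : ‖T‖ ≤ t) (hR₀ : ‖R₀‖ ≤ η⁻¹) (hR : ‖R‖ ≤ η⁻¹) (ζ : ℂ) :
    ‖ζ * (T * N * (R₀ * (ζ • N + star ζ • Nᴴ) *
      (R₀ * (ζ • N + star ζ • Nᴴ) * R))).trace‖ ≤ 4 * ‖ζ‖ ^ 3 * (t * a ^ 3 / η ^ 3) := by
  have ha : 0 ≤ a := (norm_nonneg _).trans hNa
  have ht : 0 ≤ t := (norm_nonneg _).trans hT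
  have hΔ := norm_smul_add_star_smul_le hNa ζ
  have h1 := norm_mul_mul_le hη hΔ hR₀ hR
  have h2 : ‖R₀ * (ζ • N + star ζ • Nᴴ) * (R₀ * (ζ • N + star ζ • Nᴴ) * R)‖ ≤
      η⁻¹ * (2 * ‖ζ‖ * a) * (2 * ‖ζ‖ * a / η ^ 2) :=
    (norm_mul_le _ _).trans (mul_le_mul ((norm_mul_le _ _).trans
      (mul_le_mul hR₀ hΔ (norm_nonneg _) (by positivity))) h1 (norm_nonneg _) (by positivity))
  rw [norm_mul]
  calc _ ≤ ‖ζ‖ * (t * a * (η⁻¹ * (2 * ‖ζ‖ * a) * (2 * ‖ζ‖ * a / η ^ 2))) := by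
        refine mul_le_mul_of_nonneg_left ?_ (norm_nonneg _)
        exact (norm_trace_mul_mul_le hN hNa hT _).trans
          (mul_le_mul_of_nonneg_left h2 (by positivity))
    _ = _ := by
      field_simp
      ring

/-- One step of integration by parts: the contribution of a single entry `ζ`. -/
theorem norm_integral_entry_le {Ω : Type*} [MeasurableSpace Ω] {P : Measure Ω}
    [IsProbabilityMeasure P] {ζ : Ω → ℂ} {R₀ R : Ω → Matrix k k ℂ} {M : ℝ} (hη : 0 < η)
    (hζ : Measurable ζ) (hR₀m : Measurable R₀) (hRm : Measurable R) (hind : IndepFun ζ R₀ P)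
    (hR₀ : ∀ ω, ‖R₀ ω‖ ≤ η⁻¹) (hR : ∀ ω, ‖R ω‖ ≤ η⁻¹) (hN : N.rank ≤ 1) (hNa : ‖N‖ ≤ a)
    (hT : ‖T‖ ≤ t)
    (hpert : ∀ ω, R₀ ω - R ω = R₀ ω * (ζ ω • N + star (ζ ω) • Nᴴ) * R ω)
    (h1 : ∫ ω, ζ ω ∂P = 0) (h2 : ∫ ω, ‖ζ ω‖ ^ 2 ∂P = 1)
    (h3i : Integrable (fun ω => ‖ζ ω‖ ^ 3) P) (h3 : ∫ ω, ‖ζ ω‖ ^ 3 ∂P ≤ M) (hM : 1 ≤ M) :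
    ‖∫ ω, (ζ ω * (T * N * R ω).trace + (T * N * (R ω * Nᴴ * R ω)).trace) ∂P‖ ≤
      ∫ ω, ‖(T * N * (R ω * N * R ω)).trace‖ ∂P + 12 * M * (t * a ^ 3 / η ^ 3) := by
  have ha : 0 ≤ a := (norm_nonneg _).trans hNa
  have ht : 0 ≤ t := (norm_nonneg _).trans hT
  have hNa' : ‖Nᴴ‖ ≤ a := by rwa [Matrix.l2_opNorm_conjTranspose]
  set q := t * a ^ 3 / η ^ 3 with hq
  have hq0 : 0 ≤ q := by positivity
  have hζn : Measurable fun ω => ‖ζ ω‖ := hζ.norm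
  have i2 : Integrable (fun ω => ‖ζ ω‖ ^ 2) P := by
    refine ((integrable_const 1).add h3i).mono' (hζn.pow_const 2).aestronglyMeasurable
      (ae_of_all _ fun ω => ?_)
    rw [Real.norm_of_nonneg (by positivity), Pi.add_apply]
    have := norm_nonneg (ζ ω)
    rcases le_total ‖ζ ω‖ 1 with h | h
    · nlinarith [pow_nonneg this 3, pow_le_one₀ this h (n := 2)]
    · nlinarith [pow_nonneg this 3, pow_le_pow_right₀ h (show 2 ≤ 3 by norm_num)]
  have i1 : Integrable (fun ω => ‖ζ ω‖) P := by
    refine ((integrable_const 1).add i2).mono' hζn.aestronglyMeasurable (ae_of_all _ fun ω => ?_)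
    rw [Real.norm_of_nonneg (norm_nonneg _), Pi.add_apply]
    nlinarith [norm_nonneg (ζ ω)]
  -- From |ζ| ≤ (1 + |ζ|²)/2 and unit variance.
  have e1 : ∫ ω, ‖ζ ω‖ ∂P ≤ 1 := by
    have hle : ∫ ω, ‖ζ ω‖ ∂P ≤ ∫ ω, (1 + ‖ζ ω‖ ^ 2) / 2 ∂P := by
      refine integral_mono i1 (((integrable_const 1).add i2).div_const 2) fun ω => ?_
      nlinarith [sq_nonneg (‖ζ ω‖ - 1)]
    rw [integral_div, integral_add (integrable_const 1) i2, h2] at hle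
    simpa using hle
  have bd : ∀ {W W' N' : Matrix k k ℂ}, ‖N'‖ ≤ a → ‖W‖ ≤ η⁻¹ → ‖W'‖ ≤ η⁻¹ →
      ‖(T * N * (W * N' * W')).trace‖ ≤ t * a * (a / η ^ 2) := fun hN' hW hW' =>
    (norm_trace_mul_mul_le hN hNa hT _).trans
      (mul_le_mul_of_nonneg_left (norm_mul_mul_le hη hN' hW hW') (by positivity))
  have mm : ∀ (N' : Matrix k k ℂ) {f g : Ω → Matrix k k ℂ}, Measurable f → Measurable g →
      Measurable fun ω => (T * N * (f ω * N' * g ω)).trace := fun N' f g hf hg =>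
    measurable_trace (measurable_matrix_mul measurable_const
      (measurable_matrix_mul (measurable_matrix_mul hf measurable_const) hg))
  set X₀ := fun ω => (T * N * R₀ ω).trace with hX₀
  set X₁ := fun ω => (T * N * (R₀ ω * N * R₀ ω)).trace with hX₁
  set X₂ := fun ω => (T * N * (R₀ ω * Nᴴ * R₀ ω)).trace with hX₂
  set W₁ := fun ω => (T * N * (R ω * N * R ω)).trace with hW₁
  set W₂ := fun ω => (T * N * (R ω * Nᴴ * R ω)).trace with hW₂
  set E₃ := fun ω => ζ ω * (T * N * (R₀ ω * (ζ ω • N + star (ζ ω) • Nᴴ) *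
      (R₀ ω * (ζ ω • N + star (ζ ω) • Nᴴ) * R ω))).trace with hE₃
  have mX₀ : Measurable X₀ := measurable_trace (measurable_matrix_mul measurable_const hR₀m)
  have mX₁ : Measurable X₁ := mm N hR₀m hR₀m
  have mX₂ : Measurable X₂ := mm Nᴴ hR₀m hR₀m
  have mW₁ : Measurable W₁ := mm N hRm hRm
  have mW₂ : Measurable W₂ := mm Nᴴ hRm hRm
  have mF : Measurable fun ω => ζ ω * (T * N * R ω).trace :=
    hζ.mul (measurable_trace (measurable_matrix_mul measurable_const hRm))
  have hexp : ∀ ω, ζ ω * (T * N * R ω).trace = ζ ω * X₀ ω - ζ ω ^ 2 * X₁ ω -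
      (‖ζ ω‖ ^ 2 : ℝ) * X₂ ω + E₃ ω := fun ω => trace_expansion (hpert ω)
  have mE₃ : Measurable E₃ := by
    have : E₃ = fun ω => ζ ω * (T * N * R ω).trace - (ζ ω * X₀ ω - ζ ω ^ 2 * X₁ ω -
      ((‖ζ ω‖ ^ 2 : ℝ) : ℂ) * X₂ ω) := by
      ext ω
      rw [hexp]
      ring
    rw [this]
    exact mF.sub (((hζ.mul mX₀).sub ((hζ.pow_const 2).mul mX₁)).sub
      ((Complex.measurable_ofReal.comp (hζn.pow_const 2)).mul mX₂))
  have bi : ∀ {X : Ω → ℂ}, Measurable X → ∀ {C : ℝ}, (∀ ω, ‖X ω‖ ≤ C) → Integrable X P :=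
    fun hX C hC => Integrable.of_bound hX.aestronglyMeasurable C (ae_of_all _ hC)
  have bX₀ : ∀ ω, ‖X₀ ω‖ ≤ t * a * η⁻¹ := fun ω => (norm_trace_mul_mul_le hN hNa hT _).trans
    (mul_le_mul_of_nonneg_left (hR₀ ω) (by positivity))
  have bX₁ : ∀ ω, ‖X₁ ω‖ ≤ t * a * (a / η ^ 2) := fun ω => bd hNa (hR₀ ω) (hR₀ ω)
  have bX₂ : ∀ ω, ‖X₂ ω‖ ≤ t * a * (a / η ^ 2) := fun ω => bd hNa' (hR₀ ω) (hR₀ ω)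
  have bW₁ : ∀ ω, ‖W₁ ω‖ ≤ t * a * (a / η ^ 2) := fun ω => bd hNa (hR ω) (hR ω)
  have bW₂ : ∀ ω, ‖W₂ ω‖ ≤ t * a * (a / η ^ 2) := fun ω => bd hNa' (hR ω) (hR ω)
  have dX : ∀ {N' : Matrix k k ℂ}, ‖N'‖ ≤ a → ∀ ω, ‖(T * N * (R₀ ω * N' * R₀ ω)).trace -
      (T * N * (R ω * N' * R ω)).trace‖ ≤ 4 * ‖ζ ω‖ * q := by
    intro N' hN' ω
    rw [← Matrix.trace_sub, ← Matrix.mul_sub]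
    refine (norm_trace_mul_mul_le hN hNa hT _).trans ?_
    refine (mul_le_mul_of_nonneg_left (norm_sandwich_sub_le hη hNa hN' (hR₀ ω) (hR ω) (hpert ω))
      (by positivity)).trans (le_of_eq ?_)
    rw [hq]
    ring
  have bE₃ : ∀ ω, ‖E₃ ω‖ ≤ 4 * ‖ζ ω‖ ^ 3 * q := fun ω =>
    norm_trace_expansion_remainder_le hη hN hNa hT (hR₀ ω) (hR ω) (ζ ω)
  have iζ : Integrable ζ P := (integrable_norm_iff hζ.aestronglyMeasurable).1 i1
  have iζ2 : Integrable (fun ω => ζ ω ^ 2) P :=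
    i2.mono' (hζ.pow_const 2).aestronglyMeasurable (ae_of_all _ fun ω => (norm_pow _ _).le)
  have inn : Integrable (fun ω => ((‖ζ ω‖ ^ 2 : ℝ) : ℂ)) P := i2.ofReal
  have iA : Integrable (fun ω => ζ ω * X₀ ω) P :=
    iζ.mul_bdd mX₀.aestronglyMeasurable (ae_of_all _ bX₀)
  have iB : Integrable (fun ω => ζ ω ^ 2 * X₁ ω) P :=
    iζ2.mul_bdd mX₁.aestronglyMeasurable (ae_of_all _ bX₁)
  have iC : Integrable (fun ω => ((‖ζ ω‖ ^ 2 : ℝ) : ℂ) * X₂ ω) P :=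
    inn.mul_bdd mX₂.aestronglyMeasurable (ae_of_all _ bX₂)
  have iE : Integrable E₃ P := ((h3i.const_mul 4).mul_const q).mono' mE₃.aestronglyMeasurable
    (ae_of_all _ bE₃)
  have iX₁ := bi mX₁ bX₁
  have iX₂ := bi mX₂ bX₂
  have iW₁ := bi mW₁ bW₁
  have iW₂ := bi mW₂ bW₂
  have trm : ∀ N' : Matrix k k ℂ, Measurable fun W : Matrix k k ℂ => (T * N * (W * N' * W)).trace :=
    fun N' => measurable_trace (measurable_matrix_mul measurable_const
      (measurable_matrix_mul (measurable_matrix_mul measurable_id measurable_const) measurable_id))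
  -- Independence of ζ and R₀ together with E ζ = 0 kills the leading term.
  have vA : ∫ ω, ζ ω * X₀ ω ∂P = 0 := by
    have hi : IndepFun ζ X₀ P := hind.comp measurable_id
      (measurable_trace (measurable_matrix_mul measurable_const measurable_id) :
        Measurable fun W : Matrix k k ℂ => (T * N * W).trace)
    have := hi.integral_mul_eq_mul_integral hζ.aestronglyMeasurable mX₀.aestronglyMeasurable
    rw [h1, zero_mul] at this
    exact this
  have vB : ∫ ω, ζ ω ^ 2 * X₁ ω ∂P = (∫ ω, ζ ω ^ 2 ∂P) * ∫ ω, X₁ ω ∂P := by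
    have hi : IndepFun (fun ω => ζ ω ^ 2) X₁ P := hind.comp
      (measurable_id.pow_const 2 : Measurable fun x : ℂ => x ^ 2) (trm N)
    exact hi.integral_mul_eq_mul_integral (hζ.pow_const 2).aestronglyMeasurable
      mX₁.aestronglyMeasurable
  have vC : ∫ ω, ((‖ζ ω‖ ^ 2 : ℝ) : ℂ) * X₂ ω ∂P = ∫ ω, X₂ ω ∂P := by
    have hm : Measurable fun x : ℂ => ((‖x‖ ^ 2 : ℝ) : ℂ) :=
      Complex.measurable_ofReal.comp (measurable_norm.pow_const 2)
    have hi : IndepFun (fun ω => ((‖ζ ω‖ ^ 2 : ℝ) : ℂ)) X₂ P := hind.comp hm (trm Nᴴ)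
    have := hi.integral_mul_eq_mul_integral (hm.comp hζ).aestronglyMeasurable
      mX₂.aestronglyMeasurable
    rw [integral_complex_ofReal, h2, Complex.ofReal_one, one_mul] at this
    exact this
  -- All that is known of E ζ² is |E ζ²| ≤ 1, as the law of a complex entry is arbitrary. The term
  -- is therefore kept, with R₀ replaced by R; it becomes small only after summation over the
  -- entries.
  have vB' : ‖(∫ ω, ζ ω ^ 2 ∂P) * ∫ ω, X₁ ω ∂P‖ ≤ ∫ ω, ‖W₁ ω‖ ∂P + 4 * q := by
    have hm2 : ‖∫ ω, ζ ω ^ 2 ∂P‖ ≤ 1 := by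
      refine (norm_integral_le_integral_norm _).trans (le_of_eq ?_)
      simp only [norm_pow]
      exact h2
    rw [norm_mul]
    refine (mul_le_of_le_one_left (norm_nonneg _) hm2).trans ?_
    refine (norm_integral_le_integral_norm _).trans ?_
    have hle : ∫ ω, ‖X₁ ω‖ ∂P ≤ ∫ ω, (‖W₁ ω‖ + 4 * ‖ζ ω‖ * q) ∂P := by
      refine integral_mono iX₁.norm (iW₁.norm.add ((i1.const_mul 4).mul_const q)) fun ω => ?_
      have := dX hNa ω
      have h5 := norm_sub_norm_le (X₁ ω) (W₁ ω)
      linarith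
    rw [integral_add iW₁.norm ((i1.const_mul 4).mul_const q), integral_mul_const,
      integral_const_mul] at hle
    nlinarith
  have vD : ‖∫ ω, (W₂ ω - X₂ ω) ∂P‖ ≤ 4 * q := by
    refine (norm_integral_le_integral_norm _).trans ?_
    have hle : ∫ ω, ‖W₂ ω - X₂ ω‖ ∂P ≤ ∫ ω, 4 * ‖ζ ω‖ * q ∂P := by
      refine integral_mono (iW₂.sub iX₂).norm ((i1.const_mul 4).mul_const q) fun ω => ?_
      rw [norm_sub_rev]
      exact dX hNa' ω
    rw [integral_mul_const, integral_const_mul] at hle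
    nlinarith
  have vE : ‖∫ ω, E₃ ω ∂P‖ ≤ 4 * M * q := by
    refine (norm_integral_le_integral_norm _).trans ?_
    have hle : ∫ ω, ‖E₃ ω‖ ∂P ≤ ∫ ω, 4 * ‖ζ ω‖ ^ 3 * q ∂P :=
      integral_mono iE.norm ((h3i.const_mul 4).mul_const q) bE₃
    rw [integral_mul_const, integral_const_mul] at hle
    nlinarith
  have htot : ∫ ω, (ζ ω * (T * N * R ω).trace + W₂ ω) ∂P =
      -((∫ ω, ζ ω ^ 2 ∂P) * ∫ ω, X₁ ω ∂P) + ∫ ω, (W₂ ω - X₂ ω) ∂P + ∫ ω, E₃ ω ∂P := by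
    have i2' : Integrable (fun ω => ζ ω * X₀ ω - ζ ω ^ 2 * X₁ ω) P := iA.sub iB
    have i3 : Integrable (fun ω => ζ ω * X₀ ω - ζ ω ^ 2 * X₁ ω -
        ((‖ζ ω‖ ^ 2 : ℝ) : ℂ) * X₂ ω) P := i2'.sub iC
    have i4 : Integrable (fun ω => ζ ω * X₀ ω - ζ ω ^ 2 * X₁ ω -
        ((‖ζ ω‖ ^ 2 : ℝ) : ℂ) * X₂ ω + E₃ ω) P := i3.add iE
    have hfun : (fun ω => ζ ω * (T * N * R ω).trace + W₂ ω) = fun ω => (ζ ω * X₀ ω -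
        ζ ω ^ 2 * X₁ ω - ((‖ζ ω‖ ^ 2 : ℝ) : ℂ) * X₂ ω + E₃ ω) + W₂ ω := by
      ext ω
      rw [hexp]
    rw [hfun, integral_add i4 iW₂, integral_add i3 iE, integral_sub i2' iC,
      integral_sub iA iB, vA, vB, vC, integral_sub iW₂ iX₂]
    ring
  -- The replacements of R₀ by R in the two quadratic terms cost 4q each and the cubic remainder
  -- 4Mq; the total is at most 12Mq because M ≥ 1.
  rw [htot]
  refine (norm_add₃_le).trans ?_
  rw [norm_neg]
  nlinarith

end EntryExpansion

/-! ### Algebra of the loop equation -/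

section LoopEquation

open scoped Matrix.Norms.L2Operator Matrix

variable {ι m n : Type*} [Fintype ι] [Fintype m] [Fintype n] [DecidableEq m] [DecidableEq n]

/-- The linear combination `∑ r, D_r Z_r E_r`. -/
def combo (D : ι → Matrix m m ℂ) (E : ι → Matrix n n ℂ) (Z : ι → m → n → ℂ) : Matrix m n ℂ :=
  ∑ r, D r * Matrix.of (Z r) * E r

/-- The coefficient of a single entry in `combo`. -/
def unitCombo (D : ι → Matrix m m ℂ) (E : ι → Matrix n n ℂ) (e : ι × m × n) : Matrix m n ℂ :=
  D e.1 * Matrix.single e.2.1 e.2.2 (1 : ℂ) * E e.1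

theorem combo_eq_sum (D : ι → Matrix m m ℂ) (E : ι → Matrix n n ℂ) (Z : ι → m → n → ℂ) :
    combo D E Z = ∑ e : ι × m × n, Z e.1 e.2.1 e.2.2 • unitCombo D E e := by
  rw [combo, Fintype.sum_prod_type]
  refine Finset.sum_congr rfl fun r _ => ?_
  have h : Matrix.of (Z r) = ∑ e : m × n, Z r e.1 e.2 • Matrix.single e.1 e.2 (1 : ℂ) := by
    rw [Fintype.sum_prod_type]
    conv_lhs => rw [Matrix.matrix_eq_sum_single (Matrix.of (Z r))]
    simp [Matrix.smul_single]
  rw [h, Matrix.mul_sum, Matrix.sum_mul]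
  refine Finset.sum_congr rfl fun e _ => ?_
  rw [Matrix.mul_smul, Matrix.smul_mul]
  rfl

/-- The coefficient of a single entry in the off-diagonal block of `herm`. -/
def unitBlock (D : ι → Matrix m m ℂ) (E : ι → Matrix n n ℂ) (e : ι × m × n) :
    Matrix (m ⊕ n) (m ⊕ n) ℂ :=
  inlMat m n * unitCombo D E e * (inrMat m n)ᴴ

theorem rank_unitBlock_le (D : ι → Matrix m m ℂ) (E : ι → Matrix n n ℂ) (e : ι × m × n) :
    (unitBlock D E e).rank ≤ 1 := by
  have h : (Matrix.single e.2.1 e.2.2 (1 : ℂ)).rank ≤ 1 := by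
    rw [Matrix.single_eq_single_vecMulVec_single]
    exact Matrix.rank_vecMulVec_le _ _
  exact (Matrix.rank_mul_le_left _ _).trans ((Matrix.rank_mul_le_right _ _).trans
    ((Matrix.rank_mul_le_left _ _).trans ((Matrix.rank_mul_le_right _ _).trans h)))

theorem norm_single_one_le (i : m) (j : n) : ‖Matrix.single i j (1 : ℂ)‖ ≤ 1 := by
  have h1 := Matrix.l2_opNorm_conjTranspose_mul_self (Matrix.single i j (1 : ℂ))
  have h2 : (Matrix.single i j (1 : ℂ))ᴴ * Matrix.single i j (1 : ℂ) =
      Matrix.diagonal (Pi.single j (1 : ℂ)) := by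
    rw [Matrix.conjTranspose_single, Matrix.single_mul_single_same, star_one, mul_one,
      Matrix.diagonal_single]
  rw [h2, Matrix.l2_opNorm_diagonal] at h1
  have h3 : ‖(Pi.single j 1 : n → ℂ)‖ ≤ 1 := by
    refine (pi_norm_le_iff_of_nonneg zero_le_one).2 fun i => ?_
    by_cases h : i = j
    · subst h
      simp
    · simp [h]
  nlinarith [norm_nonneg (Matrix.single i j (1 : ℂ))]

theorem norm_unitBlock_le {D : ι → Matrix m m ℂ} {E : ι → Matrix n n ℂ} {a b : ℝ}
    (hD : ∀ r, ‖D r‖ ≤ a) (hE : ∀ r, ‖E r‖ ≤ b) (e : ι × m × n) : ‖unitBlock D E e‖ ≤ a * b := by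
  refine (norm_mul_mul_conjTranspose_le norm_inlMat_le norm_inrMat_le _).trans ?_
  have ha := (norm_nonneg _).trans (hD e.1)
  have h1 : ‖D e.1 * Matrix.single e.2.1 e.2.2 (1 : ℂ)‖ ≤ a := by
    refine (Matrix.l2_opNorm_mul _ _).trans ?_
    exact (mul_le_of_le_one_right (norm_nonneg _) (norm_single_one_le _ _)).trans (hD _)
  exact (Matrix.l2_opNorm_mul _ _).trans (mul_le_mul h1 (hE _) (norm_nonneg _) ha)

theorem sum_smul_unitBlock (D : ι → Matrix m m ℂ) (E : ι → Matrix n n ℂ) (Z : ι → m → n → ℂ) :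
    ∑ e : ι × m × n, Z e.1 e.2.1 e.2.2 • unitBlock D E e =
      inlMat m n * combo D E Z * (inrMat m n)ᴴ := by
  rw [combo_eq_sum, Matrix.mul_sum, Matrix.sum_mul]
  refine Finset.sum_congr rfl fun e _ => ?_
  rw [Matrix.mul_smul, Matrix.smul_mul]
  rfl

theorem combo_sub (D : ι → Matrix m m ℂ) (E : ι → Matrix n n ℂ) (Z Z' : ι → m → n → ℂ) :
    combo D E Z - combo D E Z' = combo D E (Z - Z') := by
  rw [combo_eq_sum, combo_eq_sum, combo_eq_sum, ← Finset.sum_sub_distrib]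
  simp [sub_smul]

theorem measurable_combo {Ω : Type*} [MeasurableSpace Ω] (D : ι → Matrix m m ℂ)
    (E : ι → Matrix n n ℂ) {Z : Ω → ι → m → n → ℂ} (hZ : Measurable Z) :
    Measurable fun ω => combo D E (Z ω) := by
  refine measurable_matrix_sum _ fun r => ?_
  refine measurable_matrix_mul (measurable_matrix_mul measurable_const ?_) measurable_const
  exact (measurable_pi_apply r).comp hZ

/-- The array with the entry at `e` replaced by `0`. -/
def eraseEntry [DecidableEq ι] (Z : ι → m → n → ℂ) (e : ι × m × n) : ι → m → n → ℂ :=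
  fun r i j => if (r, i, j) = e then 0 else Z r i j

theorem herm_combo_sub_eraseEntry [DecidableEq ι] (D : ι → Matrix m m ℂ) (E : ι → Matrix n n ℂ)
    (Z : ι → m → n → ℂ) (e : ι × m × n) :
    herm (combo D E Z) - herm (combo D E (eraseEntry Z e)) =
      Z e.1 e.2.1 e.2.2 • unitBlock D E e + star (Z e.1 e.2.1 e.2.2) • (unitBlock D E e)ᴴ := by
  have h1 : inlMat m n * combo D E Z * (inrMat m n)ᴴ -
      inlMat m n * combo D E (eraseEntry Z e) * (inrMat m n)ᴴ =
      Z e.1 e.2.1 e.2.2 • unitBlock D E e := by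
    rw [← sum_smul_unitBlock, ← sum_smul_unitBlock, ← Finset.sum_sub_distrib,
      Finset.sum_eq_single e]
    · simp [eraseEntry]
    · rintro f - hf
      have : (f.1, f.2.1, f.2.2) ≠ e := hf
      simp [eraseEntry, this]
    · simp
  have h2 : ∀ X Y : Matrix (m ⊕ n) (m ⊕ n) ℂ, X + Xᴴ - (Y + Yᴴ) = (X - Y) + (X - Y)ᴴ := by
    intro X Y
    rw [Matrix.conjTranspose_sub]
    abel
  rw [herm, herm, h2, h1, Matrix.conjTranspose_smul]

variable {D : ι → Matrix m m ℂ} {E : ι → Matrix n n ℂ} {w : ℂ}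

/-- The block of the resolvent identity behind the loop equation. -/
theorem mul_inrMat_resolv_herm {Y : Matrix m n ℂ} (hw : 0 < w.im) (hw2 : 0 < (w ^ 2).im) :
    Y * ((inrMat m n)ᴴ * resolv (herm Y) w * inlMat m n) = 1 + w ^ 2 • resolv (Y * Yᴴ) (w ^ 2) := by
  have hR := mul_resolv (herm_isHermitian Y) hw
  have := congrArg (fun M => (inlMat m n)ᴴ * M * inlMat m n) hR
  simp only [Matrix.sub_mul, Matrix.mul_sub, Matrix.mul_one, inlMat_conjTranspose_mul_self,
    Matrix.smul_mul, Matrix.mul_smul, Matrix.one_mul] at this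
  rw [inlMat_resolv_herm hw hw2, ← Matrix.mul_assoc, inlMat_conjTranspose_mul_herm, smul_smul,
    ← sq] at this
  rw [← this]
  simp only [Matrix.mul_assoc, sub_add_cancel]

/-- Summed with the entries as coefficients, the unit blocks reassemble Y in the upper right corner;
what remains is tr T times Y times a block of the resolvent, evaluated by `mul_inrMat_resolv_herm`.
-/
theorem sum_mul_trace_unitBlock (T : Matrix m m ℂ) (Z : ι → m → n → ℂ) (hw : 0 < w.im)
    (hw2 : 0 < (w ^ 2).im) :
    ∑ e : ι × m × n, Z e.1 e.2.1 e.2.2 * (inlMat m n * T * (inlMat m n)ᴴ * unitBlock D E e *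
      resolv (herm (combo D E Z)) w).trace =
    T.trace + w ^ 2 * (T * resolv (combo D E Z * (combo D E Z)ᴴ) (w ^ 2)).trace := by
  set R := resolv (herm (combo D E Z)) w
  have h1 : ∀ e : ι × m × n, Z e.1 e.2.1 e.2.2 * (inlMat m n * T * (inlMat m n)ᴴ *
      unitBlock D E e * R).trace = (inlMat m n * T * (inlMat m n)ᴴ *
      (Z e.1 e.2.1 e.2.2 • unitBlock D E e) * R).trace := by
    intro e
    rw [Matrix.mul_smul, Matrix.smul_mul, Matrix.trace_smul, smul_eq_mul]
  simp only [h1]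
  rw [← Matrix.trace_sum, ← Matrix.sum_mul, ← Matrix.mul_sum, sum_smul_unitBlock]
  have h2 : (inlMat m n * T * (inlMat m n)ᴴ * (inlMat m n * combo D E Z * (inrMat m n)ᴴ) *
      R).trace = (T * (combo D E Z * ((inrMat m n)ᴴ * R * inlMat m n))).trace := by
    have : inlMat m n * T * (inlMat m n)ᴴ * (inlMat m n * combo D E Z * (inrMat m n)ᴴ) * R =
        inlMat m n * (T * ((inlMat m n)ᴴ * inlMat m n) * combo D E Z * (inrMat m n)ᴴ * R) := by
      simp only [Matrix.mul_assoc]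
    rw [this, Matrix.trace_mul_comm, inlMat_conjTranspose_mul_self, Matrix.mul_one]
    simp only [Matrix.mul_assoc]
  rw [h2, mul_inrMat_resolv_herm hw hw2, Matrix.mul_add, Matrix.mul_one, Matrix.mul_smul,
    Matrix.trace_add, Matrix.trace_smul, smul_eq_mul]

/-- This identity is what turns the sum over entries into a product of two traces and thereby closes
the equations. -/
theorem sum_single_mul_mul_single (X : Matrix n n ℂ) :
    ∑ e : m × n, Matrix.single e.1 e.2 (1 : ℂ) * X * (Matrix.single e.1 e.2 (1 : ℂ))ᴴ =
      X.trace • (1 : Matrix m m ℂ) := by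
  have h : ∀ e : m × n, Matrix.single e.1 e.2 (1 : ℂ) * X * (Matrix.single e.1 e.2 (1 : ℂ))ᴴ =
      Matrix.single e.1 e.1 (X e.2 e.2) := by
    intro e
    rw [Matrix.conjTranspose_single, Matrix.single_mul_mul_single]
    simp
  simp only [h]
  rw [Fintype.sum_prod_type]
  ext i j
  simp only [Matrix.sum_apply, Matrix.smul_apply, Matrix.one_apply, smul_eq_mul, Matrix.single_apply]
  by_cases hij : i = j
  · subst hij
    simp [Matrix.trace, Finset.sum_ite_eq']
  · have : ∀ x, ¬ (x = i ∧ x = j) := fun x hx => hij (hx.1.symm.trans hx.2)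
    simp [this, hij]

/-- Between a unit block and its adjoint stands the lower right block wQ' of the resolvent, and
outside stands the upper left block wQ. `sum_single_mul_mul_single` separates them into two traces,
and the two factors w combine to w². -/
theorem sum_trace_unitBlock_conjTranspose (T : Matrix m m ℂ) (Z : ι → m → n → ℂ) (hw : 0 < w.im)
    (hw2 : 0 < (w ^ 2).im) :
    ∑ e : ι × m × n, (inlMat m n * T * (inlMat m n)ᴴ * unitBlock D E e *
      (resolv (herm (combo D E Z)) w * (unitBlock D E e)ᴴ * resolv (herm (combo D E Z)) w)).trace =
    ∑ r, w ^ 2 * (((E r)ᴴ * E r * resolv ((combo D E Z)ᴴ * combo D E Z) (w ^ 2)).trace *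
      (T * (D r * (D r)ᴴ) * resolv (combo D E Z * (combo D E Z)ᴴ) (w ^ 2)).trace) := by
  have hq := inlMat_resolv_herm (Y := combo D E Z) hw hw2
  have hq' := inrMat_resolv_herm (Y := combo D E Z) hw hw2
  set R := resolv (herm (combo D E Z)) w
  set Q := resolv (combo D E Z * (combo D E Z)ᴴ) (w ^ 2)
  set Q' := resolv ((combo D E Z)ᴴ * combo D E Z) (w ^ 2)
  rw [Fintype.sum_prod_type]
  refine Finset.sum_congr rfl fun r _ => ?_
  have h1 : ∀ e : m × n, (inlMat m n * T * (inlMat m n)ᴴ * unitBlock D E (r, e) *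
      (R * (unitBlock D E (r, e))ᴴ * R)).trace = (T * D r * (Matrix.single e.1 e.2 (1 : ℂ) *
      (E r * (w • Q') * (E r)ᴴ) * (Matrix.single e.1 e.2 (1 : ℂ))ᴴ) * ((D r)ᴴ * (w • Q))).trace := by
    intro e
    rw [← hq, ← hq']
    have : inlMat m n * T * (inlMat m n)ᴴ * unitBlock D E (r, e) *
        (R * (unitBlock D E (r, e))ᴴ * R) = inlMat m n * (T * ((inlMat m n)ᴴ * inlMat m n) * D r *
        (Matrix.single e.1 e.2 (1 : ℂ) * (E r * ((inrMat m n)ᴴ * R * inrMat m n) * (E r)ᴴ) *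
        (Matrix.single e.1 e.2 (1 : ℂ))ᴴ) * ((D r)ᴴ * (inlMat m n)ᴴ * R)) := by
      simp only [unitBlock, unitCombo, Matrix.conjTranspose_mul, Matrix.conjTranspose_conjTranspose,
        Matrix.mul_assoc]
    rw [this, Matrix.trace_mul_comm, inlMat_conjTranspose_mul_self, Matrix.mul_one]
    simp only [Matrix.mul_assoc]
  simp only [h1]
  rw [← Matrix.trace_sum, ← Matrix.sum_mul, ← Matrix.mul_sum, sum_single_mul_mul_single]
  have h2 : (E r * (w • Q') * (E r)ᴴ).trace = w * ((E r)ᴴ * E r * Q').trace := by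
    rw [Matrix.trace_mul_comm, Matrix.mul_smul, Matrix.mul_smul, Matrix.trace_smul, smul_eq_mul,
      Matrix.mul_assoc]
  rw [h2, Matrix.mul_smul, Matrix.mul_one, Matrix.smul_mul, Matrix.trace_smul, smul_eq_mul,
    Matrix.mul_smul, Matrix.mul_smul, Matrix.trace_smul, smul_eq_mul]
  simp only [Matrix.mul_assoc]
  ring

theorem sum_norm_sq_le (X : Matrix n m ℂ) :
    ∑ e : m × n, ‖X e.2 e.1‖ ^ 2 ≤ Fintype.card m * ‖X‖ ^ 2 := by
  have h1 : (Xᴴ * X).trace = ((∑ e : m × n, ‖X e.2 e.1‖ ^ 2 : ℝ) : ℂ) := by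
    rw [Fintype.sum_prod_type, Matrix.trace]
    push_cast
    refine Finset.sum_congr rfl fun i _ => ?_
    rw [Matrix.diag_apply, Matrix.mul_apply]
    refine Finset.sum_congr rfl fun j _ => ?_
    rw [Matrix.conjTranspose_apply, Complex.star_def, ← Complex.normSq_eq_conj_mul_self,
      Complex.normSq_eq_norm_sq, Complex.ofReal_pow]
  have h2 := norm_trace_le_card_mul (Xᴴ * X)
  rw [h1, Complex.norm_real, Real.norm_of_nonneg (Finset.sum_nonneg fun e _ => by positivity),
    Matrix.l2_opNorm_conjTranspose_mul_self, ← sq] at h2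
  exact h2

theorem sum_norm_mul_norm_le (X X' : Matrix n m ℂ) :
    ∑ e : m × n, ‖X e.2 e.1‖ * ‖X' e.2 e.1‖ ≤ Fintype.card m * (‖X‖ * ‖X'‖) := by
  refine abs_le_of_sq_le_sq' ?_ (by positivity) |>.2
  refine (Finset.sum_mul_sq_le_sq_mul_sq _ _ _).trans ?_
  refine (mul_le_mul (sum_norm_sq_le X) (sum_norm_sq_le X')
    (Finset.sum_nonneg fun e _ => by positivity) (by positivity)).trans (le_of_eq ?_)
  ring

/-- With N in both places, no adjoint occurs and the trace for the entry (i, j) is a product X_ji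
X'_ji of matrix coefficients. By Cauchy-Schwarz the sum over all entries is a Hilbert-Schmidt
pairing, of size `card m` instead of `card m * card n`, so the contribution of E ζ² is of lower
order. -/
theorem sum_norm_trace_unitBlock_le {a b t η : ℝ} (hη : 0 < η) (hD : ∀ r, ‖D r‖ ≤ a)
    (hE : ∀ r, ‖E r‖ ≤ b) (ha : 0 ≤ a) (hb : 0 ≤ b) {T R : Matrix (m ⊕ n) (m ⊕ n) ℂ}
    (hT : ‖T‖ ≤ t) (hR : ‖R‖ ≤ η⁻¹) :
    ∑ e : ι × m × n, ‖(T * unitBlock D E e * (R * unitBlock D E e * R)).trace‖ ≤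
      Fintype.card ι * (Fintype.card m * ((a * b) ^ 2 * t / η ^ 2)) := by
  have ht := (norm_nonneg _).trans hT
  rw [Fintype.sum_prod_type]
  have key : ∀ r ∈ Finset.univ, ∑ e : m × n,
      ‖(T * unitBlock D E (r, e) * (R * unitBlock D E (r, e) * R)).trace‖ ≤
      Fintype.card m * ((a * b) ^ 2 * t / η ^ 2) := by
    intro r _
    set X := E r * ((inrMat m n)ᴴ * R * inlMat m n) * D r with hX
    set X' := E r * ((inrMat m n)ᴴ * (R * T) * inlMat m n) * D r with hX'
    have h1 : ∀ e : m × n, ‖(T * unitBlock D E (r, e) * (R * unitBlock D E (r, e) * R)).trace‖ =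
        ‖X e.2 e.1‖ * ‖X' e.2 e.1‖ := by
      intro e
      have e1 : T * unitBlock D E (r, e) * (R * unitBlock D E (r, e) * R) =
          T * inlMat m n * D r * (Matrix.single e.1 e.2 (1 : ℂ) * X * Matrix.single e.1 e.2 (1 : ℂ)) *
            (E r * (inrMat m n)ᴴ * R) := by
        simp only [hX, unitBlock, unitCombo, Matrix.mul_assoc]
      have e2 : Matrix.single e.1 e.2 (1 : ℂ) * X * Matrix.single e.1 e.2 (1 : ℂ) =
          X e.2 e.1 • Matrix.single e.1 e.2 (1 : ℂ) := by
        rw [Matrix.single_mul_mul_single, Matrix.smul_single]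
        simp
      rw [e1, e2, Matrix.mul_smul, Matrix.smul_mul, Matrix.trace_smul, smul_eq_mul, norm_mul,
        Matrix.trace_mul_comm]
      congr 2
      have e4 : E r * (inrMat m n)ᴴ * R * (T * inlMat m n * D r * Matrix.single e.1 e.2 (1 : ℂ)) =
          X' * Matrix.single e.1 e.2 (1 : ℂ) := by
        simp only [hX', Matrix.mul_assoc]
      rw [e4, Matrix.trace_mul_single, MulOpposite.op_one, one_smul]
    simp only [h1]
    refine (sum_norm_mul_norm_le X X').trans (mul_le_mul_of_nonneg_left ?_ (by positivity))
    have nb : ∀ {W : Matrix (m ⊕ n) (m ⊕ n) ℂ} {s : ℝ}, ‖W‖ ≤ s → 0 ≤ s →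
        ‖E r * ((inrMat m n)ᴴ * W * inlMat m n) * D r‖ ≤ b * s * a := by
      intro W s hW hs
      have f1 : ‖(inrMat m n)ᴴ * W * inlMat m n‖ ≤ s := by
        refine (Matrix.l2_opNorm_mul _ _).trans ?_
        refine (mul_le_of_le_one_right (norm_nonneg _) norm_inlMat_le).trans ?_
        refine (Matrix.l2_opNorm_mul _ _).trans ?_
        rw [Matrix.l2_opNorm_conjTranspose]
        exact (mul_le_of_le_one_left (norm_nonneg _) norm_inrMat_le).trans hW
      refine (Matrix.l2_opNorm_mul _ _).trans (mul_le_mul ?_ (hD r) (norm_nonneg _) (by positivity))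
      exact (Matrix.l2_opNorm_mul _ _).trans (mul_le_mul (hE r) f1 (norm_nonneg _) hb)
    have f2 : ‖R * T‖ ≤ η⁻¹ * t :=
      (norm_mul_le _ _).trans (mul_le_mul hR hT (norm_nonneg _) (by positivity))
    calc ‖X‖ * ‖X'‖ ≤ (b * η⁻¹ * a) * (b * (η⁻¹ * t) * a) :=
          mul_le_mul (nb hR (by positivity)) (nb f2 (by positivity)) (norm_nonneg _) (by positivity)
      _ = _ := by
        field_simp
  refine (Finset.sum_le_card_nsmul _ _ _ key).trans (le_of_eq ?_)
  rw [nsmul_eq_mul, Finset.card_univ]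

end LoopEquation

/-! ### The loop equations in expectation -/

section Innovation

open scoped Matrix.Norms.L2Operator Matrix

variable {Ω : Type*} [MeasurableSpace Ω] {P : Measure Ω}
  {ι m n : Type*}

/-- Arrays of independent, centred entries of unit variance with third absolute moments at most
`M`. -/
structure IsInnovation (P : Measure Ω) (M : ℝ) (Z : Ω → ι → m → n → ℂ) : Prop where
  meas : Measurable Z
  indep : iIndepFun (fun (e : ι × m × n) ω => Z ω e.1 e.2.1 e.2.2) P
  mean : ∀ r i j, ∫ ω, Z ω r i j ∂P = 0
  var : ∀ r i j, ∫ ω, ‖Z ω r i j‖ ^ 2 ∂P = 1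
  third_integrable : ∀ r i j, Integrable (fun ω => ‖Z ω r i j‖ ^ 3) P
  third : ∀ r i j, ∫ ω, ‖Z ω r i j‖ ^ 3 ∂P ≤ M

theorem IsInnovation.measurable_entry {M : ℝ} {Z : Ω → ι → m → n → ℂ} (hZ : IsInnovation P M Z)
    (r : ι) (i : m) (j : n) : Measurable fun ω => Z ω r i j :=
  (measurable_pi_apply j).comp ((measurable_pi_apply i).comp ((measurable_pi_apply r).comp hZ.meas))

/-- Yᴴ is a matrix of the same form with left and right factors exchanged; this symmetry yields the
dual loop equation from the direct one. -/
theorem IsInnovation.conj_swap {M : ℝ} {Z : Ω → ι → m → n → ℂ} (hZ : IsInnovation P M Z) :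
    IsInnovation P M fun ω r j i => star (Z ω r i j) where
  meas := by
    refine measurable_pi_iff.2 fun r => measurable_pi_iff.2 fun j => measurable_pi_iff.2 fun i => ?_
    exact continuous_star.measurable.comp (hZ.measurable_entry r i j)
  indep := by
    have h1 := hZ.indep.precomp (g := fun e : ι × n × m => (e.1, e.2.2, e.2.1))
      (fun e f h => by simp only [Prod.mk.injEq] at h; exact Prod.ext h.1 (Prod.ext h.2.2 h.2.1))
    exact h1.comp (fun _ => star) fun _ => continuous_star.measurable
  mean r j i := by
    have := integral_conj (μ := P) (f := fun ω => Z ω r i j)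
    rw [hZ.mean, map_zero] at this
    exact this
  var r j i := by simpa using hZ.var r i j
  third_integrable r j i := by simpa using hZ.third_integrable r i j
  third r j i := by simpa using hZ.third r i j

variable [Fintype ι] [Fintype m] [Fintype n]

theorem combo_conjTranspose (D : ι → Matrix m m ℂ) (E : ι → Matrix n n ℂ) (Z : ι → m → n → ℂ) :
    (combo D E Z)ᴴ = combo (fun r => (E r)ᴴ) (fun r => (D r)ᴴ) (fun r j i => star (Z r i j)) := by
  rw [combo, Matrix.conjTranspose_sum]
  refine Finset.sum_congr rfl fun r _ => ?_
  rw [Matrix.conjTranspose_mul, Matrix.conjTranspose_mul, ← Matrix.mul_assoc]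
  rfl

variable [DecidableEq m] [DecidableEq n] [IsProbabilityMeasure P]

/-- The erased array is a measurable function of the other entries only. -/
theorem IsInnovation.indepFun_eraseEntry [DecidableEq ι] {M : ℝ} {Z : Ω → ι → m → n → ℂ}
    (hZ : IsInnovation P M Z) (e : ι × m × n) :
    IndepFun (fun ω => Z ω e.1 e.2.1 e.2.2) (fun ω => eraseEntry (Z ω) e) P := by
  have h := hZ.indep.indepFun_finset {e} (Finset.univ.erase e)
    (Finset.disjoint_singleton_left.2 (Finset.notMem_erase _ _))
    fun f => hZ.measurable_entry f.1 f.2.1 f.2.2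
  have m1 : Measurable fun x : ({e} : Finset (ι × m × n)) → ℂ => x ⟨e, Finset.mem_singleton_self e⟩ :=
    measurable_pi_apply _
  have m2 : Measurable fun (x : ((Finset.univ.erase e : Finset (ι × m × n)) : Type _) → ℂ) (r : ι) (i : m)
      (j : n) => if h : (r, i, j) = e then 0 else
        x ⟨(r, i, j), Finset.mem_erase.2 ⟨h, Finset.mem_univ _⟩⟩ := by
    refine measurable_pi_iff.2 fun r => measurable_pi_iff.2 fun i => measurable_pi_iff.2 fun j => ?_
    by_cases h : (r, i, j) = e
    · simp only [h, dite_true]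
      exact measurable_const
    · simp only [h, dite_false]
      exact measurable_pi_apply _
  have h3 := h.comp m1 m2
  have h4 : (fun ω => eraseEntry (Z ω) e) = (fun (x : ((Finset.univ.erase e :
      Finset (ι × m × n)) : Type _) → ℂ) (r : ι) (i : m) (j : n) => if h : (r, i, j) = e then 0 else
        x ⟨(r, i, j), Finset.mem_erase.2 ⟨h, Finset.mem_univ _⟩⟩) ∘
      fun a i => Z a i.1.1 i.1.2.1 i.1.2.2 := by
    funext ω r i j
    by_cases h : (r, i, j) = e <;> simp [eraseEntry, h]
  rw [h4]
  exact h3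

/-- The loop equation for the resolvent of `Y Yᴴ`, `Y = ∑ r, D_r Z_r E_r`. -/
theorem IsInnovation.norm_integral_loop_le {M : ℝ} {Z : Ω → ι → m → n → ℂ}
    (hZ : IsInnovation P M Z) (hM : 1 ≤ M) {D : ι → Matrix m m ℂ} {E : ι → Matrix n n ℂ}
    {a b t : ℝ} (ha : 0 ≤ a) (hb : 0 ≤ b) (hD : ∀ r, ‖D r‖ ≤ a) (hE : ∀ r, ‖E r‖ ≤ b)
    {T : Matrix m m ℂ} (hT : ‖T‖ ≤ t) {w : ℂ} (hw : 0 < w.im) (hw2 : 0 < (w ^ 2).im) :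
    ‖∫ ω, (T.trace + w ^ 2 * (T * resolv (combo D E (Z ω) * (combo D E (Z ω))ᴴ) (w ^ 2)).trace +
      ∑ r, w ^ 2 * (((E r)ᴴ * E r * resolv ((combo D E (Z ω))ᴴ * combo D E (Z ω)) (w ^ 2)).trace *
      (T * (D r * (D r)ᴴ) * resolv (combo D E (Z ω) * (combo D E (Z ω))ᴴ) (w ^ 2)).trace)) ∂P‖ ≤
    Fintype.card ι * Fintype.card m * ((a * b) ^ 2 * t / w.im ^ 2) +
      Fintype.card ι * Fintype.card m * Fintype.card n *
        (12 * M * (t * (a * b) ^ 3 / w.im ^ 3)) := by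
  classical
  set T' := inlMat m n * T * (inlMat m n)ᴴ with hT'
  have hT'n : ‖T'‖ ≤ t :=
    (norm_mul_mul_conjTranspose_le norm_inlMat_le norm_inlMat_le _).trans hT
  set R : Ω → Matrix (m ⊕ n) (m ⊕ n) ℂ := fun ω => resolv (herm (combo D E (Z ω))) w with hR
  set R₀ : ι × m × n → Ω → Matrix (m ⊕ n) (m ⊕ n) ℂ := fun e ω =>
    resolv (herm (combo D E (eraseEntry (Z ω) e))) w with hR₀
  have mres : Measurable fun x : ι → m → n → ℂ => resolv (herm (combo D E x)) w :=
    measurable_resolv (measurable_herm (measurable_combo D E measurable_id)) w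
  have mR : Measurable R := mres.comp hZ.meas
  have bR : ∀ ω, ‖R ω‖ ≤ w.im⁻¹ := fun ω => norm_resolv_le (herm_isHermitian _) hw
  have mer : ∀ e, Measurable fun ω => eraseEntry (Z ω) e := by
    intro e
    refine measurable_pi_iff.2 fun r => measurable_pi_iff.2 fun i => measurable_pi_iff.2 fun j => ?_
    unfold eraseEntry
    by_cases h : (r, i, j) = e
    · simp only [h, if_true]
      exact measurable_const
    · simp only [h, if_false]
      exact hZ.measurable_entry r i j
  have hentry : ∀ e : ι × m × n,
      ‖∫ ω, (Z ω e.1 e.2.1 e.2.2 * (T' * unitBlock D E e * R ω).trace +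
        (T' * unitBlock D E e * (R ω * (unitBlock D E e)ᴴ * R ω)).trace) ∂P‖ ≤
      ∫ ω, ‖(T' * unitBlock D E e * (R ω * unitBlock D E e * R ω)).trace‖ ∂P +
        12 * M * (t * (a * b) ^ 3 / w.im ^ 3) := by
    intro e
    refine norm_integral_entry_le (R₀ := R₀ e) hw (hZ.measurable_entry _ _ _)
      (mres.comp (mer e)) mR ((hZ.indepFun_eraseEntry e).comp measurable_id mres)
      (fun ω => norm_resolv_le (herm_isHermitian _) hw) bR (rank_unitBlock_le D E e)
      (norm_unitBlock_le hD hE e) hT'n (fun ω => ?_) (hZ.mean _ _ _) (hZ.var _ _ _)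
      (hZ.third_integrable _ _ _) (hZ.third _ _ _) hM
    rw [← herm_combo_sub_eraseEntry]
    exact resolv_sub_resolv (herm_isHermitian _) (herm_isHermitian _) hw
  have iZ : ∀ e : ι × m × n, Integrable (fun ω => Z ω e.1 e.2.1 e.2.2) P := by
    intro e
    have h3 := hZ.third_integrable e.1 e.2.1 e.2.2
    refine ((integrable_const 1).add h3).mono' (hZ.measurable_entry _ _ _).aestronglyMeasurable
      (ae_of_all _ fun ω => ?_)
    rw [Pi.add_apply]
    have := norm_nonneg (Z ω e.1 e.2.1 e.2.2)
    rcases le_total ‖Z ω e.1 e.2.1 e.2.2‖ 1 with h | h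
    · nlinarith [pow_nonneg this 3]
    · nlinarith [pow_le_pow_right₀ h (show 1 ≤ 3 by norm_num)]
  have tm : ∀ (e : ι × m × n) (N' : Matrix (m ⊕ n) (m ⊕ n) ℂ),
      Measurable fun ω => (T' * unitBlock D E e * (R ω * N' * R ω)).trace := fun e N' =>
    measurable_trace (measurable_matrix_mul measurable_const
      (measurable_matrix_mul (measurable_matrix_mul mR measurable_const) mR))
  have tb : ∀ (e : ι × m × n) (N' : Matrix (m ⊕ n) (m ⊕ n) ℂ) ω,
      ‖(T' * unitBlock D E e * (R ω * N' * R ω)).trace‖ ≤ t * (a * b) * (‖N'‖ / w.im ^ 2) := by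
    intro e N' ω
    refine (norm_trace_mul_mul_le (rank_unitBlock_le D E e) (norm_unitBlock_le hD hE e) hT'n
      _).trans (mul_le_mul_of_nonneg_left (norm_mul_mul_le hw le_rfl (bR ω) (bR ω)) ?_)
    have := (norm_nonneg _).trans hT'n
    positivity
  have ti : ∀ (e : ι × m × n) (N' : Matrix (m ⊕ n) (m ⊕ n) ℂ),
      Integrable (fun ω => (T' * unitBlock D E e * (R ω * N' * R ω)).trace) P := fun e N' =>
    Integrable.of_bound (tm e N').aestronglyMeasurable _ (ae_of_all _ (tb e N'))
  have ii : ∀ e ∈ Finset.univ, Integrable (fun ω => Z ω e.1 e.2.1 e.2.2 *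
      (T' * unitBlock D E e * R ω).trace +
        (T' * unitBlock D E e * (R ω * (unitBlock D E e)ᴴ * R ω)).trace) P := by
    intro e _
    refine Integrable.add ((iZ e).mul_bdd (c := t * (a * b) * w.im⁻¹)
      (measurable_trace (measurable_matrix_mul measurable_const mR)).aestronglyMeasurable
      (ae_of_all _ fun ω => ?_)) (ti e _)
    refine (norm_trace_mul_mul_le (rank_unitBlock_le D E e) (norm_unitBlock_le hD hE e) hT'n
      _).trans (mul_le_mul_of_nonneg_left (bR ω) ?_)
    have := (norm_nonneg _).trans hT'n
    positivity
  have hfun : ∀ ω, T.trace + w ^ 2 *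
      (T * resolv (combo D E (Z ω) * (combo D E (Z ω))ᴴ) (w ^ 2)).trace +
      ∑ r, w ^ 2 * (((E r)ᴴ * E r * resolv ((combo D E (Z ω))ᴴ * combo D E (Z ω)) (w ^ 2)).trace *
      (T * (D r * (D r)ᴴ) * resolv (combo D E (Z ω) * (combo D E (Z ω))ᴴ) (w ^ 2)).trace) =
      ∑ e : ι × m × n, (Z ω e.1 e.2.1 e.2.2 * (T' * unitBlock D E e * R ω).trace +
        (T' * unitBlock D E e * (R ω * (unitBlock D E e)ᴴ * R ω)).trace) := by
    intro ω
    rw [Finset.sum_add_distrib, sum_mul_trace_unitBlock T (Z ω) hw hw2,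
      sum_trace_unitBlock_conjTranspose T (Z ω) hw hw2]
  simp only [hfun]
  rw [integral_finsetSum _ ii]
  refine (norm_sum_le _ _).trans ((Finset.sum_le_sum fun e _ => hentry e).trans ?_)
  rw [Finset.sum_add_distrib, ← integral_finsetSum _ fun e _ => (ti e _).norm]
  refine add_le_add ?_ (le_of_eq ?_)
  · have h1 : ∫ ω, ∑ e : ι × m × n,
        ‖(T' * unitBlock D E e * (R ω * unitBlock D E e * R ω)).trace‖ ∂P ≤
        ∫ _, (Fintype.card ι * (Fintype.card m * ((a * b) ^ 2 * t / w.im ^ 2)) : ℝ) ∂P :=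
      integral_mono (integrable_finsetSum _ fun e _ => (ti e _).norm) (integrable_const _)
        fun ω => sum_norm_trace_unitBlock_le hw hD hE ha hb hT'n (bR ω)
    refine h1.trans (le_of_eq ?_)
    simp [mul_assoc]
  · simp only [Finset.sum_const, Finset.card_univ, Fintype.card_prod, nsmul_eq_mul]
    push_cast
    ring

/-- The loop equation for the resolvent of `Yᴴ Y`, `Y = ∑ r, D_r Z_r E_r`. -/
theorem IsInnovation.norm_integral_dual_loop_le {M : ℝ} {Z : Ω → ι → m → n → ℂ}
    (hZ : IsInnovation P M Z) (hM : 1 ≤ M) {D : ι → Matrix m m ℂ} {E : ι → Matrix n n ℂ}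
    {a b t : ℝ} (ha : 0 ≤ a) (hb : 0 ≤ b) (hD : ∀ r, ‖D r‖ ≤ a) (hE : ∀ r, ‖E r‖ ≤ b)
    {T : Matrix n n ℂ} (hT : ‖T‖ ≤ t) {w : ℂ} (hw : 0 < w.im) (hw2 : 0 < (w ^ 2).im) :
    ‖∫ ω, (T.trace + w ^ 2 * (T * resolv ((combo D E (Z ω))ᴴ * combo D E (Z ω)) (w ^ 2)).trace +
      ∑ r, w ^ 2 * ((D r * (D r)ᴴ * resolv (combo D E (Z ω) * (combo D E (Z ω))ᴴ) (w ^ 2)).trace *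
      (T * ((E r)ᴴ * E r) * resolv ((combo D E (Z ω))ᴴ * combo D E (Z ω)) (w ^ 2)).trace)) ∂P‖ ≤
    Fintype.card ι * Fintype.card n * ((a * b) ^ 2 * t / w.im ^ 2) +
      Fintype.card ι * Fintype.card n * Fintype.card m *
        (12 * M * (t * (a * b) ^ 3 / w.im ^ 3)) := by
  have h := hZ.conj_swap.norm_integral_loop_le hM (D := fun r => (E r)ᴴ) (E := fun r => (D r)ᴴ)
    hb ha (fun r => (Matrix.l2_opNorm_conjTranspose _).trans_le (hE r))
    (fun r => (Matrix.l2_opNorm_conjTranspose _).trans_le (hD r)) hT hw hw2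
  simp only [← combo_conjTranspose, Matrix.conjTranspose_conjTranspose, mul_comm b a] at h
  exact h

end Innovation

/-! ### Statistics of the linearized resolvent and rank perturbations -/

section ResolventStatistics

open scoped Matrix.Norms.L2Operator Matrix

variable {m n : Type*} [Fintype m] [Fintype n] [DecidableEq m] [DecidableEq n] {w : ℂ}

/-- The linearization has spectral parameter w with w² = z. Of the two roots one lies in the upper
half plane, since a real w would make z real. -/
theorem exists_sq_eq_im_pos {z : ℂ} (hz : 0 < z.im) : ∃ w : ℂ, 0 < w.im ∧ w ^ 2 = z := by
  obtain ⟨w, hw⟩ := IsAlgClosed.exists_pow_nat_eq z (n := 2) (by norm_num)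
  rcases lt_trichotomy w.im 0 with h | h | h
  · exact ⟨-w, by simpa using h, by rw [neg_sq, hw]⟩
  · rw [← hw, sq, Complex.mul_im, h] at hz
    simp at hz
  · exact ⟨w, h, hw⟩

theorem ne_zero_of_im_pos {w : ℂ} (hw : 0 < w.im) : w ≠ 0 := by
  rintro rfl
  simp at hw

theorem trace_mul_resolv_eq (A : Matrix m m ℂ) (Y : Matrix m n ℂ) (hw : 0 < w.im)
    (hw2 : 0 < (w ^ 2).im) : (A * resolv (Y * Yᴴ) (w ^ 2)).trace =
      w⁻¹ * (inlMat m n * A * (inlMat m n)ᴴ * resolv (herm Y) w).trace := by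
  have h1 : inlMat m n * A * (inlMat m n)ᴴ * resolv (herm Y) w =
      inlMat m n * (A * (inlMat m n)ᴴ * resolv (herm Y) w) := by simp only [Matrix.mul_assoc]
  have h2 : A * (inlMat m n)ᴴ * resolv (herm Y) w * inlMat m n =
      A * ((inlMat m n)ᴴ * resolv (herm Y) w * inlMat m n) := by simp only [Matrix.mul_assoc]
  rw [h1, Matrix.trace_mul_comm (inlMat m n), h2, inlMat_resolv_herm hw hw2, Matrix.mul_smul, Matrix.trace_smul,
    smul_eq_mul, inv_mul_cancel_left₀ (ne_zero_of_im_pos hw)]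

theorem trace_mul_dual_resolv_eq (B : Matrix n n ℂ) (Y : Matrix m n ℂ) (hw : 0 < w.im)
    (hw2 : 0 < (w ^ 2).im) : (B * resolv (Yᴴ * Y) (w ^ 2)).trace =
      w⁻¹ * (inrMat m n * B * (inrMat m n)ᴴ * resolv (herm Y) w).trace := by
  have h1 : inrMat m n * B * (inrMat m n)ᴴ * resolv (herm Y) w =
      inrMat m n * (B * (inrMat m n)ᴴ * resolv (herm Y) w) := by simp only [Matrix.mul_assoc]
  have h2 : B * (inrMat m n)ᴴ * resolv (herm Y) w * inrMat m n =
      B * ((inrMat m n)ᴴ * resolv (herm Y) w * inrMat m n) := by simp only [Matrix.mul_assoc]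
  rw [h1, Matrix.trace_mul_comm (inrMat m n), h2, inrMat_resolv_herm hw hw2, Matrix.mul_smul, Matrix.trace_smul,
    smul_eq_mul, inv_mul_cancel_left₀ (ne_zero_of_im_pos hw)]

/-- Perturbations of rank `k` change `tr (resolv (Y Yᴴ))` by `O(k)`. -/
theorem norm_trace_resolv_sub_le (Y Y' : Matrix m n ℂ) (hw : 0 < w.im) (hw2 : 0 < (w ^ 2).im) :
    ‖(resolv (Y * Yᴴ) (w ^ 2)).trace - (resolv (Y' * Y'ᴴ) (w ^ 2)).trace‖ ≤
      ‖w‖⁻¹ * (4 * (Y - Y').rank / w.im) := by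
  have h1 := trace_mul_resolv_eq 1 Y hw hw2
  have h2 := trace_mul_resolv_eq 1 Y' hw hw2
  rw [Matrix.one_mul] at h1 h2
  rw [h1, h2, ← mul_sub, norm_mul, norm_inv]
  refine mul_le_mul_of_nonneg_left ?_ (by positivity)
  refine (norm_trace_mul_resolv_sub_le _ Y Y' hw).trans ?_
  have h3 : ‖inlMat m n * (1 : Matrix m m ℂ) * (inlMat m n)ᴴ‖ ≤ 1 :=
    (norm_mul_mul_conjTranspose_le norm_inlMat_le norm_inlMat_le _).trans norm_matrix_one_le
  refine div_le_div_of_nonneg_right ?_ hw.le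
  exact mul_le_of_le_one_right (by positivity) h3

theorem rank_sum_le {ι : Type*} (s : Finset ι) (M : ι → Matrix m n ℂ) :
    (∑ r ∈ s, M r).rank ≤ ∑ r ∈ s, (M r).rank := by
  classical
  induction s using Finset.induction_on with
  | empty => simp
  | insert a s ha ih =>
    rw [Finset.sum_insert ha, Finset.sum_insert ha]
    exact (rank_add_le _ _).trans (Nat.add_le_add_left ih _)

theorem rank_le_one_of_column {X : Matrix m n ℂ} (j : n) (h : ∀ i j', j' ≠ j → X i j' = 0) :
    X.rank ≤ 1 := by
  have : X = Matrix.vecMulVec (fun i => X i j) (Pi.single j 1) := by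
    ext i j'
    rw [Matrix.vecMulVec_apply]
    by_cases hj : j' = j
    · subst hj
      simp
    · simp [hj, h i j' hj]
  rw [this]
  exact Matrix.rank_vecMulVec_le _ _

/-- Each of the arrays Z_r changes by a rank-one matrix. Columns, rather than entries, are the
independent blocks for concentration: there are n of them and each moves a trace by O(1). -/
theorem rank_combo_sub_le {ι : Type*} [Fintype ι] (D : ι → Matrix m m ℂ) (E : ι → Matrix n n ℂ)
    {Z Z' : ι → m → n → ℂ} (j : n) (h : ∀ r i j', j' ≠ j → Z r i j' = Z' r i j') :
    (combo D E Z - combo D E Z').rank ≤ Fintype.card ι := by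
  rw [combo_sub, combo]
  refine (rank_sum_le _ _).trans ?_
  refine (Finset.sum_le_card_nsmul _ _ 1 fun r _ => ?_).trans (by simp)
  refine (Matrix.rank_mul_le_left _ _).trans ((Matrix.rank_mul_le_right _ _).trans
    (rank_le_one_of_column j fun i j' hj => ?_))
  simp [h r i j' hj]

/-- A trade-off replacing the fourth root. -/
theorem integral_norm_le_of_pow_four {Ω : Type*} [MeasurableSpace Ω] {P : Measure Ω}
    [IsProbabilityMeasure P] {X : Ω → ℂ} (hX : Integrable X P)
    (hX4 : Integrable (fun ω => ‖X ω‖ ^ 4) P) {s C : ℝ} (hs : 0 < s)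
    (h : ∫ ω, ‖X ω‖ ^ 4 ∂P ≤ C * s ^ 4) : ∫ ω, ‖X ω‖ ∂P ≤ (1 + C) * s := by
  have h1 : ∫ ω, ‖X ω‖ ∂P ≤ ∫ ω, (s + ‖X ω‖ ^ 4 / s ^ 3) ∂P := by
    refine integral_mono hX.norm ((integrable_const _).add (hX4.div_const _)) fun ω => ?_
    have hx := norm_nonneg (X ω)
    rcases le_total ‖X ω‖ s with h | h
    · exact h.trans (le_add_of_nonneg_right (by positivity))
    · refine le_trans ?_ (le_add_of_nonneg_left hs.le)
      rw [le_div_iff₀ (by positivity)]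
      calc ‖X ω‖ * s ^ 3 ≤ ‖X ω‖ * ‖X ω‖ ^ 3 := by gcongr
        _ = ‖X ω‖ ^ 4 := by ring
  rw [integral_add (integrable_const _) (hX4.div_const _), integral_div] at h1
  refine h1.trans ?_
  simp only [integral_const, probReal_univ, one_smul]
  have h2 : (∫ ω, ‖X ω‖ ^ 4 ∂P) / s ^ 3 ≤ C * s := by
    rw [div_le_iff₀ (by positivity)]
    linarith [show C * s * s ^ 3 = C * s ^ 4 by ring]
  linarith

end ResolventStatistics

/-! ### Concentration of resolvent traces -/

section Concentration

open scoped Matrix.Norms.L2Operator Matrix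

variable {Ω : Type*} [MeasurableSpace Ω] {P : Measure Ω} [IsProbabilityMeasure P] {K p n : ℕ}
  {Z : Ω → Fin K → Fin p → Fin n → ℂ} {w : ℂ}

theorem measurable_trace_mul_resolv_herm {T : Matrix (Fin p ⊕ Fin n) (Fin p ⊕ Fin n) ℂ}
    (D : Fin K → Matrix (Fin p) (Fin p) ℂ) (E : Fin K → Matrix (Fin n) (Fin n) ℂ) :
    Measurable fun ζ : Fin K → Fin p → Fin n → ℂ =>
      w⁻¹ * (T * resolv (herm (combo D E ζ)) w).trace :=
  measurable_const.mul (measurable_trace (measurable_matrix_mul measurable_const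
    (measurable_resolv (measurable_herm (measurable_combo D E measurable_id)) w)))

theorem norm_trace_mul_resolv_herm_le {T : Matrix (Fin p ⊕ Fin n) (Fin p ⊕ Fin n) ℂ} {t : ℝ}
    (hT : ‖T‖ ≤ t) (hw : 0 < w.im) (Y : Matrix (Fin p) (Fin n) ℂ) :
    ‖w⁻¹ * (T * resolv (herm Y) w).trace‖ ≤ ‖w‖⁻¹ * ((p + n) * (t * w.im⁻¹)) := by
  rw [norm_mul, norm_inv]
  refine mul_le_mul_of_nonneg_left ?_ (by positivity)
  refine (norm_trace_le_card_mul _).trans ?_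
  rw [Fintype.card_sum, Fintype.card_fin, Fintype.card_fin, Nat.cast_add]
  refine mul_le_mul_of_nonneg_left ?_ (by positivity)
  exact (norm_mul_le _ _).trans (mul_le_mul hT (norm_resolv_le (herm_isHermitian _) hw)
    (norm_nonneg _) ((norm_nonneg _).trans hT))

theorem integral_norm_pow_four_trace_le (hZ : Measurable Z)
    (hind : iIndepFun (fun (e : Fin K × Fin p × Fin n) ω => Z ω e.1 e.2.1 e.2.2) P) (hn : 0 < n)
    (D : Fin K → Matrix (Fin p) (Fin p) ℂ) (E : Fin K → Matrix (Fin n) (Fin n) ℂ)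
    {T : Matrix (Fin p ⊕ Fin n) (Fin p ⊕ Fin n) ℂ} {t : ℝ} (ht : 0 < t) (hT : ‖T‖ ≤ t)
    (hw : 0 < w.im) :
    ∫ ω, ‖w⁻¹ * (T * resolv (herm (combo D E (Z ω))) w).trace -
      ∫ ω', w⁻¹ * (T * resolv (herm (combo D E (Z ω'))) w).trace ∂P‖ ^ 4 ∂P ≤
      384 * (n ^ 2 * (4 * (K + 1) * t / (‖w‖ * w.im)) ^ 4) := by
  have hw0 : 0 < ‖w‖ := norm_pos_iff.2 (ne_zero_of_im_pos hw)
  refine integral_norm_pow_four_le_of_columns hZ hind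
    (f := fun ζ => w⁻¹ * (T * resolv (herm (combo D E ζ)) w).trace)
    (measurable_trace_mul_resolv_herm D E)
    (fun ζ => norm_trace_mul_resolv_herm_le hT hw _) (by positivity) hn fun ζ ζ' j h => ?_
  rw [← mul_sub, norm_mul, norm_inv]
  have h1 := norm_trace_mul_resolv_sub_le T (combo D E ζ) (combo D E ζ') hw
  have h2 := rank_combo_sub_le D E j h
  rw [Fintype.card_fin] at h2
  -- K + 1 in place of K keeps the oscillation bound strictly positive also for K = 0.
  have h3 : ((combo D E ζ - combo D E ζ').rank : ℝ) ≤ K + 1 := by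
    have : ((combo D E ζ - combo D E ζ').rank : ℝ) ≤ K := by exact_mod_cast h2
    linarith
  calc ‖w‖⁻¹ * ‖(T * resolv (herm (combo D E ζ)) w).trace -
        (T * resolv (herm (combo D E ζ')) w).trace‖
      ≤ ‖w‖⁻¹ * (4 * (K + 1) * t / w.im) := by
        refine mul_le_mul_of_nonneg_left (h1.trans ?_) (by positivity)
        gcongr
    _ = _ := by
        field_simp

theorem integral_norm_trace_le (hZ : Measurable Z)
    (hind : iIndepFun (fun (e : Fin K × Fin p × Fin n) ω => Z ω e.1 e.2.1 e.2.2) P) (hn : 0 < n)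
    (D : Fin K → Matrix (Fin p) (Fin p) ℂ) (E : Fin K → Matrix (Fin n) (Fin n) ℂ)
    {T : Matrix (Fin p ⊕ Fin n) (Fin p ⊕ Fin n) ℂ} {t : ℝ} (ht : 0 < t) (hT : ‖T‖ ≤ t)
    (hw : 0 < w.im) :
    ∫ ω, ‖w⁻¹ * (T * resolv (herm (combo D E (Z ω))) w).trace -
      ∫ ω', w⁻¹ * (T * resolv (herm (combo D E (Z ω'))) w).trace ∂P‖ ∂P ≤
      385 * (√n * (4 * (K + 1) * t / (‖w‖ * w.im))) := by
  have hw0 : 0 < ‖w‖ := norm_pos_iff.2 (ne_zero_of_im_pos hw)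
  have hn' : (0 : ℝ) < n := by exact_mod_cast hn
  have hm : Measurable fun ω => w⁻¹ * (T * resolv (herm (combo D E (Z ω))) w).trace :=
    (measurable_trace_mul_resolv_herm D E).comp hZ
  set X := fun ω => w⁻¹ * (T * resolv (herm (combo D E (Z ω))) w).trace -
      ∫ ω', w⁻¹ * (T * resolv (herm (combo D E (Z ω'))) w).trace ∂P with hX
  have hXm : Measurable X := hm.sub_const _
  have hXb : ∀ ω, ‖X ω‖ ≤ ‖w‖⁻¹ * ((p + n) * (t * w.im⁻¹)) +
      ‖∫ ω', w⁻¹ * (T * resolv (herm (combo D E (Z ω'))) w).trace ∂P‖ := fun ω =>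
    (norm_sub_le _ _).trans (add_le_add (norm_trace_mul_resolv_herm_le hT hw _) le_rfl)
  have h4 := integral_norm_pow_four_trace_le hZ hind hn D E ht hT hw
  -- The constant 385 is 1 + C with C = 384 from the fourth moment.
  refine (integral_norm_le_of_pow_four (X := X) (C := 384)
    (s := √n * (4 * (K + 1) * t / (‖w‖ * w.im)))
    (Integrable.of_bound hXm.aestronglyMeasurable _ (ae_of_all _ hXb)) ?_ (by positivity) ?_).trans
    (by norm_num)
  · refine Integrable.of_bound (hXm.norm.pow_const 4).aestronglyMeasurable
      ((‖w‖⁻¹ * ((p + n) * (t * w.im⁻¹)) +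
      ‖∫ ω', w⁻¹ * (T * resolv (herm (combo D E (Z ω'))) w).trace ∂P‖) ^ 4)
      (ae_of_all _ fun ω => ?_)
    rw [Real.norm_of_nonneg (by positivity)]
    exact pow_le_pow_left₀ (norm_nonneg _) (hXb ω) 4
  · refine h4.trans (le_of_eq ?_)
    rw [mul_pow, show (√(n : ℝ)) ^ 4 = (√(n : ℝ) ^ 2) ^ 2 by ring, Real.sq_sqrt hn'.le]

end Concentration

/-! ### Decoupling the product of traces -/

section Decoupling

open scoped Matrix.Norms.L2Operator Matrix

variable {Ω : Type*} [MeasurableSpace Ω] {P : Measure Ω} [IsProbabilityMeasure P]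

/-- Replacing concentrated factors by their means. -/
theorem norm_integral_decouple_le {ι : Type*} [Fintype ι] {L : Ω → ℂ} {X V : ι → Ω → ℂ} {z : ℂ}
    {e v δ : ℝ} (hL : Integrable L P) (hX : ∀ r, Integrable (X r) P)
    (hVm : ∀ r, Measurable (V r)) (hV : ∀ r ω, ‖V r ω‖ ≤ v) (hv : 0 ≤ v)
    (hδ : ∀ r, ∫ ω, ‖X r ω - ∫ ω', X r ω' ∂P‖ ∂P ≤ δ)
    (he : ‖∫ ω, (L ω + ∑ r, z * (X r ω * V r ω)) ∂P‖ ≤ e) :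
    ‖∫ ω, (L ω + ∑ r, z * ((∫ ω', X r ω' ∂P) * V r ω)) ∂P‖ ≤
      e + Fintype.card ι * (‖z‖ * (v * δ)) := by
  have iV : ∀ r, Integrable (V r) P := fun r =>
    Integrable.of_bound (hVm r).aestronglyMeasurable v (ae_of_all _ (hV r))
  have iXV : ∀ r, Integrable (fun ω => z * (X r ω * V r ω)) P := fun r =>
    ((hX r).mul_bdd (hVm r).aestronglyMeasurable (ae_of_all _ (hV r))).const_mul z
  have iEV : ∀ r, Integrable (fun ω => z * ((∫ ω', X r ω' ∂P) * V r ω)) P := fun r =>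
    ((iV r).const_mul _).const_mul z
  have i1 : Integrable (fun ω => L ω + ∑ r, z * (X r ω * V r ω)) P :=
    hL.add (integrable_finsetSum _ fun r _ => iXV r)
  have i2 : Integrable (fun ω => L ω + ∑ r, z * ((∫ ω', X r ω' ∂P) * V r ω)) P :=
    hL.add (integrable_finsetSum _ fun r _ => iEV r)
  have h1 : ∫ ω, (L ω + ∑ r, z * ((∫ ω', X r ω' ∂P) * V r ω)) ∂P =
      ∫ ω, (L ω + ∑ r, z * (X r ω * V r ω)) ∂P -
      ∑ r, ∫ ω, z * ((X r ω - ∫ ω', X r ω' ∂P) * V r ω) ∂P := by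
    rw [eq_sub_iff_add_eq, ← integral_finsetSum, ← integral_add i2]
    · refine integral_congr_ae (ae_of_all _ fun ω => ?_)
      simp only
      rw [add_assoc, ← Finset.sum_add_distrib]
      congr 1
      refine Finset.sum_congr rfl fun r _ => ?_
      ring
    · refine integrable_finsetSum _ fun r _ => ?_
      exact (((hX r).sub (integrable_const _)).mul_bdd (hVm r).aestronglyMeasurable
        (ae_of_all _ (hV r))).const_mul z
    · intro r _
      exact (((hX r).sub (integrable_const _)).mul_bdd (hVm r).aestronglyMeasurable
        (ae_of_all _ (hV r))).const_mul z
  rw [h1]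
  refine (norm_sub_le _ _).trans (add_le_add he ?_)
  refine (norm_sum_le _ _).trans ?_
  have h2 : ∀ r ∈ Finset.univ, ‖∫ ω, z * ((X r ω - ∫ ω', X r ω' ∂P) * V r ω) ∂P‖ ≤
      ‖z‖ * (v * δ) := by
    intro r _
    rw [integral_const_mul, norm_mul]
    refine mul_le_mul_of_nonneg_left ?_ (norm_nonneg _)
    refine (norm_integral_le_integral_norm _).trans ?_
    have h3 : ∫ ω, ‖(X r ω - ∫ ω', X r ω' ∂P) * V r ω‖ ∂P ≤
        ∫ ω, v * ‖X r ω - ∫ ω', X r ω' ∂P‖ ∂P := by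
      refine integral_mono (((hX r).sub (integrable_const _)).mul_bdd
        (hVm r).aestronglyMeasurable (ae_of_all _ (hV r))).norm
        (((hX r).sub (integrable_const _)).norm.const_mul v) fun ω => ?_
      simp only
      rw [norm_mul, mul_comm]
      exact mul_le_mul_of_nonneg_right (hV r ω) (norm_nonneg _)
    rw [integral_const_mul] at h3
    exact h3.trans (mul_le_mul_of_nonneg_left (hδ r) hv)
  refine (Finset.sum_le_card_nsmul _ _ _ h2).trans (le_of_eq ?_)
  rw [nsmul_eq_mul, Finset.card_univ]

variable {K p n : ℕ} {Z : Ω → Fin K → Fin p → Fin n → ℂ} {w : ℂ}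
  {D : Fin K → Matrix (Fin p) (Fin p) ℂ} {E : Fin K → Matrix (Fin n) (Fin n) ℂ}

theorem measurable_trace_resolv (hZ : Measurable Z) (T : Matrix (Fin p) (Fin p) ℂ) (z : ℂ) :
    Measurable fun ω => (T * resolv (combo D E (Z ω) * (combo D E (Z ω))ᴴ) z).trace := by
  have h := measurable_combo D E hZ
  exact measurable_trace (measurable_matrix_mul measurable_const
    (measurable_resolv (measurable_matrix_mul h (measurable_conjTranspose h)) z))

theorem measurable_trace_dual_resolv (hZ : Measurable Z) (T : Matrix (Fin n) (Fin n) ℂ) (z : ℂ) :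
    Measurable fun ω => (T * resolv ((combo D E (Z ω))ᴴ * combo D E (Z ω)) z).trace := by
  have h := measurable_combo D E hZ
  exact measurable_trace (measurable_matrix_mul measurable_const
    (measurable_resolv (measurable_matrix_mul (measurable_conjTranspose h) h) z))

theorem norm_trace_mul_resolv_le {d : ℕ} {T S : Matrix (Fin d) (Fin d) ℂ} (hS : S.IsHermitian)
    {t : ℝ} (hT : ‖T‖ ≤ t) {z : ℂ} (hz : 0 < z.im) :
    ‖(T * resolv S z).trace‖ ≤ d * (t * z.im⁻¹) := by
  refine (norm_trace_le_card_mul _).trans ?_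
  rw [Fintype.card_fin]
  refine mul_le_mul_of_nonneg_left ?_ (by positivity)
  exact (norm_mul_le _ _).trans (mul_le_mul hT (norm_resolv_le hS hz) (norm_nonneg _)
    ((norm_nonneg _).trans hT))

theorem integrable_trace_resolv (hZ : Measurable Z) (T : Matrix (Fin p) (Fin p) ℂ) {z : ℂ}
    (hz : 0 < z.im) :
    Integrable (fun ω => (T * resolv (combo D E (Z ω) * (combo D E (Z ω))ᴴ) z).trace) P :=
  Integrable.of_bound (measurable_trace_resolv hZ T z).aestronglyMeasurable _
    (ae_of_all _ fun _ => norm_trace_mul_resolv_le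
      (Matrix.isHermitian_mul_conjTranspose_self _) le_rfl hz)

theorem integrable_trace_dual_resolv (hZ : Measurable Z) (T : Matrix (Fin n) (Fin n) ℂ) {z : ℂ}
    (hz : 0 < z.im) :
    Integrable (fun ω => (T * resolv ((combo D E (Z ω))ᴴ * combo D E (Z ω)) z).trace) P :=
  Integrable.of_bound (measurable_trace_dual_resolv hZ T z).aestronglyMeasurable _
    (ae_of_all _ fun _ => norm_trace_mul_resolv_le
      (Matrix.isHermitian_conjTranspose_mul_self _) le_rfl hz)

theorem norm_mul_conjTranspose_self_le {d : ℕ} {M : Matrix (Fin d) (Fin d) ℂ} {a : ℝ}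
    (h : ‖M‖ ≤ a) : ‖M * Mᴴ‖ ≤ a ^ 2 := by
  refine (norm_mul_le _ _).trans ?_
  rw [Matrix.l2_opNorm_conjTranspose, sq]
  exact mul_self_le_mul_self (norm_nonneg _) h

theorem norm_conjTranspose_mul_self_le {d : ℕ} {M : Matrix (Fin d) (Fin d) ℂ} {a : ℝ}
    (h : ‖M‖ ≤ a) : ‖Mᴴ * M‖ ≤ a ^ 2 := by
  refine (norm_mul_le _ _).trans ?_
  rw [Matrix.l2_opNorm_conjTranspose, sq]
  exact mul_self_le_mul_self (norm_nonneg _) h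

theorem trace_mul_one_add_sum_smul {d : ℕ} {ι : Type*} [Fintype ι] (T Q : Matrix (Fin d) (Fin d) ℂ)
    (s : ι → ℂ) (A : ι → Matrix (Fin d) (Fin d) ℂ) :
    (T * (1 + ∑ r, s r • A r) * Q).trace = (T * Q).trace + ∑ r, s r * (T * A r * Q).trace := by
  rw [Matrix.mul_add, Matrix.mul_one, Matrix.add_mul, Matrix.trace_add, Matrix.mul_sum,
    Matrix.sum_mul, Matrix.trace_sum]
  simp only [Matrix.mul_smul, Matrix.smul_mul, Matrix.trace_smul, smul_eq_mul]

/-- The decoupled loop equation for `resolv (Y Yᴴ)`. -/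
theorem IsInnovation.norm_decoupled_loop_le {M : ℝ} (hZ : IsInnovation P M Z) (hM : 1 ≤ M)
    (hn : 0 < n) {a b t : ℝ} (ha : 0 < a) (hb : 0 < b) (hD : ∀ r, ‖D r‖ ≤ a)
    (hE : ∀ r, ‖E r‖ ≤ b) {T : Matrix (Fin p) (Fin p) ℂ} (hT : ‖T‖ ≤ t) (hw : 0 < w.im)
    (hw2 : 0 < (w ^ 2).im) :
    ‖T.trace + w ^ 2 * ∫ ω, (T * (1 + ∑ r,
      (∫ ω', ((E r)ᴴ * E r * resolv ((combo D E (Z ω'))ᴴ * combo D E (Z ω')) (w ^ 2)).trace ∂P) •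
      (D r * (D r)ᴴ)) * resolv (combo D E (Z ω) * (combo D E (Z ω))ᴴ) (w ^ 2)).trace ∂P‖ ≤
    K * p * ((a * b) ^ 2 * t / w.im ^ 2) + K * p * n * (12 * M * (t * (a * b) ^ 3 / w.im ^ 3)) +
      K * (‖w ^ 2‖ * (p * (t * a ^ 2 * (w ^ 2).im⁻¹) *
        (385 * (√n * (4 * (K + 1) * b ^ 2 / (‖w‖ * w.im)))))) := by
  have ht := (norm_nonneg _).trans hT
  have hloop := hZ.norm_integral_loop_le hM ha.le hb.le hD hE hT hw hw2
  rw [Fintype.card_fin, Fintype.card_fin, Fintype.card_fin] at hloop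
  have hTA : ∀ r, ‖T * (D r * (D r)ᴴ)‖ ≤ t * a ^ 2 := fun r =>
    (norm_mul_le _ _).trans (mul_le_mul hT (norm_mul_conjTranspose_self_le (hD r)) (norm_nonneg _) ht)
  have iT := integrable_trace_resolv (P := P) (D := D) (E := E) hZ.meas T hw2
  -- Of the two traces in each product, the one with Q' is replaced by its mean; the one with Q is
  -- merely bounded, by p times the norms of its factors.
  have key := norm_integral_decouple_le (P := P)
    (L := fun ω => T.trace + w ^ 2 *
      (T * resolv (combo D E (Z ω) * (combo D E (Z ω))ᴴ) (w ^ 2)).trace)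
    (X := fun r ω => ((E r)ᴴ * E r * resolv ((combo D E (Z ω))ᴴ * combo D E (Z ω)) (w ^ 2)).trace)
    (V := fun r ω => (T * (D r * (D r)ᴴ) *
      resolv (combo D E (Z ω) * (combo D E (Z ω))ᴴ) (w ^ 2)).trace) (z := w ^ 2)
    (v := p * (t * a ^ 2 * (w ^ 2).im⁻¹))
    (δ := 385 * (√n * (4 * (K + 1) * b ^ 2 / (‖w‖ * w.im))))
    ((integrable_const _).add (iT.const_mul _))
    (fun r => integrable_trace_dual_resolv hZ.meas _ hw2)
    (fun r => measurable_trace_resolv hZ.meas _ _)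
    (fun r ω => norm_trace_mul_resolv_le (Matrix.isHermitian_mul_conjTranspose_self _) (hTA r) hw2)
    (by positivity) (fun r => ?_) hloop
  · rw [Fintype.card_fin] at key
    refine le_trans (le_of_eq ?_) key
    congr 1
    simp only [add_assoc, ← Finset.mul_sum, ← mul_add, ← trace_mul_one_add_sum_smul]
    rw [integral_add (integrable_const _) ((integrable_trace_resolv hZ.meas _ hw2).const_mul _),
      integral_const, probReal_univ, one_smul, integral_const_mul]
  · simp only [trace_mul_dual_resolv_eq _ _ hw hw2]
    exact integral_norm_trace_le hZ.meas hZ.indep hn D E (by positivity)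
      ((norm_mul_mul_conjTranspose_le norm_inrMat_le norm_inrMat_le _).trans
        (norm_conjTranspose_mul_self_le (hE r))) hw

/-- The decoupled loop equation for `resolv (Yᴴ Y)`. -/
theorem IsInnovation.norm_decoupled_dual_loop_le {M : ℝ} (hZ : IsInnovation P M Z) (hM : 1 ≤ M)
    (hn : 0 < n) {a b t : ℝ} (ha : 0 < a) (hb : 0 < b) (hD : ∀ r, ‖D r‖ ≤ a)
    (hE : ∀ r, ‖E r‖ ≤ b) {T : Matrix (Fin n) (Fin n) ℂ} (hT : ‖T‖ ≤ t) (hw : 0 < w.im)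
    (hw2 : 0 < (w ^ 2).im) :
    ‖T.trace + w ^ 2 * ∫ ω, (T * (1 + ∑ r,
      (∫ ω', (D r * (D r)ᴴ * resolv (combo D E (Z ω') * (combo D E (Z ω'))ᴴ) (w ^ 2)).trace ∂P) •
      ((E r)ᴴ * E r)) * resolv ((combo D E (Z ω))ᴴ * combo D E (Z ω)) (w ^ 2)).trace ∂P‖ ≤
    K * n * ((a * b) ^ 2 * t / w.im ^ 2) + K * n * p * (12 * M * (t * (a * b) ^ 3 / w.im ^ 3)) +
      K * (‖w ^ 2‖ * (n * (t * b ^ 2 * (w ^ 2).im⁻¹) *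
        (385 * (√n * (4 * (K + 1) * a ^ 2 / (‖w‖ * w.im)))))) := by
  have ht := (norm_nonneg _).trans hT
  have hloop := hZ.norm_integral_dual_loop_le hM ha.le hb.le hD hE hT hw hw2
  rw [Fintype.card_fin, Fintype.card_fin, Fintype.card_fin] at hloop
  have hTA : ∀ r, ‖T * ((E r)ᴴ * E r)‖ ≤ t * b ^ 2 := fun r =>
    (norm_mul_le _ _).trans (mul_le_mul hT (norm_conjTranspose_mul_self_le (hE r)) (norm_nonneg _) ht)
  have iT := integrable_trace_dual_resolv (P := P) (D := D) (E := E) hZ.meas T hw2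
  have key := norm_integral_decouple_le (P := P)
    (L := fun ω => T.trace + w ^ 2 *
      (T * resolv ((combo D E (Z ω))ᴴ * combo D E (Z ω)) (w ^ 2)).trace)
    (X := fun r ω => (D r * (D r)ᴴ * resolv (combo D E (Z ω) * (combo D E (Z ω))ᴴ) (w ^ 2)).trace)
    (V := fun r ω => (T * ((E r)ᴴ * E r) *
      resolv ((combo D E (Z ω))ᴴ * combo D E (Z ω)) (w ^ 2)).trace) (z := w ^ 2)
    (v := n * (t * b ^ 2 * (w ^ 2).im⁻¹))
    (δ := 385 * (√n * (4 * (K + 1) * a ^ 2 / (‖w‖ * w.im))))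
    ((integrable_const _).add (iT.const_mul _))
    (fun r => integrable_trace_resolv hZ.meas _ hw2)
    (fun r => measurable_trace_dual_resolv hZ.meas _ _)
    (fun r ω => norm_trace_mul_resolv_le (Matrix.isHermitian_conjTranspose_mul_self _) (hTA r) hw2)
    (by positivity) (fun r => ?_) hloop
  · rw [Fintype.card_fin] at key
    refine le_trans (le_of_eq ?_) key
    congr 1
    simp only [add_assoc, ← Finset.mul_sum, ← mul_add, ← trace_mul_one_add_sum_smul]
    rw [integral_add (integrable_const _) ((integrable_trace_dual_resolv hZ.meas _ hw2).const_mul _),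
      integral_const, probReal_univ, one_smul, integral_const_mul]
  · simp only [trace_mul_resolv_eq _ _ hw hw2]
    exact integral_norm_trace_le hZ.meas hZ.indep hn D E (by positivity)
      ((norm_mul_mul_conjTranspose_le norm_inlMat_le norm_inlMat_le _).trans
        (norm_mul_conjTranspose_self_le (hD r))) hw

end Decoupling

/-! ### The model in joint eigencoordinates and its approximate equations -/

section DiagonalModel

open scoped Matrix.Norms.L2Operator Matrix

variable {K p n : ℕ}

/-- The left factors `n^{-1/2} A_r^{1/2}`. -/
def leftFac (n : ℕ) (U : Matrix (Fin p) (Fin p) ℂ) (x : Fin p → Fin K → ℝ) (r : Fin K) :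
    Matrix (Fin p) (Fin p) ℂ :=
  cdiag U fun j => ((√(x j r) / √n : ℝ) : ℂ)

/-- The right factors `B_r^{1/2}`. -/
def rightFac (V : Matrix (Fin n) (Fin n) ℂ) (y : Fin n → Fin K → ℝ) (r : Fin K) :
    Matrix (Fin n) (Fin n) ℂ :=
  cdiag V fun j => ((√(y j r) : ℝ) : ℂ)

/-- The normalized data matrix with joint eigenvalues `x` on the left and `y` on the right. -/
def modelMat (U : Matrix (Fin p) (Fin p) ℂ) (V : Matrix (Fin n) (Fin n) ℂ)
    (x : Fin p → Fin K → ℝ) (y : Fin n → Fin K → ℝ) (ζ : Fin K → Fin p → Fin n → ℂ) :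
    Matrix (Fin p) (Fin n) ℂ :=
  combo (leftFac n U x) (rightFac V y) ζ

/-- `p⁻¹ tr (A_r (Y Yᴴ - z)⁻¹)`. -/
def leftStat (U : Matrix (Fin p) (Fin p) ℂ) (V : Matrix (Fin n) (Fin n) ℂ)
    (x : Fin p → Fin K → ℝ) (y : Fin n → Fin K → ℝ) (z : ℂ) (r : Fin K)
    (ζ : Fin K → Fin p → Fin n → ℂ) : ℂ :=
  (p : ℂ)⁻¹ * (cdiag U (fun j => (x j r : ℂ)) *
    resolv (modelMat U V x y ζ * (modelMat U V x y ζ)ᴴ) z).trace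

/-- `n⁻¹ tr (B_r (Yᴴ Y - z)⁻¹)`. -/
def rightStat (U : Matrix (Fin p) (Fin p) ℂ) (V : Matrix (Fin n) (Fin n) ℂ)
    (x : Fin p → Fin K → ℝ) (y : Fin n → Fin K → ℝ) (z : ℂ) (r : Fin K)
    (ζ : Fin K → Fin p → Fin n → ℂ) : ℂ :=
  (n : ℂ)⁻¹ * (cdiag V (fun j => (y j r : ℂ)) *
    resolv ((modelMat U V x y ζ)ᴴ * modelMat U V x y ζ) z).trace

variable {U : Matrix (Fin p) (Fin p) ℂ} {V : Matrix (Fin n) (Fin n) ℂ}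
  {x : Fin p → Fin K → ℝ} {y : Fin n → Fin K → ℝ}

theorem leftFac_mul_conjTranspose (hU : U ∈ unitary (Matrix (Fin p) (Fin p) ℂ))
    (hx : ∀ j r, 0 ≤ x j r) (r : Fin K) :
    leftFac n U x r * (leftFac n U x r)ᴴ = (n : ℂ)⁻¹ • cdiag U fun j => (x j r : ℂ) := by
  rw [leftFac, cdiag_conjTranspose, cdiag_mul hU, smul_cdiag]
  congr 1
  ext j
  rw [Complex.star_def, Complex.conj_ofReal, ← Complex.ofReal_mul, div_mul_div_comm,
    Real.mul_self_sqrt (hx j r), Real.mul_self_sqrt (Nat.cast_nonneg n), Complex.ofReal_div,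
    Complex.ofReal_natCast, div_eq_inv_mul]

theorem rightFac_conjTranspose_mul (hV : V ∈ unitary (Matrix (Fin n) (Fin n) ℂ))
    (hy : ∀ j r, 0 ≤ y j r) (r : Fin K) :
    (rightFac V y r)ᴴ * rightFac V y r = cdiag V fun j => (y j r : ℂ) := by
  rw [rightFac, cdiag_conjTranspose, cdiag_mul hV]
  congr 1
  ext j
  rw [Complex.star_def, Complex.conj_ofReal, ← Complex.ofReal_mul, Real.mul_self_sqrt (hy j r)]

theorem norm_leftFac_le (hU : U ∈ unitary (Matrix (Fin p) (Fin p) ℂ)) {τ : ℝ}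
    (hx : ∀ j r, x j r ≤ τ) (r : Fin K) : ‖leftFac n U x r‖ ≤ √τ / √n := by
  refine norm_cdiag_le hU (by positivity) fun j => ?_
  rw [Complex.norm_real, Real.norm_of_nonneg (by positivity)]
  gcongr
  exact hx j r

theorem norm_rightFac_le (hV : V ∈ unitary (Matrix (Fin n) (Fin n) ℂ)) {τ : ℝ}
    (hy : ∀ j r, y j r ≤ τ) (r : Fin K) : ‖rightFac V y r‖ ≤ √τ := by
  refine norm_cdiag_le hV (by positivity) fun j => ?_
  rw [Complex.norm_real, Real.norm_of_nonneg (by positivity)]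
  gcongr
  exact hy j r

theorem one_add_sum_smul_cdiag {d : ℕ} {W : Matrix (Fin d) (Fin d) ℂ}
    (hW : W ∈ unitary (Matrix (Fin d) (Fin d) ℂ)) (x : Fin d → Fin K → ℝ) (q : Fin K → ℂ) :
    1 + ∑ r, q r • cdiag W (fun j => (x j r : ℂ)) = cdiag W fun j => 1 + pair (x j) q := by
  simp only [smul_cdiag, sum_cdiag]
  rw [← cdiag_one hW, cdiag_add]
  simp only [pair, mul_comm]

/-- The constant in the approximate fixed-point equations. -/
def loopConst (K : ℕ) (M : ℝ) (w : ℂ) : ℝ :=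
  K / w.im ^ 2 + 12 * M * K / w.im ^ 3 +
    K * ‖w ^ 2‖ * 385 * (4 * (K + 1)) / (‖w‖ * w.im * (w ^ 2).im)

/-- The three errors are the contribution of E ζ², the cubic remainders and the decoupling. With
factors of norm √τ/√n and √τ they are of order d τ²/n, d d' τ³/n^{3/2} and d τ²/√n, all absorbed
into one multiple of d τ³/√n. -/
theorem loopBound_le {M t τ : ℝ} {w : ℂ} (hw : 0 < w.im) (hw2 : 0 < (w ^ 2).im) (hM : 1 ≤ M)
    (ht : 0 ≤ t) (hτ : 1 ≤ τ) (hn : 0 < n) (d d' : ℝ) (hd : 0 ≤ d) (hd' : 0 ≤ d') :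
    K * d * ((√τ / √n * √τ) ^ 2 * t / w.im ^ 2) +
      K * d * d' * (12 * M * (t * (√τ / √n * √τ) ^ 3 / w.im ^ 3)) +
      K * (‖w ^ 2‖ * (d * (t * (w ^ 2).im⁻¹) *
        (385 * (4 * (K + 1) * (τ ^ 2 / √n) / (‖w‖ * w.im))))) ≤
    d * (loopConst K M w * (1 + d' / n) * (t * τ ^ 3 / √n)) := by
  have hw0 : 0 < ‖w‖ := norm_pos_iff.2 (ne_zero_of_im_pos hw)
  have hn1 : (1 : ℝ) ≤ n := by exact_mod_cast hn
  set q := √(n : ℝ) with hq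
  have hq1 : 1 ≤ q := Real.one_le_sqrt.2 hn1
  have hq0 : 0 < q := by linarith
  have hqn : (n : ℝ) = q ^ 2 := (Real.sq_sqrt (by linarith)).symm
  have e1 : √τ / q * √τ = τ / q := by
    rw [div_mul_eq_mul_div, Real.mul_self_sqrt (by linarith)]
  rw [e1, hqn]
  have hτ2 : τ ^ 2 ≤ τ ^ 3 := pow_le_pow_right₀ hτ (by norm_num)
  have hτ0 : 0 < τ := by linarith
  have a1 : (τ / q) ^ 2 ≤ τ ^ 3 / q := by
    rw [div_pow]
    refine (div_le_div_of_nonneg_right hτ2 (by positivity)).trans ?_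
    exact div_le_div_of_nonneg_left (by positivity) hq0 (by nlinarith)
  have a2 : τ ^ 2 / q ≤ τ ^ 3 / q := div_le_div_of_nonneg_right hτ2 hq0.le
  set s := τ ^ 3 / q with hs
  have hs0 : 0 ≤ s := by positivity
  have t1 : K * d * ((τ / q) ^ 2 * t / w.im ^ 2) ≤ d * (K / w.im ^ 2 * (t * s)) := by
    calc K * d * ((τ / q) ^ 2 * t / w.im ^ 2) ≤ K * d * (s * t / w.im ^ 2) := by gcongr
      _ = _ := by ring
  have t2 : K * d * d' * (12 * M * (t * (τ / q) ^ 3 / w.im ^ 3)) =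
      d * (12 * M * K / w.im ^ 3 * (d' / q ^ 2) * (t * s)) := by
    rw [hs]
    field_simp
  have t3 : K * (‖w ^ 2‖ * (d * (t * (w ^ 2).im⁻¹) *
        (385 * (4 * (K + 1) * (τ ^ 2 / q) / (‖w‖ * w.im))))) ≤
      d * (K * ‖w ^ 2‖ * 385 * (4 * (K + 1)) / (‖w‖ * w.im * (w ^ 2).im) * (t * s)) := by
    calc _ ≤ K * (‖w ^ 2‖ * (d * (t * (w ^ 2).im⁻¹) *
        (385 * (4 * (K + 1) * s / (‖w‖ * w.im))))) := by gcongr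
      _ = _ := by
        field_simp
  rw [t2]
  refine (add_le_add (add_le_add t1 le_rfl) t3).trans ?_
  have hd'' : 0 ≤ d' / q ^ 2 := by positivity
  have b1 : 0 ≤ K / w.im ^ 2 := by positivity
  have b2 : 0 ≤ 12 * M * K / w.im ^ 3 := by positivity
  have b3 : 0 ≤ K * ‖w ^ 2‖ * 385 * (4 * (K + 1)) / (‖w‖ * w.im * (w ^ 2).im) := by positivity
  have hts : 0 ≤ t * s := by positivity
  rw [loopConst, ← mul_add, ← mul_add, show t * τ ^ 3 / q = t * s by rw [hs]; ring]
  refine mul_le_mul_of_nonneg_left ?_ hd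
  rw [← add_mul, ← add_mul]
  refine mul_le_mul_of_nonneg_right ?_ hts
  nlinarith [mul_nonneg b1 hd'', mul_nonneg b3 hd'']

variable {Ω : Type*} [MeasurableSpace Ω] {P : Measure Ω} [IsProbabilityMeasure P]
  {Z : Ω → Fin K → Fin p → Fin n → ℂ} {M τ : ℝ} {w : ℂ}

theorem sq_div_sqrt_eq (hn : 0 < n) (τ : ℝ) : τ ^ 2 / √(n : ℝ) = τ / n * (√n * τ) := by
  have hn' : (0 : ℝ) < n := by exact_mod_cast hn
  rw [div_eq_iff (by positivity)]
  calc τ ^ 2 = τ / n * τ * n := by field_simp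
    _ = τ / n * τ * (√n * √n) := by rw [Real.mul_self_sqrt hn'.le]
    _ = _ := by ring

theorem norm_inv_mul_add_le {d : ℕ} (hd : 0 < d) {a b z : ℂ} {e : ℝ} (h : ‖a + z * b‖ ≤ d * e) :
    ‖(d : ℂ)⁻¹ * a + z * ((d : ℂ)⁻¹ * b)‖ ≤ e := by
  have hd' : (0 : ℝ) < d := by exact_mod_cast hd
  have e1 : (d : ℂ)⁻¹ * a + z * ((d : ℂ)⁻¹ * b) = (d : ℂ)⁻¹ * (a + z * b) := by ring
  rw [e1, norm_mul, norm_inv, Complex.norm_natCast, inv_mul_le_iff₀ hd']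
  exact h

/-- The loop equation for test matrices diagonal in the joint eigenbasis, where 1 + ∑ g_r A_r acts
as multiplication by 1 + xᵀg. The test φ is left free: φ = x_s / (z(1 + xᵀg)) yields the equation
for h, and φ = 1 the formula for the Stieltjes transform. -/
theorem IsInnovation.norm_left_test_le (hZ : IsInnovation P M Z) (hM : 1 ≤ M) (hn : 0 < n)
    (hp : 0 < p) (hU : U ∈ unitary (Matrix (Fin p) (Fin p) ℂ))
    (hV : V ∈ unitary (Matrix (Fin n) (Fin n) ℂ)) (hτ : 1 ≤ τ)
    (hx : ∀ j r, 0 ≤ x j r) (hy : ∀ j r, 0 ≤ y j r) (hxτ : ∀ j r, x j r ≤ τ)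
    (hyτ : ∀ j r, y j r ≤ τ) (hw : 0 < w.im) (hw2 : 0 < (w ^ 2).im) {φ : Fin p → ℂ} {t : ℝ}
    (ht : 0 ≤ t) (hφ : ∀ j, ‖φ j‖ ≤ t) :
    ‖(p : ℂ)⁻¹ * ∑ j, φ j + w ^ 2 * ((p : ℂ)⁻¹ * ∫ ω, (cdiag U (fun j => φ j *
      (1 + pair (x j) fun r => ∫ ω', rightStat U V x y (w ^ 2) r (Z ω') ∂P)) *
      resolv (modelMat U V x y (Z ω) * (modelMat U V x y (Z ω))ᴴ) (w ^ 2)).trace ∂P)‖ ≤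
    loopConst K M w * (1 + n / n) * (t * τ ^ 3 / √n) := by
  have hp' : (0 : ℝ) < p := by exact_mod_cast hp
  have hn' : (0 : ℝ) < n := by exact_mod_cast hn
  have hτ0 : 0 < τ := by linarith
  have h := hZ.norm_decoupled_loop_le hM hn (by positivity) (by positivity)
    (norm_leftFac_le (n := n) hU hxτ) (norm_rightFac_le hV hyτ) (norm_cdiag_le hU ht hφ) hw hw2
  have h1 : 1 + ∑ r, (∫ ω', ((rightFac V y r)ᴴ * rightFac V y r *
      resolv ((combo (leftFac n U x) (rightFac V y) (Z ω'))ᴴ *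
        combo (leftFac n U x) (rightFac V y) (Z ω')) (w ^ 2)).trace ∂P) •
      (leftFac n U x r * (leftFac n U x r)ᴴ) =
      cdiag U fun j => 1 + pair (x j) fun r => ∫ ω', rightStat U V x y (w ^ 2) r (Z ω') ∂P := by
    rw [← one_add_sum_smul_cdiag hU]
    congr 1
    refine Finset.sum_congr rfl fun r _ => ?_
    rw [leftFac_mul_conjTranspose hU hx, rightFac_conjTranspose_mul hV hy, smul_smul, mul_comm]
    unfold rightStat
    rw [integral_const_mul]
    rfl
  rw [h1, trace_cdiag hU] at h
  simp only [cdiag_mul hU] at h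
  have h2 := loopBound_le (K := K) hw hw2 hM ht hτ hn p n hp'.le hn'.le
  refine norm_inv_mul_add_le hp ((h.trans (le_of_eq ?_)).trans h2)
  congr 1
  rw [div_pow, Real.sq_sqrt hτ0.le, Real.sq_sqrt hn'.le, sq_div_sqrt_eq hn]
  ring

theorem IsInnovation.norm_right_test_le (hZ : IsInnovation P M Z) (hM : 1 ≤ M) (hn : 0 < n)
    (hp : 0 < p) (hU : U ∈ unitary (Matrix (Fin p) (Fin p) ℂ))
    (hV : V ∈ unitary (Matrix (Fin n) (Fin n) ℂ)) (hτ : 1 ≤ τ)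
    (hx : ∀ j r, 0 ≤ x j r) (hy : ∀ j r, 0 ≤ y j r) (hxτ : ∀ j r, x j r ≤ τ)
    (hyτ : ∀ j r, y j r ≤ τ) (hw : 0 < w.im) (hw2 : 0 < (w ^ 2).im) {φ : Fin n → ℂ} {t : ℝ}
    (ht : 0 ≤ t) (hφ : ∀ j, ‖φ j‖ ≤ t) :
    ‖(n : ℂ)⁻¹ * ∑ j, φ j + w ^ 2 * ((n : ℂ)⁻¹ * ∫ ω, (cdiag V (fun j => φ j *
      (1 + pair (y j) fun r => (p / n : ℝ) * ∫ ω', leftStat U V x y (w ^ 2) r (Z ω') ∂P)) *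
      resolv ((modelMat U V x y (Z ω))ᴴ * modelMat U V x y (Z ω)) (w ^ 2)).trace ∂P)‖ ≤
    loopConst K M w * (1 + p / n) * (t * τ ^ 3 / √n) := by
  have hp' : (0 : ℝ) < p := by exact_mod_cast hp
  have hn' : (0 : ℝ) < n := by exact_mod_cast hn
  have hpC : (p : ℂ) ≠ 0 := by exact_mod_cast hp.ne'
  have hτ0 : 0 < τ := by linarith
  have h := hZ.norm_decoupled_dual_loop_le hM hn (by positivity) (by positivity)
    (norm_leftFac_le (n := n) hU hxτ) (norm_rightFac_le hV hyτ) (norm_cdiag_le hV ht hφ) hw hw2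
  have h1 : 1 + ∑ r, (∫ ω', (leftFac n U x r * (leftFac n U x r)ᴴ *
      resolv (combo (leftFac n U x) (rightFac V y) (Z ω') *
        (combo (leftFac n U x) (rightFac V y) (Z ω'))ᴴ) (w ^ 2)).trace ∂P) •
      ((rightFac V y r)ᴴ * rightFac V y r) =
      cdiag V fun j => 1 + pair (y j) fun r =>
        (p / n : ℝ) * ∫ ω', leftStat U V x y (w ^ 2) r (Z ω') ∂P := by
    rw [← one_add_sum_smul_cdiag hV]
    congr 1
    refine Finset.sum_congr rfl fun r _ => ?_
    rw [leftFac_mul_conjTranspose hU hx, rightFac_conjTranspose_mul hV hy]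
    congr 1
    unfold leftStat
    simp only [Matrix.smul_mul, Matrix.trace_smul, smul_eq_mul]
    rw [integral_const_mul, integral_const_mul, Complex.ofReal_div, Complex.ofReal_natCast,
      Complex.ofReal_natCast, ← mul_assoc, div_mul_eq_mul_div, mul_inv_cancel₀ hpC, one_div]
    rfl
  rw [h1, trace_cdiag hV] at h
  simp only [cdiag_mul hV] at h
  have h2 := loopBound_le (K := K) hw hw2 hM ht hτ hn n p hn'.le hp'.le
  refine norm_inv_mul_add_le hn ((h.trans (le_of_eq ?_)).trans h2)
  congr 1
  rw [div_pow, Real.sq_sqrt hτ0.le, Real.sq_sqrt hn'.le, sq_div_sqrt_eq hn]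
  ring

/-- All three facts are read off from the weighted spectral measure, a measure on [0, ∞) of mass tr
A. -/
theorem im_trace_mul_resolv_nonneg {d : ℕ} {A S : Matrix (Fin d) (Fin d) ℂ} (hA : A.PosSemidef)
    (hS : S.PosSemidef) {z : ℂ} (hz : 0 < z.im) :
    0 ≤ (A * resolv S z).trace.im ∧ 0 ≤ (z * (A * resolv S z).trace).im ∧
      ‖(A * resolv S z).trace‖ ≤ A.trace.re / z.im := by
  obtain ⟨μ, hμ, hμ0, hμ1, h⟩ := exists_stieltjes_eq_trace hA hS
  rw [h z hz, ← hμ1]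
  exact ⟨stieltjes_im_nonneg μ hz, mul_stieltjes_im_nonneg μ hμ0 hz, norm_stieltjes_le μ hz⟩

/-- The elementary properties of `leftStat` and `rightStat`. -/
structure IsHalfPlaneStat (X : ℂ) (z : ℂ) (C : ℝ) : Prop where
  im_nonneg : 0 ≤ X.im
  mul_im_nonneg : 0 ≤ (z * X).im
  norm_le : ‖X‖ ≤ C / z.im

theorem isHalfPlaneStat_trace {d : ℕ} {A S : Matrix (Fin d) (Fin d) ℂ} (hA : A.PosSemidef)
    (hS : S.PosSemidef) {z : ℂ} (hz : 0 < z.im) {C : ℝ} (hC : A.trace.re / d ≤ C) :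
    IsHalfPlaneStat ((d : ℂ)⁻¹ * (A * resolv S z).trace) z C := by
  obtain ⟨h1, h2, h3⟩ := im_trace_mul_resolv_nonneg hA hS hz
  have hd : ((d : ℂ)⁻¹) = (((d : ℝ)⁻¹ : ℝ) : ℂ) := by push_cast; rfl
  refine ⟨?_, ?_, ?_⟩
  · rw [hd, Complex.im_ofReal_mul]
    positivity
  · rw [mul_left_comm, hd, Complex.im_ofReal_mul]
    positivity
  · rw [norm_mul, norm_inv, Complex.norm_natCast]
    calc (d : ℝ)⁻¹ * ‖(A * resolv S z).trace‖ ≤ (d : ℝ)⁻¹ * (A.trace.re / z.im) := by gcongr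
      _ = A.trace.re / d / z.im := by ring
      _ ≤ C / z.im := by gcongr

theorem IsHalfPlaneStat.integral {X : Ω → ℂ} {z : ℂ} {C : ℝ} (hX : Integrable X P)
    (h : ∀ ω, IsHalfPlaneStat (X ω) z C) : IsHalfPlaneStat (∫ ω, X ω ∂P) z C := by
  refine ⟨?_, ?_, ?_⟩
  · rw [im_integral hX]
    exact integral_nonneg fun ω => (h ω).im_nonneg
  · rw [← integral_const_mul, im_integral (hX.const_mul z)]
    exact integral_nonneg fun ω => (h ω).mul_im_nonneg
  · refine (norm_integral_le_of_norm_le_const (ae_of_all _ fun ω => (h ω).norm_le)).trans ?_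
    simp

theorem trace_cdiag_re {d : ℕ} {W : Matrix (Fin d) (Fin d) ℂ}
    (hW : W ∈ unitary (Matrix (Fin d) (Fin d) ℂ)) (v : Fin d → ℝ) :
    (cdiag W fun j => (v j : ℂ)).trace.re = ∑ j, v j := by
  rw [trace_cdiag hW, Complex.re_sum]
  simp

theorem isHalfPlaneStat_leftStat (hU : U ∈ unitary (Matrix (Fin p) (Fin p) ℂ))
    (hx : ∀ j r, 0 ≤ x j r) {C : ℝ} {r : Fin K} (hC : (∑ j, x j r) / p ≤ C) {z : ℂ}
    (hz : 0 < z.im) (ζ : Fin K → Fin p → Fin n → ℂ) :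
    IsHalfPlaneStat (leftStat U V x y z r ζ) z C :=
  isHalfPlaneStat_trace (posSemidef_cdiag U fun j => hx j r)
    (Matrix.posSemidef_self_mul_conjTranspose _) hz (by rwa [trace_cdiag_re hU])

theorem isHalfPlaneStat_rightStat (hV : V ∈ unitary (Matrix (Fin n) (Fin n) ℂ))
    (hy : ∀ j r, 0 ≤ y j r) {C : ℝ} {r : Fin K} (hC : (∑ j, y j r) / n ≤ C) {z : ℂ}
    (hz : 0 < z.im) (ζ : Fin K → Fin p → Fin n → ℂ) :
    IsHalfPlaneStat (rightStat U V x y z r ζ) z C :=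
  isHalfPlaneStat_trace (posSemidef_cdiag V fun j => hy j r)
    (Matrix.posSemidef_conjTranspose_mul_self _) hz (by rwa [trace_cdiag_re hV])

theorem integrable_leftStat (hZ : Measurable Z) {z : ℂ} (hz : 0 < z.im) (r : Fin K) :
    Integrable (fun ω => leftStat U V x y z r (Z ω)) P :=
  (integrable_trace_resolv hZ _ hz).const_mul _

theorem integrable_rightStat (hZ : Measurable Z) {z : ℂ} (hz : 0 < z.im) (r : Fin K) :
    Integrable (fun ω => rightStat U V x y z r (Z ω)) P :=
  (integrable_trace_dual_resolv hZ _ hz).const_mul _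

theorem opO_emp {d : ℕ} (x : Fin d → Fin K → ℝ) (z : ℂ) (q : Fin K → ℂ) (s : Fin K) :
    opO z q (emp x) s = -((d : ℂ)⁻¹ * ∑ j, (x j s : ℂ) / (z * (1 + pair (x j) q))) := by
  rw [opO, integral_emp, Complex.real_smul, ← mul_neg, ← Finset.sum_neg_distrib]
  push_cast
  congr 1
  refine Finset.sum_congr rfl fun j _ => ?_
  rw [neg_mul, div_neg]

/-- The test function x_s / (z(1 + xᵀq)) is chosen to cancel the factor 1 + xᵀq in the loop equation
(`test_mul_eq`); it is bounded because Im(zq) ≥ 0 keeps its denominator above Im z. -/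
theorem test_bound {d : ℕ} {x : Fin d → Fin K → ℝ} (hx : ∀ j r, 0 ≤ x j r)
    (hxτ : ∀ j r, x j r ≤ τ) {z : ℂ} (hz : 0 < z.im) {q : Fin K → ℂ}
    (hq : ∀ r, 0 ≤ (z * q r).im) (s : Fin K) (j : Fin d) :
    ‖(x j s : ℂ) / (z * (1 + pair (x j) q))‖ ≤ τ / z.im := by
  rw [norm_div, Complex.norm_real, Real.norm_of_nonneg (hx j s)]
  have h1 := im_le_norm_mul_one_add_pair hq (hx j)
  have h2 := hx j s
  have h3 := hxτ j s
  exact div_le_div₀ (h2.trans h3) h3 hz h1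

theorem test_mul_eq {x : Fin K → ℝ} (hx : ∀ r, 0 ≤ x r) {z : ℂ} (hz : 0 < z.im) {q : Fin K → ℂ}
    (hq : ∀ r, 0 ≤ (z * q r).im) (v : ℂ) :
    z * (v / (z * (1 + pair x q)) * (1 + pair x q)) = v := by
  have h1 := im_le_norm_mul_one_add_pair hq hx
  have h2 : z * (1 + pair x q) ≠ 0 := norm_pos_iff.1 (hz.trans_le h1)
  rw [div_mul_eq_mul_div, mul_div_assoc', mul_left_comm, mul_div_assoc, div_self h2, mul_one]

theorem mul_trace_cdiag_mul {d : ℕ} (W Q : Matrix (Fin d) (Fin d) ℂ) (z : ℂ) (v : Fin d → ℂ) :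
    z * (cdiag W v * Q).trace = (cdiag W (fun j => z * v j) * Q).trace := by
  rw [← smul_cdiag, Matrix.smul_mul, Matrix.trace_smul, smul_eq_mul]

/-- The first approximate fixed-point equation. -/
theorem IsInnovation.norm_leftStat_sub_opO_le (hZ : IsInnovation P M Z) (hM : 1 ≤ M) (hn : 0 < n)
    (hp : 0 < p) (hU : U ∈ unitary (Matrix (Fin p) (Fin p) ℂ))
    (hV : V ∈ unitary (Matrix (Fin n) (Fin n) ℂ)) (hτ : 1 ≤ τ)
    (hx : ∀ j r, 0 ≤ x j r) (hy : ∀ j r, 0 ≤ y j r) (hxτ : ∀ j r, x j r ≤ τ)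
    (hyτ : ∀ j r, y j r ≤ τ) (hw : 0 < w.im) (hw2 : 0 < (w ^ 2).im) (s : Fin K) :
    ‖(∫ ω, leftStat U V x y (w ^ 2) s (Z ω) ∂P) -
      opO (w ^ 2) (fun r => ∫ ω, rightStat U V x y (w ^ 2) r (Z ω) ∂P) (emp x) s‖ ≤
    loopConst K M w * (1 + n / n) * (τ / (w ^ 2).im * τ ^ 3 / √n) := by
  set q : Fin K → ℂ := fun r => ∫ ω, rightStat U V x y (w ^ 2) r (Z ω) ∂P with hq
  have hq0 : ∀ r, 0 ≤ (w ^ 2 * q r).im := fun r => (IsHalfPlaneStat.integral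
    (integrable_rightStat hZ.meas hw2 r)
    fun ω => isHalfPlaneStat_rightStat hV hy le_rfl hw2 (Z ω)).mul_im_nonneg
  have h := hZ.norm_left_test_le hM hn hp hU hV hτ hx hy hxτ hyτ hw hw2
    (div_nonneg (by linarith) hw2.le) (test_bound hx hxτ hw2 hq0 s)
  rw [← hq, mul_left_comm, ← integral_const_mul] at h
  simp only [mul_trace_cdiag_mul, test_mul_eq (hx _) hw2 hq0] at h
  rw [opO_emp, sub_neg_eq_add, add_comm]
  unfold leftStat
  rw [integral_const_mul]
  exact h

/-- The second approximate fixed-point equation. -/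
theorem IsInnovation.norm_rightStat_sub_opO_le (hZ : IsInnovation P M Z) (hM : 1 ≤ M) (hn : 0 < n)
    (hp : 0 < p) (hU : U ∈ unitary (Matrix (Fin p) (Fin p) ℂ))
    (hV : V ∈ unitary (Matrix (Fin n) (Fin n) ℂ)) (hτ : 1 ≤ τ)
    (hx : ∀ j r, 0 ≤ x j r) (hy : ∀ j r, 0 ≤ y j r) (hxτ : ∀ j r, x j r ≤ τ)
    (hyτ : ∀ j r, y j r ≤ τ) (hw : 0 < w.im) (hw2 : 0 < (w ^ 2).im) (s : Fin K) :
    ‖(∫ ω, rightStat U V x y (w ^ 2) s (Z ω) ∂P) -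
      opO (w ^ 2) (((p / n : ℝ) : ℂ) • fun r => ∫ ω, leftStat U V x y (w ^ 2) r (Z ω) ∂P)
        (emp y) s‖ ≤
    loopConst K M w * (1 + p / n) * (τ / (w ^ 2).im * τ ^ 3 / √n) := by
  set q : Fin K → ℂ := ((p / n : ℝ) : ℂ) • fun r => ∫ ω, leftStat U V x y (w ^ 2) r (Z ω) ∂P with hq
  have hq0 : ∀ r, 0 ≤ (w ^ 2 * q r).im := fun r => by
    have h1 := (IsHalfPlaneStat.integral (integrable_leftStat (P := P) hZ.meas hw2 r)
      fun ω => isHalfPlaneStat_leftStat (V := V) (y := y) hU hx le_rfl hw2 (Z ω)).mul_im_nonneg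
    rw [hq, Pi.smul_apply, smul_eq_mul, mul_left_comm, Complex.im_ofReal_mul]
    exact mul_nonneg (by positivity) h1
  have h := hZ.norm_right_test_le hM hn hp hU hV hτ hx hy hxτ hyτ hw hw2
    (div_nonneg (by linarith) hw2.le) (test_bound hy hyτ hw2 hq0 s)
  have hq' : (fun r => ((p / n : ℝ) : ℂ) * ∫ ω, leftStat U V x y (w ^ 2) r (Z ω) ∂P) = q := rfl
  rw [hq', mul_left_comm, ← integral_const_mul] at h
  simp only [mul_trace_cdiag_mul, test_mul_eq (hy _) hw2 hq0] at h
  rw [opO_emp, sub_neg_eq_add, add_comm]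
  unfold rightStat
  rw [integral_const_mul]
  exact h

/-- The approximate formula for the Stieltjes transform of the spectral distribution. -/
theorem IsInnovation.norm_trace_resolv_add_le (hZ : IsInnovation P M Z) (hM : 1 ≤ M) (hn : 0 < n)
    (hp : 0 < p) (hU : U ∈ unitary (Matrix (Fin p) (Fin p) ℂ))
    (hV : V ∈ unitary (Matrix (Fin n) (Fin n) ℂ)) (hτ : 1 ≤ τ)
    (hx : ∀ j r, 0 ≤ x j r) (hy : ∀ j r, 0 ≤ y j r) (hxτ : ∀ j r, x j r ≤ τ)
    (hyτ : ∀ j r, y j r ≤ τ) (hw : 0 < w.im) (hw2 : 0 < (w ^ 2).im) :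
    ‖1 + w ^ 2 * ((p : ℂ)⁻¹ *
        ∫ ω, (resolv (modelMat U V x y (Z ω) * (modelMat U V x y (Z ω))ᴴ) (w ^ 2)).trace ∂P +
      ∑ r, (∫ ω, leftStat U V x y (w ^ 2) r (Z ω) ∂P) *
        ∫ ω, rightStat U V x y (w ^ 2) r (Z ω) ∂P)‖ ≤
    loopConst K M w * (1 + n / n) * (1 * τ ^ 3 / √n) := by
  have hpC : (p : ℂ) ≠ 0 := by exact_mod_cast hp.ne'
  -- With the constant test the factor 1 + ∑ g_r A_r stays in the trace and produces the scalar
  -- product of h and g.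
  have h := hZ.norm_left_test_le hM hn hp hU hV hτ hx hy hxτ hyτ hw hw2 (φ := fun _ => 1)
    zero_le_one (fun j => by simp)
  simp only [one_mul, ← one_add_sum_smul_cdiag hU] at h
  have h1 : ∀ ω, ((1 + ∑ r, (∫ ω', rightStat U V x y (w ^ 2) r (Z ω') ∂P) •
      cdiag U (fun j => (x j r : ℂ))) *
      resolv (modelMat U V x y (Z ω) * (modelMat U V x y (Z ω))ᴴ) (w ^ 2)).trace =
      (resolv (modelMat U V x y (Z ω) * (modelMat U V x y (Z ω))ᴴ) (w ^ 2)).trace +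
      ∑ r, (∫ ω', rightStat U V x y (w ^ 2) r (Z ω') ∂P) * (cdiag U (fun j => (x j r : ℂ)) *
        resolv (modelMat U V x y (Z ω) * (modelMat U V x y (Z ω))ᴴ) (w ^ 2)).trace := by
    intro ω
    have := trace_mul_one_add_sum_smul 1
      (resolv (modelMat U V x y (Z ω) * (modelMat U V x y (Z ω))ᴴ) (w ^ 2))
      (fun r => ∫ ω', rightStat U V x y (w ^ 2) r (Z ω') ∂P) fun r => cdiag U fun j => (x j r : ℂ)
    simpa only [Matrix.one_mul] using this
  have i1 : Integrable (fun ω => (resolv (modelMat U V x y (Z ω) *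
      (modelMat U V x y (Z ω))ᴴ) (w ^ 2)).trace) P := by
    have := integrable_trace_resolv (P := P) (D := leftFac n U x) (E := rightFac V y) hZ.meas 1 hw2
    simp only [Matrix.one_mul] at this
    exact this
  have i2 : ∀ r, Integrable (fun ω => (∫ ω', rightStat U V x y (w ^ 2) r (Z ω') ∂P) *
      (cdiag U (fun j => (x j r : ℂ)) *
        resolv (modelMat U V x y (Z ω) * (modelMat U V x y (Z ω))ᴴ) (w ^ 2)).trace) P := fun r =>
    (integrable_trace_resolv hZ.meas _ hw2).const_mul _
  simp only [h1] at h
  rw [integral_add i1 (integrable_finsetSum _ fun r _ => i2 r), integral_finsetSum _ fun r _ => i2 r]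
    at h
  simp only [integral_const_mul, Finset.sum_const, Finset.card_univ, Fintype.card_fin,
    nsmul_eq_mul, mul_one, inv_mul_cancel₀ hpC] at h
  rw [mul_add (p : ℂ)⁻¹, Finset.mul_sum] at h
  simp only [one_mul]
  convert h using 6
  rename_i r _
  unfold leftStat
  rw [integral_const_mul]
  ring

end DiagonalModel

/-! ### Truncation of the joint eigenvalues -/

section Truncation

open scoped Matrix.Norms.L2Operator Matrix

variable {K p n d : ℕ}

/-- The coordinatewise truncation at the level `τ`. -/
def trunc (τ : ℝ) (x : Fin d → Fin K → ℝ) : Fin d → Fin K → ℝ := fun j r => min (x j r) τ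

theorem trunc_nonneg {τ : ℝ} (hτ : 0 ≤ τ) {x : Fin d → Fin K → ℝ} (hx : ∀ j r, 0 ≤ x j r) :
    ∀ j r, 0 ≤ trunc τ x j r := fun j r => le_min (hx j r) hτ

theorem trunc_le (τ : ℝ) (x : Fin d → Fin K → ℝ) : ∀ j r, trunc τ x j r ≤ τ :=
  fun _ _ => min_le_right _ _

theorem sum_trunc_div_le {τ C : ℝ} {x : Fin d → Fin K → ℝ} {r : Fin K}
    (h : (∑ j, x j r) / d ≤ C) : (∑ j, trunc τ x j r) / d ≤ C :=
  (div_le_div_of_nonneg_right (Finset.sum_le_sum fun _ _ => min_le_left _ _)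
    (Nat.cast_nonneg d)).trans h

/-- Markov's inequality. The bound on normalized traces is what makes truncation harmless. -/
theorem card_lt_le {τ C : ℝ} (hτ : 0 < τ) (hd : 0 < d) {x : Fin d → Fin K → ℝ}
    (hx : ∀ j r, 0 ≤ x j r) {r : Fin K} (h : (∑ j, x j r) / d ≤ C) :
    ((Finset.univ.filter fun j => τ < x j r).card : ℝ) ≤ C * d / τ := by
  have hd' : (0 : ℝ) < d := by exact_mod_cast hd
  rw [le_div_iff₀ hτ]
  rw [div_le_iff₀ hd'] at h
  refine le_trans ?_ h
  rw [← nsmul_eq_mul]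
  refine (Finset.card_nsmul_le_sum _ (fun j => x j r) τ fun j hj => ?_).trans ?_
  · exact (Finset.mem_filter.1 hj).2.le
  · exact Finset.sum_le_sum_of_subset_of_nonneg (Finset.subset_univ _) fun j _ _ => hx j r

theorem trunc_eq_of_not_lt {τ : ℝ} {x : Fin d → Fin K → ℝ} {j : Fin d} {r : Fin K}
    (h : ¬ τ < x j r) : trunc τ x j r = x j r := min_eq_left (not_lt.1 h)

theorem rank_cdiag_sub_trunc_le {W : Matrix (Fin d) (Fin d) ℂ}
    (hW : W ∈ unitary (Matrix (Fin d) (Fin d) ℂ)) (f : ℝ → ℂ) (τ : ℝ) (x : Fin d → Fin K → ℝ)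
    (r : Fin K) :
    (cdiag W (fun j => f (x j r)) - cdiag W (fun j => f (trunc τ x j r))).rank ≤
      (Finset.univ.filter fun j => τ < x j r).card := by
  rw [cdiag_sub, rank_cdiag hW, Fintype.card_subtype]
  refine Finset.card_le_card fun j hj => ?_
  rw [Finset.mem_filter] at hj ⊢
  refine ⟨hj.1, ?_⟩
  by_contra h
  exact hj.2 (by rw [trunc_eq_of_not_lt h, sub_self])

theorem rank_combo_sub_combo_le (D D' : Fin K → Matrix (Fin p) (Fin p) ℂ)
    (E E' : Fin K → Matrix (Fin n) (Fin n) ℂ) (ζ : Fin K → Fin p → Fin n → ℂ) :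
    (combo D E ζ - combo D' E' ζ).rank ≤ ∑ r, ((D r - D' r).rank + (E r - E' r).rank) := by
  have h : combo D E ζ - combo D' E' ζ = ∑ r, ((D r - D' r) * (Matrix.of (ζ r) * E r) +
      D' r * Matrix.of (ζ r) * (E r - E' r)) := by
    rw [combo, combo, ← Finset.sum_sub_distrib]
    refine Finset.sum_congr rfl fun r _ => ?_
    rw [Matrix.sub_mul, Matrix.mul_sub]
    simp only [Matrix.mul_assoc]
    abel
  rw [h]
  refine (rank_sum_le _ _).trans (Finset.sum_le_sum fun r _ => ?_)
  exact (rank_add_le _ _).trans (add_le_add (Matrix.rank_mul_le_left _ _)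
    (Matrix.rank_mul_le_right _ _))

/-- Truncation alters the factors only on the eigenvectors whose eigenvalue exceeds τ, a fraction
O(1/τ) of each spectrum; hence the rank is small relative to p + n, although the norm of the
difference may be large. -/
theorem rank_modelMat_sub_trunc_le {U : Matrix (Fin p) (Fin p) ℂ} {V : Matrix (Fin n) (Fin n) ℂ}
    (hU : U ∈ unitary (Matrix (Fin p) (Fin p) ℂ)) (hV : V ∈ unitary (Matrix (Fin n) (Fin n) ℂ))
    {x : Fin p → Fin K → ℝ} {y : Fin n → Fin K → ℝ} (hx : ∀ j r, 0 ≤ x j r)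
    (hy : ∀ j r, 0 ≤ y j r) {τ C : ℝ} (hτ : 0 < τ) (hp : 0 < p) (hn : 0 < n)
    (hxC : ∀ r, (∑ j, x j r) / p ≤ C) (hyC : ∀ r, (∑ j, y j r) / n ≤ C)
    (ζ : Fin K → Fin p → Fin n → ℂ) :
    ((modelMat U V x y ζ - modelMat U V (trunc τ x) (trunc τ y) ζ).rank : ℝ) ≤
      K * (C * (p + n) / τ) := by
  have h1 := rank_combo_sub_combo_le (leftFac n U x) (leftFac n U (trunc τ x)) (rightFac V y)
    (rightFac V (trunc τ y)) ζ
  have h2 : ((modelMat U V x y ζ - modelMat U V (trunc τ x) (trunc τ y) ζ).rank : ℝ) ≤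
      ∑ r, (((leftFac n U x r - leftFac n U (trunc τ x) r).rank : ℝ) +
        (rightFac V y r - rightFac V (trunc τ y) r).rank) := by exact_mod_cast h1
  refine h2.trans ((Finset.sum_le_card_nsmul _ _ (C * (p + n) / τ) fun r _ => ?_).trans ?_)
  · have e1 := rank_cdiag_sub_trunc_le hU (fun a => ((√a / √n : ℝ) : ℂ)) τ x r
    have e2 := rank_cdiag_sub_trunc_le hV (fun a => ((√a : ℝ) : ℂ)) τ y r
    have e3 := card_lt_le hτ hp hx (hxC r)
    have e4 := card_lt_le hτ hn hy (hyC r)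
    have e5 : C * (p + n) / τ = C * p / τ + C * n / τ := by ring
    rw [e5]
    exact add_le_add ((Nat.cast_le.2 e1).trans e3) ((Nat.cast_le.2 e2).trans e4)
  · rw [Finset.card_univ, Fintype.card_fin, nsmul_eq_mul]

/-- Only points with some coordinate above τ move, each of them changing f by at most 2‖f‖; there
are at most K C d/τ of them by a union bound. -/
theorem abs_integral_emp_sub_trunc_le (f : BoundedContinuousFunction (Fin K → ℝ) ℝ) {τ C : ℝ}
    (hτ : 0 < τ) (hd : 0 < d) {x : Fin d → Fin K → ℝ} (hx : ∀ j r, 0 ≤ x j r)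
    (hC : ∀ r, (∑ j, x j r) / d ≤ C) :
    |∫ a, f a ∂(emp x) - ∫ a, f a ∂(emp (trunc τ x))| ≤ 2 * ‖f‖ * (K * (C / τ)) := by
  classical
  have hd' : (0 : ℝ) < d := by exact_mod_cast hd
  rw [integral_emp, integral_emp, ← smul_sub, ← Finset.sum_sub_distrib, smul_eq_mul, abs_mul,
    abs_inv, abs_of_pos hd', inv_mul_le_iff₀ hd']
  refine (Finset.abs_sum_le_sum_abs _ _).trans ?_
  have h1 : ∀ j ∈ Finset.univ, |f (x j) - f (trunc τ x j)| ≤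
      ∑ r, if τ < x j r then 2 * ‖f‖ else 0 := by
    intro j _
    by_cases h : ∃ r, τ < x j r
    · obtain ⟨r, hr⟩ := h
      have h2 : |f (x j) - f (trunc τ x j)| ≤ 2 * ‖f‖ := by
        have := (norm_sub_le (f (x j)) (f (trunc τ x j))).trans
          (add_le_add (f.norm_coe_le_norm _) (f.norm_coe_le_norm _))
        rw [Real.norm_eq_abs] at this
        linarith
      refine h2.trans ?_
      have h3 := Finset.single_le_sum (f := fun r => if τ < x j r then 2 * ‖f‖ else 0)
        (fun r _ => by split_ifs <;> positivity) (Finset.mem_univ r)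
      simpa [hr] using h3
    · push Not at h
      have : trunc τ x j = x j := funext fun r => min_eq_left (h r)
      rw [this, sub_self, abs_zero]
      exact Finset.sum_nonneg fun r _ => by split_ifs <;> positivity
  refine (Finset.sum_le_sum h1).trans ?_
  rw [Finset.sum_comm]
  refine (Finset.sum_le_card_nsmul _ _ (C * d / τ * (2 * ‖f‖)) fun r _ => ?_).trans
    (le_of_eq ?_)
  · rw [← Finset.sum_filter, Finset.sum_const, nsmul_eq_mul]
    exact mul_le_mul_of_nonneg_right (card_lt_le hτ hd hx (hC r)) (by positivity)
  · rw [Finset.card_univ, Fintype.card_fin, nsmul_eq_mul]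
    field_simp

/-- A slowly growing sequence of truncation levels. -/
def cutoff (n : ℕ) : ℝ := (n : ℝ) ^ (1 / 16 : ℝ)

theorem one_le_cutoff {n : ℕ} (hn : 0 < n) : 1 ≤ cutoff n :=
  Real.one_le_rpow (by exact_mod_cast hn) (by norm_num)

theorem tendsto_cutoff : Tendsto cutoff atTop atTop :=
  (tendsto_rpow_atTop (by norm_num)).comp tendsto_natCast_atTop_atTop

/-- This is the size of the error in the fixed-point equations. Any positive exponent below 1/8
would make τ⁴/√n vanish; with 1/16 the fourth moments n⁻² τ⁴ = n^{−7/4} are also summable. -/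
theorem cutoff_pow_four_div_sqrt {n : ℕ} (hn : 0 < n) :
    cutoff n ^ 4 / √n = (n : ℝ) ^ (-(1 / 4) : ℝ) := by
  have hn' : (0 : ℝ) < n := by exact_mod_cast hn
  rw [cutoff, ← Real.rpow_natCast, ← Real.rpow_mul hn'.le, Real.sqrt_eq_rpow,
    ← Real.rpow_sub hn']
  norm_num

theorem tendsto_cutoff_pow_four_div_sqrt :
    Tendsto (fun n : ℕ => cutoff n ^ 4 / √n) atTop (𝓝 0) := by
  have h := (tendsto_rpow_neg_atTop (y := 1 / 4) (by norm_num)).comp tendsto_natCast_atTop_atTop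
  refine h.congr' ?_
  filter_upwards [eventually_gt_atTop 0] with n hn
  exact (cutoff_pow_four_div_sqrt hn).symm

theorem tendsto_cutoff_pow_three_div_sqrt :
    Tendsto (fun n : ℕ => cutoff n ^ 3 / √n) atTop (𝓝 0) := by
  refine squeeze_zero' ?_ ?_ tendsto_cutoff_pow_four_div_sqrt
  · filter_upwards [eventually_gt_atTop 0] with n hn
    have := one_le_cutoff hn
    positivity
  · filter_upwards [eventually_gt_atTop 0] with n hn
    exact div_le_div_of_nonneg_right (pow_le_pow_right₀ (one_le_cutoff hn) (by norm_num))
      (Real.sqrt_nonneg _)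

end Truncation

/-! ### Limits of the mean statistics for fixed scaling matrices -/

section DeterministicLimit

open scoped Matrix

variable {Ω : Type*} [MeasurableSpace Ω] {K : ℕ}

/-- The assumptions for fixed scaling matrices, in joint eigencoordinates. -/
structure IsModel (P : Measure Ω) (c : ℝ) (H G : Measure (Fin K → ℝ)) (M C₀ : ℝ) (p : ℕ → ℕ)
    (Z : (n : ℕ) → Ω → Fin K → Fin (p n) → Fin n → ℂ)
    (U : (n : ℕ) → Matrix (Fin (p n)) (Fin (p n)) ℂ) (V : (n : ℕ) → Matrix (Fin n) (Fin n) ℂ)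
    (x : (n : ℕ) → Fin (p n) → Fin K → ℝ) (y : (n : ℕ) → Fin n → Fin K → ℝ) : Prop where
  pos : 0 < c
  ratio : Tendsto (fun n => (p n : ℝ) / n) atTop (𝓝 c)
  innov : ∀ n, IsInnovation P M (Z n)
  one_le : 1 ≤ M
  specH : IsLimitSpectrum H
  specG : IsLimitSpectrum G
  U_mem : ∀ n, U n ∈ unitary (Matrix (Fin (p n)) (Fin (p n)) ℂ)
  V_mem : ∀ n, V n ∈ unitary (Matrix (Fin n) (Fin n) ℂ)
  x_nonneg : ∀ n j r, 0 ≤ x n j r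
  y_nonneg : ∀ n j r, 0 ≤ y n j r
  convH : WeakConv (fun n => emp (x n)) H
  convG : WeakConv (fun n => emp (y n)) G
  trace_x : ∀ᶠ n in atTop, ∀ r, (∑ j, x n j r) / p n ≤ C₀
  trace_y : ∀ᶠ n in atTop, ∀ r, (∑ j, y n j r) / n ≤ C₀

variable {P : Measure Ω} {c M C₀ : ℝ} {H G : Measure (Fin K → ℝ)}
  {p : ℕ → ℕ} {Z : (n : ℕ) → Ω → Fin K → Fin (p n) → Fin n → ℂ}
  {U : (n : ℕ) → Matrix (Fin (p n)) (Fin (p n)) ℂ} {V : (n : ℕ) → Matrix (Fin n) (Fin n) ℂ}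
  {x : (n : ℕ) → Fin (p n) → Fin K → ℝ} {y : (n : ℕ) → Fin n → Fin K → ℝ}

theorem eventually_pos_of_ratio (hc : 0 < c)
    (h : Tendsto (fun n => (p n : ℝ) / n) atTop (𝓝 c)) : ∀ᶠ n in atTop, 0 < p n := by
  filter_upwards [h.eventually_const_lt hc] with n hn
  by_contra h0
  have : p n = 0 := by omega
  simp [this] at hn

theorem weakConv_trunc {p : ℕ → ℕ} {x : (n : ℕ) → Fin (p n) → Fin K → ℝ} {C : ℝ}
    (hp : ∀ᶠ n in atTop, 0 < p n) (hx : ∀ n j r, 0 ≤ x n j r)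
    (hC : ∀ᶠ n in atTop, ∀ r, (∑ j, x n j r) / p n ≤ C)
    (h : WeakConv (fun n => emp (x n)) H) :
    WeakConv (fun n => emp (trunc (cutoff n) (x n))) H := by
  intro f
  have h1 : Tendsto (fun n => ∫ a, f a ∂(emp (x n)) - ∫ a, f a ∂(emp (trunc (cutoff n) (x n))))
      atTop (𝓝 0) := by
    have h2 : Tendsto (fun n => 2 * ‖f‖ * (K * (C / cutoff n))) atTop (𝓝 0) := by
      have := ((tendsto_cutoff.const_div_atTop C).const_mul (K : ℝ)).const_mul (2 * ‖f‖)
      simpa using this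
    refine squeeze_zero_norm' ?_ h2
    filter_upwards [hp, hC, eventually_gt_atTop 0] with n hpn hCn hn
    exact abs_integral_emp_sub_trunc_le f (by linarith [one_le_cutoff hn]) hpn (hx n) hCn
  have h3 := (h f).sub h1
  simpa using h3

/-- The mean of `leftStat` after truncation. -/
def leftMean (P : Measure Ω) (Z : (n : ℕ) → Ω → Fin K → Fin (p n) → Fin n → ℂ)
    (U : (n : ℕ) → Matrix (Fin (p n)) (Fin (p n)) ℂ) (V : (n : ℕ) → Matrix (Fin n) (Fin n) ℂ)
    (x : (n : ℕ) → Fin (p n) → Fin K → ℝ) (y : (n : ℕ) → Fin n → Fin K → ℝ) (z : ℂ) (n : ℕ) :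
    Fin K → ℂ := fun r =>
  ∫ ω, leftStat (U n) (V n) (trunc (cutoff n) (x n)) (trunc (cutoff n) (y n)) z r (Z n ω) ∂P

/-- The mean of `rightStat` after truncation. -/
def rightMean (P : Measure Ω) (Z : (n : ℕ) → Ω → Fin K → Fin (p n) → Fin n → ℂ)
    (U : (n : ℕ) → Matrix (Fin (p n)) (Fin (p n)) ℂ) (V : (n : ℕ) → Matrix (Fin n) (Fin n) ℂ)
    (x : (n : ℕ) → Fin (p n) → Fin K → ℝ) (y : (n : ℕ) → Fin n → Fin K → ℝ) (z : ℂ) (n : ℕ) :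
    Fin K → ℂ := fun r =>
  ∫ ω, rightStat (U n) (V n) (trunc (cutoff n) (x n)) (trunc (cutoff n) (y n)) z r (Z n ω) ∂P

namespace IsModel

theorem eventually_pos (h : IsModel P c H G M C₀ p Z U V x y) : ∀ᶠ n in atTop, 0 < p n :=
  eventually_pos_of_ratio h.pos h.ratio

variable [IsProbabilityMeasure P]

theorem eventually_leftMean (h : IsModel P c H G M C₀ p Z U V x y) {z : ℂ} (hz : 0 < z.im) :
    ∀ᶠ n in atTop, ∀ r, IsHalfPlaneStat (leftMean P Z U V x y z n r) z C₀ := by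
  filter_upwards [h.trace_x, eventually_gt_atTop 0] with n hn h0 r
  exact IsHalfPlaneStat.integral (integrable_leftStat (h.innov n).meas hz r) fun ω =>
    isHalfPlaneStat_leftStat (h.U_mem n) (trunc_nonneg (by linarith [one_le_cutoff h0])
      (h.x_nonneg n)) (sum_trunc_div_le (hn r)) hz _

theorem eventually_rightMean (h : IsModel P c H G M C₀ p Z U V x y) {z : ℂ} (hz : 0 < z.im) :
    ∀ᶠ n in atTop, ∀ r, IsHalfPlaneStat (rightMean P Z U V x y z n r) z C₀ := by
  filter_upwards [h.trace_y, eventually_gt_atTop 0] with n hn h0 r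
  exact IsHalfPlaneStat.integral (integrable_rightStat (h.innov n).meas hz r) fun ω =>
    isHalfPlaneStat_rightStat (h.V_mem n) (trunc_nonneg (by linarith [one_le_cutoff h0])
      (h.y_nonneg n)) (sum_trunc_div_le (hn r)) hz _

theorem tendsto_leftMean_sub (h : IsModel P c H G M C₀ p Z U V x y) {z : ℂ} (hz : 0 < z.im)
    (r : Fin K) : Tendsto (fun n => leftMean P Z U V x y z n r -
      opO z (rightMean P Z U V x y z n) (emp (trunc (cutoff n) (x n))) r) atTop (𝓝 0) := by
  obtain ⟨w, hw, rfl⟩ := exists_sq_eq_im_pos hz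
  have h2 : Tendsto (fun n : ℕ => loopConst K M w * 2 * ((w ^ 2).im⁻¹ * (cutoff n ^ 4 / √n)))
      atTop (𝓝 0) := by
    have := (tendsto_cutoff_pow_four_div_sqrt.const_mul (w ^ 2).im⁻¹).const_mul
      (loopConst K M w * 2)
    simpa using this
  refine squeeze_zero_norm' ?_ h2
  filter_upwards [h.eventually_pos, eventually_gt_atTop 0] with n hp hn
  have hτ := one_le_cutoff hn
  have hn' : (n : ℝ) ≠ 0 := by exact_mod_cast hn.ne'
  refine ((h.innov n).norm_leftStat_sub_opO_le h.one_le hn hp (h.U_mem n) (h.V_mem n) hτ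
    (trunc_nonneg (by linarith) (h.x_nonneg n)) (trunc_nonneg (by linarith) (h.y_nonneg n))
    (trunc_le _ _) (trunc_le _ _) hw hz r).trans (le_of_eq ?_)
  rw [div_self hn']
  ring

theorem tendsto_rightMean_sub (h : IsModel P c H G M C₀ p Z U V x y) {z : ℂ} (hz : 0 < z.im)
    (r : Fin K) : Tendsto (fun n => rightMean P Z U V x y z n r -
      opO z ((((p n : ℝ) / n : ℝ) : ℂ) • leftMean P Z U V x y z n)
        (emp (trunc (cutoff n) (y n))) r) atTop (𝓝 0) := by
  obtain ⟨w, hw, rfl⟩ := exists_sq_eq_im_pos hz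
  have h2 : Tendsto (fun n : ℕ => loopConst K M w * (1 + p n / n) *
      ((w ^ 2).im⁻¹ * (cutoff n ^ 4 / √n))) atTop (𝓝 0) := by
    have := ((h.ratio.const_add 1).const_mul (loopConst K M w)).mul
      (tendsto_cutoff_pow_four_div_sqrt.const_mul (w ^ 2).im⁻¹)
    simpa using this
  refine squeeze_zero_norm' ?_ h2
  filter_upwards [h.eventually_pos, eventually_gt_atTop 0] with n hp hn
  have hτ := one_le_cutoff hn
  refine ((h.innov n).norm_rightStat_sub_opO_le h.one_le hn hp (h.U_mem n) (h.V_mem n) hτ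
    (trunc_nonneg (by linarith) (h.x_nonneg n)) (trunc_nonneg (by linarith) (h.y_nonneg n))
    (trunc_le _ _) (trunc_le _ _) hw hz r).trans (le_of_eq ?_)
  ring

theorem isFixedPair_of_ultrafilter (h : IsModel P c H G M C₀ p Z U V x y) {z : ℂ} (hz : 0 < z.im)
    {𝒰 : Ultrafilter ℕ} (h𝒰 : (𝒰 : Filter ℕ) ≤ atTop) {h₀ g₀ : Fin K → ℂ}
    (hh : Tendsto (leftMean P Z U V x y z) 𝒰 (𝓝 h₀))
    (hg : Tendsto (rightMean P Z U V x y z) 𝒰 (𝓝 g₀)) : IsFixedPair z c H G h₀ g₀ := by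
  have hl := h.eventually_leftMean hz
  have hr := h.eventually_rightMean hz
  refine isFixedPair_of_tendsto (l := (𝒰 : Filter ℕ)) h.pos hz h.specH h.specG
    (μ := fun n => emp (trunc (cutoff n) (x n))) (ν := fun n => emp (trunc (cutoff n) (y n)))
    (cs := fun n => (p n : ℝ) / n) (h𝒰 ?_) (h𝒰 ?_)
    (fun f => (weakConv_trunc h.eventually_pos h.x_nonneg h.trace_x h.convH f).mono_left h𝒰)
    (fun f => (weakConv_trunc (eventually_gt_atTop 0) h.y_nonneg h.trace_y h.convG f).mono_left
      h𝒰) (h.ratio.mono_left h𝒰) hh hg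
    (h𝒰 (hl.mono fun n hn r => (hn r).im_nonneg)) (h𝒰 (hr.mono fun n hn r => (hn r).im_nonneg))
    (h𝒰 (hl.mono fun n hn r => (hn r).mul_im_nonneg))
    (h𝒰 (hr.mono fun n hn r => (hn r).mul_im_nonneg))
    (fun r => (h.tendsto_leftMean_sub hz r).mono_left h𝒰)
    (fun r => (h.tendsto_rightMean_sub hz r).mono_left h𝒰)
  · filter_upwards [h.eventually_pos, eventually_gt_atTop 0] with n hp hn
    exact isOrthantLaw_emp hp.ne' (trunc_nonneg (by linarith [one_le_cutoff hn]) (h.x_nonneg n))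
  · filter_upwards [eventually_gt_atTop 0] with n hn
    exact isOrthantLaw_emp hn.ne' (trunc_nonneg (by linarith [one_le_cutoff hn]) (h.y_nonneg n))

/-- For fixed scaling matrices the means converge to the solution of the fixed-point equations. -/
theorem exists_isFixedPair (h : IsModel P c H G M C₀ p Z U V x y) {z : ℂ} (hz : 0 < z.im) :
    ∃ h₀ g₀, IsFixedPair z c H G h₀ g₀ ∧ Tendsto (leftMean P Z U V x y z) atTop (𝓝 h₀) ∧
      Tendsto (rightMean P Z U V x y z) atTop (𝓝 g₀) := by
  set u : ℕ → (Fin K → ℂ) × (Fin K → ℂ) := fun n =>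
    (leftMean P Z U V x y z n, rightMean P Z U V x y z n) with hu
  set S : Set ((Fin K → ℂ) × (Fin K → ℂ)) := Metric.closedBall 0 (max (C₀ / z.im) 0)
  have hS : IsCompact S := isCompact_closedBall _ _
  have huS : ∀ᶠ n in atTop, u n ∈ S := by
    filter_upwards [h.eventually_leftMean hz, h.eventually_rightMean hz] with n h1 h2
    rw [mem_closedBall_zero_iff, Prod.norm_def]
    exact max_le
      ((pi_norm_le_iff_of_nonneg (le_max_right _ _)).2 fun r =>
        (h1 r).norm_le.trans (le_max_left _ _))
      ((pi_norm_le_iff_of_nonneg (le_max_right _ _)).2 fun r =>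
        (h2 r).norm_le.trans (le_max_left _ _))
  -- Every limit of the pair of means along an ultrafilter solves the exact equations.
  have key : ∀ (𝒰 : Ultrafilter ℕ), (𝒰 : Filter ℕ) ≤ atTop → ∀ q, Tendsto u 𝒰 (𝓝 q) →
      IsFixedPair z c H G q.1 q.2 := fun 𝒰 h𝒰 q hq =>
    h.isFixedPair_of_ultrafilter hz h𝒰 ((continuous_fst.tendsto _).comp hq)
      ((continuous_snd.tendsto _).comp hq)
  obtain ⟨q, -, hq⟩ := hS.ultrafilter_le_nhds ((Ultrafilter.of atTop).map u)
    (le_principal_iff.2 (Ultrafilter.of_le atTop huS))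
  have hqf := key _ (Ultrafilter.of_le atTop) q hq
  -- Uniqueness of the fixed pair leaves a single cluster point in a compact set, so the whole
  -- sequence converges.
  have hlim : Tendsto u atTop (𝓝 q) := by
    refine hS.tendsto_nhds_of_unique_mapClusterPt huS fun q' _ hq' => ?_
    obtain ⟨𝒰, h𝒰, hq''⟩ := mapClusterPt_iff_ultrafilter.1 hq'
    have := (key 𝒰 h𝒰 q' hq'').unique h.pos hz h.specH h.specG hqf
    exact Prod.ext this.1 this.2
  exact ⟨q.1, q.2, hqf, (continuous_fst.tendsto _).comp hlim, (continuous_snd.tendsto _).comp hlim⟩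

/-- Convergence of the mean Stieltjes transform, without truncation. -/
theorem tendsto_mean_trace (h : IsModel P c H G M C₀ p Z U V x y) {z : ℂ} (hz : 0 < z.im)
    {h₀ g₀ : Fin K → ℂ} (hh : Tendsto (leftMean P Z U V x y z) atTop (𝓝 h₀))
    (hg : Tendsto (rightMean P Z U V x y z) atTop (𝓝 g₀)) :
    Tendsto (fun n => ((p n : ℂ))⁻¹ * ∫ ω, (resolv (modelMat (U n) (V n) (x n) (y n) (Z n ω) *
      (modelMat (U n) (V n) (x n) (y n) (Z n ω))ᴴ) z).trace ∂P) atTop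
      (𝓝 (-z⁻¹ - ∑ r, h₀ r * g₀ r)) := by
  obtain ⟨w, hw, rfl⟩ := exists_sq_eq_im_pos hz
  have hw0 : 0 < ‖w‖ := norm_pos_iff.2 (ne_zero_of_im_pos hw)
  have hz0 := ne_zero_of_im_pos hz
  set s : ℕ → ℂ := fun n => ((p n : ℂ))⁻¹ * ∫ ω, (resolv (modelMat (U n) (V n) (x n) (y n) (Z n ω) *
      (modelMat (U n) (V n) (x n) (y n) (Z n ω))ᴴ) (w ^ 2)).trace ∂P
  set s' : ℕ → ℂ := fun n => ((p n : ℂ))⁻¹ * ∫ ω, (resolv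
    (modelMat (U n) (V n) (trunc (cutoff n) (x n)) (trunc (cutoff n) (y n)) (Z n ω) *
      (modelMat (U n) (V n) (trunc (cutoff n) (x n)) (trunc (cutoff n) (y n)) (Z n ω))ᴴ) (w ^ 2)).trace ∂P
  have hs' : Tendsto s' atTop (𝓝 (-(w ^ 2)⁻¹ - ∑ r, h₀ r * g₀ r)) := by
    have h2 : Tendsto (fun n : ℕ => loopConst K M w * 2 * (1 * (cutoff n ^ 3 / √n)))
        atTop (𝓝 0) := by
      have := (tendsto_cutoff_pow_three_div_sqrt.const_mul 1).const_mul (loopConst K M w * 2)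
      simpa using this
    have h3 : Tendsto (fun n => 1 + w ^ 2 * (s' n + ∑ r, leftMean P Z U V x y (w ^ 2) n r *
        rightMean P Z U V x y (w ^ 2) n r)) atTop (𝓝 0) := by
      refine squeeze_zero_norm' ?_ h2
      filter_upwards [h.eventually_pos, eventually_gt_atTop 0] with n hp hn
      have hτ := one_le_cutoff hn
      have hn' : (n : ℝ) ≠ 0 := by exact_mod_cast hn.ne'
      refine ((h.innov n).norm_trace_resolv_add_le h.one_le hn hp (h.U_mem n) (h.V_mem n) hτ
        (trunc_nonneg (by linarith) (h.x_nonneg n)) (trunc_nonneg (by linarith) (h.y_nonneg n))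
        (trunc_le _ _) (trunc_le _ _) hw hz).trans (le_of_eq ?_)
      rw [div_self hn']
      ring
    have h4 : Tendsto (fun n => ∑ r, leftMean P Z U V x y (w ^ 2) n r *
        rightMean P Z U V x y (w ^ 2) n r) atTop (𝓝 (∑ r, h₀ r * g₀ r)) :=
      tendsto_finsetSum _ fun r _ => (((continuous_apply r).tendsto _).comp hh).mul
        (((continuous_apply r).tendsto _).comp hg)
    have h5 := (((h3.sub_const 1).const_mul (w ^ 2)⁻¹).sub h4)
    have e : (w ^ 2)⁻¹ * (0 - 1) - ∑ r, h₀ r * g₀ r = -(w ^ 2)⁻¹ - ∑ r, h₀ r * g₀ r := by ring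
    rw [e] at h5
    refine h5.congr fun n => ?_
    rw [add_sub_cancel_left, inv_mul_cancel_left₀ hz0, add_sub_cancel_right]
  -- The truncation is undone: a perturbation of rank O((p + n)/τ) moves the normalized trace by
  -- O((1 + n/p)/τ).
  have hd : Tendsto (fun n => s n - s' n) atTop (𝓝 0) := by
    have h2 : Tendsto (fun n : ℕ => ‖w‖⁻¹ * (4 * (K * (C₀ * (1 + ((p n : ℝ) / n)⁻¹) / cutoff n)) /
        w.im)) atTop (𝓝 0) := by
      have h6 : Tendsto (fun n : ℕ => C₀ * (1 + ((p n : ℝ) / n)⁻¹) / cutoff n) atTop (𝓝 0) :=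
        (((h.ratio.inv₀ h.pos.ne').const_add 1).const_mul C₀).div_atTop tendsto_cutoff
      have := (((h6.const_mul (K : ℝ)).const_mul 4).div_const w.im).const_mul ‖w‖⁻¹
      simpa using this
    refine squeeze_zero_norm' ?_ h2
    filter_upwards [h.eventually_pos, eventually_gt_atTop 0, h.trace_x, h.trace_y] with n hp hn hx hy
    have hτ : 0 < cutoff n := by linarith [one_le_cutoff hn]
    have hp' : (0 : ℝ) < p n := by exact_mod_cast hp
    have hn' : (0 : ℝ) < n := by exact_mod_cast hn
    have it : ∀ (x' : Fin (p n) → Fin K → ℝ) (y' : Fin n → Fin K → ℝ),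
        Integrable (fun ω => (resolv (modelMat (U n) (V n) x' y' (Z n ω) *
          (modelMat (U n) (V n) x' y' (Z n ω))ᴴ) (w ^ 2)).trace) P := by
      intro x' y'
      have := integrable_trace_resolv (P := P) (D := leftFac n (U n) x') (E := rightFac (V n) y')
        (h.innov n).meas 1 hz
      simp only [Matrix.one_mul] at this
      exact this
    rw [← mul_sub, ← integral_sub (it _ _) (it _ _), norm_mul, norm_inv, Complex.norm_natCast]
    have hb : ∀ ω, ‖(resolv (modelMat (U n) (V n) (x n) (y n) (Z n ω) *
          (modelMat (U n) (V n) (x n) (y n) (Z n ω))ᴴ) (w ^ 2)).trace - (resolv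
        (modelMat (U n) (V n) (trunc (cutoff n) (x n)) (trunc (cutoff n) (y n)) (Z n ω) *
        (modelMat (U n) (V n) (trunc (cutoff n) (x n)) (trunc (cutoff n) (y n)) (Z n ω))ᴴ)
          (w ^ 2)).trace‖ ≤ ‖w‖⁻¹ * (4 * (K * (C₀ * (p n + n) / cutoff n)) / w.im) := by
      intro ω
      refine (norm_trace_resolv_sub_le _ _ hw hz).trans ?_
      have := rank_modelMat_sub_trunc_le (h.U_mem n) (h.V_mem n) (h.x_nonneg n) (h.y_nonneg n) hτ hp
        hn hx hy (Z n ω)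
      gcongr
    have hb' := norm_integral_le_of_norm_le_const (μ := P) (ae_of_all _ hb)
    rw [probReal_univ, mul_one] at hb'
    refine (mul_le_mul_of_nonneg_left hb' (by positivity)).trans (le_of_eq ?_)
    rw [inv_div]
    field_simp
  have := hd.add hs'
  simpa using this

end IsModel

end DeterministicLimit

/-! ### From fourth moments to almost sure convergence -/

section AlmostSure

open scoped Matrix.Norms.L2Operator Matrix

variable {Ω : Type*} [MeasurableSpace Ω] {P : Measure Ω}

/-- Summable fourth moments imply almost sure convergence. -/
theorem ae_tendsto_zero_of_summable {X : ℕ → Ω → ℂ} (hX : ∀ n, Measurable (X n)) {a : ℕ → ℝ}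
    (ha : Summable a) (ha0 : ∀ n, 0 ≤ a n)
    (h : ∀ᶠ n in atTop, ∫⁻ ω, ‖X n ω‖ₑ ^ 4 ∂P ≤ ENNReal.ofReal (a n)) :
    ∀ᵐ ω ∂P, Tendsto (fun n => X n ω) atTop (𝓝 0) := by
  obtain ⟨N, hN⟩ := eventually_atTop.1 h
  have hm : ∀ n, Measurable fun ω => ‖X (n + N) ω‖ₑ ^ 4 := fun n => (hX _).enorm.pow_const 4
  have h1 : ∫⁻ ω, ∑' n, ‖X (n + N) ω‖ₑ ^ 4 ∂P ≠ ⊤ := by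
    rw [lintegral_tsum fun n => (hm n).aemeasurable]
    refine ne_top_of_le_ne_top ?_ (ENNReal.tsum_le_tsum fun n => hN (n + N) (Nat.le_add_left _ _))
    have hs : Summable fun n => a (n + N) := (summable_nat_add_iff N).2 ha
    rw [← ENNReal.ofReal_tsum_of_nonneg (fun n => ha0 _) hs]
    exact ENNReal.ofReal_ne_top
  filter_upwards [ae_lt_top (Measurable.tsum hm) h1] with ω hω
  have h2 := ENNReal.tendsto_atTop_zero_of_tsum_ne_top hω.ne
  rw [← tendsto_add_atTop_iff_nat N]
  have h3 : Tendsto (fun n => ‖X (n + N) ω‖ ^ 4) atTop (𝓝 0) := by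
    have h4 := (ENNReal.tendsto_toReal ENNReal.zero_ne_top).comp h2
    refine h4.congr fun n => ?_
    simp
  rw [tendsto_zero_iff_norm_tendsto_zero]
  have h5 := h3.rpow_const (p := 1 / 4) (Or.inr (by norm_num))
  rw [Real.zero_rpow (by norm_num)] at h5
  refine h5.congr fun n => ?_
  rw [← Real.rpow_natCast, ← Real.rpow_mul (norm_nonneg _)]
  norm_num

theorem lintegral_enorm_pow_four_le {X : Ω → ℂ} {b : ℝ}
    (hi : Integrable (fun ω => ‖X ω‖ ^ 4) P) (h : ∫ ω, ‖X ω‖ ^ 4 ∂P ≤ b) :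
    ∫⁻ ω, ‖X ω‖ₑ ^ 4 ∂P ≤ ENNReal.ofReal b := by
  have h1 : ∫⁻ ω, ‖X ω‖ₑ ^ 4 ∂P = ENNReal.ofReal (∫ ω, ‖X ω‖ ^ 4 ∂P) := by
    rw [ofReal_integral_eq_lintegral_ofReal hi (ae_of_all _ fun ω => by positivity)]
    refine lintegral_congr fun ω => ?_
    rw [ENNReal.ofReal_pow (norm_nonneg _), ofReal_norm]
  rw [h1]
  exact ENNReal.ofReal_le_ofReal h

/-- A sequence dominating the fourth moments of normalized statistics. -/
theorem eventually_moment_le {p : ℕ → ℕ} {c : ℝ} (hc : 0 < c)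
    (hp : Tendsto (fun n => (p n : ℝ) / n) atTop (𝓝 c)) (C : ℝ) :
    ∃ a : ℕ → ℝ, Summable a ∧ (∀ n, 0 ≤ a n) ∧ ∀ᶠ n in atTop,
      ((p n : ℝ)⁻¹) ^ 4 * (384 * (n ^ 2 * (C * cutoff n) ^ 4)) ≤ a n ∧
      ((n : ℝ)⁻¹) ^ 4 * (384 * (n ^ 2 * (C * cutoff n) ^ 4)) ≤ a n := by
  -- The exponent is −4 + 2 + 4/16 = −7/4. The factor (c/2)⁻⁴ comes from p ≥ cn/2, valid eventually,
  -- and the summand 1 serves the normalization by n.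
  refine ⟨fun n => (((c / 2)⁻¹) ^ 4 + 1) * (384 * C ^ 4) * (n : ℝ) ^ (-(7 / 4) : ℝ),
    (Real.summable_nat_rpow.2 (by norm_num)).mul_left _, fun n => by positivity, ?_⟩
  filter_upwards [hp.eventually_const_lt (show c / 2 < c by linarith), eventually_gt_atTop 0]
    with n h1 hn
  have hn' : (0 : ℝ) < n := by exact_mod_cast hn
  have hp' : 0 < (c / 2) * n := by positivity
  have h2 : (c / 2) * n ≤ p n := by
    rw [lt_div_iff₀ hn'] at h1
    exact h1.le
  have e1 : (n : ℝ) ^ (-(7 / 4) : ℝ) = ((n : ℝ)⁻¹) ^ 4 * (n ^ 2 * cutoff n ^ 4) := by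
    have f1 : cutoff n ^ 4 = (n : ℝ) ^ (1 / 4 : ℝ) := by
      rw [cutoff, ← Real.rpow_natCast, ← Real.rpow_mul hn'.le]
      norm_num
    have f2 : ((n : ℝ)⁻¹) ^ 4 * n ^ 2 = (n : ℝ) ^ (-2 : ℝ) := by
      rw [Real.rpow_neg hn'.le, Real.rpow_ofNat]
      field_simp
    rw [← mul_assoc, f1, f2, ← Real.rpow_add hn']
    norm_num
  have hcut : 0 ≤ cutoff n ^ 4 := by positivity
  rw [e1]
  have e2 : ((p n : ℝ)⁻¹) ^ 4 ≤ ((c / 2)⁻¹) ^ 4 * ((n : ℝ)⁻¹) ^ 4 := by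
    rw [← mul_pow, ← mul_inv]
    exact pow_le_pow_left₀ (by positivity) (inv_anti₀ hp' h2) 4
  constructor
  · calc ((p n : ℝ)⁻¹) ^ 4 * (384 * (n ^ 2 * (C * cutoff n) ^ 4))
        ≤ (((c / 2)⁻¹) ^ 4 * ((n : ℝ)⁻¹) ^ 4) * (384 * (n ^ 2 * (C * cutoff n) ^ 4)) := by gcongr
      _ = ((c / 2)⁻¹) ^ 4 * (384 * C ^ 4) * (((n : ℝ)⁻¹) ^ 4 * (n ^ 2 * cutoff n ^ 4)) := by ring
      _ ≤ _ := by
        gcongr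
        linarith
  · calc ((n : ℝ)⁻¹) ^ 4 * (384 * (n ^ 2 * (C * cutoff n) ^ 4))
        = 1 * (384 * C ^ 4) * (((n : ℝ)⁻¹) ^ 4 * (n ^ 2 * cutoff n ^ 4)) := by ring
      _ ≤ _ := by
        gcongr
        have : 0 ≤ ((c / 2)⁻¹) ^ 4 := by positivity
        linarith

/-- Normalized traces against the resolvent are Stieltjes transforms. -/
theorem exists_stieltjes_eq_normalized_trace {d : ℕ} {A S : Matrix (Fin d) (Fin d) ℂ}
    (hA : A.PosSemidef) (hS : S.PosSemidef) :
    ∃ μ : Measure ℝ, IsFiniteMeasure μ ∧ μ (Set.Ici 0)ᶜ = 0 ∧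
      μ.real Set.univ = A.trace.re / d ∧
      ∀ z : ℂ, 0 < z.im → (d : ℂ)⁻¹ * (A * resolv S z).trace = stieltjes μ z := by
  obtain ⟨μ, hμ, hμ0, hμ1, h⟩ := exists_stieltjes_eq_trace hA hS
  refine ⟨ENNReal.ofReal (d : ℝ)⁻¹ • μ, Measure.smul_finite _ ENNReal.ofReal_ne_top, ?_, ?_, ?_⟩
  · rw [Measure.smul_apply, hμ0, smul_zero]
  · rw [measureReal_ennreal_smul_apply, hμ1, ENNReal.toReal_ofReal (by positivity), div_eq_inv_mul]
  · intro z hz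
    rw [h z hz, stieltjes, stieltjes, integral_smul_measure, ENNReal.toReal_ofReal (by positivity),
      Complex.real_smul]
    push_cast
    rfl

theorem norm_normalized_trace_sub_le {d : ℕ} {A S : Matrix (Fin d) (Fin d) ℂ}
    (hA : A.PosSemidef) (hS : S.PosSemidef) {C : ℝ} (hC : A.trace.re / d ≤ C) {z z' : ℂ}
    (hz : 0 < z.im) (hz' : 0 < z'.im) :
    ‖(d : ℂ)⁻¹ * (A * resolv S z).trace - (d : ℂ)⁻¹ * (A * resolv S z').trace‖ ≤
      C * (‖z - z'‖ / (z.im * z'.im)) := by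
  obtain ⟨μ, hμ, hμ0, hμ1, h⟩ := exists_stieltjes_eq_normalized_trace hA hS
  rw [h z hz, h z' hz']
  refine (norm_stieltjes_sub_le μ hz hz').trans ?_
  rw [hμ1]
  exact mul_le_mul_of_nonneg_right hC (by positivity)

theorem norm_sub_integral_sub_le [IsProbabilityMeasure P] {X X' : Ω → ℂ} (hX : Integrable X P)
    (hX' : Integrable X' P) {b : ℝ} (h : ∀ ω, ‖X ω - X' ω‖ ≤ b) (ω : Ω) :
    ‖(X ω - ∫ ω', X ω' ∂P) - (X' ω - ∫ ω', X' ω' ∂P)‖ ≤ 2 * b := by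
  have h1 : ‖∫ ω', (X ω' - X' ω') ∂P‖ ≤ b := by
    refine (norm_integral_le_of_norm_le_const (ae_of_all _ h)).trans ?_
    simp
  rw [integral_sub hX hX'] at h1
  have e : (X ω - ∫ ω', X ω' ∂P) - (X' ω - ∫ ω', X' ω' ∂P) =
      (X ω - X' ω) - ((∫ ω', X ω' ∂P) - ∫ ω', X' ω' ∂P) := by ring
  rw [e]
  refine (norm_sub_le _ _).trans ?_
  linarith [h ω]

variable [IsProbabilityMeasure P] {K : ℕ}

theorem lintegral_stat_pow_four_le {p n : ℕ} {Z : Ω → Fin K → Fin p → Fin n → ℂ}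
    (hZ : Measurable Z)
    (hind : iIndepFun (fun (e : Fin K × Fin p × Fin n) ω => Z ω e.1 e.2.1 e.2.2) P) (hn : 0 < n)
    (D : Fin K → Matrix (Fin p) (Fin p) ℂ) (E : Fin K → Matrix (Fin n) (Fin n) ℂ)
    {T : Matrix (Fin p ⊕ Fin n) (Fin p ⊕ Fin n) ℂ} {t : ℝ} (ht : 0 < t) (hT : ‖T‖ ≤ t) {w : ℂ}
    (hw : 0 < w.im) (d : ℕ) :
    ∫⁻ ω, ‖(d : ℂ)⁻¹ * (w⁻¹ * (T * resolv (herm (combo D E (Z ω))) w).trace) -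
      ∫ ω', (d : ℂ)⁻¹ * (w⁻¹ * (T * resolv (herm (combo D E (Z ω'))) w).trace) ∂P‖ₑ ^ 4 ∂P ≤
      ENNReal.ofReal ((d : ℝ)⁻¹ ^ 4 * (384 * (n ^ 2 * (4 * (K + 1) / (‖w‖ * w.im) * t) ^ 4))) := by
  have hm : Measurable fun ω => w⁻¹ * (T * resolv (herm (combo D E (Z ω))) w).trace :=
    (measurable_trace_mul_resolv_herm D E).comp hZ
  refine lintegral_enorm_pow_four_le ?_ ?_
  · refine Integrable.of_bound (((hm.const_mul _).sub_const _).norm.pow_const 4).aestronglyMeasurable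
      (((d : ℝ)⁻¹ * (‖w‖⁻¹ * ((p + n) * (t * w.im⁻¹))) +
      ‖∫ ω', (d : ℂ)⁻¹ * (w⁻¹ * (T * resolv (herm (combo D E (Z ω'))) w).trace) ∂P‖) ^ 4)
      (ae_of_all _ fun ω => ?_)
    rw [Real.norm_of_nonneg (by positivity)]
    refine pow_le_pow_left₀ (norm_nonneg _) ((norm_sub_le _ _).trans (add_le_add ?_ le_rfl)) 4
    rw [norm_mul, norm_inv, Complex.norm_natCast]
    exact mul_le_mul_of_nonneg_left (norm_trace_mul_resolv_herm_le hT hw _) (by positivity)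
  · have e : ∀ f : Ω → ℂ, ∫ ω, ‖(d : ℂ)⁻¹ * f ω - ∫ ω', (d : ℂ)⁻¹ * f ω' ∂P‖ ^ 4 ∂P =
        (d : ℝ)⁻¹ ^ 4 * ∫ ω, ‖f ω - ∫ ω', f ω' ∂P‖ ^ 4 ∂P := by
      intro f
      simp only [integral_const_mul, ← mul_sub, norm_mul, mul_pow, norm_inv, Complex.norm_natCast]
    rw [e fun ω => w⁻¹ * (T * resolv (herm (combo D E (Z ω))) w).trace]
    refine mul_le_mul_of_nonneg_left ?_ (by positivity)
    refine (integral_norm_pow_four_trace_le hZ hind hn D E ht hT hw).trans (le_of_eq ?_)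
    ring

end AlmostSure

/-! ### The fixed pair consists of Stieltjes transforms -/

section StieltjesSolution

open scoped Matrix.Norms.L2Operator Matrix

variable {Ω : Type*} [MeasurableSpace Ω] {K : ℕ} {P : Measure Ω} [IsProbabilityMeasure P]
  {c M C₀ : ℝ} {H G : Measure (Fin K → ℝ)}
  {p : ℕ → ℕ} {Z : (n : ℕ) → Ω → Fin K → Fin (p n) → Fin n → ℂ}
  {U : (n : ℕ) → Matrix (Fin (p n)) (Fin (p n)) ℂ} {V : (n : ℕ) → Matrix (Fin n) (Fin n) ℂ}
  {x : (n : ℕ) → Fin (p n) → Fin K → ℝ} {y : (n : ℕ) → Fin n → Fin K → ℝ}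

theorem cutoff_nonneg (n : ℕ) : 0 ≤ cutoff n := Real.rpow_nonneg (Nat.cast_nonneg n) _

namespace IsModel

theorem ae_tendsto_leftStat (h : IsModel P c H G M C₀ p Z U V x y) {z : ℂ} (hz : 0 < z.im)
    (r : Fin K) : ∀ᵐ ω ∂P, Tendsto (fun n => leftStat (U n) (V n) (trunc (cutoff n) (x n))
      (trunc (cutoff n) (y n)) z r (Z n ω) - leftMean P Z U V x y z n r) atTop (𝓝 0) := by
  obtain ⟨w, hw, rfl⟩ := exists_sq_eq_im_pos hz
  obtain ⟨a, ha, ha0, hae⟩ := eventually_moment_le h.pos h.ratio (4 * (K + 1) / (‖w‖ * w.im))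
  refine ae_tendsto_zero_of_summable (fun n => ?_) ha ha0 ?_
  · exact ((measurable_trace_resolv (h.innov n).meas _ _).const_mul _).sub_const _
  · filter_upwards [hae, eventually_gt_atTop 0] with n hn hn0
    have hτ : 0 < cutoff n := by linarith [one_le_cutoff hn0]
    have hT : ‖cdiag (U n) fun j => (trunc (cutoff n) (x n) j r : ℂ)‖ ≤ cutoff n := by
      refine norm_cdiag_le (h.U_mem n) hτ.le fun j => ?_
      rw [Complex.norm_real, Real.norm_of_nonneg (trunc_nonneg hτ.le (h.x_nonneg n) j r)]
      exact trunc_le _ _ j r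
    refine le_trans (le_of_eq ?_) ((lintegral_stat_pow_four_le (h.innov n).meas (h.innov n).indep hn0
      (leftFac n (U n) (trunc (cutoff n) (x n))) (rightFac (V n) (trunc (cutoff n) (y n))) hτ
      ((norm_mul_mul_conjTranspose_le norm_inlMat_le norm_inlMat_le _).trans hT) hw (p n)).trans
      (ENNReal.ofReal_le_ofReal hn.1))
    simp only [leftMean, leftStat, trace_mul_resolv_eq _ _ hw hz, modelMat]

theorem ae_tendsto_rightStat (h : IsModel P c H G M C₀ p Z U V x y) {z : ℂ} (hz : 0 < z.im)
    (r : Fin K) : ∀ᵐ ω ∂P, Tendsto (fun n => rightStat (U n) (V n) (trunc (cutoff n) (x n))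
      (trunc (cutoff n) (y n)) z r (Z n ω) - rightMean P Z U V x y z n r) atTop (𝓝 0) := by
  obtain ⟨w, hw, rfl⟩ := exists_sq_eq_im_pos hz
  obtain ⟨a, ha, ha0, hae⟩ := eventually_moment_le h.pos h.ratio (4 * (K + 1) / (‖w‖ * w.im))
  refine ae_tendsto_zero_of_summable (fun n => ?_) ha ha0 ?_
  · exact ((measurable_trace_dual_resolv (h.innov n).meas _ _).const_mul _).sub_const _
  · filter_upwards [hae, eventually_gt_atTop 0] with n hn hn0
    have hτ : 0 < cutoff n := by linarith [one_le_cutoff hn0]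
    have hT : ‖cdiag (V n) fun j => (trunc (cutoff n) (y n) j r : ℂ)‖ ≤ cutoff n := by
      refine norm_cdiag_le (h.V_mem n) hτ.le fun j => ?_
      rw [Complex.norm_real, Real.norm_of_nonneg (trunc_nonneg hτ.le (h.y_nonneg n) j r)]
      exact trunc_le _ _ j r
    refine le_trans (le_of_eq ?_) ((lintegral_stat_pow_four_le (h.innov n).meas (h.innov n).indep hn0
      (leftFac n (U n) (trunc (cutoff n) (x n))) (rightFac (V n) (trunc (cutoff n) (y n))) hτ
      ((norm_mul_mul_conjTranspose_le norm_inrMat_le norm_inrMat_le _).trans hT) hw n).trans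
      (ENNReal.ofReal_le_ofReal hn.2))
    simp only [rightMean, rightStat, trace_mul_dual_resolv_eq _ _ hw hz, modelMat]

/-- The solutions of the fixed-point equations are Stieltjes transforms. -/
theorem exists_isStieltjes (h : IsModel P c H G M C₀ p Z U V x y) :
    ∃ h₀ g₀ : ℂ → Fin K → ℂ, (∀ r, IsStieltjes (Set.Ici 0) fun z => h₀ z r) ∧
      (∀ r, IsStieltjes (Set.Ici 0) fun z => g₀ z r) ∧
      ∀ z : ℂ, 0 < z.im → IsFixedPair z c H G (h₀ z) (g₀ z) := by
  have hex : ∀ z : ℂ, ∃ h₀ g₀ : Fin K → ℂ, 0 < z.im → IsFixedPair z c H G h₀ g₀ ∧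
      Tendsto (leftMean P Z U V x y z) atTop (𝓝 h₀) ∧
      Tendsto (rightMean P Z U V x y z) atTop (𝓝 g₀) := by
    intro z
    by_cases hz : 0 < z.im
    · obtain ⟨h₀, g₀, h1⟩ := h.exists_isFixedPair hz
      exact ⟨h₀, g₀, fun _ => h1⟩
    · exact ⟨0, 0, fun h' => absurd h' hz⟩
  choose h₀ g₀ hfix using hex
  -- Convergence is first obtained off a null set for countably many z; the common Lipschitz bound
  -- extends it to all z in the upper half plane.
  obtain ⟨D, hDc, hD⟩ := TopologicalSpace.exists_countable_dense ℂ
  have hall : ∀ᵐ ω ∂P, ∀ z ∈ D, ∀ r, 0 < z.im →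
      Tendsto (fun n => leftStat (U n) (V n) (trunc (cutoff n) (x n))
        (trunc (cutoff n) (y n)) z r (Z n ω) - leftMean P Z U V x y z n r) atTop (𝓝 0) ∧
      Tendsto (fun n => rightStat (U n) (V n) (trunc (cutoff n) (x n))
        (trunc (cutoff n) (y n)) z r (Z n ω) - rightMean P Z U V x y z n r) atTop (𝓝 0) := by
    rw [ae_ball_iff hDc]
    intro z _
    rw [ae_all_iff]
    intro r
    by_cases hz : 0 < z.im
    · filter_upwards [h.ae_tendsto_leftStat hz r, h.ae_tendsto_rightStat hz r] with ω h1 h2 _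
      exact ⟨h1, h2⟩
    · exact ae_of_all _ fun ω h' => absurd h' hz
  -- One good realization suffices: its statistics are Stieltjes transforms of explicit spectral
  -- measures with bounded mass, and they have the same limits as the means.
  obtain ⟨ω, hω⟩ := hall.exists
  have hxn := fun n => trunc_nonneg (cutoff_nonneg n) (h.x_nonneg n)
  have hyn := fun n => trunc_nonneg (cutoff_nonneg n) (h.y_nonneg n)
  refine ⟨h₀, g₀, fun r => ?_, fun r => ?_, fun z hz => (hfix z hz).1⟩
  · have hst := fun n => exists_stieltjes_eq_normalized_trace
      (posSemidef_cdiag (U n) fun j => hxn n j r)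
      (Matrix.posSemidef_self_mul_conjTranspose (modelMat (U n) (V n) (trunc (cutoff n) (x n))
        (trunc (cutoff n) (y n)) (Z n ω)))
    choose μ hμ hμ0 hμ1 hμs using hst
    refine isStieltjes_of_tendsto (l := atTop) μ hμ0 (C := C₀.toNNReal) ?_ fun z hz => ?_
    · filter_upwards [h.trace_x] with n hn
      have h1 := sum_trunc_div_le (τ := cutoff n) (hn r)
      rw [← trace_cdiag_re (h.U_mem n), ← hμ1 n] at h1
      rw [← ENNReal.ofReal_toReal (measure_ne_top (μ n) Set.univ)]
      exact ENNReal.ofReal_le_ofReal h1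
    · have h1 : Tendsto (fun n => leftStat (U n) (V n) (trunc (cutoff n) (x n))
          (trunc (cutoff n) (y n)) z r (Z n ω) - leftMean P Z U V x y z n r) atTop (𝓝 0) := by
        refine tendsto_zero_of_dense (u := fun n z => leftStat (U n) (V n) (trunc (cutoff n) (x n))
          (trunc (cutoff n) (y n)) z r (Z n ω) - leftMean P Z U V x y z n r) (C := 2 * C₀) hD ?_
          (fun z hz hz' => (hω z hz r hz').1) hz
        filter_upwards [h.trace_x] with n hn z z' hz hz'
        have h1 := sum_trunc_div_le (τ := cutoff n) (hn r)
        rw [← trace_cdiag_re (h.U_mem n)] at h1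
        rw [mul_assoc]
        exact norm_sub_integral_sub_le (integrable_leftStat (h.innov n).meas hz r)
          (integrable_leftStat (h.innov n).meas hz' r) (fun ω => norm_normalized_trace_sub_le
            (posSemidef_cdiag (U n) fun j => hxn n j r)
            (Matrix.posSemidef_self_mul_conjTranspose _) h1 hz hz') ω
      have h2 := h1.add (((continuous_apply r).tendsto _).comp (hfix z hz).2.1)
      rw [zero_add] at h2
      refine h2.congr fun n => ?_
      rw [← hμs n z hz, Function.comp_apply, sub_add_cancel]
      rfl
  · have hst := fun n => exists_stieltjes_eq_normalized_trace
      (posSemidef_cdiag (V n) fun j => hyn n j r)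
      (Matrix.posSemidef_conjTranspose_mul_self (modelMat (U n) (V n) (trunc (cutoff n) (x n))
        (trunc (cutoff n) (y n)) (Z n ω)))
    choose μ hμ hμ0 hμ1 hμs using hst
    refine isStieltjes_of_tendsto (l := atTop) μ hμ0 (C := C₀.toNNReal) ?_ fun z hz => ?_
    · filter_upwards [h.trace_y] with n hn
      have h1 := sum_trunc_div_le (τ := cutoff n) (hn r)
      rw [← trace_cdiag_re (h.V_mem n), ← hμ1 n] at h1
      rw [← ENNReal.ofReal_toReal (measure_ne_top (μ n) Set.univ)]
      exact ENNReal.ofReal_le_ofReal h1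
    · have h1 : Tendsto (fun n => rightStat (U n) (V n) (trunc (cutoff n) (x n))
          (trunc (cutoff n) (y n)) z r (Z n ω) - rightMean P Z U V x y z n r) atTop (𝓝 0) := by
        refine tendsto_zero_of_dense (u := fun n z => rightStat (U n) (V n) (trunc (cutoff n) (x n))
          (trunc (cutoff n) (y n)) z r (Z n ω) - rightMean P Z U V x y z n r) (C := 2 * C₀) hD ?_
          (fun z hz hz' => (hω z hz r hz').2) hz
        filter_upwards [h.trace_y] with n hn z z' hz hz'
        have h1 := sum_trunc_div_le (τ := cutoff n) (hn r)
        rw [← trace_cdiag_re (h.V_mem n)] at h1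
        rw [mul_assoc]
        exact norm_sub_integral_sub_le (integrable_rightStat (h.innov n).meas hz r)
          (integrable_rightStat (h.innov n).meas hz' r) (fun ω => norm_normalized_trace_sub_le
            (posSemidef_cdiag (V n) fun j => hyn n j r)
            (Matrix.posSemidef_conjTranspose_mul_self _) h1 hz hz') ω
      have h2 := h1.add (((continuous_apply r).tendsto _).comp (hfix z hz).2.2)
      rw [zero_add] at h2
      refine h2.congr fun n => ?_
      rw [← hμs n z hz, Function.comp_apply, sub_add_cancel]
      rfl

end IsModel

end StieltjesSolution

/-- The joint law is a product, so Tonelli's theorem reduces the integral to one with the first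
variable frozen, where the bound holds uniformly. Centring is by the mean over Y alone, a function
of X. -/
theorem lintegral_sub_integral_le_of_indepFun {Ω α β : Type*} [MeasurableSpace Ω]
    [MeasurableSpace α] [MeasurableSpace β] {P : Measure Ω} [IsProbabilityMeasure P] {X : Ω → α}
    {Y : Ω → β} (hX : Measurable X) (hY : Measurable Y) (hXY : IndepFun X Y P) {f : α → β → ℂ}
    (hf : Measurable fun q : α × β => f q.1 q.2) {b : ENNReal}
    (h : ∀ a, ∫⁻ ω, ‖f a (Y ω) - ∫ ω', f a (Y ω') ∂P‖ₑ ^ 4 ∂P ≤ b) :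
    (Measurable fun ω => f (X ω) (Y ω) - ∫ ω', f (X ω) (Y ω') ∂P) ∧
    ∫⁻ ω, ‖f (X ω) (Y ω) - ∫ ω', f (X ω) (Y ω') ∂P‖ₑ ^ 4 ∂P ≤ b := by
  have hm : Measurable fun a => ∫ ω', f a (Y ω') ∂P := by
    have h1 : Measurable fun q : α × Ω => f q.1 (Y q.2) :=
      hf.comp (measurable_fst.prodMk (hY.comp measurable_snd))
    exact h1.stronglyMeasurable.integral_prod_right'.measurable
  have hm' : Measurable fun q : α × β => f q.1 q.2 - ∫ ω', f q.1 (Y ω') ∂P :=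
    hf.sub (hm.comp measurable_fst)
  refine ⟨hm'.comp (hX.prodMk hY), ?_⟩
  have hm4 : Measurable fun q : α × β => ‖f q.1 q.2 - ∫ ω', f q.1 (Y ω') ∂P‖ₑ ^ 4 :=
    hm'.enorm.pow_const 4
  have := Measure.isProbabilityMeasure_map (μ := P) hX.aemeasurable
  have := Measure.isProbabilityMeasure_map (μ := P) hY.aemeasurable
  have e : ∫⁻ ω, ‖f (X ω) (Y ω) - ∫ ω', f (X ω) (Y ω') ∂P‖ₑ ^ 4 ∂P =
      ∫⁻ q, ‖f q.1 q.2 - ∫ ω', f q.1 (Y ω') ∂P‖ₑ ^ 4 ∂((P.map X).prod (P.map Y)) := by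
    rw [← (indepFun_iff_map_prod_eq_prod_map_map hX.aemeasurable hY.aemeasurable).1 hXY,
      lintegral_map hm4 (hX.prodMk hY)]
  rw [e, lintegral_prod _ hm4.aemeasurable]
  have hle : ∀ x, ∫⁻ y, ‖f x y - ∫ ω', f x (Y ω') ∂P‖ₑ ^ 4 ∂(P.map Y) ≤ b := by
    intro x
    have hmx : Measurable fun y => ‖f x y - ∫ ω', f x (Y ω') ∂P‖ₑ ^ 4 :=
      ((hf.comp (measurable_prodMk_left (x := x))).sub_const _).enorm.pow_const 4
    rw [lintegral_map hmx hY]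
    exact h x
  calc ∫⁻ x, ∫⁻ y, ‖f x y - ∫ ω', f x (Y ω') ∂P‖ₑ ^ 4 ∂(P.map Y) ∂(P.map X)
      ≤ ∫⁻ _, b ∂(P.map X) := lintegral_mono hle
    _ = b := by rw [lintegral_const, measure_univ, mul_one]

/-! ### Conditional concentration for random scaling matrices -/

section RandomScaling

open scoped Matrix Matrix.Norms.L2Operator MatrixOrder

variable {K p n : ℕ}

/-- The normalized data matrix `n^{-1/2} ∑ r, A_r^{1/2} Z_r B_r^{1/2}` as a function of the arrays of
entries. -/
def normData (a : Fin K → Fin p → Fin p → ℂ) (b : Fin K → Fin n → Fin n → ℂ)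
    (ζ : Fin K → Fin p → Fin n → ℂ) : Matrix (Fin p) (Fin n) ℂ :=
  combo (fun r => ((√n : ℝ) : ℂ)⁻¹ • CFC.sqrt (Matrix.of (a r)))
    (fun r => CFC.sqrt (Matrix.of (b r))) ζ

/-- The Stieltjes transform of the spectral distribution of `Y Yᴴ` with `Y = normData a b ζ`. -/
def covStat (z : ℂ) (a : Fin K → Fin p → Fin p → ℂ) (b : Fin K → Fin n → Fin n → ℂ)
    (ζ : Fin K → Fin p → Fin n → ℂ) : ℂ :=
  (p : ℂ)⁻¹ * (1 * resolv (normData a b ζ * (normData a b ζ)ᴴ) z).trace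

theorem measurable_covStat (z : ℂ) : Measurable fun q : ((Fin K → Fin p → Fin p → ℂ) ×
    (Fin K → Fin n → Fin n → ℂ)) × (Fin K → Fin p → Fin n → ℂ) => covStat z q.1.1 q.1.2 q.2 := by
  have hn : Measurable fun q : ((Fin K → Fin p → Fin p → ℂ) ×
      (Fin K → Fin n → Fin n → ℂ)) × (Fin K → Fin p → Fin n → ℂ) =>
        normData q.1.1 q.1.2 q.2 := by
    have hsq : ∀ d : ℕ, Measurable (CFC.sqrt : Matrix (Fin d) (Fin d) ℂ → Matrix (Fin d) (Fin d) ℂ) :=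
      fun d => measurable_sqrt
    unfold normData combo
    refine measurable_matrix_sum _ fun r => ?_
    have h1 : Measurable fun q : ((Fin K → Fin p → Fin p → ℂ) ×
        (Fin K → Fin n → Fin n → ℂ)) × (Fin K → Fin p → Fin n → ℂ) =>
          CFC.sqrt (Matrix.of (q.1.1 r)) :=
      (hsq _).comp ((measurable_pi_apply r).comp (measurable_fst.comp measurable_fst))
    have h2 : Measurable fun q : ((Fin K → Fin p → Fin p → ℂ) ×
        (Fin K → Fin n → Fin n → ℂ)) × (Fin K → Fin p → Fin n → ℂ) =>
          CFC.sqrt (Matrix.of (q.1.2 r)) :=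
      (hsq _).comp ((measurable_pi_apply r).comp (measurable_snd.comp measurable_fst))
    have h3 : Measurable fun M : Matrix (Fin p) (Fin p) ℂ => ((√n : ℝ) : ℂ)⁻¹ • M :=
      (continuous_const_smul _).measurable
    refine measurable_matrix_mul (measurable_matrix_mul (h3.comp h1) ?_) h2
    exact (measurable_pi_apply r).comp measurable_snd
  exact (measurable_trace (measurable_matrix_mul measurable_const
    (measurable_resolv (measurable_matrix_mul hn (measurable_conjTranspose hn)) z))).const_mul _

theorem sampleCov_dataMatrix (A : Fin K → Matrix (Fin p) (Fin p) ℂ)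
    (B : Fin K → Matrix (Fin n) (Fin n) ℂ) (Z : Fin K → Matrix (Fin p) (Fin n) ℂ) :
    sampleCov (dataMatrix A B Z) = normData (entries A) (entries B) (entries Z) *
      (normData (entries A) (entries B) (entries Z))ᴴ := by
  have e : normData (entries A) (entries B) (entries Z) =
      ((√n : ℝ) : ℂ)⁻¹ • dataMatrix A B Z := by
    rw [normData, combo, dataMatrix, Finset.smul_sum]
    refine Finset.sum_congr rfl fun r _ => ?_
    rw [Matrix.smul_mul, Matrix.smul_mul]
    rfl
  have e2 : ((√n : ℝ) : ℂ)⁻¹ * star ((√n : ℝ) : ℂ)⁻¹ = ((n : ℝ)⁻¹ : ℝ) := by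
    rw [← Complex.ofReal_inv, ← starRingEnd_apply, Complex.conj_ofReal, ← Complex.ofReal_mul, ← mul_inv,
      Real.mul_self_sqrt (Nat.cast_nonneg n)]
  rw [e, Matrix.conjTranspose_smul, Matrix.smul_mul, Matrix.mul_smul, smul_smul, e2, sampleCov]
  rfl

theorem normData_eq_modelMat {A : Fin K → Matrix (Fin p) (Fin p) ℂ}
    {B : Fin K → Matrix (Fin n) (Fin n) ℂ} {U : Matrix (Fin p) (Fin p) ℂ}
    {V : Matrix (Fin n) (Fin n) ℂ} {x : Fin p → Fin K → ℝ} {y : Fin n → Fin K → ℝ}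
    (hU : U ∈ unitary (Matrix (Fin p) (Fin p) ℂ)) (hV : V ∈ unitary (Matrix (Fin n) (Fin n) ℂ))
    (hx : ∀ j r, 0 ≤ x j r) (hy : ∀ j r, 0 ≤ y j r)
    (hA : ∀ r, A r = cdiag U fun j => (x j r : ℂ)) (hB : ∀ r, B r = cdiag V fun j => (y j r : ℂ))
    (ζ : Fin K → Fin p → Fin n → ℂ) :
    normData (entries A) (entries B) ζ = modelMat U V x y ζ := by
  have h1 : ∀ r, ((√n : ℝ) : ℂ)⁻¹ • CFC.sqrt (Matrix.of (entries A r)) = leftFac n U x r := by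
    intro r
    change ((√n : ℝ) : ℂ)⁻¹ • CFC.sqrt (A r) = _
    rw [hA r, sqrt_cdiag hU fun j => hx j r, smul_cdiag, leftFac]
    congr 1
    ext j
    push_cast
    ring
  have h2 : ∀ r, CFC.sqrt (Matrix.of (entries B r)) = rightFac V y r := by
    intro r
    change CFC.sqrt (B r) = _
    rw [hB r, sqrt_cdiag hV fun j => hy j r, rightFac]
  simp only [normData, modelMat, h1, h2]

theorem norm_covStat_sub_le (a : Fin K → Fin p → Fin p → ℂ) (b : Fin K → Fin n → Fin n → ℂ)
    (ζ : Fin K → Fin p → Fin n → ℂ) {z z' : ℂ} (hz : 0 < z.im) (hz' : 0 < z'.im) :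
    ‖covStat z a b ζ - covStat z' a b ζ‖ ≤ 1 * (‖z - z'‖ / (z.im * z'.im)) := by
  refine norm_normalized_trace_sub_le Matrix.PosSemidef.one
    (Matrix.posSemidef_self_mul_conjTranspose _) ?_ hz hz'
  simpa using div_self_le_one (p : ℝ)

variable {Ω : Type*} [MeasurableSpace Ω] {P : Measure Ω} [IsProbabilityMeasure P]

theorem integrable_covStat (a : Fin K → Fin p → Fin p → ℂ) (b : Fin K → Fin n → Fin n → ℂ)
    {Z : Ω → Fin K → Fin p → Fin n → ℂ} (hZ : Measurable Z) {z : ℂ} (hz : 0 < z.im) :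
    Integrable (fun ω => covStat z a b (Z ω)) P :=
  (integrable_trace_resolv hZ 1 hz).const_mul _

theorem lintegral_covStat_pow_four_le (a : Fin K → Fin p → Fin p → ℂ)
    (b : Fin K → Fin n → Fin n → ℂ) {Z : Ω → Fin K → Fin p → Fin n → ℂ} (hZ : Measurable Z)
    (hind : iIndepFun (fun (e : Fin K × Fin p × Fin n) ω => Z ω e.1 e.2.1 e.2.2) P) (hn : 0 < n)
    {w : ℂ} (hw : 0 < w.im) (hw2 : 0 < (w ^ 2).im) :
    ∫⁻ ω, ‖covStat (w ^ 2) a b (Z ω) - ∫ ω', covStat (w ^ 2) a b (Z ω') ∂P‖ₑ ^ 4 ∂P ≤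
      ENNReal.ofReal ((p : ℝ)⁻¹ ^ 4 *
        (384 * (n ^ 2 * (4 * (K + 1) / (‖w‖ * w.im) * cutoff n) ^ 4))) := by
  have hτ : 0 < cutoff n := by linarith [one_le_cutoff hn]
  -- The identity has norm at most one; the larger bound is taken so that the moment estimate
  -- matches `eventually_moment_le`.
  have hT : ‖(1 : Matrix (Fin p) (Fin p) ℂ)‖ ≤ cutoff n := by
    rw [← cdiag_one (one_mem (unitary (Matrix (Fin p) (Fin p) ℂ)))]
    refine norm_cdiag_le (one_mem _) hτ.le fun _ => ?_
    simpa using one_le_cutoff hn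
  refine le_trans (le_of_eq ?_) (lintegral_stat_pow_four_le hZ hind hn
    (fun r => ((√n : ℝ) : ℂ)⁻¹ • CFC.sqrt (Matrix.of (a r)))
    (fun r => CFC.sqrt (Matrix.of (b r))) hτ
    ((norm_mul_mul_conjTranspose_le norm_inlMat_le norm_inlMat_le _).trans hT) hw p)
  simp only [covStat, trace_mul_resolv_eq _ _ hw hw2, normData]

theorem lintegral_covStat_sub_integral_le {a : Ω → Fin K → Fin p → Fin p → ℂ}
    {b : Ω → Fin K → Fin n → Fin n → ℂ} {Z : Ω → Fin K → Fin p → Fin n → ℂ}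
    (ha : Measurable a) (hb : Measurable b) (hZ : Measurable Z)
    (hindep : IndepFun (fun ω => (a ω, b ω)) Z P)
    (hind : iIndepFun (fun (e : Fin K × Fin p × Fin n) ω => Z ω e.1 e.2.1 e.2.2) P) (hn : 0 < n)
    {w : ℂ} (hw : 0 < w.im) (hw2 : 0 < (w ^ 2).im) :
    (Measurable fun ω => covStat (w ^ 2) (a ω) (b ω) (Z ω) -
      ∫ ω', covStat (w ^ 2) (a ω) (b ω) (Z ω') ∂P) ∧
    ∫⁻ ω, ‖covStat (w ^ 2) (a ω) (b ω) (Z ω) -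
      ∫ ω', covStat (w ^ 2) (a ω) (b ω) (Z ω') ∂P‖ₑ ^ 4 ∂P ≤
      ENNReal.ofReal ((p : ℝ)⁻¹ ^ 4 *
        (384 * (n ^ 2 * (4 * (K + 1) / (‖w‖ * w.im) * cutoff n) ^ 4))) := by
  let f : (Fin K → Fin p → Fin p → ℂ) × (Fin K → Fin n → Fin n → ℂ) →
    (Fin K → Fin p → Fin n → ℂ) → ℂ := fun q ζ => covStat (w ^ 2) q.1 q.2 ζ
  have hf : Measurable fun q : ((Fin K → Fin p → Fin p → ℂ) × (Fin K → Fin n → Fin n → ℂ)) ×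
    (Fin K → Fin p → Fin n → ℂ) => f q.1 q.2 := measurable_covStat _
  have hle : ∀ q, ∫⁻ ω, ‖f q (Z ω) - ∫ ω', f q (Z ω') ∂P‖ₑ ^ 4 ∂P ≤ ENNReal.ofReal ((p : ℝ)⁻¹ ^ 4 *
      (384 * (n ^ 2 * (4 * (K + 1) / (‖w‖ * w.im) * cutoff n) ^ 4))) :=
    fun q => lintegral_covStat_pow_four_le q.1 q.2 hZ hind hn hw hw2
  have hfe : ∀ ω ω', covStat (w ^ 2) (a ω) (b ω) (Z ω') = f (a ω, b ω) (Z ω') := fun _ _ => rfl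
  simp only [hfe]
  exact lintegral_sub_integral_le_of_indepFun (ha.prodMk hb) hZ hindep hf hle

/-- The bounded differences estimate sees the scaling matrices only through ranks, so it is uniform
over all values of a and b. Truncation plays no part here. -/
theorem ae_tendsto_covStat_sub_integral {p : ℕ → ℕ} {c : ℝ}
    {a : (n : ℕ) → Ω → Fin K → Fin (p n) → Fin (p n) → ℂ}
    {b : (n : ℕ) → Ω → Fin K → Fin n → Fin n → ℂ}
    {Z : (n : ℕ) → Ω → Fin K → Fin (p n) → Fin n → ℂ}
    (ha : ∀ n, Measurable (a n)) (hb : ∀ n, Measurable (b n)) (hZ : ∀ n, Measurable (Z n))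
    (hindep : ∀ n, IndepFun (fun ω => (a n ω, b n ω)) (Z n) P)
    (hc : 0 < c) (hp : Tendsto (fun n => (p n : ℝ) / n) atTop (𝓝 c))
    (hind : ∀ n, iIndepFun (fun (e : Fin K × Fin (p n) × Fin n) ω => Z n ω e.1 e.2.1 e.2.2) P) :
    ∀ᵐ ω ∂P, ∀ z : ℂ, 0 < z.im → Tendsto (fun n => covStat z (a n ω) (b n ω) (Z n ω) -
      ∫ ω', covStat z (a n ω) (b n ω) (Z n ω') ∂P) atTop (𝓝 0) := by
  have key : ∀ z : ℂ, 0 < z.im → ∀ᵐ ω ∂P, Tendsto (fun n => covStat z (a n ω) (b n ω) (Z n ω) -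
      ∫ ω', covStat z (a n ω) (b n ω) (Z n ω') ∂P) atTop (𝓝 0) := by
    intro z hz
    obtain ⟨w, hw, rfl⟩ := exists_sq_eq_im_pos hz
    obtain ⟨s, hs, hs0, hse⟩ := eventually_moment_le hc hp (4 * (K + 1) / (‖w‖ * w.im))
    have h1 := fun n (hn : 0 < n) => lintegral_covStat_sub_integral_le (ha n) (hb n) (hZ n)
      (hindep n) (hind n) hn hw hz
    -- The index is shifted by one because the moment bound and the measurability are supplied for n
    -- > 0 only.
    have h2 : ∀ᵐ ω ∂P, Tendsto (fun n => covStat (w ^ 2) (a (n + 1) ω) (b (n + 1) ω) (Z (n + 1) ω) -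
        ∫ ω', covStat (w ^ 2) (a (n + 1) ω) (b (n + 1) ω) (Z (n + 1) ω') ∂P) atTop (𝓝 0) := by
      refine ae_tendsto_zero_of_summable (a := fun n => s (n + 1))
        (fun n => (h1 (n + 1) n.succ_pos).1) ((summable_nat_add_iff 1).2 hs) (fun n => hs0 _) ?_
      filter_upwards [(tendsto_add_atTop_nat 1).eventually hse] with n hn
      exact (h1 (n + 1) n.succ_pos).2.trans (ENNReal.ofReal_le_ofReal hn.1)
    filter_upwards [h2] with ω hω
    exact (tendsto_add_atTop_iff_nat (f := fun n => covStat (w ^ 2) (a n ω) (b n ω) (Z n ω) -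
      ∫ ω', covStat (w ^ 2) (a n ω) (b n ω) (Z n ω') ∂P) 1).1 hω
  obtain ⟨D, hDc, hD⟩ := TopologicalSpace.exists_countable_dense ℂ
  have hall : ∀ᵐ ω ∂P, ∀ z ∈ D, 0 < z.im → Tendsto (fun n => covStat z (a n ω) (b n ω) (Z n ω) -
      ∫ ω', covStat z (a n ω) (b n ω) (Z n ω') ∂P) atTop (𝓝 0) := by
    rw [ae_ball_iff hDc]
    intro z _
    by_cases hz : 0 < z.im
    · filter_upwards [key z hz] with ω hω _ using hω
    · exact ae_of_all _ fun ω h' => absurd h' hz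
  filter_upwards [hall] with ω hω z hz
  refine tendsto_zero_of_dense (u := fun n z => covStat z (a n ω) (b n ω) (Z n ω) -
      ∫ ω', covStat z (a n ω) (b n ω) (Z n ω') ∂P) (C := 2 * 1) hD ?_ hω hz
  refine Eventually.of_forall fun n z z' hz hz' => ?_
  rw [mul_assoc]
  exact norm_sub_integral_sub_le (integrable_covStat _ _ (hZ n) hz)
    (integrable_covStat _ _ (hZ n) hz') (fun ω' => norm_covStat_sub_le _ _ _ hz hz') ω

end RandomScaling

/-! ### The limit law and its formulas -/

section Conclusion

open scoped Matrix Matrix.Norms.L2Operator MatrixOrder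

variable {Ω : Type*} [MeasurableSpace Ω] {P : Measure Ω} {K : ℕ} {c : ℝ}
  {H G : Measure (Fin K → ℝ)}

theorem pow_three_le_one_add_rpow {t η : ℝ} (ht : 0 ≤ t) (hη : 0 < η) :
    t ^ 3 ≤ 1 + t ^ (4 + η) := by
  rcases le_total t 1 with h | h
  · exact (pow_le_one₀ ht h).trans (le_add_of_nonneg_right (Real.rpow_nonneg ht _))
  · have h1 : t ^ 3 ≤ t ^ (4 + η) := by
      rw [← Real.rpow_natCast]
      exact Real.rpow_le_rpow_of_exponent_le h (by push_cast; linarith)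
    linarith

/-- The entrywise expansion stops at third order, so the moment bound is needed only through |ζ|³ ≤
1 + |ζ|^{4+η}. -/
theorem isInnovation_of_moment [IsProbabilityMeasure P] {p n : ℕ} {Z : Ω → Fin K → Fin p → Fin n → ℂ} (hZ : Measurable Z)
    (hind : iIndepFun (fun (e : Fin K × Fin p × Fin n) ω => Z ω e.1 e.2.1 e.2.2) P)
    (hmean : ∀ r i j, ∫ ω, Z ω r i j ∂P = 0) (hvar : ∀ r i j, ∫ ω, ‖Z ω r i j‖ ^ 2 ∂P = 1)
    {η M : ℝ} (hη : 0 < η) (hM : ∀ r i j, Integrable (fun ω => ‖Z ω r i j‖ ^ (4 + η)) P ∧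
      ∫ ω, ‖Z ω r i j‖ ^ (4 + η) ∂P ≤ M) : IsInnovation P (1 + |M|) Z := by
  have hi : ∀ r i j, Integrable (fun ω => 1 + ‖Z ω r i j‖ ^ (4 + η)) P :=
    fun r i j => (integrable_const 1).add (hM r i j).1
  have hle : ∀ r i j ω, ‖Z ω r i j‖ ^ 3 ≤ 1 + ‖Z ω r i j‖ ^ (4 + η) :=
    fun r i j ω => pow_three_le_one_add_rpow (norm_nonneg _) hη
  have h3 : ∀ r i j, Integrable (fun ω => ‖Z ω r i j‖ ^ 3) P := by
    intro r i j
    have hm : Measurable fun ω => Z ω r i j := (measurable_pi_apply j).comp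
      ((measurable_pi_apply i).comp ((measurable_pi_apply r).comp hZ))
    refine (hi r i j).mono' (hm.norm.pow_const 3).aestronglyMeasurable (ae_of_all _ fun ω => ?_)
    rw [Real.norm_of_nonneg (by positivity)]
    exact hle r i j ω
  refine ⟨hZ, hind, hmean, hvar, h3, fun r i j => ?_⟩
  refine (integral_mono (h3 r i j) (hi r i j) (hle r i j)).trans ?_
  rw [integral_add (integrable_const 1) (hM r i j).1]
  simpa using (hM r i j).2.trans (le_abs_self M)

/-- Trading the scalar product of a fixed pair for a single integral. -/
theorem IsFixedPair.mul_sum_eq (hc : 0 < c) (hG : IsLimitSpectrum G) {z : ℂ} (hz : 0 < z.im)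
    {h g : Fin K → ℂ} (hf : IsFixedPair z c H G h g) :
    (c : ℂ) * ∑ r, h r * g r = -z⁻¹ * (1 - ∫ y, 1 / (1 + (c : ℂ) * pair y h) ∂G) := by
  have := hG.prob
  have hz0 := ne_zero_of_im_pos hz
  have hq : ∀ s, 0 ≤ (z * ((c : ℂ) • h) s).im := by
    intro s
    have e : z * ((c : ℂ) • h) s = (c : ℂ) * (z * h s) := by
      rw [Pi.smul_apply, smul_eq_mul]
      ring
    rw [e, Complex.im_ofReal_mul]
    exact (mul_pos hc (hf.zh_im s)).le
  have hintg : ∀ r, Integrable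
      (fun y : Fin K → ℝ => (y r : ℂ) / (-z * (1 + pair y ((c : ℂ) • h)))) G := by
    intro r
    -- A non-integrable integrand would give the integral its default value 0, contradicting Im g_r
    -- > 0.
    by_contra hni
    have h0 : g r = 0 := by
      rw [hf.g_eq]
      exact integral_undef hni
    have h1 := hf.g_im r
    rw [h0] at h1
    simp at h1
  have hbd : ∀ᵐ y ∂G, z.im ≤ ‖z * (1 + pair y ((c : ℂ) • h))‖ := by
    filter_upwards [hG.nonneg] with y hy using im_le_norm_mul_one_add_pair hq hy
  have hmeas : Measurable fun y : Fin K → ℝ => (1 + pair y ((c : ℂ) • h))⁻¹ :=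
    ((continuous_pair _).measurable.const_add 1).inv
  have hint1 : Integrable (fun y : Fin K → ℝ => (1 + pair y ((c : ℂ) • h))⁻¹) G := by
    refine Integrable.of_bound hmeas.aestronglyMeasurable (‖z‖ / z.im) ?_
    filter_upwards [hbd] with y hy
    rw [norm_mul] at hy
    have hz' : 0 < ‖z‖ := norm_pos_iff.2 hz0
    have hp : 0 < ‖1 + pair y ((c : ℂ) • h)‖ := by
      rcases (norm_nonneg (1 + pair y ((c : ℂ) • h))).eq_or_lt with h0 | h0
      · rw [← h0, mul_zero] at hy
        linarith
      · exact h0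
    rw [norm_inv, le_div_iff₀ hz, inv_mul_le_iff₀ hp]
    linarith
  have e1 : (c : ℂ) * ∑ r, h r * g r =
      ∫ y, ∑ r, ((c : ℂ) * h r) * ((y r : ℂ) / (-z * (1 + pair y ((c : ℂ) • h)))) ∂G := by
    rw [integral_finsetSum _ fun r _ => (hintg r).const_mul _, Finset.mul_sum]
    refine Finset.sum_congr rfl fun r _ => ?_
    rw [integral_const_mul, ← mul_assoc]
    congr 1
    exact congrFun hf.g_eq r
  -- With q = c h, summing c h_r y_r over r gives yᵀq, and yᵀq / (−z(1 + yᵀq)) = −z⁻¹ (1 − (1 +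
  -- yᵀq)⁻¹).
  have e2 : ∫ y, ∑ r, ((c : ℂ) * h r) * ((y r : ℂ) / (-z * (1 + pair y ((c : ℂ) • h)))) ∂G =
      ∫ y, -z⁻¹ * (1 - (1 + pair y ((c : ℂ) • h))⁻¹) ∂G := by
    refine integral_congr_ae ?_
    filter_upwards [hbd] with y hy
    have h0 : 1 + pair y ((c : ℂ) • h) ≠ 0 := by
      intro h0
      rw [h0, mul_zero, norm_zero] at hy
      linarith
    have e3 : ∑ r, ((c : ℂ) * h r) * ((y r : ℂ) / (-z * (1 + pair y ((c : ℂ) • h)))) =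
        pair y ((c : ℂ) • h) / (-z * (1 + pair y ((c : ℂ) • h))) := by
      generalize -z * (1 + pair y ((c : ℂ) • h)) = D
      rw [pair, Finset.sum_div]
      refine Finset.sum_congr rfl fun r _ => ?_
      rw [Pi.smul_apply, smul_eq_mul]
      ring
    rw [e3]
    field_simp
    ring
  rw [e1, e2, integral_const_mul, integral_sub (integrable_const 1) hint1]
  simp only [pair_smul, integral_const, probReal_univ, one_smul, one_div]

/-- At z = iv the term −1/z contributes exactly 1, while each h_r and g_r is O(1/v), so their scalar
product contributes O(1/v). Hence no mass is lost in the limit law. -/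
theorem tendsto_mul_im_limit {h g : ℂ → Fin K → ℂ}
    (hh : ∀ r, IsStieltjes (Set.Ici 0) fun z => h z r)
    (hg : ∀ r, IsStieltjes (Set.Ici 0) fun z => g z r) :
    Tendsto (fun v : ℝ => v * (-(v * Complex.I : ℂ)⁻¹ -
      ∑ r, h (v * Complex.I) r * g (v * Complex.I) r).im) atTop (𝓝 1) := by
  choose μ hμ hμ0 hμs using hh
  choose ν hν hν0 hνs using hg
  have h1 : Tendsto (fun v : ℝ => (∑ r, (μ r).real Set.univ * (ν r).real Set.univ) * v⁻¹) atTop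
      (𝓝 0) := by
    simpa using tendsto_inv_atTop_zero.const_mul
      (∑ r, (μ r).real Set.univ * (ν r).real Set.univ)
  rw [tendsto_iff_norm_sub_tendsto_zero]
  refine squeeze_zero' (Eventually.of_forall fun _ => norm_nonneg _) ?_ h1
  filter_upwards [eventually_gt_atTop 0] with v hv
  have him : 0 < ((v : ℂ) * Complex.I).im := by simpa using hv
  have e : v * (-(v * Complex.I : ℂ)⁻¹ - ∑ r, h (v * Complex.I) r * g (v * Complex.I) r).im - 1 =
      -(v * (∑ r, h (v * Complex.I) r * g (v * Complex.I) r).im) := by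
    have e1 : (-(v * Complex.I : ℂ)⁻¹).im = v⁻¹ := by
      rw [mul_inv, Complex.inv_I, ← Complex.ofReal_inv]
      simp
    rw [Complex.sub_im, e1, mul_sub, mul_inv_cancel₀ hv.ne']
    ring
  rw [e, norm_neg, norm_mul, Real.norm_of_nonneg hv.le]
  have h2 : ‖(∑ r, h (v * Complex.I) r * g (v * Complex.I) r).im‖ ≤
      ∑ r, ((μ r).real Set.univ / v) * ((ν r).real Set.univ / v) := by
    refine (Complex.abs_im_le_norm _).trans ((norm_sum_le _ _).trans
      (Finset.sum_le_sum fun r _ => ?_))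
    have a1 := norm_stieltjes_le (μ r) him
    have a2 := norm_stieltjes_le (ν r) him
    have e3 : ((v : ℂ) * Complex.I).im = v := by simp
    rw [← hμs r _ him, e3] at a1
    rw [← hνs r _ him, e3] at a2
    rw [norm_mul]
    exact mul_le_mul a1 a2 (norm_nonneg _) (by positivity)
  refine (mul_le_mul_of_nonneg_left h2 hv.le).trans (le_of_eq ?_)
  rw [Finset.mul_sum, Finset.sum_mul]
  refine Finset.sum_congr rfl fun r _ => ?_
  field_simp

/-- Normalized traces with limit `-z⁻¹ - ∑ r, h_r g_r` determine a probability measure. -/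
theorem exists_limit_law {p : ℕ → ℕ} {S : (n : ℕ) → Matrix (Fin (p n)) (Fin (p n)) ℂ}
    (hS : ∀ n, (S n).PosSemidef) {h g : ℂ → Fin K → ℂ}
    (hh : ∀ r, IsStieltjes (Set.Ici 0) fun z => h z r)
    (hg : ∀ r, IsStieltjes (Set.Ici 0) fun z => g z r)
    (hlim : ∀ z : ℂ, 0 < z.im → Tendsto (fun n => (p n : ℂ)⁻¹ * (1 * resolv (S n) z).trace) atTop
      (𝓝 (-z⁻¹ - ∑ r, h z r * g z r))) :
    ∃ F : Measure ℝ, IsProbabilityMeasure F ∧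
      ∀ z : ℂ, 0 < z.im → stieltjes F z = -z⁻¹ - ∑ r, h z r * g z r := by
  choose μ hμ hμ0 hμ1 hμs using fun n =>
    exists_stieltjes_eq_normalized_trace Matrix.PosSemidef.one (hS n)
  have hF : IsStieltjes (Set.Ici 0) fun z => -z⁻¹ - ∑ r, h z r * g z r := by
    refine isStieltjes_of_tendsto (l := atTop) μ hμ0 (C := 1) (Eventually.of_forall fun n => ?_)
      fun z hz => ?_
    · have h1 : (μ n).real Set.univ ≤ 1 := by
        rw [hμ1]
        simpa using div_self_le_one (p n : ℝ)
      rw [← ENNReal.ofReal_toReal (measure_ne_top (μ n) Set.univ), ENNReal.coe_one,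
        ← ENNReal.ofReal_one]
      exact ENNReal.ofReal_le_ofReal h1
    · exact (hlim z hz).congr fun n => hμs n z hz
  obtain ⟨F, hFf, -, hFs⟩ := hF
  have h1 : F.real Set.univ = 1 := by
    -- A limit of transforms of probability measures might have lost mass at infinity; the growth
    -- along the imaginary axis shows that it has not.
    refine tendsto_nhds_unique (tendsto_mul_im_stieltjes F) ((tendsto_mul_im_limit hh hg).congr' ?_)
    filter_upwards [eventually_gt_atTop 0] with v hv
    rw [← hFs _ (by simpa using hv)]
  refine ⟨F, ⟨?_⟩, fun z hz => (hFs z hz).symm⟩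
  rw [← ENNReal.ofReal_toReal (measure_ne_top F Set.univ)]
  change ENNReal.ofReal (F.real Set.univ) = 1
  rw [h1, ENNReal.ofReal_one]

theorem isProbabilityMeasure_esd {d : ℕ} (hd : 0 < d) {S : Matrix (Fin d) (Fin d) ℂ}
    (hS : S.IsHermitian) : IsProbabilityMeasure (esd hS) :=
  isProbabilityMeasure_emp hd.ne' _

/-- The limit is expressed by a fixed pair chosen in advance. By uniqueness it is the same for every
choice of scaling matrices with spectra converging to H and G. -/
theorem IsModel.tendsto_integral_trace [IsProbabilityMeasure P] {M C₀ : ℝ} {p : ℕ → ℕ}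
    {Z : (n : ℕ) → Ω → Fin K → Fin (p n) → Fin n → ℂ}
    {U : (n : ℕ) → Matrix (Fin (p n)) (Fin (p n)) ℂ} {V : (n : ℕ) → Matrix (Fin n) (Fin n) ℂ}
    {x : (n : ℕ) → Fin (p n) → Fin K → ℝ} {y : (n : ℕ) → Fin n → Fin K → ℝ}
    (h : IsModel P c H G M C₀ p Z U V x y) {z : ℂ} (hz : 0 < z.im) {h₀ g₀ : Fin K → ℂ}
    (hf : IsFixedPair z c H G h₀ g₀) :
    Tendsto (fun n => ∫ ω, ((p n : ℂ))⁻¹ * (1 * resolv (modelMat (U n) (V n) (x n) (y n) (Z n ω) *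
      (modelMat (U n) (V n) (x n) (y n) (Z n ω))ᴴ) z).trace ∂P) atTop
      (𝓝 (-z⁻¹ - ∑ r, h₀ r * g₀ r)) := by
  obtain ⟨h₁, g₁, hf₁, hh, hg⟩ := h.exists_isFixedPair hz
  obtain ⟨rfl, rfl⟩ := hf₁.unique h.pos hz h.specH h.specG hf
  simpa only [integral_const_mul, Matrix.one_mul] using h.tendsto_mean_trace hz hh hg

/-- Applied to one realization of the scaling matrices at a time: commutation provides joint
eigencoordinates, in which the hypotheses on joint spectra and traces become statements about the
points x and y. -/
theorem exists_isModel {M C₀ : ℝ} {p : ℕ → ℕ}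
    {Z : (n : ℕ) → Ω → Fin K → Fin (p n) → Fin n → ℂ}
    {A : (n : ℕ) → Fin K → Matrix (Fin (p n)) (Fin (p n)) ℂ}
    {B : (n : ℕ) → Fin K → Matrix (Fin n) (Fin n) ℂ}
    (hc : 0 < c) (hp : Tendsto (fun n => (p n : ℝ) / n) atTop (𝓝 c))
    (hZ : ∀ n, IsInnovation P M (Z n)) (hM : 1 ≤ M) (hH : IsLimitSpectrum H)
    (hG : IsLimitSpectrum G) (hpsd : ∀ n r, (A n r).PosSemidef ∧ (B n r).PosSemidef)
    (hA : WeakConv (fun n => jesd (A n)) H) (hB : WeakConv (fun n => jesd (B n)) G)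
    (htr : ∀ᶠ n : ℕ in atTop, ∀ r, (A n r).trace.re / p n < C₀ ∧ (B n r).trace.re / n < C₀)
    (hcomm : ∀ n r s, Commute (A n r) (A n s) ∧ Commute (B n r) (B n s)) :
    ∃ (U : (n : ℕ) → Matrix (Fin (p n)) (Fin (p n)) ℂ) (V : (n : ℕ) → Matrix (Fin n) (Fin n) ℂ)
      (x : (n : ℕ) → Fin (p n) → Fin K → ℝ) (y : (n : ℕ) → Fin n → Fin K → ℝ),
      IsModel P c H G M C₀ p Z U V x y ∧ ∀ n ζ, normData (entries (A n)) (entries (B n)) ζ =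
        modelMat (U n) (V n) (x n) (y n) ζ := by
  choose U hU x hx hAx using fun n =>
    exists_eq_cdiag (fun r => (hpsd n r).1) fun r s => (hcomm n r s).1
  choose V hV y hy hBy using fun n =>
    exists_eq_cdiag (fun r => (hpsd n r).2) fun r s => (hcomm n r s).2
  have eA : ∀ n, jesd (A n) = emp (x n) := fun n => by
    rw [show A n = fun r => cdiag (U n) fun j => (x n j r : ℂ) from funext (hAx n)]
    exact jesd_cdiag (hU n) (x n)
  have eB : ∀ n, jesd (B n) = emp (y n) := fun n => by
    rw [show B n = fun r => cdiag (V n) fun j => (y n j r : ℂ) from funext (hBy n)]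
    exact jesd_cdiag (hV n) (y n)
  refine ⟨U, V, x, y, ⟨hc, hp, hZ, hM, hH, hG, hU, hV, hx, hy, ?_, ?_, ?_, ?_⟩, fun n ζ =>
    normData_eq_modelMat (hU n) (hV n) (hx n) (hy n) (hAx n) (hBy n) ζ⟩
  · simpa only [eA] using hA
  · simpa only [eB] using hB
  · filter_upwards [htr] with n hn r
    rw [← trace_cdiag_re (hU n), ← hAx n r]
    exact (hn r).1.le
  · filter_upwards [htr] with n hn r
    rw [← trace_cdiag_re (hV n), ← hBy n r]
    exact (hn r).2.le

end Conclusion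

end

end SumSepCov

/-! ### The main theorem -/

theorem corollary4p2 {K : ℕ} {Ω : Type*} [MeasurableSpace Ω] (P : Measure Ω)
    [IsProbabilityMeasure P] (p : ℕ → ℕ) (c : ℝ) (H G : Measure (Fin K → ℝ))
    (A : (n : ℕ) → Ω → Fin K → Matrix (Fin (p n)) (Fin (p n)) ℂ)
    (B : (n : ℕ) → Ω → Fin K → Matrix (Fin n) (Fin n) ℂ)
    (Z : (n : ℕ) → Ω → Fin K → Matrix (Fin (p n)) (Fin n) ℂ)
    (hA : ∀ n, Measurable fun ω => SumSepCov.entries (A n ω))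
    (hB : ∀ n, Measurable fun ω => SumSepCov.entries (B n ω))
    (hZ : ∀ n, Measurable fun ω => SumSepCov.entries (Z n ω))
    -- the innovations are independent of the scaling matrices (void if these are not random)
    (hindep : ∀ n, IndepFun
      (fun ω => (SumSepCov.entries (A n ω), SumSepCov.entries (B n ω)))
      (fun ω => SumSepCov.entries (Z n ω)) P)
    -- T1
    (hc : 0 < c) (T1 : Tendsto (fun n => (p n : ℝ) / n) atTop (𝓝 c))
    -- T2
    (T2_indep : ∀ n, iIndepFun
      (fun (e : Fin K × Fin (p n) × Fin n) ω => Z n ω e.1 e.2.1 e.2.2) P)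
    (T2_mean : ∀ n r i j, ∫ ω, Z n ω r i j ∂P = 0)
    (T2_var : ∀ n r i j, ∫ ω, ‖Z n ω r i j‖ ^ 2 ∂P = 1)
    (T2_moment : ∃ η₀ > (0 : ℝ), ∃ M : ℝ, ∀ n r i j,
      Integrable (fun ω => ‖Z n ω r i j‖ ^ (4 + η₀)) P ∧
        ∫ ω, ‖Z n ω r i j‖ ^ (4 + η₀) ∂P ≤ M)
    -- T3
    (T3_psd : ∀ᵐ ω ∂P, ∀ n r, (A n ω r).PosSemidef ∧ (B n ω r).PosSemidef)
    (T3_H : SumSepCov.IsLimitSpectrum H) (T3_G : SumSepCov.IsLimitSpectrum G)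
    (T3_A : ∀ᵐ ω ∂P, SumSepCov.WeakConv (fun n => SumSepCov.jesd (A n ω)) H)
    (T3_B : ∀ᵐ ω ∂P, SumSepCov.WeakConv (fun n => SumSepCov.jesd (B n ω)) G)
    -- T4
    (T4 : ∃ C₀ > (0 : ℝ), ∀ᵐ ω ∂P, ∀ᶠ n : ℕ in atTop, ∀ r,
      (A n ω r).trace.re / p n < C₀ ∧ (B n ω r).trace.re / n < C₀)
    -- T5
    (T5 : ∀ᵐ ω ∂P, ∀ n r s, Commute (A n ω r) (A n ω s) ∧ Commute (B n ω r) (B n ω s)) :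
    ∃ (F : Measure ℝ) (h g : ℂ → Fin K → ℂ),
      -- `F` is the limiting spectral distribution of `S_n`
      IsProbabilityMeasure F ∧
      (∀ᵐ ω ∂P, SumSepCov.WeakConv (fun n => SumSepCov.esd (SumSepCov.sampleCov_isHermitian
        (SumSepCov.dataMatrix (A n ω) (B n ω) (Z n ω)))) F) ∧
      -- `h` and `g` are the unique solutions of their fixed-point equations
      SumSepCov.IsSolutionH (Set.Ici 0) c H G h ∧
      (∀ h', SumSepCov.IsSolutionH Set.univ c H G h' → ∀ z : ℂ, 0 < z.im → h' z = h z) ∧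
      SumSepCov.IsSolutionG (Set.Ici 0) c H G g ∧
      (∀ g', SumSepCov.IsSolutionG Set.univ c H G g' → ∀ z : ℂ, 0 < z.im → g' z = g z) ∧
      ∀ z : ℂ, 0 < z.im →
        -- the dual characterization of the Stieltjes transform of `F`
        SumSepCov.stieltjes F z =
          1 / (c : ℂ) * ∫ y, 1 / (-z * (1 + (c : ℂ) *
            SumSepCov.pair y (SumSepCov.opO z (g z) H))) ∂G + (1 / (c : ℂ) - 1) * (1 / z) ∧
        -- the relations between `g` and `h`
        g z = SumSepCov.opO z ((c : ℂ) • h z) G ∧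
        h z = SumSepCov.opO z (g z) H ∧
        -- the two further formulas for the Stieltjes transform of `F`
        SumSepCov.stieltjes F z =
          1 / z * (1 / (c : ℂ) - 1) -
            1 / ((c : ℂ) * z) * ∫ y, 1 / (1 + (c : ℂ) * SumSepCov.pair y (h z)) ∂G ∧
        SumSepCov.stieltjes F z = -z⁻¹ - ∑ r, h z r * g z r := by
  obtain ⟨η₀, hη₀, M, hM⟩ := T2_moment
  obtain ⟨C₀, -, T4⟩ := T4
  have hinn : ∀ n, SumSepCov.IsInnovation P (1 + |M|) fun ω => SumSepCov.entries (Z n ω) :=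
    fun n => SumSepCov.isInnovation_of_moment (hZ n) (T2_indep n) (T2_mean n) (T2_var n) hη₀ (hM n)
  have hmodel : ∀ᵐ ω ∂P, ∃ U V x y, SumSepCov.IsModel P c H G (1 + |M|) C₀ p
      (fun n ω => SumSepCov.entries (Z n ω)) U V x y ∧ ∀ n ζ, SumSepCov.normData
        (SumSepCov.entries (A n ω)) (SumSepCov.entries (B n ω)) ζ =
          SumSepCov.modelMat (U n) (V n) (x n) (y n) ζ := by
    -- For almost every ω the scaling matrices at ω are treated as constants, while the innovations
    -- keep their law under P.
    filter_upwards [T3_psd, T3_A, T3_B, T4, T5] with ω h1 h2 h3 h4 h5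
    exact SumSepCov.exists_isModel hc T1 hinn (by linarith [abs_nonneg M]) T3_H T3_G h1 h2 h3 h4 h5
  obtain ⟨h, g, hh, hg, hfix⟩ : ∃ h g : ℂ → Fin K → ℂ,
      (∀ r, SumSepCov.IsStieltjes (Set.Ici 0) fun z => h z r) ∧
      (∀ r, SumSepCov.IsStieltjes (Set.Ici 0) fun z => g z r) ∧
      ∀ z : ℂ, 0 < z.im → SumSepCov.IsFixedPair z c H G (h z) (g z) := by
    -- The pair is built from a single realization; by uniqueness it depends only on c, H and G.
    obtain ⟨ω, U, V, x, y, hm, -⟩ := hmodel.exists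
    exact hm.exists_isStieltjes
  have hlim : ∀ᵐ ω ∂P, ∀ z : ℂ, 0 < z.im → Tendsto (fun n => (p n : ℂ)⁻¹ * (1 * SumSepCov.resolv
      (SumSepCov.sampleCov (SumSepCov.dataMatrix (A n ω) (B n ω) (Z n ω))) z).trace) atTop
      (𝓝 (-z⁻¹ - ∑ r, h z r * g z r)) := by
    -- Two limits are added: the statistic minus its mean over Z with A and B frozen at ω tends to
    -- zero, and that mean converges by the deterministic theory.
    filter_upwards [hmodel, SumSepCov.ae_tendsto_covStat_sub_integral hA hB hZ hindep hc T1 T2_indep]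
      with ω ⟨U, V, x, y, hm, he⟩ hω z hz
    have h1 := hm.tendsto_integral_trace hz (hfix z hz)
    simp only [← he] at h1
    have h2 := (hω z hz).add h1
    rw [zero_add] at h2
    refine h2.congr fun n => ?_
    rw [SumSepCov.sampleCov_dataMatrix]
    exact sub_add_cancel _ _
  have hpsd : ∀ n ω, (SumSepCov.sampleCov
      (SumSepCov.dataMatrix (A n ω) (B n ω) (Z n ω))).PosSemidef := fun n ω => by
    rw [SumSepCov.sampleCov_dataMatrix]
    exact Matrix.posSemidef_self_mul_conjTranspose _
  obtain ⟨F, hF, hFs⟩ : ∃ F : Measure ℝ, IsProbabilityMeasure F ∧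
      ∀ z : ℂ, 0 < z.im → SumSepCov.stieltjes F z = -z⁻¹ - ∑ r, h z r * g z r := by
    obtain ⟨ω, hω⟩ := hlim.exists
    exact SumSepCov.exists_limit_law (fun n => hpsd n ω) hh hg hω
  have hsmul : ∀ (y : Fin K → ℝ) (q : Fin K → ℂ),
      (c : ℂ) * SumSepCov.pair y q = SumSepCov.pair y ((c : ℂ) • q) :=
    fun y q => (SumSepCov.pair_smul y c q).symm
  have hgeq : ∀ z : ℂ, 0 < z.im → ∀ r,
      g z r = SumSepCov.opO z ((c : ℂ) • SumSepCov.opO z (g z) H) G r := fun z hz r => by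
    rw [← (hfix z hz).h_eq]
    exact congrFun (hfix z hz).g_eq r
  have hheq : ∀ z : ℂ, 0 < z.im → ∀ r,
      h z r = SumSepCov.opO z (SumSepCov.opO z ((c : ℂ) • h z) G) H r := fun z hz r => by
    rw [← (hfix z hz).g_eq]
    exact congrFun (hfix z hz).h_eq r
  refine ⟨F, h, g, hF, ?_, ⟨hh, fun z hz r => ⟨(hfix z hz).h_im r, hheq z hz r⟩⟩, ?_,
    ⟨hg, fun z hz r => ⟨(hfix z hz).g_im r, ?_⟩⟩, ?_, fun z hz => ?_⟩
  · filter_upwards [hlim] with ω hω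
    refine SumSepCov.weakConv_of_tendsto_stieltjes ?_ fun z hz => ?_
    · filter_upwards [SumSepCov.eventually_pos_of_ratio hc T1] with n hn
      exact SumSepCov.isProbabilityMeasure_esd hn _
    · rw [hFs z hz]
      refine (hω z hz).congr fun n => ?_
      rw [SumSepCov.stieltjes_esd _ hz, Matrix.one_mul]
  -- Uniqueness holds at each z separately, from the equation and positivity of the imaginary parts.
  · intro h' hh' z hz
    exact SumSepCov.eq_of_solutionH hc hz T3_H T3_G (fun r => (hh'.2 z hz r).1) (hfix z hz).h_im
      (fun r => (hh'.2 z hz r).2) (hheq z hz)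
  · simp only [hsmul]
    exact hgeq z hz r
  · intro g' hg' z hz
    refine SumSepCov.eq_of_solutionG hc hz T3_H T3_G (fun r => (hg'.2 z hz r).1) (hfix z hz).g_im
      (fun r => ?_) (hgeq z hz)
    have h1 := (hg'.2 z hz r).2
    simp only [hsmul] at h1
    exact h1
  · have hz0 : z ≠ 0 := SumSepCov.ne_zero_of_im_pos hz
    have hc0 : (c : ℂ) ≠ 0 := by exact_mod_cast hc.ne'
    -- The three formulas for the Stieltjes transform of F differ only by this identity and by h =
    -- O(z, g, H).
    have hsum : ∑ r, h z r * g z r =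
        (c : ℂ)⁻¹ * (-z⁻¹ * (1 - ∫ y, 1 / (1 + (c : ℂ) * SumSepCov.pair y (h z)) ∂G)) := by
      rw [← (hfix z hz).mul_sum_eq hc T3_G hz, inv_mul_cancel_left₀ hc0]
    have hintg : ∫ y, 1 / (-z * (1 + (c : ℂ) * SumSepCov.pair y (h z))) ∂G =
        -z⁻¹ * ∫ y, 1 / (1 + (c : ℂ) * SumSepCov.pair y (h z)) ∂G := by
      rw [← integral_const_mul]
      congr 1
      ext y
      rw [one_div, one_div, mul_inv, inv_neg]
    refine ⟨?_, (hfix z hz).g_eq, (hfix z hz).h_eq, ?_, hFs z hz⟩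
    · rw [← (hfix z hz).h_eq, hintg, hFs z hz, hsum]
      field_simp
      ring
    · rw [hFs z hz, hsum]
      field_simp
      ring
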